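/- Let $m,n\ge 1$ be integers and let $\theta>m$, $\theta\ge 2$ (the second condition matters only for $m=1$). There is a constant $\nu_0=\nu_0(m,n,\theta)>0$ such that the following holds. Let $\Omega\subset\mathbb R^m$ be a bounded open set with the cone property (for instance, a bounded domain with $C^1$ boundary), let $\Gamma=\partial\Omega$, and consider the system $$-\sum_{j=1}^n\operatorname{div}(a^{ij}\nabla y^j)+\sum_{j=1}^nC^{ij}\cdot\nabla y^j+D^i\cdot y=f^i\ \text{ in }\Omega,\qquad y^i=g^i\ \text{ on }\Gamma,\qquad i=1,\dots,n,$$ where $a^{ij}\in L^\infty(\Omega)$, $C^{ij}\in L^\theta(\Omega;\mathbb R^m)$, $D^i\in L^{\theta/2}(\Omega;\mathbb R^n)$, $f\in L^{\theta/2}(\Omega;\mathbb R^n)$, $g\in H^1(\Omega;\mathbb R^n)$. Suppose that: (i) for some $\rho>0$ and a.e. $x\in\Omega$, $\sum_{i,j=1}^n\sum_{p=1}^m a^{ij}(x)\xi^i_p\xi^j_p\ge\rho|\xi|^2$ for all $\xi\in\mathbb R^{nm}$; (ii) for some $\nu\ge\nu_0$ and a.e. $x\in\Omega$, $$\sum_{i=1}^n(D^i(x)\cdot\mu)\mu^i\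 \ge\ \nu\,\rho^{\frac{m+\theta}{m-\theta}}\Big[\sum_{i,j=1}^n|C^{ij}|_{L^\theta(\Omega;\mathbb R^m)}\Big]^{\frac{2\theta}{\theta-m}}|\mu|^2\quad\text{for all }\mu\in\mathbb R^n;$$ (iii) $\det B^{ij}/\det B\in W^{1,\infty}(\Omega)$ for $i,j=1,\dots,n$, where $A$ is the $n\times n$ matrix with entry $a^{sr}$ in row $r$ and column $s$, $B^{ij}$ is obtained from $A$ by deleting the row and the column of the entry $a^{ij}$, and $B=B^{11}$ (with $\det B=1$ if $n=1$). Then the system has exactly one weak solution $y\in H^1(\Omega;\mathbb R^n)$, that is, exactly one $y$ (up to null sets) with $y^i-g^i\in H^1_0(\Omega)$ for all $i$ and $$\sum_{i,j}\int_\Omega a^{ij}\nabla y^j\cdot\nabla\varphi^i\,dx+\int_\Omega\sum_i\Big[\sum_jC^{ij}\cdot\nabla y^j\,\varphi^i+(D^i\cdot y)\,\varphi^i\Big]dx=\int_\Omega f\cdot\varphi\,dx\quad\text{for all }\varphi\in H^1_0(\Omega;\mathbb R^n).$$ Moreover, if $\operatorname{esssup}_\Gamma|y|<\infty$, then $y$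 is essentially bounded and $$\operatorname*{esssup}_\Omega|y|\le C\Big(m,n,\theta,\Omega,\rho,|a^{ij}|_{L^\infty(\Omega)},|C^{ij}|_{L^\theta(\Omega;\mathbb R^m)},|D^i|_{L^{\theta/2}(\Omega;\mathbb R^n)},\Big|\tfrac{\det B^{ij}}{\det B}\Big|_{W^{1,\infty}(\Omega)},|g|_{H^1(\Omega;\mathbb R^n)},|f|_{L^{\theta/2}(\Omega;\mathbb R^n)},\operatorname*{esssup}_\Gamma|y|\Big),$$ where $C$ depends only on the listed quantities. Here $\operatorname{esssup}_\Gamma|y|$ is the infimum of all $K\ge0$ with $(|y|-K)_+\in H^1_0(\Omega)$ (for a $C^1$ boundary, the essential supremum over $\Gamma$ of the modulus of the trace of $y$). -/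

import Mathlib

open MeasureTheory Filter Topology
open scoped ENNReal NNReal

/-- The Euclidean space `ℝ^k`. -/
abbrev Eu (k : ℕ) : Type := EuclideanSpace ℝ (Fin k)

/-- `φ ∈ C_c^∞(Ω)`. -/
structure IsTestFunction {m : ℕ} (Ω : Set (Eu m)) (φ : Eu m → ℝ) : Prop where
  smooth : ContDiff ℝ (⊤ : ℕ∞) φ
  compact : HasCompactSupport φ
  supp : tsupport φ ⊆ Ω

/-- `G = (u_{x_1}, …, u_{x_m})` is the weak gradient of `u` in `Ω`. -/
structure HasWeakGrad {m : ℕ} (Ω : Set (Eu m)) (u : Eu m → ℝ) (G : Eu m → Eu m) : Prop where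
  locInt : LocallyIntegrableOn u Ω
  locInt_grad : LocallyIntegrableOn G Ω
  integral_eq : ∀ φ : Eu m → ℝ, IsTestFunction Ω φ → ∀ p : Fin m,
    ∫ x in Ω, u x * fderiv ℝ φ x (EuclideanSpace.single p 1) = -∫ x in Ω, G x p * φ x

open Classical in
/-- The weak gradient of `u` in `Ω`, unique up to a null subset of `Ω`
(and `0` if `u` is not weakly differentiable). -/
noncomputable def weakGrad {m : ℕ} (Ω : Set (Eu m)) (u : Eu m → ℝ) : Eu m → Eu m :=
  if h : ∃ G, HasWeakGrad Ω u G then h.choose else 0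

theorem HasWeakGrad.ae_eq {m : ℕ} {Ω : Set (Eu m)} (hΩ : IsOpen Ω) {u : Eu m → ℝ}
    {G H : Eu m → Eu m} (hG : HasWeakGrad Ω u G) (hH : HasWeakGrad Ω u H) :
    G =ᵐ[volume.restrict Ω] H := by
  have key : ∀ p : Fin m, ∀ᵐ x, x ∈ Ω → (G x - H x) p = 0 := by
    intro p
    have hl : LocallyIntegrableOn (fun x => (G x - H x) p) Ω := by
      intro x hx
      obtain ⟨s, hs, h1⟩ := (hG.locInt_grad.sub hH.locInt_grad) x hx
      refine ⟨s, hs, ?_⟩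
      exact (EuclideanSpace.proj p : Eu m →L[ℝ] ℝ).integrable_comp h1
    refine hΩ.ae_eq_zero_of_integral_contDiff_smul_eq_zero hl ?_
    intro φ h1 h2 h3
    have hφ : IsTestFunction Ω φ := ⟨h1, h2, h3⟩
    have e := (hG.integral_eq φ hφ p).symm.trans (hH.integral_eq φ hφ p)
    have int : ∀ K : Eu m → Eu m, HasWeakGrad Ω u K →
        IntegrableOn (fun x => K x p * φ x) Ω := by
      intro K hK
      have hl : LocallyIntegrableOn (fun x => K x p) Ω := by
        intro x hx
        obtain ⟨s, hs, h1⟩ := hK.locInt_grad x hx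
        exact ⟨s, hs, (EuclideanSpace.proj p : Eu m →L[ℝ] ℝ).integrable_comp h1⟩
      have := (hl.integrableOn_compact_subset h3 h2).mul_continuousOn h1.continuous.continuousOn h2
      exact (integrableOn_iff_integrable_of_support_subset (fun x hx => subset_tsupport _ (by
        intro h0; exact hx (by simp [h0])))).1 this |>.integrableOn
    have e2 : ∫ x in Ω, (G x - H x) p * φ x = 0 := by
      simp only [PiLp.sub_apply, sub_mul]
      rw [integral_sub (int G hG) (int H hH)]
      linarith
    rw [← e2, ← integral_indicator hΩ.measurableSet]
    congr 1; ext x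
    by_cases hx : x ∈ Ω
    · simp [hx, mul_comm]
    · have : φ x = 0 := image_eq_zero_of_notMem_tsupport (fun h => hx (h3 h))
      simp [hx, this]
  rw [Filter.EventuallyEq, ae_restrict_iff' hΩ.measurableSet]
  filter_upwards [ae_all_iff.2 key] with x hx hxΩ
  ext p
  have := hx p hxΩ
  simpa [sub_eq_zero] using this

/-- The choice in `weakGrad` does not matter. -/
theorem HasWeakGrad.weakGrad_ae_eq {m : ℕ} {Ω : Set (Eu m)} (hΩ : IsOpen Ω) {u : Eu m → ℝ}
    {G : Eu m → Eu m} (hG : HasWeakGrad Ω u G) :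
    weakGrad Ω u =ᵐ[volume.restrict Ω] G := by
  have h : ∃ G, HasWeakGrad Ω u G := ⟨G, hG⟩
  rw [weakGrad, dif_pos h]
  exact h.choose_spec.ae_eq hΩ hG

/-- `u ∈ H¹(Ω)`. -/
structure MemH1 {m : ℕ} (Ω : Set (Eu m)) (u : Eu m → ℝ) : Prop where
  memLp : MemLp u 2 (volume.restrict Ω)
  weakDiff : ∃ G, HasWeakGrad Ω u G
  memLp_grad : MemLp (weakGrad Ω u) 2 (volume.restrict Ω)

/-- `|u|_{H¹(Ω)}` -/
noncomputable def h1Norm {m : ℕ} (Ω : Set (Eu m)) (u : Eu m → ℝ) : ℝ≥0∞ :=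
  (eLpNorm u 2 (volume.restrict Ω) ^ 2
    + eLpNorm (weakGrad Ω u) 2 (volume.restrict Ω) ^ 2) ^ (1 / 2 : ℝ)

/-- `u ∈ H¹₀(Ω)`, the closure of `C_c^∞(Ω)` in `H¹(Ω)`. -/
def MemH10 {m : ℕ} (Ω : Set (Eu m)) (u : Eu m → ℝ) : Prop :=
  MemH1 Ω u ∧ ∃ φ : ℕ → Eu m → ℝ, (∀ k, IsTestFunction Ω (φ k)) ∧
    Tendsto (fun k => h1Norm Ω (u - φ k)) atTop (𝓝 0)

/-- `u ∈ W^{1,∞}(Ω)`. -/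
structure MemW1inf {m : ℕ} (Ω : Set (Eu m)) (u : Eu m → ℝ) : Prop where
  memLp : MemLp u ∞ (volume.restrict Ω)
  weakDiff : ∃ G, HasWeakGrad Ω u G
  memLp_grad : MemLp (weakGrad Ω u) ∞ (volume.restrict Ω)

/-- `|u|_{W^{1,∞}(Ω)}` -/
noncomputable def w1infNorm {m : ℕ} (Ω : Set (Eu m)) (u : Eu m → ℝ) : ℝ≥0∞ :=
  eLpNorm u ∞ (volume.restrict Ω) + eLpNorm (weakGrad Ω u) ∞ (volume.restrict Ω)

/-- `|v|_{H¹(Ω; ℝ^N)}` -/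
noncomputable def h1NormVec {m N : ℕ} (Ω : Set (Eu m)) (v : Eu m → Eu N) : ℝ≥0∞ :=
  (∑ i, h1Norm Ω (fun x => v x i) ^ 2) ^ (1 / 2 : ℝ)

/-- `esssup_Γ |v|` for `v ∈ H¹(Ω; ℝ^N)` and `Γ = ∂Ω`. As usual for Sobolev functions,
`|v| ≤ K` on `Γ` means that `(|v| - K)₊ ∈ H¹₀(Ω)`, and `esssup_Γ |v|` is the infimum of these `K`
(for a `C¹` boundary this is the essential supremum of the modulus of the trace of `v`).
It is `∞` if there is no such `K`. -/
noncomputable def boundarySup {m N : ℕ} (Ω : Set (Eu m)) (v : Eu m → Eu N) : ℝ≥0∞ :=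
  ⨅ (K : ℝ≥0) (_ : MemH10 Ω (fun x => max (‖v x‖ - K) 0)), (K : ℝ≥0∞)

/-- The cone property: for some height `h` and some opening, each point `x` of `Ω` is the vertex
of a finite cone of that height and opening which is contained in `Ω`. Here `e` is the axis of the
cone and `c` is the cosine of the angle between the axis and the lateral surface. -/
def ConeProperty {m : ℕ} (Ω : Set (Eu m)) : Prop :=
  ∃ h > (0 : ℝ), ∃ c : ℝ, 0 < c ∧ c < 1 ∧ ∀ x ∈ Ω, ∃ e : Eu m, ‖e‖ = 1 ∧
    ∀ v : Eu m, ‖v‖ ≤ h → c * ‖v‖ ≤ inner ℝ e v → x + v ∈ Ω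

/-- The matrix `A` whose entry in row `r` and column `s` is `a^{sr}`. -/
def coeffMatrix {m N : ℕ} (a : Fin N → Fin N → Eu m → ℝ) (x : Eu m) :
    Matrix (Fin N) (Fin N) ℝ :=
  Matrix.of fun r s => a s r x

/-- `det B^{ij}`, where `B^{ij}` is obtained from `A` by deleting the row and the column of the
entry `a^{ij}`. In particular `B = B^{11}` has determinant `minorDet a 0 0`. -/
def minorDet {m n : ℕ} (a : Fin (n + 1) → Fin (n + 1) → Eu m → ℝ) (i j : Fin (n + 1))
    (x : Eu m) : ℝ :=
  ((coeffMatrix a x).submatrix j.succAbove i.succAbove).det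

/-- `y` is a weak solution in `H¹(Ω; ℝ^N)` of
`-∑_j div (a^{ij} ∇y^j) + ∑_j C^{ij} · ∇y^j + D^i · y = f^i` in `Ω`, `y^i = g^i` on `∂Ω`. -/
structure IsWeakSolution {m N : ℕ} (Ω : Set (Eu m)) (a : Fin N → Fin N → Eu m → ℝ)
    (C : Fin N → Fin N → Eu m → Eu m) (D : Fin N → Eu m → Eu N) (f g y : Eu m → Eu N) :
    Prop where
  memH1 : ∀ i, MemH1 Ω (fun x => y x i)
  boundary : ∀ i, MemH10 Ω (fun x => y x i - g x i)
  equation : ∀ φ : Eu m → Eu N, (∀ i, MemH10 Ω (fun x => φ x i)) →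
    (∑ i, ∑ j, ∫ x in Ω, a i j x *
        inner ℝ (weakGrad Ω (fun z => y z j) x) (weakGrad Ω (fun z => φ z i) x))
      + (∫ x in Ω, ∑ i, ((∑ j, inner ℝ (C i j x) (weakGrad Ω (fun z => y z j) x) * φ x i)
          + inner ℝ (D i x) (y x) * φ x i))
      = ∫ x in Ω, ∑ i, f x i * φ x i

/-! Everything rests on one weighted inequality. For `θ > m`, `θ ≥ 2`, `V ∈ L^{θ/2}` and `h > 0`, ∫
|V| u² ≤ c h^{-2m/θ} |V|_{θ/2} (∫ u² + h² ∫ |∇u|²). On `H¹₀(Ω)` the constant depends only on `m` and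
`θ` (`exists_weighted_H10`). On `H¹(Ω)` it holds with `h = 1` and a constant depending also on `Ω`,
thanks to the cone property (`exists_weighted_H1`). The proof bounds |u(x)| by a Riesz potential of
|u| + |∇u| over a cone with vertex x, and splits the squared kernel |z|^{2-2m} into an integrable
power and a power that Hölder's inequality pairs with `V` (`exists_potential_le`). With V = Σ|C|² +
Σ|D| + |f| + 1 the inequality controls all lower order terms; with V = 1 and large `h` it is
Poincaré's inequality; with `V` an indicator it replaces the Sobolev embedding.

Existence and uniqueness come from Lax–Milgram for w = y - g in `H¹₀`. Let X = ∫|∇w|², Y = ∫|w|²,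
and let S be the sum of the norms of the `C^{ij}`. The transport terms are at most √c h^{1-m/θ} S (X
+ Y/(2h²)). Choosing `h` so that the factor in front is ρ/2 leaves ρX/2 of the ellipticity and costs
ρY/(4h²), and hypothesis (ii) says that the zero order term pays for this cost (`coercive_scale`,
`SysBound.coercive`). The threshold ν₀ does not see `Ω` because `c` does not.

Boundedness uses cofactors. The functions b^{ik} = (-1)^{i+k} det B^{ik} / det B satisfy Σ_i a^{ij}
b^{ik} = α δ_{jk} with α = det A / det B ≥ ρ (`sum_mul_minorDet`). Test the system with φ^i = Σ_k
b^{ik} t(|y|²) y^k, where `t` is a cutoff vanishing below a level above the boundary values; φ is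
admissible because the b^{ik} are in W^{1,∞}. The leading part becomes α Σ_k ∇y^k · ∇(t y^k) = α (t
|∇y|² + 2 t' |Σ_i y^i ∇y^i|²), which is nonnegative, plus terms with ∇b that Young's inequality
absorbs. The result is a Caccioppoli inequality (`SysBound.caccioppoli`), and a De Giorgi iteration
over the sets {|y|² > 2 - 2^{-j}} follows. Applying the weighted inequality also with an exponent θ'
strictly between max(m, 2) and θ gives Y_{j+1} ≤ L B^j Y_j^{1 + 2/θ' - 2/θ} for the energies of `y`
on these sets (`exists_level_step`), so a small L² norm forces |y|² ≤ 2
(`exists_small_energy_bound`). By linearity, dividing y and f by a large M makes the energy small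
and puts the boundary values below 1 (`exists_sup_bound`). When θ = 2, hence m = 1, there is no room
for θ', but then the weighted inequality with weights in L¹ embeds `H¹` into `L^∞` directly
(`WeightedIneq.sq_le`). -/

/-! ### Convergence in L² of functions, without passing to classes. -/

section L2Lim

variable {α F : Type*} [MeasurableSpace α] {μ : Measure α} [NormedAddCommGroup F]

/-- Convergence in `L²(μ)` of a sequence of functions. -/
def L2Lim (μ : Measure α) (f : ℕ → α → F) (g : α → F) : Prop :=
  Tendsto (fun n => eLpNorm (f n - g) 2 μ) atTop (𝓝 0)

theorem L2Lim.comp {f : ℕ → α → F} {g : α → F} (h : L2Lim μ f g) {s : ℕ → ℕ}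
    (hs : StrictMono s) : L2Lim μ (fun n => f (s n)) g :=
  Tendsto.comp (g := fun n => eLpNorm (f n - g) 2 μ) h hs.tendsto_atTop

theorem L2Lim.congr {f f' : ℕ → α → F} {g g' : α → F} (h : L2Lim μ f g)
    (hf : ∀ n, f n =ᵐ[μ] f' n) (hg : g =ᵐ[μ] g') : L2Lim μ f' g' := by
  refine Tendsto.congr (fun n => ?_) h
  exact eLpNorm_congr_ae ((hf n).sub hg)

theorem L2Lim.congr' {f f' : ℕ → α → F} {g g' : α → F} (h : L2Lim μ f g)
    (hf : ∀ᶠ n in atTop, f n =ᵐ[μ] f' n) (hg : g =ᵐ[μ] g') : L2Lim μ f' g' := by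
  refine Tendsto.congr' ?_ h
  filter_upwards [hf] with n hn
  exact eLpNorm_congr_ae (hn.sub hg)

theorem L2Lim.const (f : α → F) : L2Lim μ (fun _ => f) f := by
  simp [L2Lim]

theorem L2Lim.add {f f' : ℕ → α → F} {g g' : α → F} (h : L2Lim μ f g) (h' : L2Lim μ f' g')
    (mf : ∀ n, AEStronglyMeasurable (f n) μ) (mg : AEStronglyMeasurable g μ)
    (mf' : ∀ n, AEStronglyMeasurable (f' n) μ) (mg' : AEStronglyMeasurable g' μ) :
    L2Lim μ (fun n => f n + f' n) (g + g') := by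
  have h2 := Tendsto.add h h'
  rw [add_zero] at h2
  refine tendsto_of_tendsto_of_tendsto_of_le_of_le tendsto_const_nhds h2 (fun _ => zero_le)
    (fun n => ?_)
  have : f n + f' n - (g + g') = (f n - g) + (f' n - g') := by abel
  rw [this]
  exact eLpNorm_add_le ((mf n).sub mg) ((mf' n).sub mg') (by norm_num)

theorem L2Lim.finset_sum {ι : Type*} (s : Finset ι) {f : ι → ℕ → α → F} {g : ι → α → F}
    (h : ∀ i ∈ s, L2Lim μ (f i) (g i)) (mf : ∀ i n, AEStronglyMeasurable (f i n) μ)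
    (mg : ∀ i, AEStronglyMeasurable (g i) μ) :
    L2Lim μ (fun n x => ∑ i ∈ s, f i n x) (fun x => ∑ i ∈ s, g i x) := by
  classical
  induction s using Finset.induction_on with
  | empty => simpa using L2Lim.const (μ := μ) (fun _ => (0 : F))
  | insert a s ha ih =>
    have := (h a (Finset.mem_insert_self _ _)).add
      (ih fun i hi => h i (Finset.mem_insert_of_mem hi)) (mf a) (mg a)
      (fun n => Finset.aestronglyMeasurable_fun_sum s fun i _ => mf i n)
      (Finset.aestronglyMeasurable_fun_sum s fun i _ => mg i)
    refine this.congr (fun n => ae_of_all _ fun x => ?_) (ae_of_all _ fun x => ?_)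
    · simp [Finset.sum_insert ha]
    · simp [Finset.sum_insert ha]

theorem L2Lim.exists_subseq_ae {f : ℕ → α → F} {g : α → F} (h : L2Lim μ f g)
    (mf : ∀ n, AEStronglyMeasurable (f n) μ) (mg : AEStronglyMeasurable g μ) :
    ∃ s : ℕ → ℕ, StrictMono s ∧ ∀ᵐ x ∂μ, Tendsto (fun n => f (s n) x) atTop (𝓝 (g x)) :=
  (tendstoInMeasure_of_tendsto_eLpNorm (by norm_num) mf mg h).exists_seq_tendsto_ae

/-- Dominated convergence for the squared differences: the bound `b` passes to the limit `g`, so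
`(2|b|)²` dominates. -/
theorem L2Lim.of_dominated {f : ℕ → α → F} {g : α → F} {b : α → ℝ}
    (mf : ∀ n, AEStronglyMeasurable (f n) μ) (hb : MemLp b 2 μ)
    (hfb : ∀ n, ∀ᵐ x ∂μ, ‖f n x‖ ≤ b x)
    (hlim : ∀ᵐ x ∂μ, Tendsto (fun n => f n x) atTop (𝓝 (g x))) : L2Lim μ f g := by
  have mg : AEStronglyMeasurable g μ := aestronglyMeasurable_of_tendsto_ae _ mf hlim
  have hgb : ∀ᵐ x ∂μ, ‖g x‖ ≤ b x := by
    filter_upwards [ae_all_iff.2 hfb, hlim] with x h1 h2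
    exact le_of_tendsto h2.norm (Eventually.of_forall h1)
  have key : Tendsto (fun n => ∫⁻ x, ‖(f n - g) x‖ₑ ^ (2 : ℝ) ∂μ) atTop
      (𝓝 (∫⁻ _, 0 ∂μ)) := by
    refine tendsto_lintegral_of_dominated_convergence' (fun x => (2 * ‖b x‖ₑ) ^ (2 : ℝ))
      (fun n => ((mf n).sub mg).enorm.pow_const _) (fun n => ?_) ?_ ?_
    · filter_upwards [hfb n, hgb] with x h1 h2
      gcongr
      have : ‖(f n - g) x‖ ≤ ‖2 * b x‖ := by
        have h3 : ‖f n x - g x‖ ≤ ‖f n x‖ + ‖g x‖ := norm_sub_le _ _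
        rw [Pi.sub_apply]
        refine h3.trans ?_
        rw [Real.norm_eq_abs]
        refine le_trans ?_ (le_abs_self _)
        linarith
      have h4 := enorm_le_iff_norm_le.2 this
      rwa [enorm_mul, show ‖(2 : ℝ)‖ₑ = 2 by simp [← ofReal_norm]] at h4
    · have := (hb.const_mul 2).eLpNorm_lt_top
      rw [eLpNorm_lt_top_iff_lintegral_rpow_enorm_lt_top (by norm_num) (by norm_num)] at this
      refine ne_of_lt ?_
      convert this using 3
      rw [enorm_mul, show ‖(2 : ℝ)‖ₑ = 2 by simp [← ofReal_norm]]
      simp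
    · filter_upwards [hlim] with x hx
      have h1 : Tendsto (fun n => (f n - g) x) atTop (𝓝 0) := by
        have := hx.sub_const (g x)
        simpa using this
      have h2 : Tendsto (fun n => ‖(f n - g) x‖ₑ) atTop (𝓝 0) := by
        simpa using h1.enorm
      have := (ENNReal.continuous_rpow_const (y := 2)).tendsto 0 |>.comp h2
      simpa [Function.comp_def] using this
  have e : ∀ n, eLpNorm (f n - g) 2 μ = (∫⁻ x, ‖(f n - g) x‖ₑ ^ (2 : ℝ) ∂μ) ^ (1 / 2 : ℝ) := by
    intro n
    rw [eLpNorm_eq_lintegral_rpow_enorm_toReal (by norm_num) (by norm_num)]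
    simp
  unfold L2Lim
  simp_rw [e]
  have := (ENNReal.continuous_rpow_const (y := (1 / 2 : ℝ))).tendsto _ |>.comp key
  simpa [Function.comp_def] using this

/-- Write θₙfₙ - θ'g = θₙ(fₙ - g) + (θₙ - θ')g. The first term is small because the θₙ are uniformly
bounded, the second by dominated convergence. This passes to the limit in chain and product rules,
where the coefficients converge only almost everywhere. -/
theorem L2Lim.bdd_smul [NormedSpace ℝ F] {θ : ℕ → α → ℝ} {θ' : α → ℝ} {L : ℝ}
    {f : ℕ → α → F} {g : α → F} (h : L2Lim μ f g)
    (mθ : ∀ n, AEStronglyMeasurable (θ n) μ) (hL : ∀ n, ∀ᵐ x ∂μ, |θ n x| ≤ L)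
    (hlim : ∀ᵐ x ∂μ, Tendsto (fun n => θ n x) atTop (𝓝 (θ' x)))
    (mf : ∀ n, AEStronglyMeasurable (f n) μ) (hg : MemLp g 2 μ) :
    L2Lim μ (fun n x => θ n x • f n x) (fun x => θ' x • g x) := by
  have h1 : L2Lim μ (fun n x => θ n x • g x) (fun x => θ' x • g x) := by
    refine L2Lim.of_dominated (b := fun x => L * ‖g x‖) (fun n => (mθ n).smul hg.1)
      (hg.norm.const_mul L) (fun n => ?_) ?_
    · filter_upwards [hL n] with x hx
      rw [norm_smul]
      exact mul_le_mul_of_nonneg_right hx (norm_nonneg _)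
    · filter_upwards [hlim] with x hx
      exact hx.smul_const _
  have h2 : L2Lim μ (fun n x => θ n x • (f n x - g x)) 0 := by
    have h3 : Tendsto (fun n => ENNReal.ofReal L * eLpNorm (f n - g) 2 μ) atTop (𝓝 0) := by
      have := ENNReal.Tendsto.const_mul (a := ENNReal.ofReal L) h (Or.inr ENNReal.ofReal_ne_top)
      simpa using this
    refine tendsto_of_tendsto_of_tendsto_of_le_of_le tendsto_const_nhds h3 (fun _ => zero_le)
      (fun n => ?_)
    refine eLpNorm_le_mul_eLpNorm_of_ae_le_mul ?_ 2
    filter_upwards [hL n] with x hx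
    simp only [Pi.sub_apply, Pi.zero_apply, sub_zero]
    rw [norm_smul]
    exact mul_le_mul_of_nonneg_right hx (norm_nonneg _)
  have h4 := h2.add h1 (fun n => (mθ n).smul ((mf n).sub hg.1)) aestronglyMeasurable_const
    (fun n => (mθ n).smul hg.1)
    ((aestronglyMeasurable_of_tendsto_ae _ mθ hlim).smul hg.1)
  refine h4.congr (fun n => ae_of_all _ fun x => ?_) (ae_of_all _ fun x => ?_)
  · simp [← smul_add]
  · simp

theorem L2Lim.linfty_smul [NormedSpace ℝ F] {b : α → ℝ} {f : ℕ → α → F} {g : α → F}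
    (h : L2Lim μ f g) (hb : MemLp b ∞ μ)
    (mf : ∀ n, AEStronglyMeasurable (f n) μ) (hg : MemLp g 2 μ) :
    L2Lim μ (fun n x => b x • f n x) (fun x => b x • g x) := by
  have hb2 : ∀ᵐ x ∂μ, |b x| ≤ (eLpNorm b ∞ μ).toReal := by
    filter_upwards [ae_le_eLpNormEssSup (f := b) (μ := μ)] with x hx
    rw [← eLpNorm_exponent_top] at hx
    have := ENNReal.toReal_mono hb.2.ne hx
    simpa using this
  exact h.bdd_smul (θ := fun _ => b) (L := (eLpNorm b ∞ μ).toReal)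
    (fun _ => hb.1) (fun _ => hb2) (ae_of_all _ fun x => tendsto_const_nhds) mf hg

theorem L2Lim.smul_linfty [NormedSpace ℝ F] {b : α → F} {f : ℕ → α → ℝ} {g : α → ℝ}
    (h : L2Lim μ f g) (hb : MemLp b ∞ μ) :
    L2Lim μ (fun n x => f n x • b x) (fun x => g x • b x) := by
  have hb2 : ∀ᵐ x ∂μ, ‖b x‖ ≤ (eLpNorm b ∞ μ).toReal := by
    filter_upwards [ae_le_eLpNormEssSup (f := b) (μ := μ)] with x hx
    rw [← eLpNorm_exponent_top] at hx
    have := ENNReal.toReal_mono hb.2.ne hx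
    simpa using this
  have h3 : Tendsto (fun n => eLpNorm b ∞ μ * eLpNorm (f n - g) 2 μ) atTop (𝓝 0) := by
    have := ENNReal.Tendsto.const_mul (a := eLpNorm b ∞ μ) h (Or.inr hb.2.ne)
    simpa using this
  refine tendsto_of_tendsto_of_tendsto_of_le_of_le tendsto_const_nhds h3 (fun _ => zero_le)
      (fun n => ?_)
  rw [← ENNReal.ofReal_toReal hb.2.ne]
  refine eLpNorm_le_mul_eLpNorm_of_ae_le_mul ?_ 2
  filter_upwards [hb2] with x hx
  simp only [Pi.sub_apply]
  rw [← sub_smul, norm_smul, mul_comm]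
  exact mul_le_mul_of_nonneg_right hx (norm_nonneg _)

theorem L2Lim.clm {F' : Type*} [NormedAddCommGroup F'] [NormedSpace ℝ F] [NormedSpace ℝ F']
    (T : F →L[ℝ] F') {f : ℕ → α → F} {g : α → F} (h : L2Lim μ f g) :
    L2Lim μ (fun n x => T (f n x)) (fun x => T (g x)) := by
  have h3 : Tendsto (fun n => ENNReal.ofReal ‖T‖ * eLpNorm (f n - g) 2 μ) atTop (𝓝 0) := by
    have := ENNReal.Tendsto.const_mul (a := ENNReal.ofReal ‖T‖) h (Or.inr ENNReal.ofReal_ne_top)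
    simpa using this
  refine tendsto_of_tendsto_of_tendsto_of_le_of_le tendsto_const_nhds h3 (fun _ => zero_le)
      (fun n => ?_)
  refine eLpNorm_le_mul_eLpNorm_of_ae_le_mul (ae_of_all _ fun x => ?_) 2
  simp only [Pi.sub_apply]
  rw [← map_sub]
  exact T.le_opNorm _

theorem L2Lim.tendsto_integral_mul {f : ℕ → α → ℝ} {g ζ : α → ℝ} (h : L2Lim μ f g)
    (hf : ∀ n, MemLp (f n) 2 μ) (hg : MemLp g 2 μ) (hζ : MemLp ζ 2 μ) :
    Tendsto (fun n => ∫ x, f n x * ζ x ∂μ) atTop (𝓝 (∫ x, g x * ζ x ∂μ)) := by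
  refine tendsto_integral_of_L1 (fun x => g x * ζ x) (hg.integrable_mul hζ).1
    (Eventually.of_forall fun n => (hf n).integrable_mul hζ) ?_
  have h3 : Tendsto (fun n => eLpNorm (f n - g) 2 μ * eLpNorm ζ 2 μ) atTop (𝓝 0) := by
    have := ENNReal.Tendsto.mul_const (b := eLpNorm ζ 2 μ) h (Or.inr hζ.2.ne)
    simpa using this
  refine tendsto_of_tendsto_of_tendsto_of_le_of_le tendsto_const_nhds h3 (fun _ => zero_le)
      (fun n => ?_)
  have := eLpNorm_smul_le_mul_eLpNorm (p := 2) (q := 2) (r := 1) hζ.1 ((hf n).sub hg).1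
  rw [eLpNorm_one_eq_lintegral_enorm] at this
  refine le_trans (le_of_eq ?_) this
  refine lintegral_congr fun x => ?_
  simp [sub_mul]

theorem L2Lim.tendsto_eLpNorm {f : ℕ → α → F} {g : α → F} (h : L2Lim μ f g)
    (mf : ∀ n, AEStronglyMeasurable (f n) μ) (hg : MemLp g 2 μ) :
    Tendsto (fun n => eLpNorm (f n) 2 μ) atTop (𝓝 (eLpNorm g 2 μ)) := by
  have h1 : Tendsto (fun n => eLpNorm g 2 μ + eLpNorm (f n - g) 2 μ) atTop
      (𝓝 (eLpNorm g 2 μ)) := by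
    have := Tendsto.const_add (eLpNorm g 2 μ) h
    simpa using this
  have h2 : Tendsto (fun n => eLpNorm g 2 μ - eLpNorm (f n - g) 2 μ) atTop
      (𝓝 (eLpNorm g 2 μ)) := by
    have := ENNReal.Tendsto.sub (tendsto_const_nhds (x := eLpNorm g 2 μ)) h (Or.inl hg.2.ne)
    simpa using this
  refine tendsto_of_tendsto_of_tendsto_of_le_of_le h2 h1 (fun n => ?_) (fun n => ?_)
  · rw [tsub_le_iff_right]
    have : g = f n - (f n - g) := by abel
    calc eLpNorm g 2 μ = eLpNorm (f n - (f n - g)) 2 μ := by rw [← this]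
      _ ≤ _ := eLpNorm_sub_le (mf n) ((mf n).sub hg.1) (by norm_num)
  · have : f n = g + (f n - g) := by abel
    calc eLpNorm (f n) 2 μ = eLpNorm (g + (f n - g)) 2 μ := by rw [← this]
      _ ≤ _ := eLpNorm_add_le hg.1 ((mf n).sub hg.1) (by norm_num)

end L2Lim

/-! ### `H¹` and `H¹₀` as pairs of a function and its gradient. -/

section Sobolev

variable {m : ℕ} {Ω : Set (Eu m)}

theorem gradient_apply_coord (φ : Eu m → ℝ) (x : Eu m) (p : Fin m) :
    gradient φ x p = fderiv ℝ φ x (EuclideanSpace.single p 1) := by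
  rw [← inner_gradient_left, EuclideanSpace.inner_single_right]
  simp

theorem gradient_eq_toDual_symm (φ : Eu m → ℝ) :
    gradient φ = fun x => (InnerProductSpace.toDual ℝ (Eu m)).symm (fderiv ℝ φ x) := rfl

theorem norm_gradient (φ : Eu m → ℝ) (x : Eu m) : ‖gradient φ x‖ = ‖fderiv ℝ φ x‖ := by
  rw [gradient_eq_toDual_symm, LinearIsometryEquiv.norm_map]

theorem ContDiff.continuous_gradient {φ : Eu m → ℝ} (h : ContDiff ℝ 1 φ) :
    Continuous (gradient φ) := by
  rw [gradient_eq_toDual_symm]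
  exact (LinearIsometryEquiv.continuous _).comp (h.continuous_fderiv (by norm_num))

namespace IsTestFunction

variable {φ ψ : Eu m → ℝ}

theorem contDiff_one (h : IsTestFunction Ω φ) : ContDiff ℝ 1 φ :=
  h.smooth.of_le (by exact_mod_cast le_top)

theorem continuous (h : IsTestFunction Ω φ) : Continuous φ := h.smooth.continuous

theorem continuous_gradient (h : IsTestFunction Ω φ) : Continuous (gradient φ) :=
  h.contDiff_one.continuous_gradient

theorem gradient_eq_zero (x : Eu m) (hx : x ∉ tsupport φ) : gradient φ x = 0 := by
  have : fderiv ℝ φ x = 0 := by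
    by_contra h0
    exact hx (support_fderiv_subset ℝ h0)
  rw [gradient_eq_toDual_symm]
  simp [this]

theorem gradient_compact (h : IsTestFunction Ω φ) : HasCompactSupport (gradient φ) :=
  HasCompactSupport.intro h.compact fun x hx => gradient_eq_zero x hx

theorem memLp (h : IsTestFunction Ω φ) (p : ℝ≥0∞) : MemLp φ p (volume.restrict Ω) :=
  (h.continuous.memLp_of_hasCompactSupport h.compact).restrict Ω

theorem memLp_gradient (h : IsTestFunction Ω φ) (p : ℝ≥0∞) :
    MemLp (gradient φ) p (volume.restrict Ω) :=
  (h.continuous_gradient.memLp_of_hasCompactSupport h.gradient_compact).restrict Ω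

theorem apply_eq_zero (h : IsTestFunction Ω φ) {x : Eu m} (hx : x ∉ Ω) : φ x = 0 :=
  image_eq_zero_of_notMem_tsupport fun h' => hx (h.supp h')

theorem gradient_apply_eq_zero (h : IsTestFunction Ω φ) {x : Eu m} (hx : x ∉ Ω) :
    gradient φ x = 0 :=
  gradient_eq_zero x fun h' => hx (h.supp h')

theorem fderiv_apply_eq_zero (h : IsTestFunction Ω φ) {x : Eu m} (hx : x ∉ Ω) :
    fderiv ℝ φ x = 0 := by
  have := h.gradient_apply_eq_zero hx
  rw [← norm_eq_zero, norm_gradient, norm_eq_zero] at this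
  exact this

theorem zero : IsTestFunction Ω (0 : Eu m → ℝ) :=
  ⟨contDiff_const, HasCompactSupport.zero, by simp [tsupport]⟩

theorem add (h : IsTestFunction Ω φ) (h' : IsTestFunction Ω ψ) : IsTestFunction Ω (φ + ψ) :=
  ⟨h.smooth.add h'.smooth, h.compact.add h'.compact,
    (tsupport_add φ ψ).trans (Set.union_subset h.supp h'.supp)⟩

theorem const_mul (h : IsTestFunction Ω φ) (c : ℝ) : IsTestFunction Ω (fun x => c * φ x) :=
  ⟨contDiff_const.mul h.smooth, h.compact.mul_left,
    (closure_mono (Function.support_mul_subset_right _ _)).trans h.supp⟩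

theorem mul_left (h : IsTestFunction Ω φ) {f : Eu m → ℝ} (hf : ContDiff ℝ (⊤ : ℕ∞) f) :
    IsTestFunction Ω (fun x => f x * φ x) :=
  ⟨hf.mul h.smooth, h.compact.mul_left,
    (closure_mono (Function.support_mul_subset_right _ _)).trans h.supp⟩

theorem comp_left (h : IsTestFunction Ω φ) {f : ℝ → ℝ} (hf : ContDiff ℝ (⊤ : ℕ∞) f)
    (hf0 : f 0 = 0) : IsTestFunction Ω (fun x => f (φ x)) :=
  ⟨hf.comp h.smooth, h.compact.comp_left hf0,
    (closure_mono (Function.support_comp_subset hf0 _)).trans h.supp⟩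

end IsTestFunction

theorem gradient_add' {φ ψ : Eu m → ℝ} {x : Eu m} (h : DifferentiableAt ℝ φ x)
    (h' : DifferentiableAt ℝ ψ x) :
    gradient (fun x => φ x + ψ x) x = gradient φ x + gradient ψ x := by
  ext p
  rw [PiLp.add_apply, gradient_apply_coord, gradient_apply_coord, gradient_apply_coord,
    fderiv_fun_add h h']
  simp

theorem gradient_mul' {φ ψ : Eu m → ℝ} {x : Eu m} (h : DifferentiableAt ℝ φ x)
    (h' : DifferentiableAt ℝ ψ x) :
    gradient (fun x => φ x * ψ x) x = φ x • gradient ψ x + ψ x • gradient φ x := by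
  ext p
  rw [PiLp.add_apply, PiLp.smul_apply, PiLp.smul_apply, gradient_apply_coord,
    gradient_apply_coord, gradient_apply_coord, fderiv_fun_mul h h']
  simp

theorem gradient_const_mul' {φ : Eu m → ℝ} {x : Eu m} (c : ℝ) (h : DifferentiableAt ℝ φ x) :
    gradient (fun x => c * φ x) x = c • gradient φ x := by
  ext p
  rw [PiLp.smul_apply, gradient_apply_coord, gradient_apply_coord, fderiv_const_mul h]
  simp

theorem gradient_comp' {f : ℝ → ℝ} {φ : Eu m → ℝ} {x : Eu m} (hf : DifferentiableAt ℝ f (φ x))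
    (h : DifferentiableAt ℝ φ x) :
    gradient (fun x => f (φ x)) x = deriv f (φ x) • gradient φ x := by
  ext p
  have := fderiv_comp x hf h
  rw [PiLp.smul_apply, gradient_apply_coord, gradient_apply_coord]
  change fderiv ℝ (f ∘ φ) x _ = _
  rw [this]
  simp only [ContinuousLinearMap.comp_apply, smul_eq_mul]
  rw [mul_comm, ← fderiv_apply_one_eq_deriv, ← smul_eq_mul, ← map_smul]
  simp

theorem setIntegral_mul_test {φ : Eu m → ℝ} (hφ : IsTestFunction Ω φ) (f : Eu m → ℝ) :
    ∫ x in Ω, f x * φ x = ∫ x, f x * φ x :=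
  setIntegral_eq_integral_of_forall_compl_eq_zero fun x hx => by
    simp [hφ.apply_eq_zero hx]

theorem setIntegral_mul_fderiv_test {φ : Eu m → ℝ} (hφ : IsTestFunction Ω φ) (f : Eu m → ℝ)
    (v : Eu m) : ∫ x in Ω, f x * fderiv ℝ φ x v = ∫ x, f x * fderiv ℝ φ x v :=
  setIntegral_eq_integral_of_forall_compl_eq_zero fun x hx => by
    simp [hφ.fderiv_apply_eq_zero hx]

/-- Integration by parts against a test function. -/
theorem ContDiff.integral_mul_fderiv_test {f φ : Eu m → ℝ} (hf : ContDiff ℝ 1 f)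
    (hφ : IsTestFunction Ω φ) (p : Fin m) :
    ∫ x in Ω, f x * fderiv ℝ φ x (EuclideanSpace.single p 1)
      = -∫ x in Ω, gradient f x p * φ x := by
  rw [setIntegral_mul_fderiv_test hφ, setIntegral_mul_test hφ (fun x => gradient f x p)]
  simp_rw [gradient_apply_coord]
  have c1 : Continuous fun x => fderiv ℝ f x (EuclideanSpace.single p 1) :=
    (hf.continuous_fderiv (by norm_num)).clm_apply continuous_const
  have c2 : Continuous fun x => fderiv ℝ φ x (EuclideanSpace.single p 1) :=
    (hφ.contDiff_one.continuous_fderiv (by norm_num)).clm_apply continuous_const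
  refine integral_mul_fderiv_eq_neg_fderiv_mul_of_integrable ?_ ?_ ?_ ?_ ?_
  · exact (c1.mul hφ.continuous).integrable_of_hasCompactSupport hφ.compact.mul_left
  · refine (hf.continuous.mul c2).integrable_of_hasCompactSupport ?_
    refine HasCompactSupport.mul_left ?_
    exact hφ.compact.fderiv_apply (𝕜 := ℝ) _
  · exact (hf.continuous.mul hφ.continuous).integrable_of_hasCompactSupport hφ.compact.mul_left
  · exact fun x _ => (hf.differentiable (by norm_num)).differentiableAt
  · exact fun x _ => (hφ.contDiff_one.differentiable (by norm_num)).differentiableAt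

/-- `(u, G)` with `u ∈ H¹(Ω)` and `G = ∇u`. -/
structure HasH1Grad (Ω : Set (Eu m)) (u : Eu m → ℝ) (G : Eu m → Eu m) : Prop where
  memLp : MemLp u 2 (volume.restrict Ω)
  memLp_grad : MemLp G 2 (volume.restrict Ω)
  weak : HasWeakGrad Ω u G

/-- `(u, G)` with `u ∈ H¹₀(Ω)` and `G = ∇u`. -/
structure HasH10Grad (Ω : Set (Eu m)) (u : Eu m → ℝ) (G : Eu m → Eu m) : Prop where
  memLp : MemLp u 2 (volume.restrict Ω)
  memLp_grad : MemLp G 2 (volume.restrict Ω)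
  approx : ∃ φ : ℕ → Eu m → ℝ, (∀ k, IsTestFunction Ω (φ k)) ∧
    L2Lim (volume.restrict Ω) φ u ∧ L2Lim (volume.restrict Ω) (fun k => gradient (φ k)) G

theorem MeasureTheory.MemLp.integrable_fun_mul {α : Type*} [MeasurableSpace α] {μ : Measure α}
    {f g : α → ℝ} (hf : MemLp f 2 μ) (hg : MemLp g 2 μ) : Integrable (fun x => f x * g x) μ :=
  hf.integrable_mul hg

theorem MeasureTheory.MemLp.coord {G : Eu m → Eu m} {q : ℝ≥0∞} {μ : Measure (Eu m)} (h : MemLp G q μ)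
    (p : Fin m) : MemLp (fun x => G x p) q μ :=
  (EuclideanSpace.proj (𝕜 := ℝ) p).comp_memLp' h

theorem L2Lim.coord {G : ℕ → Eu m → Eu m} {H : Eu m → Eu m} {μ : Measure (Eu m)}
    (h : L2Lim μ G H) (p : Fin m) : L2Lim μ (fun n x => G n x p) (fun x => H x p) :=
  h.clm (EuclideanSpace.proj (𝕜 := ℝ) p)

theorem MeasureTheory.MemLp.locallyIntegrableOn' {F : Type*} [NormedAddCommGroup F] {u : Eu m → F}
    (h : MemLp u 2 (volume.restrict Ω)) : LocallyIntegrableOn u Ω :=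
  locallyIntegrableOn_of_locallyIntegrable_restrict (h.locallyIntegrable (by norm_num))

/-- Weak gradients are stable under limits in `L²`. -/
theorem HasH1Grad.of_L2Lim {u : Eu m → ℝ} {G : Eu m → Eu m} {un : ℕ → Eu m → ℝ}
    {Gn : ℕ → Eu m → Eu m} (hu : MemLp u 2 (volume.restrict Ω))
    (hG : MemLp G 2 (volume.restrict Ω)) (hun : ∀ n, MemLp (un n) 2 (volume.restrict Ω))
    (hGn : ∀ n, MemLp (Gn n) 2 (volume.restrict Ω)) (h1 : L2Lim (volume.restrict Ω) un u)
    (h2 : L2Lim (volume.restrict Ω) Gn G)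
    (h : ∀ φ : Eu m → ℝ, IsTestFunction Ω φ → ∀ p : Fin m, ∀ᶠ n in atTop,
      ∫ x in Ω, un n x * fderiv ℝ φ x (EuclideanSpace.single p 1)
        = -∫ x in Ω, Gn n x p * φ x) : HasH1Grad Ω u G := by
  refine ⟨hu, hG, hu.locallyIntegrableOn', hG.locallyIntegrableOn', fun φ hφ p => ?_⟩
  have t1 := h1.tendsto_integral_mul hun hu
    (ζ := fun x => fderiv ℝ φ x (EuclideanSpace.single p 1)) (by
      have := (hφ.memLp_gradient 2).coord p
      simpa only [gradient_apply_coord] using this)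
  have t2 := (h2.coord p).tendsto_integral_mul (fun n => (hGn n).coord p) (hG.coord p)
    (hφ.memLp 2)
  -- The identity for the approximants is required only for large `n`, depending on `φ`: a
  -- mollification has the right gradient only away from the boundary.
  exact tendsto_nhds_unique t1 (t2.neg.congr' ((h φ hφ p).mono fun n hn => hn.symm))

theorem IsTestFunction.hasH1Grad {φ : Eu m → ℝ} (hφ : IsTestFunction Ω φ) :
    HasH1Grad Ω φ (gradient φ) :=
  ⟨hφ.memLp 2, hφ.memLp_gradient 2, (hφ.memLp 2).locallyIntegrableOn',
    (hφ.memLp_gradient 2).locallyIntegrableOn',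
    fun _ hψ p => hφ.contDiff_one.integral_mul_fderiv_test hψ p⟩

theorem HasH10Grad.hasH1Grad {u : Eu m → ℝ} {G : Eu m → Eu m} (h : HasH10Grad Ω u G) :
    HasH1Grad Ω u G := by
  obtain ⟨φ, hφ, h1, h2⟩ := h.approx
  exact HasH1Grad.of_L2Lim h.memLp h.memLp_grad (fun n => (hφ n).memLp 2)
    (fun n => (hφ n).memLp_gradient 2) h1 h2 fun ψ hψ p =>
      Eventually.of_forall fun n => (hφ n).hasH1Grad.weak.integral_eq ψ hψ p

theorem IsTestFunction.hasH10Grad {φ : Eu m → ℝ} (hφ : IsTestFunction Ω φ) :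
    HasH10Grad Ω φ (gradient φ) :=
  ⟨hφ.memLp 2, hφ.memLp_gradient 2, fun _ => φ, fun _ => hφ, L2Lim.const _, L2Lim.const _⟩

theorem HasH1Grad.congr {u v : Eu m → ℝ} {G H : Eu m → Eu m} (h : HasH1Grad Ω u G)
    (huv : u =ᵐ[volume.restrict Ω] v) (hGH : G =ᵐ[volume.restrict Ω] H) :
    HasH1Grad Ω v H := by
  refine HasH1Grad.of_L2Lim (un := fun _ => u) (Gn := fun _ => G) (h.memLp.ae_eq huv)
    (h.memLp_grad.ae_eq hGH) (fun _ => h.memLp) (fun _ => h.memLp_grad)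
    ((L2Lim.const u).congr (fun _ => ae_eq_refl _) huv)
    ((L2Lim.const G).congr (fun _ => ae_eq_refl _) hGH) fun φ hφ p => ?_
  exact Eventually.of_forall fun _ => h.weak.integral_eq φ hφ p

theorem HasH10Grad.congr {u v : Eu m → ℝ} {G H : Eu m → Eu m} (h : HasH10Grad Ω u G)
    (huv : u =ᵐ[volume.restrict Ω] v) (hGH : G =ᵐ[volume.restrict Ω] H) :
    HasH10Grad Ω v H := by
  obtain ⟨φ, hφ, h1, h2⟩ := h.approx
  exact ⟨h.memLp.ae_eq huv, h.memLp_grad.ae_eq hGH, φ, hφ,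
    h1.congr (fun _ => ae_eq_refl _) huv, h2.congr (fun _ => ae_eq_refl _) hGH⟩

theorem HasH1Grad.add {u v : Eu m → ℝ} {G H : Eu m → Eu m} (h : HasH1Grad Ω u G)
    (h' : HasH1Grad Ω v H) : HasH1Grad Ω (u + v) (G + H) := by
  have hu := h.memLp.add h'.memLp
  have hG := h.memLp_grad.add h'.memLp_grad
  refine ⟨hu, hG, hu.locallyIntegrableOn', hG.locallyIntegrableOn', fun φ hφ p => ?_⟩
  have i1 : MemLp (fun x => fderiv ℝ φ x (EuclideanSpace.single p 1)) 2 (volume.restrict Ω) := by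
    have := (hφ.memLp_gradient 2).coord p
    simpa only [gradient_apply_coord] using this
  simp only [Pi.add_apply, PiLp.add_apply, add_mul]
  rw [integral_add (h.memLp.integrable_fun_mul i1) (h'.memLp.integrable_fun_mul i1),
    integral_add ((h.memLp_grad.coord p).integrable_fun_mul (hφ.memLp 2))
      ((h'.memLp_grad.coord p).integrable_fun_mul (hφ.memLp 2)),
    h.weak.integral_eq φ hφ p, h'.weak.integral_eq φ hφ p]
  ring

theorem HasH1Grad.const_smul {u : Eu m → ℝ} {G : Eu m → Eu m} (h : HasH1Grad Ω u G) (c : ℝ) :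
    HasH1Grad Ω (c • u) (c • G) := by
  have hu := h.memLp.const_smul c
  have hG := h.memLp_grad.const_smul c
  refine ⟨hu, hG, hu.locallyIntegrableOn', hG.locallyIntegrableOn', fun φ hφ p => ?_⟩
  simp only [Pi.smul_apply, PiLp.smul_apply, smul_eq_mul, mul_assoc]
  rw [integral_const_mul, integral_const_mul, h.weak.integral_eq φ hφ p]
  ring

theorem HasH10Grad.add {u v : Eu m → ℝ} {G H : Eu m → Eu m} (h : HasH10Grad Ω u G)
    (h' : HasH10Grad Ω v H) : HasH10Grad Ω (u + v) (G + H) := by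
  obtain ⟨φ, hφ, h1, h2⟩ := h.approx
  obtain ⟨ψ, hψ, h3, h4⟩ := h'.approx
  refine ⟨h.memLp.add h'.memLp, h.memLp_grad.add h'.memLp_grad, fun n => φ n + ψ n,
    fun n => (hφ n).add (hψ n),
    h1.add h3 (fun n => ((hφ n).memLp 2).1) h.memLp.1 (fun n => ((hψ n).memLp 2).1) h'.memLp.1,
    (h2.add h4 (fun n => ((hφ n).memLp_gradient 2).1) h.memLp_grad.1
      (fun n => ((hψ n).memLp_gradient 2).1) h'.memLp_grad.1).congr
      (fun n => ae_of_all _ fun x => ?_) (ae_eq_refl _)⟩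
  exact (gradient_add' ((hφ n).contDiff_one.differentiable (by norm_num) x)
    ((hψ n).contDiff_one.differentiable (by norm_num) x)).symm

theorem HasH10Grad.const_smul {u : Eu m → ℝ} {G : Eu m → Eu m} (h : HasH10Grad Ω u G) (c : ℝ) :
    HasH10Grad Ω (c • u) (c • G) := by
  obtain ⟨φ, hφ, h1, h2⟩ := h.approx
  refine ⟨h.memLp.const_smul c, h.memLp_grad.const_smul c, fun n x => c * φ n x,
    fun n => (hφ n).const_mul c, h1.clm (c • ContinuousLinearMap.id ℝ ℝ),
    (h2.clm (c • ContinuousLinearMap.id ℝ (Eu m))).congr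
      (fun n => ae_of_all _ fun x => ?_) (ae_eq_refl _)⟩
  exact (gradient_const_mul' c ((hφ n).contDiff_one.differentiable (by norm_num) x)).symm

theorem HasH1Grad.sub {u v : Eu m → ℝ} {G H : Eu m → Eu m} (h : HasH1Grad Ω u G)
    (h' : HasH1Grad Ω v H) : HasH1Grad Ω (u - v) (G - H) := by
  have := h.add (h'.const_smul (-1))
  convert this using 1 <;> simp [sub_eq_add_neg]

theorem HasH10Grad.sub {u v : Eu m → ℝ} {G H : Eu m → Eu m} (h : HasH10Grad Ω u G)
    (h' : HasH10Grad Ω v H) : HasH10Grad Ω (u - v) (G - H) := by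
  have := h.add (h'.const_smul (-1))
  convert this using 1 <;> simp [sub_eq_add_neg]

theorem HasH10Grad.zero : HasH10Grad Ω (0 : Eu m → ℝ) 0 := by
  have := (IsTestFunction.zero (Ω := Ω)).hasH10Grad
  refine this.congr (ae_eq_refl _) (ae_of_all _ fun x => ?_)
  rw [gradient_eq_toDual_symm]
  simp

theorem HasH10Grad.finset_sum {ι : Type*} (s : Finset ι) {u : ι → Eu m → ℝ}
    {G : ι → Eu m → Eu m} (h : ∀ i ∈ s, HasH10Grad Ω (u i) (G i)) :
    HasH10Grad Ω (∑ i ∈ s, u i) (∑ i ∈ s, G i) := by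
  classical
  induction s using Finset.induction_on with
  | empty => simpa using HasH10Grad.zero
  | insert a s ha ih =>
    rw [Finset.sum_insert ha, Finset.sum_insert ha]
    exact (h a (Finset.mem_insert_self _ _)).add
      (ih fun i hi => h i (Finset.mem_insert_of_mem hi))

/-- `H¹₀(Ω)` is closed in `H¹(Ω)`. -/
theorem HasH10Grad.of_L2Lim {u : Eu m → ℝ} {G : Eu m → Eu m} {un : ℕ → Eu m → ℝ}
    {Gn : ℕ → Eu m → Eu m} (hu : MemLp u 2 (volume.restrict Ω))
    (hG : MemLp G 2 (volume.restrict Ω)) (h1 : L2Lim (volume.restrict Ω) un u)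
    (h2 : L2Lim (volume.restrict Ω) Gn G) (h : ∀ n, HasH10Grad Ω (un n) (Gn n)) :
    HasH10Grad Ω u G := by
  -- Diagonal choice: a test function within `1 / (n + 1)` of the `n`-th member, for both function
  -- and gradient.
  have key : ∀ n : ℕ, ∃ φ, IsTestFunction Ω φ ∧
      eLpNorm (un n - φ) 2 (volume.restrict Ω) ≤ ENNReal.ofReal (1 / (n + 1)) ∧
      eLpNorm (Gn n - gradient φ) 2 (volume.restrict Ω) ≤ ENNReal.ofReal (1 / (n + 1)) := by
    intro n
    obtain ⟨φ, hφ, h3, h4⟩ := (h n).approx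
    have hpos : 0 < ENNReal.ofReal (1 / ((n : ℝ) + 1)) := by
      rw [ENNReal.ofReal_pos]; positivity
    obtain ⟨k, hk1, hk2⟩ := ((ENNReal.tendsto_nhds_zero.1 h3 _ hpos).and
      (ENNReal.tendsto_nhds_zero.1 h4 _ hpos)).exists
    refine ⟨φ k, hφ k, ?_, ?_⟩
    · rwa [eLpNorm_sub_comm]
    · rwa [eLpNorm_sub_comm]
  choose φ hφ h3 h4 using key
  have lim0 : Tendsto (fun n : ℕ => ENNReal.ofReal (1 / ((n : ℝ) + 1))) atTop (𝓝 0) := by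
    have := ENNReal.tendsto_ofReal (tendsto_one_div_add_atTop_nhds_zero_nat (𝕜 := ℝ))
    simpa using this
  refine ⟨hu, hG, φ, hφ, ?_, ?_⟩
  · have := lim0.add h1
    rw [add_zero] at this
    refine tendsto_of_tendsto_of_tendsto_of_le_of_le tendsto_const_nhds this
      (fun _ => zero_le) (fun n => ?_)
    have e : φ n - u = (φ n - un n) + (un n - u) := by abel
    rw [e]
    refine (eLpNorm_add_le (((hφ n).memLp 2).1.sub (h n).memLp.1)
      ((h n).memLp.1.sub hu.1) (by norm_num)).trans ?_
    gcongr
    rw [eLpNorm_sub_comm]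
    exact h3 n
  · have := lim0.add h2
    rw [add_zero] at this
    refine tendsto_of_tendsto_of_tendsto_of_le_of_le tendsto_const_nhds this
      (fun _ => zero_le) (fun n => ?_)
    have e : gradient (φ n) - G = (gradient (φ n) - Gn n) + (Gn n - G) := by abel
    rw [e]
    refine (eLpNorm_add_le (((hφ n).memLp_gradient 2).1.sub (h n).memLp_grad.1)
      ((h n).memLp_grad.1.sub hG.1) (by norm_num)).trans ?_
    gcongr
    rw [eLpNorm_sub_comm]
    exact h4 n

/-- The pairs `HasH1Grad` and `HasH10Grad` carry the gradient as a datum that can be computed and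
changed on null sets. This lemma and the next ones translate between the pairs and the chosen
`weakGrad` of the statement. -/
theorem MemH1.hasH1Grad {u : Eu m → ℝ} (h : MemH1 Ω u) : HasH1Grad Ω u (weakGrad Ω u) := by
  refine ⟨h.memLp, h.memLp_grad, ?_⟩
  rw [weakGrad, dif_pos h.weakDiff]
  exact h.weakDiff.choose_spec

theorem HasH1Grad.weakGrad_ae_eq (hΩ : IsOpen Ω) {u : Eu m → ℝ} {G : Eu m → Eu m}
    (h : HasH1Grad Ω u G) : weakGrad Ω u =ᵐ[volume.restrict Ω] G :=
  h.weak.weakGrad_ae_eq hΩ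

theorem HasH1Grad.memH1 (hΩ : IsOpen Ω) {u : Eu m → ℝ} {G : Eu m → Eu m}
    (h : HasH1Grad Ω u G) : MemH1 Ω u :=
  ⟨h.memLp, ⟨G, h.weak⟩, h.memLp_grad.ae_eq (h.weakGrad_ae_eq hΩ).symm⟩

theorem HasH10Grad.memH10 (hΩ : IsOpen Ω) {u : Eu m → ℝ} {G : Eu m → Eu m}
    (h : HasH10Grad Ω u G) : MemH10 Ω u := by
  refine ⟨h.hasH1Grad.memH1 hΩ, ?_⟩
  obtain ⟨φ, hφ, h1, h2⟩ := h.approx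
  refine ⟨φ, hφ, ?_⟩
  have e : ∀ k, h1Norm Ω (u - φ k) = (eLpNorm (φ k - u) 2 (volume.restrict Ω) ^ 2
      + eLpNorm (gradient (φ k) - G) 2 (volume.restrict Ω) ^ 2) ^ (1 / 2 : ℝ) := by
    intro k
    have := (h.hasH1Grad.sub (hφ k).hasH1Grad).weakGrad_ae_eq hΩ
    rw [h1Norm, eLpNorm_congr_ae this, eLpNorm_sub_comm, eLpNorm_sub_comm G]
  simp_rw [e]
  have h3 := ((ENNReal.continuous_pow 2).tendsto 0 |>.comp h1).add
    ((ENNReal.continuous_pow 2).tendsto 0 |>.comp h2)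
  have h4 := (ENNReal.continuous_rpow_const (y := (1 / 2 : ℝ))).tendsto _ |>.comp h3
  simpa [Function.comp_def] using h4

theorem MemH10.hasH10Grad (hΩ : IsOpen Ω) {u : Eu m → ℝ} (h : MemH10 Ω u) :
    HasH10Grad Ω u (weakGrad Ω u) := by
  obtain ⟨h0, φ, hφ, h1⟩ := h
  have e : ∀ k, eLpNorm (weakGrad Ω (u - φ k)) 2 (volume.restrict Ω)
      = eLpNorm (gradient (φ k) - weakGrad Ω u) 2 (volume.restrict Ω) := by
    intro k
    rw [eLpNorm_congr_ae ((h0.hasH1Grad.sub (hφ k).hasH1Grad).weakGrad_ae_eq hΩ),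
      eLpNorm_sub_comm]
  have aux : ∀ a b : ℝ≥0∞, a ≤ (a ^ 2 + b ^ 2) ^ (1 / 2 : ℝ) := by
    intro a b
    calc a = (a ^ 2) ^ (1 / 2 : ℝ) := by
          rw [← ENNReal.rpow_natCast, ← ENNReal.rpow_mul]; norm_num
      _ ≤ _ := by gcongr; exact le_self_add
  refine ⟨h0.memLp, h0.memLp_grad, φ, hφ, ?_, ?_⟩
  · refine tendsto_of_tendsto_of_tendsto_of_le_of_le tendsto_const_nhds h1
      (fun _ => zero_le) (fun n => ?_)
    simp only
    rw [eLpNorm_sub_comm]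
    exact aux _ _
  · refine tendsto_of_tendsto_of_tendsto_of_le_of_le tendsto_const_nhds h1
      (fun _ => zero_le) (fun n => ?_)
    simp only
    rw [← e, h1Norm, add_comm]
    exact aux _ _

end Sobolev

/-! ### A weighted L² bound for integral operators. -/

section Kernel

/-- Cauchy–Schwarz for a kernel `k` with `k² ≤ P Q`. -/
theorem lintegral_mul_sq_le {α : Type*} [MeasurableSpace α] {μ : Measure α}
    {k P Q F : α → ℝ≥0∞} (hP : AEMeasurable P μ) (hQ : AEMeasurable Q μ) (hF : AEMeasurable F μ)
    (hk : ∀ᵐ z ∂μ, k z ^ 2 ≤ P z * Q z) :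
    (∫⁻ z, k z * F z ∂μ) ^ 2 ≤ (∫⁻ z, P z ∂μ) * ∫⁻ z, Q z * F z ^ 2 ∂μ := by
  have h := ENNReal.lintegral_mul_le_Lp_mul_Lq μ Real.HolderConjugate.two_two
    (hP.pow_const (1 / 2 : ℝ)) ((hQ.pow_const (1 / 2 : ℝ)).mul hF)
  have sq : ∀ a : ℝ≥0∞, (a ^ (1 / 2 : ℝ)) ^ (2 : ℝ) = a := fun a => by
    rw [← ENNReal.rpow_mul]; norm_num
  have sq' : ∀ a : ℝ≥0∞, (a ^ (1 / 2 : ℝ)) ^ 2 = a := fun a => by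
    rw [← ENNReal.rpow_natCast]; exact_mod_cast sq a
  have h1 : ∫⁻ z, k z * F z ∂μ ≤
      ∫⁻ z, ((fun z => P z ^ (1 / 2 : ℝ)) * ((fun z => Q z ^ (1 / 2 : ℝ)) * F)) z ∂μ := by
    refine lintegral_mono_ae ?_
    filter_upwards [hk] with z hz
    simp only [Pi.mul_apply]
    rw [← mul_assoc, ← ENNReal.mul_rpow_of_nonneg _ _ (by norm_num)]
    gcongr
    calc k z = (k z ^ 2) ^ (1 / 2 : ℝ) := by
          rw [← ENNReal.rpow_natCast, ← ENNReal.rpow_mul]; norm_num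
      _ ≤ _ := by gcongr
  refine (pow_le_pow_left' (h1.trans h) 2).trans (le_of_eq ?_)
  rw [mul_pow, sq', sq']
  congr 1
  · simp_rw [sq]
  · refine lintegral_congr fun z => ?_
    simp only [Pi.mul_apply]
    rw [ENNReal.mul_rpow_of_nonneg _ _ (by norm_num), sq]
    norm_cast

variable {m : ℕ}

/-- Cauchy–Schwarz for each `x`, then Tonelli and the translation `y = x + z` carry the weight over
to `Q`. The operator with kernel `k` is thus bounded as soon as `∫ P` is finite and `∫ Q(z) V(y - z)
dz` is bounded in `y`. -/
theorem lintegral_kernel_sq_le {k P Q F V : Eu m → ℝ≥0∞} (hP : Measurable P)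
    (hQ : Measurable Q) (hF : Measurable F) (hV : Measurable V)
    (hk : ∀ᵐ z, k z ^ 2 ≤ P z * Q z) :
    ∫⁻ x, V x * (∫⁻ z, k z * F (x + z)) ^ 2 ≤
      (∫⁻ z, P z) * ∫⁻ y, F y ^ 2 * ∫⁻ z, Q z * V (y - z) := by
  have h1 : ∀ x, V x * (∫⁻ z, k z * F (x + z)) ^ 2 ≤
      (∫⁻ z, P z) * ∫⁻ z, V x * (Q z * F (x + z) ^ 2) := by
    intro x
    rw [lintegral_const_mul _ (by fun_prop), mul_left_comm]
    gcongr
    exact lintegral_mul_sq_le hP.aemeasurable hQ.aemeasurable (by fun_prop) hk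
  refine (lintegral_mono h1).trans ?_
  rw [lintegral_const_mul _ (Measurable.lintegral_prod_right' (f := fun q : Eu m × Eu m =>
    V q.1 * (Q q.2 * F (q.1 + q.2) ^ 2)) (by fun_prop))]
  refine mul_le_mul_right ?_ _
  change ∫⁻ x, ∫⁻ z, V x * (Q z * F (x + z) ^ 2) ≤ _
  rw [lintegral_lintegral_swap (by fun_prop)]
  have h2 : ∀ z, ∫⁻ x, V x * (Q z * F (x + z) ^ 2) = ∫⁻ y, F y ^ 2 * (Q z * V (y - z)) := by
    intro z
    rw [← lintegral_add_right_eq_self (fun y => F y ^ 2 * (Q z * V (y - z))) z]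
    refine lintegral_congr fun x => ?_
    rw [add_sub_cancel_right]
    ring
  simp_rw [h2]
  rw [lintegral_lintegral_swap (by fun_prop)]
  refine le_of_eq (lintegral_congr fun y => ?_)
  rw [lintegral_const_mul _ (by fun_prop)]

end Kernel

/-! ### Mollification. -/

section Mollify

variable {m : ℕ} {F : Type*} [NormedAddCommGroup F] [NormedSpace ℝ F]

/-- A bump function supported in the ball of radius `2 / (n + 1)`. -/
noncomputable def mollBump (m n : ℕ) : ContDiffBump (0 : Eu m) where
  rIn := 1 / (n + 1)
  rOut := 2 / (n + 1)
  rIn_pos := by positivity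
  rIn_lt_rOut := by
    have : (0 : ℝ) < n + 1 := by positivity
    gcongr
    norm_num

/-- The mollification of `f` at the scale `2 / (n + 1)`. -/
noncomputable def mollify (n : ℕ) (f : Eu m → F) : Eu m → F :=
  convolution ((mollBump m n).normed volume) f (ContinuousLinearMap.lsmul ℝ ℝ) volume

theorem mollify_congr {f g : Eu m → F} (h : f =ᵐ[volume] g) (n : ℕ) :
    mollify n f = mollify n g :=
  convolution_congr _ (ae_eq_refl _) h

theorem mollBump_rOut_tendsto : Tendsto (fun n => (mollBump m n).rOut) atTop (𝓝 0) := by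
  have := (tendsto_one_div_add_atTop_nhds_zero_nat (𝕜 := ℝ)).const_mul 2
  simpa [mollBump, div_eq_mul_inv] using this

theorem enorm_mollify_le (n : ℕ) (f : Eu m → F) (x : Eu m) :
    ‖mollify n f x‖ₑ ≤
      ∫⁻ z, ENNReal.ofReal ((mollBump m n).normed volume z) * ‖f (x + z)‖ₑ := by
  rw [mollify, convolution_lsmul]
  refine (enorm_integral_le_lintegral_enorm _).trans (le_of_eq ?_)
  rw [← lintegral_neg_eq_self]
  refine lintegral_congr fun z => ?_
  rw [enorm_smul, ContDiffBump.normed_neg, sub_neg_eq_add,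
    Real.enorm_eq_ofReal ((mollBump m n).nonneg_normed _)]

theorem lintegral_mollBump (n : ℕ) :
    ∫⁻ z, ENNReal.ofReal ((mollBump m n).normed volume z) = 1 := by
  rw [← ofReal_integral_eq_lintegral_ofReal (mollBump m n).integrable_normed
    (ae_of_all _ (mollBump m n).nonneg_normed), (mollBump m n).integral_normed]
  simp

theorem mollify_sub {f g : Eu m → F} (hf : LocallyIntegrable f) (hg : LocallyIntegrable g)
    (n : ℕ) : mollify n (f - g) = mollify n f - mollify n g := by
  have hc := (mollBump m n).hasCompactSupport_normed (μ := volume)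
  have hk : Continuous ((mollBump m n).normed volume) := (mollBump m n).continuous_normed
  ext x
  have h1 := hc.convolutionExists_left (ContinuousLinearMap.lsmul ℝ ℝ) hk hf x
  have h2 := hc.convolutionExists_left (ContinuousLinearMap.lsmul ℝ ℝ) hk hg x
  simp only [mollify, Pi.sub_apply, convolution_lsmul, smul_sub]
  exact integral_sub h1.integrable h2.integrable

theorem contDiff_mollify {f : Eu m → F} (hf : LocallyIntegrable f) (n : ℕ) :
    ContDiff ℝ (⊤ : ℕ∞) (mollify n f) :=
  (mollBump m n).hasCompactSupport_normed.contDiff_convolution_left _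
    (mollBump m n).contDiff_normed hf

/-- The kernel bound with `P = Q = k` and `V = 1`, since the bump `k` has integral 1. -/
theorem eLpNorm_mollify_le {f : Eu m → F} (hf : AEStronglyMeasurable f volume) (n : ℕ) :
    eLpNorm (mollify n f) 2 volume ≤ eLpNorm f 2 volume := by
  obtain ⟨g, hg, hfg⟩ := hf
  rw [mollify_congr hfg, eLpNorm_congr_ae hfg]
  rw [eLpNorm_eq_lintegral_rpow_enorm_toReal (by norm_num) (by norm_num),
    eLpNorm_eq_lintegral_rpow_enorm_toReal (by norm_num) (by norm_num)]
  gcongr 1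
  have hk : Measurable fun z => ENNReal.ofReal ((mollBump m n).normed volume z) :=
    ((mollBump m n).continuous_normed.measurable).ennreal_ofReal
  have h := lintegral_kernel_sq_le (V := 1) hk hk (hg.enorm)
    measurable_const (ae_of_all _ fun z => (sq (ENNReal.ofReal
      ((mollBump m n).normed volume z))).le)
  simp only [Pi.one_apply, one_mul, mul_one, lintegral_mollBump] at h
  simp only [ENNReal.toReal_ofNat, ENNReal.rpow_ofNat]
  refine le_trans (lintegral_mono fun x => ?_) h
  gcongr
  exact enorm_mollify_le n g x

theorem mollify_apply_eq_zero {f : Eu m → F} {n : ℕ} {x : Eu m}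
    (h : ∀ y ∈ Metric.ball x (2 / (n + 1)), f y = 0) : mollify n f x = 0 := by
  rw [mollify, convolution_lsmul]
  refine integral_eq_zero_of_ae (ae_of_all _ fun t => ?_)
  by_cases ht : t ∈ Metric.ball (0 : Eu m) (2 / (n + 1))
  · have : x - t ∈ Metric.ball x (2 / (n + 1)) := by
      simpa [dist_eq_norm] using ht
    simp [h _ this]
  · have : (mollBump m n).normed volume t = 0 := by
      have := (mollBump m n).support_normed_eq (μ := volume)
      by_contra h0
      have h1 : t ∈ Function.support ((mollBump m n).normed volume) := h0
      rw [this] at h1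
      exact ht h1
    simp [this]

variable [CompleteSpace F]

theorem mollify_tendsto_of_continuous {f : Eu m → F} (hf : Continuous f) (x : Eu m) :
    Tendsto (fun n => mollify n f x) atTop (𝓝 (f x)) :=
  ContDiffBump.convolution_tendsto_right_of_continuous mollBump_rOut_tendsto hf x

/-- Approximate `f` in L² by a continuous `g` with compact support. For `g` the convergence is
pointwise and dominated by a constant on the 2-neighbourhood of the support, all radii `2 / (n + 1)`
being at most 2. The error `f - g` is not enlarged by mollification. -/
theorem L2Lim_mollify {f : Eu m → F} (hf : MemLp f 2 volume) :
    L2Lim volume (fun n => mollify n f) f := by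
  refine ENNReal.tendsto_nhds_zero.2 fun ε hε => ?_
  have hε3 : ε / 3 ≠ 0 := by
    simp [hε.ne']
  obtain ⟨g, hgc, hfg, hg, hg2⟩ := hf.exists_hasCompactSupport_eLpNorm_sub_le
    (by norm_num) hε3
  have hlg : LocallyIntegrable g volume := hg.locallyIntegrable
  have hlf : LocallyIntegrable f volume := hf.locallyIntegrable (by norm_num)
  have key : L2Lim volume (fun n => mollify n g) g := by
    obtain ⟨C, hC⟩ := hgc.exists_bound_of_continuous hg
    have hC0 : 0 ≤ C := (norm_nonneg _).trans (hC 0)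
    have hcpt : IsCompact (Metric.cthickening 2 (tsupport g)) := hgc.isCompact.cthickening
    refine L2Lim.of_dominated (b := (Metric.cthickening 2 (tsupport g)).indicator fun _ => C)
      (fun n => (contDiff_mollify hlg n).continuous.aestronglyMeasurable) ?_ (fun n => ?_)
      (ae_of_all _ fun x => mollify_tendsto_of_continuous hg x)
    · exact memLp_indicator_const 2 Metric.isClosed_cthickening.measurableSet C
        (Or.inr hcpt.measure_lt_top.ne)
    · refine ae_of_all _ fun x => ?_
      by_cases hx : x ∈ Metric.cthickening 2 (tsupport g)
      · rw [Set.indicator_of_mem hx]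
        have h1 := enorm_mollify_le n g x
        have h2 : ∫⁻ z, ENNReal.ofReal ((mollBump m n).normed volume z) * ‖g (x + z)‖ₑ ≤
            ∫⁻ z, ENNReal.ofReal ((mollBump m n).normed volume z) * ENNReal.ofReal C := by
          gcongr with z
          rw [← ofReal_norm]
          exact ENNReal.ofReal_le_ofReal (hC _)
        rw [lintegral_mul_const _ (mollBump m n).continuous_normed.measurable.ennreal_ofReal,
          lintegral_mollBump, one_mul] at h2
        have h3 := h1.trans h2
        rw [← ofReal_norm] at h3
        exact (ENNReal.ofReal_le_ofReal_iff hC0).1 h3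
      · rw [Set.indicator_of_notMem hx, mollify_apply_eq_zero, norm_zero]
        intro y hy
        by_contra h0
        refine hx (Metric.mem_cthickening_of_dist_le x y 2 _ (subset_tsupport _ h0) ?_)
        have : (2 : ℝ) / (n + 1) ≤ 2 := div_le_self (by norm_num) (by
          have : (0 : ℝ) ≤ n := Nat.cast_nonneg n
          linarith)
        rw [dist_comm]
        exact (Metric.mem_ball.1 hy).le.trans this
  filter_upwards [ENNReal.tendsto_nhds_zero.1 key _ (pos_iff_ne_zero.2 hε3)] with n hn
  have e : mollify n f - f = mollify n (f - g) + ((mollify n g - g) + (g - f)) := by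
    rw [mollify_sub hlf hlg]; abel
  have mm : ∀ h : Eu m → F, LocallyIntegrable h → AEStronglyMeasurable (mollify n h) volume :=
    fun h hh => (contDiff_mollify hh n).continuous.aestronglyMeasurable
  rw [e]
  refine (eLpNorm_add_le (mm _ (hlf.sub hlg)) (((mm _ hlg).sub hg2.1).add (hg2.1.sub hf.1))
    (by norm_num)).trans ?_
  have h5 : eLpNorm (mollify n g - g + (g - f)) 2 volume ≤ ε / 3 + ε / 3 := by
    refine (eLpNorm_add_le ((mm _ hlg).sub hg2.1) (hg2.1.sub hf.1) (by norm_num)).trans ?_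
    gcongr
    rw [eLpNorm_sub_comm]
    exact hfg
  calc _ ≤ ε / 3 + (ε / 3 + ε / 3) := by
        gcongr
        exact (eLpNorm_mollify_le (hf.1.sub hg2.1) n).trans hfg
    _ = ε := by rw [← add_assoc]; exact ENNReal.add_thirds ε

variable {Ω : Set (Eu m)}

/-- The gradient of a mollification is the mollification of the weak gradient. -/
theorem HasWeakGrad.gradient_mollify (hΩ : IsOpen Ω) {u : Eu m → ℝ} {G : Eu m → Eu m}
    (h : HasH1Grad Ω u G) {n : ℕ} {x : Eu m}
    (hx : Metric.closedBall x (2 / (n + 1)) ⊆ Ω) :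
    gradient (mollify n (Ω.indicator u)) x = mollify n (Ω.indicator G) x := by
  have hu : LocallyIntegrable (Ω.indicator u) volume :=
    ((memLp_indicator_iff_restrict hΩ.measurableSet).2 h.memLp).locallyIntegrable (by norm_num)
  have hG : LocallyIntegrable (Ω.indicator G) volume :=
    ((memLp_indicator_iff_restrict hΩ.measurableSet).2 h.memLp_grad).locallyIntegrable
      (by norm_num)
  set ρ := (mollBump m n).normed (volume : Measure (Eu m)) with hρ
  have hρs : ContDiff ℝ (⊤ : ℕ∞) ρ := (mollBump m n).contDiff_normed
  have hρc : HasCompactSupport ρ := (mollBump m n).hasCompactSupport_normed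
  have hρ1 : ContDiff ℝ 1 ρ := hρs.of_le (by exact_mod_cast le_top)
  -- Because the closed ball lies in `Ω`, the reflected kernel `ρ (x - ·)` may be used in the
  -- definition of the weak gradient. That is the whole point; the rest identifies both sides with
  -- convolutions.
  have htest : IsTestFunction Ω (fun t => ρ (x - t)) := by
    have ts : tsupport (fun t => ρ (x - t)) ⊆ Metric.closedBall x (2 / (n + 1)) := by
      refine closure_minimal (fun t ht => ?_) Metric.isClosed_closedBall
      have h1 : x - t ∈ Function.support ρ := ht
      rw [hρ, (mollBump m n).support_normed_eq] at h1
      have : ‖x - t‖ < 2 / (n + 1) := by simpa [mollBump] using h1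
      rw [Metric.mem_closedBall, dist_comm, dist_eq_norm]
      exact this.le
    refine ⟨hρs.comp (contDiff_const.sub contDiff_id), ?_, ts.trans hx⟩
    exact HasCompactSupport.of_support_subset_isCompact (isCompact_closedBall x _)
      (subset_closure.trans ts)
  ext p
  rw [gradient_apply_coord]
  have hd := hρc.hasFDerivAt_convolution_left (ContinuousLinearMap.lsmul ℝ ℝ) hρ1 hu x
  change fderiv ℝ (convolution ρ (Ω.indicator u) (ContinuousLinearMap.lsmul ℝ ℝ) volume) x _ = _
  rw [hd.fderiv]
  have hρf : HasCompactSupport (fderiv ℝ ρ) := hρc.fderiv ℝ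
  have cρf : Continuous (fderiv ℝ ρ) := hρ1.continuous_fderiv (by norm_num)
  have hce := hρf.convolutionExists_left
    (ContinuousLinearMap.precompL (Eu m) (ContinuousLinearMap.lsmul ℝ ℝ)) cρf hu x
  have e1 : (convolution (fderiv ℝ ρ) (Ω.indicator u)
      (ContinuousLinearMap.precompL (Eu m) (ContinuousLinearMap.lsmul ℝ ℝ)) volume x)
        (EuclideanSpace.single p 1)
      = ∫ t, fderiv ℝ ρ (x - t) (EuclideanSpace.single p 1) * Ω.indicator u t := by
    rw [convolution_def, ContinuousLinearMap.integral_apply hce.integrable]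
    rw [← integral_sub_left_eq_self _ volume x]
    refine integral_congr_ae (ae_of_all _ fun t => ?_)
    simp [ContinuousLinearMap.precompL_apply]
  have e2 : ∀ t, fderiv ℝ (fun t => ρ (x - t)) t (EuclideanSpace.single p 1)
      = - fderiv ℝ ρ (x - t) (EuclideanSpace.single p 1) := by
    intro t
    have h1 : HasFDerivAt ρ (fderiv ℝ ρ (x - t)) (x - t) :=
      (hρ1.differentiable (by norm_num) (x - t)).hasFDerivAt
    have h2 := h1.comp t ((hasFDerivAt_id t).const_sub x)
    change fderiv ℝ (ρ ∘ fun t => x - t) t _ = _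
    erw [h2.fderiv]
    simp
  have e3 : ∫ t, fderiv ℝ ρ (x - t) (EuclideanSpace.single p 1) * Ω.indicator u t
      = - ∫ t in Ω, u t * fderiv ℝ (fun t => ρ (x - t)) t (EuclideanSpace.single p 1) := by
    rw [← integral_neg, ← integral_indicator hΩ.measurableSet]
    refine integral_congr_ae (ae_of_all _ fun t => ?_)
    by_cases ht : t ∈ Ω
    · simp [ht, e2, mul_comm]
    · simp [ht]
  have e4 : mollify n (Ω.indicator G) x p = ∫ t in Ω, G t p * ρ (x - t) := by
    have hce2 := hρc.convolutionExists_left (ContinuousLinearMap.lsmul ℝ ℝ) hρ1.continuous hG x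
    rw [← integral_indicator hΩ.measurableSet]
    change (EuclideanSpace.proj (𝕜 := ℝ) p) (convolution ρ (Ω.indicator G)
      (ContinuousLinearMap.lsmul ℝ ℝ) volume x) = _
    rw [convolution_def, ← ContinuousLinearMap.integral_comp_comm _ hce2.integrable]
    rw [← integral_sub_left_eq_self _ volume x]
    refine integral_congr_ae (ae_of_all _ fun t => ?_)
    by_cases ht : t ∈ Ω
    · simp [ht, mul_comm]
    · simp [ht]
  rw [e1, e3, e4, h.weak.integral_eq _ htest p, neg_neg]

end Mollify

/-! ### Product and chain rules for weak gradients. -/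

section Calculus

variable {m : ℕ} {Ω : Set (Eu m)}

theorem L2Lim.restrict {F : Type*} [NormedAddCommGroup F] {f : ℕ → Eu m → F} {g : Eu m → F}
    (h : L2Lim volume f g) (Ω : Set (Eu m)) : L2Lim (volume.restrict Ω) f g :=
  tendsto_of_tendsto_of_tendsto_of_le_of_le tendsto_const_nhds h (fun _ => zero_le)
    fun _ => eLpNorm_mono_measure _ Measure.restrict_le_self

section

variable {F : Type*} [NormedAddCommGroup F] [NormedSpace ℝ F]

theorem contDiff_mollify_indicator (hΩ : IsOpen Ω) {f : Eu m → F}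
    (hf : MemLp f 2 (volume.restrict Ω)) (n : ℕ) :
    ContDiff ℝ (⊤ : ℕ∞) (mollify n (Ω.indicator f)) :=
  contDiff_mollify (((memLp_indicator_iff_restrict hΩ.measurableSet).2 hf).locallyIntegrable
    (by norm_num)) n

theorem memLp_mollify_indicator (hΩ : IsOpen Ω) {f : Eu m → F}
    (hf : MemLp f 2 (volume.restrict Ω)) (n : ℕ) :
    MemLp (mollify n (Ω.indicator f)) 2 (volume.restrict Ω) := by
  have h := (memLp_indicator_iff_restrict hΩ.measurableSet).2 hf
  refine MemLp.restrict Ω ⟨?_, (eLpNorm_mollify_le h.1 n).trans_lt h.2⟩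
  exact (contDiff_mollify (h.locallyIntegrable (by norm_num)) n).continuous.aestronglyMeasurable

variable [CompleteSpace F]

theorem L2Lim_mollify_indicator (hΩ : IsOpen Ω) {f : Eu m → F}
    (hf : MemLp f 2 (volume.restrict Ω)) :
    L2Lim (volume.restrict Ω) (fun n => mollify n (Ω.indicator f)) f := by
  have h1 : MemLp (Ω.indicator f) 2 volume := (memLp_indicator_iff_restrict hΩ.measurableSet).2 hf
  have h2 : Ω.indicator f =ᵐ[volume.restrict Ω] f := indicator_ae_eq_restrict hΩ.measurableSet
  exact L2Lim.congr ((L2Lim_mollify h1).restrict Ω) (fun n => ae_eq_refl _) h2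

end

/-- A compact subset of `Ω` has a neighbourhood of positive width in `Ω`; the radii are those of the
mollifiers, so `HasWeakGrad.gradient_mollify` applies on `K` for large `n`. -/
theorem IsCompact.eventually_closedBall_subset {K : Set (Eu m)} (hK : IsCompact K)
    (hΩ : IsOpen Ω) (hKΩ : K ⊆ Ω) :
    ∀ᶠ n : ℕ in atTop, ∀ x ∈ K, Metric.closedBall x (2 / (n + 1)) ⊆ Ω := by
  obtain ⟨δ, hδ, h⟩ := hK.exists_cthickening_subset_open hΩ hKΩ
  have h1 : Tendsto (fun n : ℕ => (2 : ℝ) / (n + 1)) atTop (𝓝 0) := by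
    have := (tendsto_one_div_add_atTop_nhds_zero_nat (𝕜 := ℝ)).const_mul 2
    simpa [div_eq_mul_inv] using this
  filter_upwards [h1.eventually (gt_mem_nhds hδ)] with n hn x hx y hy
  exact h (Metric.mem_cthickening_of_dist_le y x δ K hx ((Metric.mem_closedBall.1 hy).trans hn.le))

/-- Mollifications of `z` times `ζ` are test functions. On the compact support of `ζ` their
gradients are eventually given by the mollified `G`, so they converge to the gradient of the
product. -/
theorem HasH1Grad.mul_test (hΩ : IsOpen Ω) {z ζ : Eu m → ℝ} {G : Eu m → Eu m}
    (h : HasH1Grad Ω z G) (hζ : IsTestFunction Ω ζ) :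
    HasH10Grad Ω (fun x => z x * ζ x) (fun x => z x • gradient ζ x + ζ x • G x) := by
  have mζ := hζ.memLp (Ω := Ω) ∞
  have mζ' := hζ.memLp_gradient (Ω := Ω) ∞
  have l1 := L2Lim_mollify_indicator hΩ h.memLp
  have l2 := L2Lim_mollify_indicator hΩ h.memLp_grad
  have m1 := memLp_mollify_indicator hΩ h.memLp
  have m2 := memLp_mollify_indicator hΩ h.memLp_grad
  have s1 := contDiff_mollify_indicator hΩ h.memLp
  refine ⟨?_, ?_, fun n x => mollify n (Ω.indicator z) x * ζ x,
    fun n => hζ.mul_left (s1 n), ?_, ?_⟩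
  · exact MemLp.smul (p := 2) (q := ∞) (r := 2) mζ h.memLp
  · refine MemLp.add ?_ ?_
    · exact MemLp.smul (p := 2) (q := ∞) (r := 2) mζ' h.memLp
    · exact MemLp.smul (p := ∞) (q := 2) (r := 2) h.memLp_grad mζ
  · exact l1.smul_linfty mζ
  · refine ((l1.smul_linfty mζ').add (l2.linfty_smul mζ (fun n => (m2 n).1) h.memLp_grad)
      (fun n => (m1 n).1.smul mζ'.1) (h.memLp.1.smul mζ'.1) (fun n => mζ.1.smul (m2 n).1)
      (mζ.1.smul h.memLp_grad.1)).congr' ?_ (ae_eq_refl _)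
    filter_upwards [hζ.compact.eventually_closedBall_subset hΩ hζ.supp] with n hn
    refine ae_of_all _ fun x => ?_
    rw [gradient_mul' ((s1 n).differentiable (by simp) x)
      (hζ.smooth.differentiable (by simp) x)]
    simp only [Pi.add_apply]
    congr 1
    by_cases hx : x ∈ tsupport ζ
    · rw [HasWeakGrad.gradient_mollify hΩ h (hn x hx)]
    · simp [image_eq_zero_of_notMem_tsupport hx]

/-- Replace `v` by test functions and use `HasH1Grad.mul_test`; boundedness of `b` and `β` lets the
products converge in L². This makes the test functions built from the cofactors admissible. -/
theorem HasH10Grad.mul_linfty (hΩ : IsOpen Ω) {b v : Eu m → ℝ} {β H : Eu m → Eu m}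
    (hb : HasH1Grad Ω b β) (hb1 : MemLp b ∞ (volume.restrict Ω))
    (hb2 : MemLp β ∞ (volume.restrict Ω)) (hv : HasH10Grad Ω v H) :
    HasH10Grad Ω (fun x => b x * v x) (fun x => b x • H x + v x • β x) := by
  obtain ⟨φ, hφ, h1, h2⟩ := hv.approx
  refine HasH10Grad.of_L2Lim (un := fun n x => b x * φ n x)
    (Gn := fun n x => b x • gradient (φ n) x + φ n x • β x) ?_ ?_ ?_ ?_
    (fun n => hb.mul_test hΩ (hφ n))
  · exact MemLp.smul (p := ∞) (q := 2) (r := 2) hv.memLp hb1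
  · refine MemLp.add ?_ ?_
    · exact MemLp.smul (p := ∞) (q := 2) (r := 2) hv.memLp_grad hb1
    · exact MemLp.smul (p := 2) (q := ∞) (r := 2) hb2 hv.memLp
  · exact h1.linfty_smul hb1 (fun n => ((hφ n).memLp 2).1) hv.memLp
  · exact (h2.linfty_smul hb1 (fun n => ((hφ n).memLp_gradient 2).1) hv.memLp_grad).add
      (h1.smul_linfty hb2) (fun n => hb1.1.smul ((hφ n).memLp_gradient 2).1)
      (hb1.1.smul hv.memLp_grad.1) (fun n => ((hφ n).memLp 2).1.smul hb2.1)
      (hv.memLp.1.smul hb2.1)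

theorem norm_sub_le_of_fderiv_le {N : ℕ} {F : Eu N → ℝ} (hF : ContDiff ℝ 1 F) {L : ℝ}
    (hL : ∀ z, ‖fderiv ℝ F z‖ ≤ L) (a b : Eu N) : |F a - F b| ≤ L * ‖a - b‖ :=
  Convex.norm_image_sub_le_of_norm_fderiv_le (s := Set.univ)
    (fun x _ => hF.differentiable (by norm_num) x) (fun x _ => hL x) convex_univ
    (Set.mem_univ b) (Set.mem_univ a)

theorem memLp_of_coord {N : ℕ} {y : Eu m → Eu N} {q : ℝ≥0∞} {μ : Measure (Eu m)}
    (h : ∀ i, MemLp (fun x => y x i) q μ) : MemLp y q μ := by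
  have : y = fun x => ∑ i, (y x i) • (EuclideanSpace.single i (1 : ℝ) : Eu N) := by
    ext x i
    simp [Pi.single_apply]
  rw [this]
  exact memLp_finsetSum _ fun i _ =>
    ((ContinuousLinearMap.id ℝ ℝ).smulRight (EuclideanSpace.single i (1 : ℝ) : Eu N)).comp_memLp' (h i)

theorem L2Lim.of_coord {N : ℕ} {yn : ℕ → Eu m → Eu N} {y : Eu m → Eu N} {μ : Measure (Eu m)}
    (h : ∀ i, L2Lim μ (fun n x => yn n x i) (fun x => y x i))
    (mn : ∀ n i, AEStronglyMeasurable (fun x => yn n x i) μ)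
    (my : ∀ i, AEStronglyMeasurable (fun x => y x i) μ) : L2Lim μ yn y := by
  have e : ∀ z : Eu N, ∑ i, (z i) • (EuclideanSpace.single i (1 : ℝ) : Eu N) = z := by
    intro z
    ext i
    simp [Pi.single_apply]
  have := L2Lim.finset_sum Finset.univ (f := fun i n x =>
    (yn n x i) • (EuclideanSpace.single i (1 : ℝ) : Eu N))
    (g := fun i x => (y x i) • (EuclideanSpace.single i (1 : ℝ) : Eu N)) (μ := μ)
    (fun i _ => (h i).clm ((ContinuousLinearMap.id ℝ ℝ).smulRight _))
    (fun i n => (mn n i).smul_const _) (fun i => (my i).smul_const _)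
  refine this.congr (fun n => ae_of_all _ fun x => e _) (ae_of_all _ fun x => e _)

theorem gradient_comp_vec {N : ℕ} {F : Eu N → ℝ} {y : Eu m → Eu N} {x : Eu m}
    (hF : DifferentiableAt ℝ F (y x)) (hy : ∀ i, DifferentiableAt ℝ (fun x => y x i) x) :
    gradient (fun x => F (y x)) x
      = ∑ i, fderiv ℝ F (y x) (EuclideanSpace.single i 1) • gradient (fun x => y x i) x := by
  have hy' : DifferentiableAt ℝ y x := differentiableAt_euclidean.2 hy
  ext p
  rw [gradient_apply_coord]
  change fderiv ℝ (F ∘ y) x _ = _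
  rw [fderiv_comp x hF hy', ContinuousLinearMap.comp_apply, WithLp.ofLp_sum, Finset.sum_apply]
  have e : fderiv ℝ y x (EuclideanSpace.single p 1)
      = ∑ i, (gradient (fun x => y x i) x p) • (EuclideanSpace.single i (1 : ℝ) : Eu N) := by
    ext i
    have h1 : ∀ i, HasFDerivAt (fun x => y x i) ((EuclideanSpace.proj (𝕜 := ℝ) i).comp (fderiv ℝ y x))
        x := fun i => (EuclideanSpace.proj (𝕜 := ℝ) i).hasFDerivAt.comp x hy'.hasFDerivAt
    have h2 := congrArg (fun T : Eu m →L[ℝ] ℝ => T (EuclideanSpace.single p 1)) (h1 i).fderiv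
    simp [gradient_apply_coord, Pi.single_apply]
    exact h2.symm
  rw [e, map_sum]
  refine Finset.sum_congr rfl fun i _ => ?_
  rw [map_smul, PiLp.smul_apply, smul_eq_mul, smul_eq_mul, mul_comm]

/-- The chain rule for a `C¹` function with bounded derivative. -/
theorem HasH1Grad.comp_contDiff (hΩ : IsOpen Ω) (hb : Bornology.IsBounded Ω) {N : ℕ}
    {y : Eu m → Eu N} {G : Fin N → Eu m → Eu m} (h : ∀ i, HasH1Grad Ω (fun x => y x i) (G i))
    {F : Eu N → ℝ} (hF : ContDiff ℝ 1 F) {L : ℝ} (hL : ∀ z, ‖fderiv ℝ F z‖ ≤ L) :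
    HasH1Grad Ω (fun x => F (y x))
      (fun x => ∑ i, fderiv ℝ F (y x) (EuclideanSpace.single i 1) • G i x) := by
  have : IsFiniteMeasure (volume.restrict Ω) := ⟨by
    rw [Measure.restrict_apply_univ]; exact hb.measure_lt_top⟩
  have hFd : ∀ i : Fin N, Continuous fun z => fderiv ℝ F z (EuclideanSpace.single i 1) :=
    fun i => (hF.continuous_fderiv (by norm_num)).clm_apply continuous_const
  have hFb : ∀ (i : Fin N) z, |fderiv ℝ F z (EuclideanSpace.single i 1)| ≤ L := by
    intro i z
    have h1 := (fderiv ℝ F z).le_opNorm (EuclideanSpace.single i 1)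
    rw [Real.norm_eq_abs] at h1
    refine h1.trans ?_
    rw [PiLp.norm_single, norm_one, mul_one]
    exact hL z
  have hy : MemLp y 2 (volume.restrict Ω) := memLp_of_coord fun i => (h i).memLp
  have hFy : ∀ w : Eu m → Eu N, MemLp w 2 (volume.restrict Ω) →
      MemLp (fun x => F (w x)) 2 (volume.restrict Ω) := by
    intro w hw
    refine MemLp.of_le ((memLp_const |F 0|).add (hw.norm.const_mul L))
      (hF.continuous.comp_aestronglyMeasurable hw.1) (ae_of_all _ fun x => ?_)
    have h1 := norm_sub_le_of_fderiv_le hF hL (w x) 0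
    rw [sub_zero] at h1
    have h2 : |F (w x)| ≤ |F (w x) - F 0| + |F 0| := by
      have := abs_add_le (F (w x) - F 0) (F 0)
      simpa using this
    simp only [Pi.add_apply, Real.norm_eq_abs]
    refine le_trans ?_ (le_abs_self _)
    linarith
  have hgrad : ∀ (w : Eu m → Eu N) (H : Fin N → Eu m → Eu m),
      AEStronglyMeasurable w (volume.restrict Ω) → (∀ i, MemLp (H i) 2 (volume.restrict Ω)) →
      MemLp (fun x => ∑ i, fderiv ℝ F (w x) (EuclideanSpace.single i 1) • H i x) 2
        (volume.restrict Ω) := by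
    intro w H hw hH
    refine memLp_finsetSum _ fun i _ => ?_
    refine MemLp.of_le ((hH i).norm.const_mul L)
      (((hFd i).comp_aestronglyMeasurable hw).smul (hH i).1) (ae_of_all _ fun x => ?_)
    rw [norm_smul, norm_mul, norm_norm, Real.norm_eq_abs L]
    gcongr
    exact (hFb i _).trans (le_abs_self L)
  set yn : ℕ → Eu m → Eu N := fun n x =>
    WithLp.toLp 2 fun i => mollify n (Ω.indicator fun x => y x i) x with hyn
  have myn : ∀ n, MemLp (yn n) 2 (volume.restrict Ω) := fun n =>
    memLp_of_coord fun i => memLp_mollify_indicator hΩ (h i).memLp n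
  have lyn : L2Lim (volume.restrict Ω) yn y := by
    refine L2Lim.of_coord (fun i => L2Lim_mollify_indicator hΩ (h i).memLp) (fun n i => ?_)
      fun i => (h i).memLp.1
    exact (memLp_mollify_indicator hΩ (h i).memLp n).1
  -- The partial derivatives of `F` are only continuous and bounded, so their values converge only
  -- almost everywhere, along a subsequence. This is what `L2Lim.bdd_smul` needs.
  obtain ⟨s, hs, hae⟩ := lyn.exists_subseq_ae (fun n => (myn n).1) hy.1
  refine HasH1Grad.of_L2Lim (un := fun n x => F (yn (s n) x))
    (Gn := fun n x => ∑ i, fderiv ℝ F (yn (s n) x) (EuclideanSpace.single i 1) •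
      mollify (s n) (Ω.indicator (G i)) x) (hFy y hy)
    (hgrad y G hy.1 fun i => (h i).memLp_grad) (fun n => hFy _ (myn _))
    (fun n => hgrad _ _ (myn _).1 fun i => memLp_mollify_indicator hΩ (h i).memLp_grad _) ?_ ?_ ?_
  · have h3 : Tendsto (fun n => ENNReal.ofReal L *
        eLpNorm (yn (s n) - y) 2 (volume.restrict Ω)) atTop (𝓝 0) := by
      have := ENNReal.Tendsto.const_mul (a := ENNReal.ofReal L) (lyn.comp hs)
        (Or.inr ENNReal.ofReal_ne_top)
      simpa using this
    refine tendsto_of_tendsto_of_tendsto_of_le_of_le tendsto_const_nhds h3 (fun _ => zero_le)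
        (fun n => ?_)
    refine eLpNorm_le_mul_eLpNorm_of_ae_le_mul (ae_of_all _ fun x => ?_) 2
    exact norm_sub_le_of_fderiv_le hF hL _ _
  · refine L2Lim.finset_sum _ (fun i _ => ?_) (fun i n => ?_) (fun i => ?_)
    · refine L2Lim.bdd_smul (L := L)
        ((L2Lim_mollify_indicator hΩ (h i).memLp_grad).comp hs)
        (fun n => (hFd i).comp_aestronglyMeasurable (myn _).1)
        (fun n => ae_of_all _ fun x => hFb i _) ?_
        (fun n => (memLp_mollify_indicator hΩ (h i).memLp_grad _).1) (h i).memLp_grad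
      filter_upwards [hae] with x hx
      exact ((hFd i).tendsto _).comp hx
    · exact ((hFd i).comp_aestronglyMeasurable (myn _).1).smul
        (memLp_mollify_indicator hΩ (h i).memLp_grad _).1
    · exact ((hFd i).comp_aestronglyMeasurable hy.1).smul (h i).memLp_grad.1
  · intro φ hφ p
    have hs' := hs.tendsto_atTop.eventually
      (hφ.compact.eventually_closedBall_subset hΩ hφ.supp)
    filter_upwards [hs'] with n hn
    have cd : ∀ i, ContDiff ℝ (⊤ : ℕ∞) fun x => yn (s n) x i := fun i =>
      contDiff_mollify_indicator hΩ (h i).memLp _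
    have cdy : ContDiff ℝ 1 (yn (s n)) :=
      contDiff_euclidean.2 fun i => (cd i).of_le (by exact_mod_cast le_top)
    have h1 : ContDiff ℝ 1 fun x => F (yn (s n) x) := hF.comp cdy
    rw [h1.integral_mul_fderiv_test hφ p]
    congr 1
    refine integral_congr_ae (ae_of_all _ fun x => ?_)
    by_cases hx : x ∈ tsupport φ
    · simp only
      rw [gradient_comp_vec (hF.differentiable (by norm_num) _)
        fun i => (cd i).differentiable (by simp) x]
      have e : ∀ i, gradient (fun x => yn (s n) x i) x = mollify (s n) (Ω.indicator (G i)) x :=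
        fun i => HasWeakGrad.gradient_mollify hΩ (h i) (hn x hx)
      simp_rw [e]
    · simp [image_eq_zero_of_notMem_tsupport hx]

theorem HasH1Grad.comp_real (hΩ : IsOpen Ω) (hb : Bornology.IsBounded Ω)
    {v : Eu m → ℝ} {G : Eu m → Eu m} (h : HasH1Grad Ω v G)
    {T : ℝ → ℝ} (hT : ContDiff ℝ 1 T) {L : ℝ} (hL : ∀ t, |deriv T t| ≤ L) :
    HasH1Grad Ω (fun x => T (v x)) (fun x => deriv T (v x) • G x) := by
  have hd : ∀ z : Eu 1, HasFDerivAt (fun z : Eu 1 => T (z 0))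
      (deriv T (z 0) • (EuclideanSpace.proj (𝕜 := ℝ) (0 : Fin 1) : Eu 1 →L[ℝ] ℝ)) z := by
    intro z
    exact (hT.differentiable (by norm_num) (z 0)).hasDerivAt.comp_hasFDerivAt z
      (EuclideanSpace.proj (𝕜 := ℝ) (0 : Fin 1)).hasFDerivAt
  have hF : ContDiff ℝ 1 fun z : Eu 1 => T (z 0) :=
    hT.comp (EuclideanSpace.proj (𝕜 := ℝ) (0 : Fin 1)).contDiff
  have key := HasH1Grad.comp_contDiff hΩ hb (y := fun x => WithLp.toLp 2 fun _ : Fin 1 => v x)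
    (G := fun _ => G) (fun _ => h) hF (L := L) (fun z => ?_)
  · refine key.congr (ae_eq_refl _) (ae_of_all _ fun x => ?_)
    simp [(hd _).fderiv]
  · rw [(hd z).fderiv, norm_smul]
    have : ‖(EuclideanSpace.proj (𝕜 := ℝ) (0 : Fin 1) : Eu 1 →L[ℝ] ℝ)‖ ≤ 1 := by
      refine ContinuousLinearMap.opNorm_le_bound _ zero_le_one fun z => ?_
      rw [one_mul]
      exact PiLp.norm_apply_le z 0
    calc _ ≤ |deriv T (z 0)| * 1 := by rw [Real.norm_eq_abs]; gcongr
      _ ≤ L := by rw [mul_one]; exact hL _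

end Calculus

theorem exists_deriv_smoothTransition_le : ∃ L : ℝ, 0 < L ∧
    ∀ t, |deriv Real.smoothTransition t| ≤ L := by
  have hc : Continuous (deriv Real.smoothTransition) :=
    (Real.smoothTransition.contDiff (n := 1)).continuous_deriv (by norm_num)
  have hs : HasCompactSupport (deriv Real.smoothTransition) := by
    refine HasCompactSupport.intro (isCompact_Icc (a := (0 : ℝ)) (b := 1)) fun x hx => ?_
    rw [Set.mem_Icc, not_and_or, not_le, not_le] at hx
    rcases hx with hx | hx
    · have : Real.smoothTransition =ᶠ[𝓝 x] fun _ => (0 : ℝ) := by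
        filter_upwards [gt_mem_nhds hx] with y hy
        exact Real.smoothTransition.zero_of_nonpos hy.le
      rw [this.deriv_eq, deriv_const]
    · have : Real.smoothTransition =ᶠ[𝓝 x] fun _ => (1 : ℝ) := by
        filter_upwards [lt_mem_nhds hx] with y hy
        exact Real.smoothTransition.one_of_one_le hy.le
      rw [this.deriv_eq, deriv_const]
  obtain ⟨C, hC⟩ := hs.exists_bound_of_continuous hc
  exact ⟨|C| + 1, by positivity, fun t => (hC t).trans (by linarith [le_abs_self C])⟩

/-! ### Membership in `H¹₀` of functions vanishing where an `H¹₀` function is small. -/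

section Vanish

variable {m : ℕ} {Ω : Set (Eu m)}

/-- Let test functions φₙ tend to `u` and let σ be smooth with σ(0) = 0 and σ = 1 on [δ, ∞). The
products v σ(φₙ) lie in `H¹₀` and tend to v σ(u) = v. Boundedness of `v` controls the gradient term
v σ'(φₙ) ∇φₙ. -/
theorem HasH1Grad.hasH10Grad_of_bounded (hΩ : IsOpen Ω)
    {v u : Eu m → ℝ} {H U : Eu m → Eu m} (hv : HasH1Grad Ω v H) (hu : HasH10Grad Ω u U)
    {δ R : ℝ} (hδ : 0 < δ) (hR : ∀ x, |v x| ≤ R)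
    (hz : ∀ᵐ x ∂(volume.restrict Ω), u x < δ → v x = 0) : HasH10Grad Ω v H := by
  obtain ⟨L, hL0, hL⟩ := exists_deriv_smoothTransition_le
  have hR0 : 0 ≤ R := (abs_nonneg _).trans (hR 0)
  set σ : ℝ → ℝ := fun t => Real.smoothTransition (t / δ) with hσ
  have σs : ContDiff ℝ (⊤ : ℕ∞) σ := Real.smoothTransition.contDiff.comp (contDiff_id.div_const δ)
  have σ0 : σ 0 = 0 := by simp [hσ]
  have σd : Continuous (deriv σ) := (σs.of_le (m := 1) (by exact_mod_cast le_top)).continuous_deriv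
    (by norm_num)
  have σ1 : ∀ t, |σ t| ≤ 1 := fun t => by
    rw [abs_of_nonneg (Real.smoothTransition.nonneg _)]
    exact Real.smoothTransition.le_one _
  have σL : ∀ t, |deriv σ t| ≤ L / δ := fun t => by
    have h1 : deriv σ t = deriv Real.smoothTransition (t / δ) / δ := by
      have h2 := ((Real.smoothTransition.contDiff (n := 1)).differentiable (by norm_num)
        (t / δ)).hasDerivAt.comp t ((hasDerivAt_id t).div_const δ)
      rw [show σ = Real.smoothTransition ∘ fun t => id t / δ from rfl, h2.deriv]
      simp [div_eq_mul_inv]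
    rw [h1, abs_div, abs_of_pos hδ]
    exact div_le_div_of_nonneg_right (hL _) hδ.le
  obtain ⟨φ, hφ, h1, h2⟩ := hu.approx
  obtain ⟨s, hs, hae⟩ := h1.exists_subseq_ae (fun n => ((hφ n).memLp 2).1) hu.memLp.1
  have hvs : ∀ᵐ x ∂(volume.restrict Ω), v x * σ (u x) = v x := by
    filter_upwards [hz] with x hx
    rcases lt_or_ge (u x) δ with h | h
    · simp [hx h]
    · have : σ (u x) = 1 := Real.smoothTransition.one_of_one_le ((one_le_div hδ).2 h)
      rw [this, mul_one]
  have ht : ∀ n, IsTestFunction Ω fun x => σ (φ (s n) x) := fun n => (hφ (s n)).comp_left σs σ0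
  have mφ : ∀ n, AEStronglyMeasurable (φ (s n)) (volume.restrict Ω) :=
    fun n => ((hφ _).memLp 2).1
  have hgr : ∀ n x, gradient (fun x => σ (φ (s n) x)) x
      = deriv σ (φ (s n) x) • gradient (φ (s n)) x := fun n x =>
    gradient_comp' (σs.differentiable (by simp) _) ((hφ (s n)).smooth.differentiable (by simp) x)
  have lim2 : L2Lim (volume.restrict Ω)
      (fun n x => (v x * deriv σ (φ (s n) x)) • gradient (φ (s n)) x)
      (fun x => (v x * deriv σ (u x)) • U x) := by
    refine (h2.comp hs).bdd_smul (L := R * (L / δ))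
      (fun n => hv.memLp.1.mul (σd.comp_aestronglyMeasurable (mφ n)))
      (fun n => ae_of_all _ fun x => ?_) ?_ (fun n => ((hφ _).memLp_gradient 2).1) hu.memLp_grad
    · rw [abs_mul]
      exact mul_le_mul (hR x) (σL _) (abs_nonneg _) hR0
    · filter_upwards [hae] with x hx
      exact ((σd.tendsto _).comp hx).const_mul _
  have lim3 : L2Lim (volume.restrict Ω) (fun n x => σ (φ (s n) x) • H x)
      (fun x => σ (u x) • H x) := by
    refine (L2Lim.const H).bdd_smul (L := 1)
      (fun n => σs.continuous.comp_aestronglyMeasurable (mφ n))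
      (fun n => ae_of_all _ fun x => σ1 _) ?_ (fun _ => hv.memLp_grad.1) hv.memLp_grad
    filter_upwards [hae] with x hx
    exact (σs.continuous.tendsto _).comp hx
  have M2 : MemLp (fun x => (v x * deriv σ (u x)) • U x) 2 (volume.restrict Ω) := by
    refine MemLp.of_le (hu.memLp_grad.norm.const_mul (R * (L / δ)))
      ((hv.memLp.1.mul (σd.comp_aestronglyMeasurable hu.memLp.1)).smul hu.memLp_grad.1)
      (ae_of_all _ fun x => ?_)
    rw [Real.norm_of_nonneg (by positivity : 0 ≤ R * (L / δ) * ‖U x‖), norm_smul, norm_mul,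
      Real.norm_eq_abs, Real.norm_eq_abs]
    gcongr
    · exact hR x
    · exact σL _
  have M3 : MemLp (fun x => σ (u x) • H x) 2 (volume.restrict Ω) := by
    refine MemLp.of_le hv.memLp_grad
      ((σs.continuous.comp_aestronglyMeasurable hu.memLp.1).smul hv.memLp_grad.1)
      (ae_of_all _ fun x => ?_)
    rw [norm_smul, Real.norm_eq_abs]
    exact mul_le_of_le_one_left (norm_nonneg _) (σ1 _)
  have key : HasH10Grad Ω v
      ((fun x => (v x * deriv σ (u x)) • U x) + fun x => σ (u x) • H x) := by
    refine HasH10Grad.of_L2Lim (un := fun n x => v x * σ (φ (s n) x))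
      (Gn := fun n x => v x • gradient (fun x => σ (φ (s n) x)) x + σ (φ (s n) x) • H x)
      hv.memLp (M2.add M3) ?_ ?_ (fun n => hv.mul_test hΩ (ht n))
    · refine L2Lim.of_dominated (b := fun x => |v x|)
        (fun n => hv.memLp.1.mul (σs.continuous.comp_aestronglyMeasurable (mφ n)))
        hv.memLp.norm (fun n => ae_of_all _ fun x => ?_) ?_
      · rw [Real.norm_eq_abs, abs_mul]
        exact mul_le_of_le_one_right (abs_nonneg _) (σ1 _)
      · filter_upwards [hae, hvs] with x hx hx2
        have := ((σs.continuous.tendsto _).comp hx).const_mul (v x)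
        rwa [hx2] at this
    · refine (lim2.add lim3 (fun n => ?_) M2.1 (fun n => ?_) M3.1).congr
        (fun n => ae_of_all _ fun x => ?_) (ae_eq_refl _)
      · exact (hv.memLp.1.mul (σd.comp_aestronglyMeasurable (mφ n))).smul
          ((hφ _).memLp_gradient 2).1
      · exact (σs.continuous.comp_aestronglyMeasurable (mφ n)).smul hv.memLp_grad.1
      · simp only [Pi.add_apply, hgr, smul_smul]
  -- The limit gradient contains the extra term v σ'(u) U; uniqueness of weak gradients identifies
  -- it with `H`.
  exact key.congr (ae_eq_refl _) (key.hasH1Grad.weak.ae_eq hΩ hv.weak)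

/-- A function in `H¹(Ω)` that vanishes where some `u ∈ H¹₀(Ω)` is below a positive level
belongs to `H¹₀(Ω)`. -/
theorem HasH1Grad.hasH10Grad_of_vanish (hΩ : IsOpen Ω) (hb : Bornology.IsBounded Ω)
    {v u : Eu m → ℝ} {H U : Eu m → Eu m} (hv : HasH1Grad Ω v H) (hu : HasH10Grad Ω u U)
    {δ : ℝ} (hδ : 0 < δ) (hz : ∀ᵐ x ∂(volume.restrict Ω), u x < δ → v x = 0) :
    HasH10Grad Ω v H := by
  -- Smooth bounded truncations of the identity, with T(0) = 0, |T'| ≤ 1, T → id and T' → 1; they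
  -- reduce the claim to the bounded case.
  set T : ℕ → ℝ → ℝ := fun n t => (n + 1) * Real.arctan (t / (n + 1)) with hT
  have npos : ∀ n : ℕ, (0 : ℝ) < n + 1 := fun n => by positivity
  have hTd : ∀ n t, HasDerivAt (T n) (1 / (1 + (t / (n + 1)) ^ 2)) t := by
    intro n t
    have h1 := (((hasDerivAt_id t).div_const ((n : ℝ) + 1)).arctan).const_mul ((n : ℝ) + 1)
    refine h1.congr_deriv ?_
    have := (npos n).ne'
    simp only [id]
    field_simp
  have hTs : ∀ n, ContDiff ℝ 1 (T n) := fun n =>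
    contDiff_const.mul (Real.contDiff_arctan.comp (contDiff_id.div_const _))
  have hT1 : ∀ n t, |deriv (T n) t| ≤ 1 := by
    intro n t
    rw [(hTd n t).deriv, abs_of_nonneg (by positivity)]
    exact (div_le_one (by positivity)).2 (by nlinarith [sq_nonneg (t / ((n : ℝ) + 1))])
  have hTle : ∀ n t, |T n t| ≤ |t| := by
    intro n t
    have := Convex.norm_image_sub_le_of_norm_deriv_le (s := Set.univ) (f := T n) (x := 0) (y := t)
      (C := 1) (fun x _ => (hTd n x).differentiableAt) (fun x _ => hT1 n x) convex_univ
      (Set.mem_univ _) (Set.mem_univ _)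
    simpa [hT] using this
  have lim0 : ∀ t : ℝ, Tendsto (fun n : ℕ => t / ((n : ℝ) + 1)) atTop (𝓝 0) := by
    intro t
    have := (tendsto_one_div_add_atTop_nhds_zero_nat (𝕜 := ℝ)).const_mul t
    simpa [div_eq_mul_inv] using this
  have hTlim : ∀ t, Tendsto (fun n => T n t) atTop (𝓝 t) := by
    intro t
    rcases eq_or_ne t 0 with rfl | ht
    · simp [hT]
    · have h1 : Tendsto (fun n : ℕ => t / ((n : ℝ) + 1)) atTop (𝓝[≠] 0) :=
        tendsto_nhdsWithin_iff.2 ⟨lim0 t, Eventually.of_forall fun n =>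
          div_ne_zero ht (npos n).ne'⟩
      have h2 := (hasDerivAt_iff_tendsto_slope.1 (Real.hasDerivAt_arctan 0)).comp h1
      have h3 := h2.const_mul t
      simp only [Function.comp_def, slope_def_field, Real.arctan_zero, sub_zero] at h3
      have h4 : t * (1 / (1 + (0 : ℝ) ^ 2)) = t := by norm_num
      rw [h4] at h3
      refine h3.congr fun n => ?_
      have := (npos n).ne'
      simp only [hT]
      field_simp
  have hTn : ∀ n, HasH10Grad Ω (fun x => T n (v x)) (fun x => deriv (T n) (v x) • H x) := by
    intro n
    refine (hv.comp_real hΩ hb (hTs n) (hT1 n)).hasH10Grad_of_bounded hΩ hu hδ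
      (R := (n + 1) * (Real.pi / 2)) (fun x => ?_) ?_
    · rw [hT, abs_mul, abs_of_pos (npos n)]
      gcongr
      rw [abs_le]
      exact ⟨(Real.neg_pi_div_two_lt_arctan _).le, (Real.arctan_lt_pi_div_two _).le⟩
    · filter_upwards [hz] with x hx hux
      simp [hx hux, hT]
  refine HasH10Grad.of_L2Lim hv.memLp hv.memLp_grad ?_ ?_ hTn
  · refine L2Lim.of_dominated (b := fun x => |v x|)
      (fun n => (hTn n).memLp.1) hv.memLp.norm (fun n => ae_of_all _ fun x => hTle n _)
      (ae_of_all _ fun x => hTlim _)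
  · have := (L2Lim.const (μ := volume.restrict Ω) H).bdd_smul (L := 1)
      (θ := fun n x => deriv (T n) (v x)) (θ' := fun _ => 1)
      (fun n => ((hTs n).continuous_deriv (by norm_num)).comp_aestronglyMeasurable hv.memLp.1)
      (fun n => ae_of_all _ fun x => hT1 n _) (ae_of_all _ fun x => ?_)
      (fun _ => hv.memLp_grad.1) hv.memLp_grad
    · simpa using this
    · have h1 : Tendsto (fun n : ℕ => 1 / (1 + (v x / ((n : ℝ) + 1)) ^ 2)) atTop
          (𝓝 (1 / (1 + 0 ^ 2))) :=
        tendsto_const_nhds.div (((lim0 (v x)).pow 2).const_add 1) (by norm_num)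
      simp only [(hTd _ _).deriv]
      simpa using h1

end Vanish

/-! ### Pointwise bounds by Riesz potentials over cones. -/

section Riesz

variable {m : ℕ}

theorem lintegral_comp_smul_eq {Φ : Eu m → ℝ≥0∞} (hΦ : Measurable Φ) {r : ℝ} (hr : 0 < r) :
    ∫⁻ x, Φ (r • x) = ENNReal.ofReal ((r ^ m)⁻¹) * ∫⁻ x, Φ x := by
  have h := Measure.map_addHaar_smul (volume : Measure (Eu m)) hr.ne'
  have h2 : ∫⁻ x, Φ x ∂(Measure.map (r • ·) (volume : Measure (Eu m))) = ∫⁻ x, Φ (r • x) :=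
    lintegral_map hΦ (measurable_const_smul r)
  rw [← h2, h, lintegral_smul_measure, finrank_euclideanSpace_fin, abs_of_pos (by positivity),
    smul_eq_mul]

/-- The kernel of the Riesz potential. -/
noncomputable def rieszKernel (m : ℕ) (z : Eu m) : ℝ≥0∞ := ENNReal.ofReal (‖z‖ ^ (1 - (m : ℝ)))

theorem measurable_ofReal_norm_rpow (a : ℝ) :
    Measurable fun z : Eu m => ENNReal.ofReal (‖z‖ ^ a) := by fun_prop

theorem measurable_rieszKernel : Measurable (rieszKernel m) := measurable_ofReal_norm_rpow _

theorem lintegral_rpow_tail_le {r : ℝ} (hr : 0 < r) (hm : 0 < m) :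
    ∫⁻ s in Set.Ioi r, ENNReal.ofReal (s ^ (-(m : ℝ) - 1)) ≤ ENNReal.ofReal (r ^ (-(m : ℝ))) := by
  have hm' : (1 : ℝ) ≤ m := by exact_mod_cast hm
  have ha : -(m : ℝ) - 1 < -1 := by linarith
  rw [← ofReal_integral_eq_lintegral_ofReal (integrableOn_Ioi_rpow_of_lt ha hr)
    ((ae_restrict_iff' measurableSet_Ioi).2 (ae_of_all _ fun s hs =>
      Real.rpow_nonneg (hr.le.trans (le_of_lt hs)) _)), integral_Ioi_rpow_of_lt ha hr]
  refine ENNReal.ofReal_le_ofReal ?_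
  have : -(m : ℝ) - 1 + 1 = -m := by ring
  rw [this, neg_div_neg_eq]
  exact div_le_self (Real.rpow_nonneg hr.le _) hm'

theorem enorm_le_add_lintegral_segment {v : Eu m → ℝ} (hv : ContDiff ℝ 1 v) (x w : Eu m) :
    ‖v x‖ₑ ≤ ‖v (x + w)‖ₑ
      + ∫⁻ s in Set.Ioc (0 : ℝ) 1, ‖gradient v (x + s • w)‖ₑ * ‖w‖ₑ := by
  have hd : ∀ s : ℝ, HasDerivAt (fun s : ℝ => v (x + s • w)) (fderiv ℝ v (x + s • w) w) s := by
    intro s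
    have h1 : HasDerivAt (fun s : ℝ => x + s • w) w s := by
      simpa using ((hasDerivAt_id s).smul_const w).const_add x
    exact ((hv.differentiable (by norm_num) (x + s • w)).hasFDerivAt).comp_hasDerivAt s h1
  have hc : Continuous fun s : ℝ => fderiv ℝ v (x + s • w) w :=
    ((hv.continuous_fderiv (by norm_num)).comp (by fun_prop)).clm_apply continuous_const
  have hi := intervalIntegral.integral_eq_sub_of_hasDerivAt (a := 0) (b := 1)
    (fun s _ => hd s) (hc.intervalIntegrable 0 1)
  simp only [one_smul, zero_smul, add_zero] at hi
  rw [intervalIntegral.integral_of_le zero_le_one] at hi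
  have e : v x = v (x + w) - ∫ s in Set.Ioc (0 : ℝ) 1, fderiv ℝ v (x + s • w) w := by
    rw [hi]; ring
  rw [e]
  refine (enorm_sub_le).trans ?_
  gcongr
  refine (enorm_integral_le_lintegral_enorm _).trans (lintegral_mono fun s => ?_)
  rw [← ofReal_norm, ← ofReal_norm, ← ofReal_norm, ← ENNReal.ofReal_mul (norm_nonneg _)]
  refine ENNReal.ofReal_le_ofReal ?_
  rw [norm_gradient]
  exact ContinuousLinearMap.le_opNorm _ _

/-- Averaging over a star-shaped set. -/
theorem enorm_le_of_starShaped (hm : 0 < m) {v : Eu m → ℝ} (hv : ContDiff ℝ 1 v) {K : Set (Eu m)}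
    (hK : MeasurableSet K) (hstar : ∀ z ∈ K, ∀ s ∈ Set.Ioc (0 : ℝ) 1, s • z ∈ K) {h : ℝ}
    (hh : 0 < h) (hKh : ∀ z ∈ K, ‖z‖ ≤ h) (x : Eu m) :
    volume K * ‖v x‖ₑ ≤ (∫⁻ z in K, ‖v (x + z)‖ₑ)
      + ENNReal.ofReal (h ^ m) * ∫⁻ z in K, rieszKernel m z * ‖gradient v (x + z)‖ₑ := by
  have : NeZero m := ⟨hm.ne'⟩
  have cg : Continuous (gradient v) := hv.continuous_gradient
  have mv : Measurable v := hv.continuous.measurable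
  have mg : Measurable (gradient v) := cg.measurable
  -- The fundamental theorem of calculus on the segment from x to x + w, integrated over w ∈ K.
  have h1 : volume K * ‖v x‖ₑ ≤ (∫⁻ z in K, ‖v (x + z)‖ₑ)
      + ∫⁻ w in K, ∫⁻ s in Set.Ioc (0 : ℝ) 1, ‖gradient v (x + s • w)‖ₑ * ‖w‖ₑ := by
    rw [← lintegral_add_left (by fun_prop)]
    rw [mul_comm, ← setLIntegral_const]
    exact lintegral_mono fun w => enorm_le_add_lintegral_segment hv x w
  refine h1.trans ?_
  refine add_le_add_right ?_ _
  rw [lintegral_lintegral_swap (by fun_prop)]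
  -- Substitute z = s w. The Jacobian s^{-m} and |w| = |z| / s produce s^{-m-1} |z|. The point z
  -- stays in the star-shaped `K`, and |w| ≤ h forces s ≥ |z| / h.
  have h2 : ∀ s ∈ Set.Ioc (0 : ℝ) 1, ∫⁻ w in K, ‖gradient v (x + s • w)‖ₑ * ‖w‖ₑ ≤
      ∫⁻ z in K, ENNReal.ofReal (s ^ (-(m : ℝ) - 1)) *
        ((Set.Ici (‖z‖ / h)).indicator 1 s * (‖gradient v (x + z)‖ₑ * ‖z‖ₑ)) := by
    intro s hs
    have hs0 : 0 < s := hs.1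
    set Ψ : Eu m → ℝ≥0∞ := K.indicator fun w => ‖gradient v (x + s • w)‖ₑ * ‖w‖ₑ with hΨ
    have mΨ : Measurable fun z => Ψ (s⁻¹ • z) :=
      (Measurable.indicator (by fun_prop) hK).comp (measurable_const_smul s⁻¹)
    have e1 : ∫⁻ w in K, ‖gradient v (x + s • w)‖ₑ * ‖w‖ₑ = ∫⁻ w, Ψ (s⁻¹ • (s • w)) := by
      rw [← lintegral_indicator hK]
      refine lintegral_congr fun w => ?_
      rw [smul_smul, inv_mul_cancel₀ hs0.ne', one_smul]
    rw [e1, lintegral_comp_smul_eq (Φ := fun z => Ψ (s⁻¹ • z)) mΨ hs0,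
      ← lintegral_const_mul _ mΨ, ← lintegral_indicator hK]
    refine lintegral_mono fun z => ?_
    rw [hΨ]
    by_cases hz : s⁻¹ • z ∈ K
    · have hzK : z ∈ K := by
        have := hstar _ hz s hs
        rwa [smul_smul, mul_inv_cancel₀ hs0.ne', one_smul] at this
      have hzs : ‖z‖ / h ≤ s := by
        have := hKh _ hz
        rw [norm_smul, norm_inv, Real.norm_eq_abs, abs_of_pos hs0] at this
        rw [div_le_iff₀ hh]
        have h3 := mul_le_mul_of_nonneg_left this hs0.le
        rwa [← mul_assoc, mul_inv_cancel₀ hs0.ne', one_mul] at h3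
      have hmem : s ∈ Set.Ici (‖z‖ / h) := hzs
      rw [Set.indicator_of_mem hz, Set.indicator_of_mem hzK, Set.indicator_of_mem hmem,
        smul_smul, mul_inv_cancel₀ hs0.ne', one_smul, enorm_smul]
      simp only [Pi.one_apply, one_mul]
      rw [Real.enorm_eq_ofReal (by positivity), mul_left_comm (‖gradient v (x + z)‖ₑ),
        ← mul_assoc, ← ENNReal.ofReal_mul (by positivity)]
      refine le_of_eq ?_
      congr 2
      rw [Real.rpow_sub hs0, Real.rpow_neg hs0.le, Real.rpow_one, Real.rpow_natCast,
        div_eq_mul_inv]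
    · rw [Set.indicator_of_notMem hz, mul_zero]
      exact zero_le
  refine (setLIntegral_mono' measurableSet_Ioc h2).trans ?_
  have mind : Measurable fun q : ℝ × Eu m => (Set.Ici (‖q.2‖ / h)).indicator (1 : ℝ → ℝ≥0∞) q.1 := by
    have : (fun q : ℝ × Eu m => (Set.Ici (‖q.2‖ / h)).indicator (1 : ℝ → ℝ≥0∞) q.1)
        = {q : ℝ × Eu m | ‖q.2‖ / h ≤ q.1}.indicator 1 := by
      ext q
      simp [Set.indicator_apply]
    rw [this]
    exact measurable_one.indicator (measurableSet_le (by fun_prop) (by fun_prop))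
  rw [lintegral_lintegral_swap (by fun_prop)]
  rw [← lintegral_const_mul _ (by have := measurable_rieszKernel (m := m); fun_prop)]
  refine lintegral_mono_ae ?_
  have hne : ∀ᵐ z : Eu m ∂(volume.restrict K), z ≠ 0 := by
    refine ae_restrict_of_ae ?_
    rw [ae_iff]
    simp
  filter_upwards [hne] with z hz
  have hz0 : 0 < ‖z‖ := norm_pos_iff.2 hz
  have hr : 0 < ‖z‖ / h := by positivity
  have h3 : ∫⁻ s in Set.Ioc (0 : ℝ) 1, ENNReal.ofReal (s ^ (-(m : ℝ) - 1)) *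
        ((Set.Ici (‖z‖ / h)).indicator 1 s * (‖gradient v (x + z)‖ₑ * ‖z‖ₑ)) ≤
      (∫⁻ s in Set.Ioi (‖z‖ / h), ENNReal.ofReal (s ^ (-(m : ℝ) - 1))) *
        (‖gradient v (x + z)‖ₑ * ‖z‖ₑ) := by
    generalize ‖gradient v (x + z)‖ₑ * ‖z‖ₑ = D
    rw [← lintegral_mul_const _ (by fun_prop), setLIntegral_congr Ioi_ae_eq_Ici,
      ← lintegral_indicator measurableSet_Ici]
    refine (setLIntegral_le_lintegral _ _).trans (lintegral_mono fun s => ?_)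
    by_cases hs : s ∈ Set.Ici (‖z‖ / h)
    · rw [Set.indicator_of_mem hs, Set.indicator_of_mem hs, Pi.one_apply, one_mul]
    · rw [Set.indicator_of_notMem hs, Set.indicator_of_notMem hs, zero_mul, mul_zero]
  refine h3.trans ?_
  -- The integral of s^{-m-1} over s ≥ |z| / h is at most (|z| / h)^{-m}; times |z| this is h^m
  -- |z|^{1-m}.
  refine (mul_le_mul_left (lintegral_rpow_tail_le hr hm) _).trans (le_of_eq ?_)
  rw [mul_left_comm, ← mul_assoc (ENNReal.ofReal (h ^ m)), mul_comm (‖gradient v (x + z)‖ₑ)]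
  congr 1
  rw [← ofReal_norm, rieszKernel, ← ENNReal.ofReal_mul (by positivity),
    ← ENNReal.ofReal_mul (by positivity)]
  congr 1
  rw [Real.div_rpow hz0.le hh.le, Real.rpow_neg hh.le, Real.rpow_sub hz0, Real.rpow_one,
    Real.rpow_neg hz0.le, Real.rpow_natCast, Real.rpow_natCast]
  have := hh.ne'
  field_simp

/-- The finite cone with vertex `0`, axis `e` and height `h`. -/
def finiteCone (h c : ℝ) (e : Eu m) : Set (Eu m) := {z | ‖z‖ ≤ h ∧ c * ‖z‖ ≤ inner ℝ e z}

theorem isClosed_finiteCone (h c : ℝ) (e : Eu m) : IsClosed (finiteCone h c e) :=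
  (isClosed_le continuous_norm continuous_const).inter
    (isClosed_le (continuous_const.mul continuous_norm) (continuous_const.inner continuous_id))

theorem isCompact_finiteCone (h c : ℝ) (e : Eu m) : IsCompact (finiteCone h c e) :=
  (isCompact_closedBall (0 : Eu m) h).of_isClosed_subset (isClosed_finiteCone h c e)
    fun z hz => by simpa using hz.1

theorem smul_mem_finiteCone {h c : ℝ} {e z : Eu m} (hz : z ∈ finiteCone h c e) {s : ℝ}
    (hs : s ∈ Set.Ioc (0 : ℝ) 1) : s • z ∈ finiteCone h c e := by
  refine ⟨?_, ?_⟩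
  · rw [norm_smul, Real.norm_eq_abs, abs_of_pos hs.1]
    exact (mul_le_of_le_one_left (norm_nonneg _) hs.2).trans hz.1
  · rw [norm_smul, Real.norm_eq_abs, abs_of_pos hs.1, inner_smul_right, mul_left_comm]
    exact mul_le_mul_of_nonneg_left hz.2 hs.1.le

/-- The radius does not depend on `e`, so the volumes of all cones of given height and opening have
a common positive lower bound. -/
theorem ball_subset_finiteCone {h c : ℝ} (hh : 0 < h) (hc0 : 0 < c) (hc : c < 1) {e : Eu m}
    (he : ‖e‖ = 1) :
    Metric.ball ((h / 2) • e) (h * ((1 - c) / 4)) ⊆ finiteCone h c e := by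
  intro z hz
  rw [Metric.mem_ball, dist_eq_norm] at hz
  set d := z - (h / 2) • e with hd
  have hzd : z = (h / 2) • e + d := by rw [hd]; abel
  have h1 : ‖z‖ ≤ h / 2 + ‖d‖ := by
    rw [hzd]
    refine (norm_add_le _ _).trans ?_
    rw [norm_smul, he, Real.norm_eq_abs, abs_of_pos (by positivity), mul_one]
  have h2 : h / 2 - ‖d‖ ≤ inner ℝ e z := by
    have h3 := real_inner_le_norm e (-d)
    rw [inner_neg_right, norm_neg, he, one_mul] at h3
    rw [hzd, inner_add_right, inner_smul_right, real_inner_self_eq_norm_sq, he]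
    linarith
  refine ⟨?_, ?_⟩
  · nlinarith
  · have : c * ‖z‖ ≤ c * (h / 2 + ‖d‖) := by gcongr
    nlinarith [norm_nonneg d]

/-- A smooth function is bounded by a truncated Riesz potential over a cone. -/
theorem exists_enorm_le_finiteCone (hm : 0 < m) {h c : ℝ} (hh : 0 < h) (hc0 : 0 < c) (hc : c < 1) :
    ∃ C : ℝ≥0∞, C ≠ ∞ ∧ ∀ v : Eu m → ℝ, ContDiff ℝ 1 v → ∀ x e : Eu m, ‖e‖ = 1 →
      ‖v x‖ₑ ≤ C * ∫⁻ z in finiteCone h c e,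
        rieszKernel m z * (‖v (x + z)‖ₑ + ‖gradient v (x + z)‖ₑ) := by
  have : NeZero m := ⟨hm.ne'⟩
  set κ : ℝ≥0∞ := volume (Metric.ball (0 : Eu m) (h * ((1 - c) / 4))) with hκ
  have hr : 0 < h * ((1 - c) / 4) := by
    have : 0 < 1 - c := by linarith
    positivity
  have κ0 : κ ≠ 0 := (Metric.measure_ball_pos _ _ hr).ne'
  have κt : κ ≠ ∞ := measure_ball_lt_top.ne
  set A : ℝ≥0∞ := ENNReal.ofReal (h ^ ((m : ℝ) - 1)) + ENNReal.ofReal (h ^ m) with hA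
  refine ⟨κ⁻¹ * A, ENNReal.mul_ne_top (ENNReal.inv_ne_top.2 κ0) (by simp [hA]),
    fun v hv x e he => ?_⟩
  have key := enorm_le_of_starShaped hm hv (isClosed_finiteCone h c e).measurableSet
    (fun z hz s hs => smul_mem_finiteCone hz hs) hh (fun z hz => hz.1) x
  have hvol : κ ≤ volume (finiteCone h c e) := by
    rw [hκ, ← Measure.addHaar_ball_center volume ((h / 2) • e)]
    exact measure_mono (ball_subset_finiteCone hh hc0 hc he)
  have mr := measurable_rieszKernel (m := m)
  have mv : Measurable v := hv.continuous.measurable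
  -- Since |z| ≤ h on the cone and m ≥ 1, the factor h^{m-1} |z|^{1-m} is at least 1, so the average
  -- of |v| is dominated by the same kernel.
  have h1 : ∫⁻ z in finiteCone h c e, ‖v (x + z)‖ₑ ≤ ENNReal.ofReal (h ^ ((m : ℝ) - 1)) *
      ∫⁻ z in finiteCone h c e, rieszKernel m z * ‖v (x + z)‖ₑ := by
    rw [← lintegral_const_mul _ (by fun_prop)]
    refine lintegral_mono_ae ?_
    have hne : ∀ᵐ z : Eu m ∂(volume.restrict (finiteCone h c e)), z ≠ 0 := by
      refine ae_restrict_of_ae ?_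
      rw [ae_iff]
      simp
    filter_upwards [hne, ae_restrict_mem (isClosed_finiteCone h c e).measurableSet] with z hz hzK
    have hz0 : 0 < ‖z‖ := norm_pos_iff.2 hz
    rw [← mul_assoc]
    refine le_mul_of_one_le_left zero_le ?_
    rw [rieszKernel, ← ENNReal.ofReal_mul (by positivity), ← ENNReal.ofReal_one]
    refine ENNReal.ofReal_le_ofReal ?_
    have hm' : (0 : ℝ) ≤ (m : ℝ) - 1 := by
      have : (1 : ℝ) ≤ m := by exact_mod_cast hm
      linarith
    have e1 : (1 : ℝ) - m = -((m : ℝ) - 1) := by ring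
    rw [e1, Real.rpow_neg hz0.le, ← div_eq_mul_inv, one_le_div (by positivity)]
    exact Real.rpow_le_rpow hz0.le hzK.1 hm'
  have h2 : κ * ‖v x‖ₑ ≤ A * ∫⁻ z in finiteCone h c e,
      rieszKernel m z * (‖v (x + z)‖ₑ + ‖gradient v (x + z)‖ₑ) := by
    refine (mul_le_mul_left hvol _).trans (key.trans ?_)
    rw [hA, add_mul]
    refine add_le_add (h1.trans ?_) ?_
    · gcongr
      exact le_self_add
    · gcongr
      exact le_add_self
  calc ‖v x‖ₑ = κ⁻¹ * (κ * ‖v x‖ₑ) := by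
        rw [← mul_assoc, ENNReal.inv_mul_cancel κ0 κt, one_mul]
    _ ≤ _ := by rw [mul_assoc]; gcongr

end Riesz

/-! ### The weighted inequality for smooth functions. -/

section Potential

variable {m : ℕ}

/-- The function `|z|^{-a}` truncated to the ball of radius `h`. -/
noncomputable def truncPow (m : ℕ) (h a : ℝ) : Eu m → ℝ≥0∞ :=
  (Metric.closedBall 0 h).indicator fun z => ENNReal.ofReal (‖z‖ ^ (-a))

theorem measurable_truncPow (h a : ℝ) : Measurable (truncPow m h a) :=
  (measurable_ofReal_norm_rpow _).indicator Metric.isClosed_closedBall.measurableSet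

/-- Polar coordinates reduce this to the integrability of r^{m-1-a} at 0. The open ball of radius
`|h| + 1` contains the closed ball of radius `h` whatever the sign of `h`. -/
theorem lintegral_truncPow_lt_top (hm : 0 < m) {h a : ℝ} (ha : a < m) :
    ∫⁻ z, truncPow m h a z < ∞ := by
  have : NeZero m := ⟨hm.ne'⟩
  have h1 : IntegrableOn (fun y : ℝ => y ^ ((m : ℝ) - 1 - a)) (Set.Ioc 0 (|h| + 1)) := by
    have := intervalIntegral.intervalIntegrable_rpow' (a := 0) (b := |h| + 1)
      (r := (m : ℝ) - 1 - a) (by linarith)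
    rwa [intervalIntegrable_iff_integrableOn_Ioc_of_le (by positivity)] at this
  have h2 : IntegrableOn (fun x : Eu m => ‖x‖ ^ (-a)) (Metric.ball 0 (|h| + 1)) := by
    rw [integrableOn_fun_norm_addHaar volume (f := fun t : ℝ => t ^ (-a))]
    refine (h1.mono_set Set.Ioo_subset_Ioc_self).congr_fun (fun y hy => ?_) measurableSet_Ioo
    have hy0 : 0 < y := hy.1
    rw [finrank_euclideanSpace_fin, smul_eq_mul, ← Real.rpow_natCast, ← Real.rpow_add hy0,
      Nat.cast_sub hm]
    simp [sub_eq_add_neg]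
  rw [truncPow, lintegral_indicator Metric.isClosed_closedBall.measurableSet]
  refine lt_of_le_of_lt (lintegral_mono_set (t := Metric.ball 0 (|h| + 1)) fun z hz => ?_)
    (h2.lintegral_lt_top)
  have : ‖z‖ ≤ h := by simpa using hz
  rw [mem_ball_zero_iff]
  linarith [le_abs_self h]

/-- Hölder's inequality with the exponents θ/(θ-2) and θ/2. The power of |z| raised to θ/(θ-2) is
integrable near 0 if (m - 1 - m/θ) θ/(θ-2) < m, which is equivalent to m < θ. If θ = 2, then m = 1
and the power is |z|^{1/2}, bounded by h^{1/2}. -/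
theorem exists_truncPow_holder (hm : 0 < m) {θ : ℝ} (hθm : (m : ℝ) < θ) (hθ2 : 2 ≤ θ) (h : ℝ) :
    ∃ N : ℝ≥0∞, N ≠ ∞ ∧ ∀ V : Eu m → ℝ≥0∞, Measurable V → ∀ y,
      ∫⁻ z, truncPow m h ((m : ℝ) - 1 - m / θ) z * V (y - z) ≤
        N * (∫⁻ z, V z ^ (θ / 2)) ^ (2 / θ) := by
  have hm1 : (1 : ℝ) ≤ m := by exact_mod_cast hm
  have hθ0 : 0 < θ := by linarith
  rcases eq_or_lt_of_le hθ2 with h2 | h2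
  · subst h2
    have hm' : m = 1 := by
      have : m < 2 := by exact_mod_cast hθm
      omega
    refine ⟨ENNReal.ofReal (h ^ (1 / 2 : ℝ)), ENNReal.ofReal_ne_top, fun V hV y => ?_⟩
    have e : (∫⁻ z, V z ^ ((2 : ℝ) / 2)) ^ ((2 : ℝ) / 2) = ∫⁻ z, V (y - z) := by
      rw [lintegral_sub_left_eq_self (fun z => V z) y]
      norm_num
    rw [e, ← lintegral_const_mul _ (by fun_prop)]
    refine lintegral_mono fun z => ?_
    gcongr
    rw [truncPow]
    refine Set.indicator_apply_le' (fun hz => ENNReal.ofReal_le_ofReal ?_) (fun _ => zero_le)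
    have hz' : ‖z‖ ≤ h := by simpa using hz
    have : -((m : ℝ) - 1 - m / 2) = 1 / 2 := by rw [hm']; norm_num
    rw [this]
    exact Real.rpow_le_rpow (norm_nonneg _) hz' (by norm_num)
  · set p : ℝ := θ / 2 with hp
    set q : ℝ := θ / (θ - 2) with hq
    have hθ2' : 0 < θ - 2 := by linarith
    have hpq : q.HolderConjugate p := by
      rw [Real.holderConjugate_iff]
      refine ⟨?_, ?_⟩
      · rw [hq, one_lt_div hθ2']; linarith
      · rw [hq, hp]; field_simp; ring
    set β : ℝ := (m : ℝ) - 1 - m / θ with hβ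
    have hβq : β * q < m := by
      rw [hq, hβ, ← mul_div_assoc, div_lt_iff₀ hθ2']
      have : (m : ℝ) / θ * θ = m := by field_simp
      nlinarith
    have fin := lintegral_truncPow_lt_top hm (h := h) hβq
    refine ⟨(∫⁻ z, truncPow m h (β * q) z) ^ (1 / q),
      (ENNReal.rpow_lt_top_of_nonneg (by rw [one_div]; exact hpq.inv_nonneg) fin.ne).ne,
      fun V hV y => ?_⟩
    have h1 := ENNReal.lintegral_mul_le_Lp_mul_Lq volume hpq
      (measurable_truncPow (m := m) h β).aemeasurable
      (g := fun z => V (y - z)) (by fun_prop)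
    refine h1.trans (le_of_eq ?_)
    congr 1
    · congr 1
      refine lintegral_congr fun z => ?_
      rw [truncPow, truncPow]
      by_cases hz : z ∈ Metric.closedBall (0 : Eu m) h
      · rw [Set.indicator_of_mem hz, Set.indicator_of_mem hz,
          ENNReal.ofReal_rpow_of_nonneg (by positivity) hpq.nonneg, ← Real.rpow_mul (norm_nonneg _)]
        ring_nf
      · rw [Set.indicator_of_notMem hz, Set.indicator_of_notMem hz,
          ENNReal.zero_rpow_of_pos hpq.pos]
    · rw [lintegral_sub_left_eq_self (fun z => V z ^ p) y, hp]
      congr 1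
      rw [one_div_div]

/-- The squared kernel |z|^{2-2m} is the product of the powers with exponents -(m - 1 + m/θ) and -(m
- 1 - m/θ). The first is integrable on balls because m < θ, the second is paired with `V` by
`exists_truncPow_holder`; these are the `P` and `Q` of `lintegral_kernel_sq_le`. -/
theorem exists_potential_le (hm : 0 < m) {θ : ℝ} (hθm : (m : ℝ) < θ) (hθ2 : 2 ≤ θ) (h : ℝ) :
    ∃ N : ℝ≥0∞, N ≠ ∞ ∧ ∀ V F : Eu m → ℝ≥0∞, Measurable V → Measurable F →
      ∫⁻ x, V x * (∫⁻ z in Metric.closedBall 0 h, rieszKernel m z * F (x + z)) ^ 2 ≤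
        N * (∫⁻ z, V z ^ (θ / 2)) ^ (2 / θ) * ∫⁻ y, F y ^ 2 := by
  have : NeZero m := ⟨hm.ne'⟩
  have hm1 : (1 : ℝ) ≤ m := by exact_mod_cast hm
  have hθ0 : 0 < θ := by linarith
  obtain ⟨N, hN, hNV⟩ := exists_truncPow_holder hm hθm hθ2 h
  have hlam : (m : ℝ) - 1 + m / θ < m := by
    have : (m : ℝ) / θ < 1 := (div_lt_one hθ0).2 hθm
    linarith
  have fin := lintegral_truncPow_lt_top hm (h := h) hlam
  refine ⟨(∫⁻ z, truncPow m h ((m : ℝ) - 1 + m / θ) z) * N, ENNReal.mul_ne_top fin.ne hN,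
    fun V F hV hF => ?_⟩
  have hk : ∀ᵐ z : Eu m, (Metric.closedBall (0 : Eu m) h).indicator (rieszKernel m) z ^ 2 ≤
      truncPow m h ((m : ℝ) - 1 + m / θ) z * truncPow m h ((m : ℝ) - 1 - m / θ) z := by
    have hne : ∀ᵐ z : Eu m, z ≠ 0 := by
      rw [ae_iff]
      simp
    filter_upwards [hne] with z hz
    have hz0 : 0 < ‖z‖ := norm_pos_iff.2 hz
    rw [truncPow, truncPow]
    by_cases hzh : z ∈ Metric.closedBall (0 : Eu m) h
    · rw [Set.indicator_of_mem hzh, Set.indicator_of_mem hzh, Set.indicator_of_mem hzh,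
        rieszKernel, ← ENNReal.ofReal_mul (by positivity), ← ENNReal.ofReal_pow (by positivity),
        ← Real.rpow_add hz0, ← Real.rpow_natCast, ← Real.rpow_mul hz0.le]
      refine le_of_eq ?_
      congr 2
      push_cast
      ring
    · rw [Set.indicator_of_notMem hzh]
      simp
  have key := lintegral_kernel_sq_le (measurable_truncPow (m := m) h ((m : ℝ) - 1 + m / θ))
    (measurable_truncPow (m := m) h ((m : ℝ) - 1 - m / θ)) hF hV hk
  have e : ∀ x, ∫⁻ z in Metric.closedBall 0 h, rieszKernel m z * F (x + z) =
      ∫⁻ z, (Metric.closedBall (0 : Eu m) h).indicator (rieszKernel m) z * F (x + z) := by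
    intro x
    rw [← lintegral_indicator Metric.isClosed_closedBall.measurableSet]
    refine lintegral_congr fun z => ?_
    by_cases hzh : z ∈ Metric.closedBall (0 : Eu m) h
    · simp [Set.indicator_of_mem hzh]
    · simp only [Set.indicator_of_notMem hzh, zero_mul]
  simp_rw [e]
  refine key.trans ?_
  rw [mul_assoc, mul_assoc]
  gcongr
  calc _ ≤ ∫⁻ y, F y ^ 2 * (N * (∫⁻ z, V z ^ (θ / 2)) ^ (2 / θ)) := by
        gcongr with y
        exact hNV V hV y
    _ = _ := by
        rw [lintegral_mul_const _ (by fun_prop)]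
        ring

theorem add_sq_le_two_mul (a b : ℝ≥0∞) : (a + b) ^ 2 ≤ 2 * (a ^ 2 + b ^ 2) := by
  have := ENNReal.rpow_add_le_mul_rpow_add_rpow a b (p := 2) (by norm_num)
  norm_num at this
  exact this

/-- Weighted inequality for smooth functions. -/
theorem exists_weighted_contDiff (hm : 0 < m) {θ : ℝ} (hθm : (m : ℝ) < θ) (hθ2 : 2 ≤ θ) :
    ∃ N : ℝ≥0∞, N ≠ ∞ ∧ ∀ (V : Eu m → ℝ≥0∞) (v : Eu m → ℝ), Measurable V → ContDiff ℝ 1 v →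
      ∫⁻ x, V x * ‖v x‖ₑ ^ 2 ≤ N * (∫⁻ z, V z ^ (θ / 2)) ^ (2 / θ) *
        ((∫⁻ y, ‖v y‖ₑ ^ 2) + ∫⁻ y, ‖gradient v y‖ₑ ^ 2) := by
  obtain ⟨N, hN, hNV⟩ := exists_potential_le hm hθm hθ2 1
  obtain ⟨C, hC, hCv⟩ := exists_enorm_le_finiteCone hm (h := 1) (c := 1 / 2) one_pos
    (by norm_num) (by norm_num)
  refine ⟨C ^ 2 * (N * 2), by finiteness, fun V v hV hv => ?_⟩
  have mv : Measurable v := hv.continuous.measurable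
  have mg : Measurable (gradient v) := hv.continuous_gradient.measurable
  have mr := measurable_rieszKernel (m := m)
  -- The function lives on the whole space, so cones with any fixed axis may be used. This is why
  -- the constant will not depend on a domain.
  have he : ‖(EuclideanSpace.single ⟨0, hm⟩ 1 : Eu m)‖ = 1 := by simp
  set F : Eu m → ℝ≥0∞ := fun y => ‖v y‖ₑ + ‖gradient v y‖ₑ with hF
  have hFm : Measurable F := by fun_prop
  have h1 : ∀ x, V x * ‖v x‖ₑ ^ 2 ≤ C ^ 2 *
      (V x * (∫⁻ z in Metric.closedBall 0 1, rieszKernel m z * F (x + z)) ^ 2) := by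
    intro x
    have h2 : ‖v x‖ₑ ≤ C * ∫⁻ z in Metric.closedBall 0 1, rieszKernel m z * F (x + z) := by
      refine (hCv v hv x _ he).trans ?_
      gcongr
      intro z hz
      simpa using hz.1
    calc _ ≤ V x * (C * ∫⁻ z in Metric.closedBall 0 1, rieszKernel m z * F (x + z)) ^ 2 := by
          gcongr
      _ = _ := by ring
  refine (lintegral_mono h1).trans ?_
  rw [lintegral_const_mul' _ _ (by finiteness)]
  rw [mul_assoc, mul_assoc]
  gcongr
  refine (hNV V F hV hFm).trans ?_
  rw [mul_assoc, mul_assoc, mul_left_comm 2]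
  gcongr
  rw [← lintegral_add_left (by fun_prop), ← lintegral_const_mul _ (by fun_prop)]
  exact lintegral_mono fun y => add_sq_le_two_mul _ _

/-- The scaled form of the weighted inequality for smooth functions. -/
theorem exists_weighted_contDiff_scaled (hm : 0 < m) {θ : ℝ} (hθm : (m : ℝ) < θ) (hθ2 : 2 ≤ θ) :
    ∃ N : ℝ≥0∞, N ≠ ∞ ∧ ∀ (V : Eu m → ℝ≥0∞) (v : Eu m → ℝ), Measurable V → ContDiff ℝ 1 v →
      ∀ h : ℝ, 0 < h →
      ∫⁻ x, V x * ‖v x‖ₑ ^ 2 ≤ N * ENNReal.ofReal (h ^ (-(2 * m / θ))) *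
        (∫⁻ z, V z ^ (θ / 2)) ^ (2 / θ) *
        ((∫⁻ y, ‖v y‖ₑ ^ 2) + ENNReal.ofReal (h ^ 2) * ∫⁻ y, ‖gradient v y‖ₑ ^ 2) := by
  obtain ⟨N, hN, hNV⟩ := exists_weighted_contDiff hm hθm hθ2
  have hθ0 : 0 < θ := by linarith
  refine ⟨N, hN, fun V v hV hv h hh => ?_⟩
  have mv : Measurable v := hv.continuous.measurable
  have mg : Measurable (gradient v) := hv.continuous_gradient.measurable
  have hvh : ContDiff ℝ 1 fun x => v (h • x) := hv.comp (contDiff_const_smul h)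
  -- Dilation by `h`: every integral acquires the factor J = h^{-m}, the squared gradient a factor
  -- h², and the norm of `V` the factor J^{2/θ} = h^{-2m/θ}. One J cancels.
  have key := hNV (fun x => V (h • x)) (fun x => v (h • x)) (by fun_prop) hvh
  have hgr : ∀ x, ‖gradient (fun x => v (h • x)) x‖ₑ ^ 2
      = ENNReal.ofReal (h ^ 2) * ‖gradient v (h • x)‖ₑ ^ 2 := by
    intro x
    have h1 : fderiv ℝ (fun x => v (h • x)) x = h • fderiv ℝ v (h • x) := by
      have := (hv.differentiable (by norm_num) (h • x)).hasFDerivAt.comp x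
        ((hasFDerivAt_id x).const_smul h)
      change fderiv ℝ (v ∘ fun x => h • x) x = _
      erw [this.fderiv]
      ext w
      simp
    rw [← ofReal_norm, ← ofReal_norm, norm_gradient, norm_gradient, h1, norm_smul,
      Real.norm_eq_abs, abs_of_pos hh, ENNReal.ofReal_mul hh.le, mul_pow,
      ENNReal.ofReal_pow hh.le]
  simp_rw [hgr] at key
  set J : ℝ≥0∞ := ENNReal.ofReal ((h ^ m)⁻¹) with hJ
  have hJ0 : J ≠ 0 := by
    rw [hJ, Ne, ENNReal.ofReal_eq_zero, not_le]; positivity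
  have hJt : J ≠ ∞ := ENNReal.ofReal_ne_top
  rw [lintegral_comp_smul_eq (Φ := fun x => V x * ‖v x‖ₑ ^ 2) (by fun_prop) hh,
    lintegral_comp_smul_eq (Φ := fun x => V x ^ (θ / 2)) (by fun_prop) hh,
    lintegral_comp_smul_eq (Φ := fun x => ‖v x‖ₑ ^ 2) (by fun_prop) hh,
    lintegral_comp_smul_eq (Φ := fun x => ENNReal.ofReal (h ^ 2) * ‖gradient v x‖ₑ ^ 2)
      (by fun_prop) hh, lintegral_const_mul _ (by fun_prop), ← hJ, ← mul_add,
      ENNReal.mul_rpow_of_nonneg _ _ (by positivity)] at key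
  have e1 : J ^ (2 / θ) = ENNReal.ofReal (h ^ (-(2 * m / θ))) := by
    rw [hJ, ENNReal.ofReal_rpow_of_pos (by positivity), ← Real.rpow_natCast,
      ← Real.rpow_neg hh.le, ← Real.rpow_mul hh.le]
    congr 2
    ring
  rw [e1] at key
  rw [← ENNReal.mul_le_mul_iff_right hJ0 hJt]
  refine key.trans (le_of_eq ?_)
  ring

end Potential

/-! ### The weighted inequality in `H¹₀(Ω)` and in `H¹(Ω)`. -/

section Weighted

variable {m : ℕ} {Ω : Set (Eu m)}

theorem eLpNorm_two_sq {α F : Type*} [MeasurableSpace α] [NormedAddCommGroup F] (f : α → F)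
    (μ : Measure α) : eLpNorm f 2 μ ^ 2 = ∫⁻ x, ‖f x‖ₑ ^ 2 ∂μ := by
  rw [eLpNorm_eq_lintegral_rpow_enorm_toReal (by norm_num) (by norm_num), ← ENNReal.rpow_natCast,
    ← ENNReal.rpow_mul]
  norm_num

theorem MeasureTheory.MemLp.integrable_normSq {α F : Type*} [MeasurableSpace α]
    [NormedAddCommGroup F] {f : α → F} {μ : Measure α} (hf : MemLp f 2 μ) :
    Integrable (fun x => ‖f x‖ ^ 2) μ :=
  (memLp_two_iff_integrable_sq_norm hf.1).1 hf

theorem MeasureTheory.MemLp.eLpNorm_two_sq_eq {α F : Type*} [MeasurableSpace α]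
    [NormedAddCommGroup F] {f : α → F} {μ : Measure α} (hf : MemLp f 2 μ) :
    eLpNorm f 2 μ ^ 2 = ENNReal.ofReal (∫ x, ‖f x‖ ^ 2 ∂μ) := by
  rw [eLpNorm_two_sq, ofReal_integral_eq_lintegral_ofReal hf.integrable_normSq
    (ae_of_all _ fun x => by positivity)]
  refine lintegral_congr fun x => ?_
  rw [ENNReal.ofReal_pow (norm_nonneg _), ofReal_norm]

theorem integrable_and_integral_le {α : Type*} [MeasurableSpace α] {μ : Measure α} {f : α → ℝ}
    (hf : AEStronglyMeasurable f μ) (hf0 : ∀ x, 0 ≤ f x) {B : ℝ} (hB : 0 ≤ B)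
    (h : ∫⁻ x, ‖f x‖ₑ ∂μ ≤ ENNReal.ofReal B) : Integrable f μ ∧ ∫ x, f x ∂μ ≤ B := by
  have hi : Integrable f μ := ⟨hf, lt_of_le_of_lt h ENNReal.ofReal_lt_top⟩
  refine ⟨hi, ?_⟩
  rw [← ENNReal.ofReal_le_ofReal_iff hB, ofReal_integral_eq_lintegral_ofReal hi (ae_of_all _ hf0)]
  refine le_trans (le_of_eq (lintegral_congr fun x => ?_)) h
  rw [Real.enorm_eq_ofReal (hf0 x)]

/-- The kernel estimates need a weight that is measurable on the whole space. A measurable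
representative of |V|, extended by zero, keeps the norm. -/
theorem exists_measurable_weight (hΩ : IsOpen Ω) {θ : ℝ} (hθ0 : 0 < θ) {V : Eu m → ℝ}
    (hV : AEStronglyMeasurable V (volume.restrict Ω)) :
    ∃ W : Eu m → ℝ≥0∞, Measurable W ∧ (∀ᵐ x ∂(volume.restrict Ω), W x = ‖V x‖ₑ) ∧
      (∫⁻ x, W x ^ (θ / 2)) ^ (2 / θ) = eLpNorm V (ENNReal.ofReal (θ / 2)) (volume.restrict Ω) := by
  obtain ⟨V', hV', hVV'⟩ := hV
  have h2 : ∀ᵐ x ∂(volume.restrict Ω), Ω.indicator (fun x => ‖V' x‖ₑ) x = ‖V x‖ₑ := by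
    filter_upwards [hVV', ae_restrict_mem hΩ.measurableSet] with x hx hxΩ
    rw [Set.indicator_of_mem hxΩ, hx]
  refine ⟨Ω.indicator fun x => ‖V' x‖ₑ, hV'.measurable.enorm.indicator hΩ.measurableSet, h2, ?_⟩
  have hp : ENNReal.ofReal (θ / 2) ≠ 0 := by
    rw [Ne, ENNReal.ofReal_eq_zero, not_le]; positivity
  rw [eLpNorm_eq_lintegral_rpow_enorm_toReal hp ENNReal.ofReal_ne_top,
    ENNReal.toReal_ofReal (by positivity), one_div_div]
  congr 1
  have h3 : (fun x => Ω.indicator (fun x => ‖V' x‖ₑ) x ^ (θ / 2))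
      = Ω.indicator fun x => Ω.indicator (fun x => ‖V' x‖ₑ) x ^ (θ / 2) := by
    ext x
    by_cases hx : x ∈ Ω
    · simp [Set.indicator_of_mem hx]
    · simp only [Set.indicator_of_notMem hx]
      exact ENNReal.zero_rpow_of_pos (by positivity)
  rw [h3, lintegral_indicator hΩ.measurableSet]
  refine lintegral_congr_ae ?_
  filter_upwards [h2] with x hx
  rw [hx]

theorem enorm_mul_sq (a b : ℝ) : ‖|a| * b ^ 2‖ₑ = ‖a‖ₑ * ‖b‖ₑ ^ 2 := by
  rw [enorm_mul, enorm_pow]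
  simp [← ofReal_norm]

/-- The weighted inequality in `H¹₀(Ω)`, with a constant independent of `Ω`. -/
theorem exists_weighted_H10 (hm : 0 < m) {θ : ℝ} (hθm : (m : ℝ) < θ) (hθ2 : 2 ≤ θ) :
    ∃ c : ℝ, 0 < c ∧ ∀ Ω : Set (Eu m), IsOpen Ω → ∀ (u : Eu m → ℝ) (G : Eu m → Eu m),
      HasH10Grad Ω u G → ∀ V : Eu m → ℝ, MemLp V (ENNReal.ofReal (θ / 2)) (volume.restrict Ω) →
      ∀ h : ℝ, 0 < h → Integrable (fun x => |V x| * u x ^ 2) (volume.restrict Ω) ∧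
        ∫ x in Ω, |V x| * u x ^ 2 ≤ c * h ^ (-(2 * m / θ)) *
          (eLpNorm V (ENNReal.ofReal (θ / 2)) (volume.restrict Ω)).toReal *
          ((∫ x in Ω, u x ^ 2) + h ^ 2 * ∫ x in Ω, ‖G x‖ ^ 2) := by
  obtain ⟨N, hN, hNV⟩ := exists_weighted_contDiff_scaled hm hθm hθ2
  have hθ0 : 0 < θ := by linarith
  refine ⟨N.toReal + 1, by positivity, fun Ω hΩ u G hu V hV h hh => ?_⟩
  have hu2 : ∫ x in Ω, u x ^ 2 = ∫ x in Ω, ‖u x‖ ^ 2 := by simp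
  have hI : 0 ≤ ∫ x in Ω, ‖u x‖ ^ 2 := integral_nonneg fun x => by positivity
  have hJ : 0 ≤ ∫ x in Ω, ‖G x‖ ^ 2 := integral_nonneg fun x => by positivity
  refine integrable_and_integral_le (f := fun x => |V x| * u x ^ 2)
    (hV.1.norm.mul (hu.memLp.1.pow 2)) (fun x => by positivity)
    (by rw [hu2]; positivity) ?_
  obtain ⟨W, hW, hWV, hWn⟩ := exists_measurable_weight hΩ hθ0 hV.1
  obtain ⟨φ, hφ, h1, h2⟩ := hu.approx
  obtain ⟨s, hs, hae⟩ := h1.exists_subseq_ae (fun n => ((hφ n).memLp 2).1) hu.memLp.1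
  have mφ : ∀ n, Measurable (φ n) := fun n => (hφ n).continuous.measurable
  set A : ℝ≥0∞ := N * ENNReal.ofReal (h ^ (-(2 * m / θ))) *
    eLpNorm V (ENNReal.ofReal (θ / 2)) (volume.restrict Ω) with hA
  have hAt : A ≠ ∞ := ENNReal.mul_ne_top (ENNReal.mul_ne_top hN ENNReal.ofReal_ne_top) hV.2.ne
  have hφn : ∀ n, ∫⁻ x in Ω, W x * ‖φ n x‖ₑ ^ 2 ≤ A *
      (eLpNorm (φ n) 2 (volume.restrict Ω) ^ 2
        + ENNReal.ofReal (h ^ 2) * eLpNorm (gradient (φ n)) 2 (volume.restrict Ω) ^ 2) := by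
    intro n
    have h3 := hNV W (φ n) hW (hφ n).contDiff_one h hh
    have e1 : ∫⁻ y in Ω, ‖φ n y‖ₑ ^ 2 = ∫⁻ y, ‖φ n y‖ₑ ^ 2 :=
      setLIntegral_eq_of_support_subset fun y hy => by
        by_contra h0
        exact hy (by simp [(hφ n).apply_eq_zero h0])
    have e2 : ∫⁻ y in Ω, ‖gradient (φ n) y‖ₑ ^ 2 = ∫⁻ y, ‖gradient (φ n) y‖ₑ ^ 2 :=
      setLIntegral_eq_of_support_subset fun y hy => by
        by_contra h0
        exact hy (by simp [(hφ n).gradient_apply_eq_zero h0])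
    rw [hWn, ← e1, ← e2, ← eLpNorm_two_sq, ← eLpNorm_two_sq] at h3
    exact (setLIntegral_le_lintegral _ _).trans h3
  have lim : Tendsto (fun n => A * (eLpNorm (φ (s n)) 2 (volume.restrict Ω) ^ 2
        + ENNReal.ofReal (h ^ 2) * eLpNorm (gradient (φ (s n))) 2 (volume.restrict Ω) ^ 2)) atTop
      (𝓝 (A * (eLpNorm u 2 (volume.restrict Ω) ^ 2
        + ENNReal.ofReal (h ^ 2) * eLpNorm G 2 (volume.restrict Ω) ^ 2))) := by
    have t1 := ((h1.comp hs).tendsto_eLpNorm (fun n => ((hφ _).memLp 2).1) hu.memLp)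
    have t2 := ((h2.comp hs).tendsto_eLpNorm (fun n => ((hφ _).memLp_gradient 2).1) hu.memLp_grad)
    refine ENNReal.Tendsto.const_mul (Tendsto.add ?_ (ENNReal.Tendsto.const_mul ?_
      (Or.inr ENNReal.ofReal_ne_top))) (Or.inr hAt)
    · exact ((ENNReal.continuous_pow 2).tendsto _).comp t1
    · exact ((ENNReal.continuous_pow 2).tendsto _).comp t2
  -- Fatou's lemma along an almost everywhere convergent subsequence of test functions;
  -- integrability of |V| u² is part of what it yields.
  calc ∫⁻ x in Ω, ‖|V x| * u x ^ 2‖ₑ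
      = ∫⁻ x in Ω, liminf (fun n => W x * ‖φ (s n) x‖ₑ ^ 2) atTop := by
        refine lintegral_congr_ae ?_
        filter_upwards [hWV, hae] with x hx1 hx2
        rw [enorm_mul_sq, ← hx1]
        refine (Tendsto.liminf_eq ?_).symm
        refine ENNReal.Tendsto.const_mul
          (((ENNReal.continuous_pow 2).tendsto _).comp hx2.enorm) (Or.inr ?_)
        rw [hx1]; exact enorm_ne_top
    _ ≤ liminf (fun n => ∫⁻ x in Ω, W x * ‖φ (s n) x‖ₑ ^ 2) atTop :=
        lintegral_liminf_le fun n => by have := mφ (s n); fun_prop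
    _ ≤ liminf (fun n => A * (eLpNorm (φ (s n)) 2 (volume.restrict Ω) ^ 2
        + ENNReal.ofReal (h ^ 2) * eLpNorm (gradient (φ (s n))) 2 (volume.restrict Ω) ^ 2)) atTop :=
        liminf_le_liminf (Eventually.of_forall fun n => hφn (s n))
    _ = _ := lim.liminf_eq
    _ ≤ _ := by
        rw [hu.memLp.eLpNorm_two_sq_eq, hu.memLp_grad.eLpNorm_two_sq_eq, hu2, hA,
          ← ENNReal.ofReal_mul (by positivity), ← ENNReal.ofReal_add hI (by positivity)]
        conv_lhs => rw [← ENNReal.ofReal_toReal hN, ← ENNReal.ofReal_toReal hV.2.ne]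
        rw [← ENNReal.ofReal_mul (by positivity), ← ENNReal.ofReal_mul (by positivity),
          ← ENNReal.ofReal_mul (by positivity)]
        refine ENNReal.ofReal_le_ofReal ?_
        gcongr
        linarith

/-- The weighted inequality in `H¹(Ω)` for a domain with the cone property. -/
theorem exists_weighted_H1 (hm : 0 < m) {θ : ℝ} (hθm : (m : ℝ) < θ) (hθ2 : 2 ≤ θ)
    (hΩ : IsOpen Ω) (hcone : ConeProperty Ω) :
    ∃ c : ℝ, 0 < c ∧ ∀ (u : Eu m → ℝ) (G : Eu m → Eu m),
      HasH1Grad Ω u G → ∀ V : Eu m → ℝ, MemLp V (ENNReal.ofReal (θ / 2)) (volume.restrict Ω) →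
      Integrable (fun x => |V x| * u x ^ 2) (volume.restrict Ω) ∧
        ∫ x in Ω, |V x| * u x ^ 2 ≤ c *
          (eLpNorm V (ENNReal.ofReal (θ / 2)) (volume.restrict Ω)).toReal *
          ((∫ x in Ω, u x ^ 2) + ∫ x in Ω, ‖G x‖ ^ 2) := by
  obtain ⟨h, hh, c, hc0, hc1, hc⟩ := hcone
  obtain ⟨N, hN, hNV⟩ := exists_potential_le hm hθm hθ2 h
  obtain ⟨C, hC, hCv⟩ := exists_enorm_le_finiteCone hm hh hc0 hc1
  have hθ0 : 0 < θ := by linarith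
  have mr := measurable_rieszKernel (m := m)
  refine ⟨C.toReal ^ 2 * N.toReal * 2 + 1, by positivity, fun u G hu V hV => ?_⟩
  have hu2 : ∫ x in Ω, u x ^ 2 = ∫ x in Ω, ‖u x‖ ^ 2 := by simp
  have hI : 0 ≤ ∫ x in Ω, ‖u x‖ ^ 2 := integral_nonneg fun x => by positivity
  have hJ : 0 ≤ ∫ x in Ω, ‖G x‖ ^ 2 := integral_nonneg fun x => by positivity
  refine integrable_and_integral_le (f := fun x => |V x| * u x ^ 2)
    (hV.1.norm.mul (hu.memLp.1.pow 2)) (fun x => by positivity)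
    (by rw [hu2]; positivity) ?_
  obtain ⟨W, hW, hWV, hWn⟩ := exists_measurable_weight hΩ hθ0 hV.1
  -- The function and its gradient are extended by zero and mollified separately. Near the boundary
  -- the second mollification need not be the gradient of the first, but only cones inside `Ω` will
  -- be used, so `u` need not be extended in `H¹`.
  set un : ℕ → Eu m → ℝ := fun n => mollify n (Ω.indicator u) with hun
  set Gn : ℕ → Eu m → Eu m := fun n => mollify n (Ω.indicator G) with hGn
  have hiu : MemLp (Ω.indicator u) 2 volume := (memLp_indicator_iff_restrict hΩ.measurableSet).2
    hu.memLp
  have hiG : MemLp (Ω.indicator G) 2 volume := (memLp_indicator_iff_restrict hΩ.measurableSet).2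
    hu.memLp_grad
  have cu : ∀ n, ContDiff ℝ (⊤ : ℕ∞) (un n) := contDiff_mollify_indicator hΩ hu.memLp
  have cu1 : ∀ n, ContDiff ℝ 1 (un n) := fun n => (cu n).of_le (by exact_mod_cast le_top)
  have cG : ∀ n, ContDiff ℝ (⊤ : ℕ∞) (Gn n) := contDiff_mollify_indicator hΩ hu.memLp_grad
  have mu : ∀ n, Measurable (un n) := fun n => (cu n).continuous.measurable
  have mG : ∀ n, Measurable (Gn n) := fun n => (cG n).continuous.measurable
  obtain ⟨s, hs, hae⟩ := (L2Lim_mollify_indicator hΩ hu.memLp).exists_subseq_ae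
    (fun n => (cu n).continuous.aestronglyMeasurable) hu.memLp.1
  set F : ℕ → Eu m → ℝ≥0∞ := fun n y => ‖un n y‖ₑ + ‖Gn n y‖ₑ with hF
  have mF : ∀ n, Measurable (F n) := fun n => by
    have := mu n; have := mG n; fun_prop
  set T : ℕ → Eu m → ℝ≥0∞ := fun n x =>
    ∫⁻ z in Metric.closedBall 0 h, rieszKernel m z * F n (x + z) with hT
  have mT : ∀ n, Measurable (T n) := fun n => by
    refine Measurable.lintegral_prod_right' (f := fun q : Eu m × Eu m =>
      rieszKernel m q.2 * F n (q.1 + q.2)) ?_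
    have := mF n
    fun_prop
  -- The cone at `x` is a compact subset of `Ω`, so on it the gradient of `un n` is `Gn n` for large
  -- `n`. How large depends on `x`, which is why the passage to the limit goes through Fatou's
  -- lemma.
  have hpt : ∀ x ∈ Ω, ∀ᶠ n in atTop, ‖un n x‖ₑ ≤ C * T n x := by
    intro x hx
    obtain ⟨e, he, hev⟩ := hc x hx
    have hK : IsCompact ((fun z => x + z) '' finiteCone h c e) :=
      (isCompact_finiteCone h c e).image (by fun_prop)
    have hKΩ : (fun z => x + z) '' finiteCone h c e ⊆ Ω := by
      rintro _ ⟨z, hz, rfl⟩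
      exact hev z hz.1 hz.2
    filter_upwards [hK.eventually_closedBall_subset hΩ hKΩ] with n hn
    refine (hCv (un n) (cu1 n) x e he).trans ?_
    gcongr
    calc _ = ∫⁻ z in finiteCone h c e, rieszKernel m z * F n (x + z) := by
          refine setLIntegral_congr_fun (isClosed_finiteCone h c e).measurableSet fun z hz => ?_
          simp only [hF]
          rw [show gradient (un n) (x + z) = Gn n (x + z) from
            HasWeakGrad.gradient_mollify hΩ hu (hn _ ⟨z, hz, rfl⟩)]
      _ ≤ _ := lintegral_mono_set fun z hz => by simpa using hz.1
  set A : ℝ≥0∞ := C ^ 2 * N *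
    eLpNorm V (ENNReal.ofReal (θ / 2)) (volume.restrict Ω) * 2 with hA
  have hbd : ∀ n, ∫⁻ x in Ω, W x * (C * T n x) ^ 2 ≤ A *
      (eLpNorm u 2 (volume.restrict Ω) ^ 2 + eLpNorm G 2 (volume.restrict Ω) ^ 2) := by
    intro n
    have h1 := hNV W (F n) hW (mF n)
    rw [hWn] at h1
    have h2 : ∫⁻ y, F n y ^ 2 ≤ 2 * (eLpNorm u 2 (volume.restrict Ω) ^ 2
        + eLpNorm G 2 (volume.restrict Ω) ^ 2) := by
      calc ∫⁻ y, F n y ^ 2 ≤ ∫⁻ y, 2 * (‖un n y‖ₑ ^ 2 + ‖Gn n y‖ₑ ^ 2) :=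
            lintegral_mono fun y => add_sq_le_two_mul _ _
        _ = 2 * (eLpNorm (un n) 2 volume ^ 2 + eLpNorm (Gn n) 2 volume ^ 2) := by
            have := mu n
            have := mG n
            rw [lintegral_const_mul _ (by fun_prop), lintegral_add_left (by fun_prop),
              eLpNorm_two_sq, eLpNorm_two_sq]
        _ ≤ _ := by
            rw [← eLpNorm_indicator_eq_eLpNorm_restrict hΩ.measurableSet,
              ← eLpNorm_indicator_eq_eLpNorm_restrict hΩ.measurableSet]
            gcongr
            · exact eLpNorm_mollify_le hiu.1 n
            · exact eLpNorm_mollify_le hiG.1 n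
    calc ∫⁻ x in Ω, W x * (C * T n x) ^ 2 ≤ ∫⁻ x, C ^ 2 * (W x * T n x ^ 2) := by
          refine (setLIntegral_le_lintegral _ _).trans (le_of_eq (lintegral_congr fun x => ?_))
          ring
      _ = C ^ 2 * ∫⁻ x, W x * T n x ^ 2 := lintegral_const_mul' _ _ (by finiteness)
      _ ≤ C ^ 2 * (N * eLpNorm V (ENNReal.ofReal (θ / 2)) (volume.restrict Ω) *
            (2 * (eLpNorm u 2 (volume.restrict Ω) ^ 2
              + eLpNorm G 2 (volume.restrict Ω) ^ 2))) := by
          refine mul_le_mul_right (h1.trans ?_) _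
          gcongr
      _ = _ := by rw [hA]; ring
  calc ∫⁻ x in Ω, ‖|V x| * u x ^ 2‖ₑ
      ≤ ∫⁻ x in Ω, liminf (fun n => W x * (C * T (s n) x) ^ 2) atTop := by
        refine lintegral_mono_ae ?_
        filter_upwards [hWV, hae, ae_restrict_mem hΩ.measurableSet] with x hx1 hx2 hx3
        rw [enorm_mul_sq, ← hx1]
        have t : Tendsto (fun n => W x * ‖un (s n) x‖ₑ ^ 2) atTop (𝓝 (W x * ‖u x‖ₑ ^ 2)) := by
          refine ENNReal.Tendsto.const_mul
            (((ENNReal.continuous_pow 2).tendsto _).comp hx2.enorm) (Or.inr ?_)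
          rw [hx1]; exact enorm_ne_top
        rw [← t.liminf_eq]
        refine liminf_le_liminf ?_
        filter_upwards [hs.tendsto_atTop.eventually (hpt x hx3)] with n hn
        gcongr
    _ ≤ liminf (fun n => ∫⁻ x in Ω, W x * (C * T (s n) x) ^ 2) atTop :=
        lintegral_liminf_le fun n => by have := mT (s n); fun_prop
    _ ≤ liminf (fun _ : ℕ => A * (eLpNorm u 2 (volume.restrict Ω) ^ 2
          + eLpNorm G 2 (volume.restrict Ω) ^ 2)) atTop :=
        liminf_le_liminf (Eventually.of_forall fun n => hbd (s n))
    _ = _ := liminf_const _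
    _ ≤ _ := by
        have e2 : ∀ a : ℝ≥0∞, a * 2 = a * ENNReal.ofReal 2 := by simp
        rw [hu.memLp.eLpNorm_two_sq_eq, hu.memLp_grad.eLpNorm_two_sq_eq, hu2, hA, e2,
          ← ENNReal.ofReal_add hI hJ]
        conv_lhs => rw [← ENNReal.ofReal_toReal hN, ← ENNReal.ofReal_toReal hV.2.ne,
          ← ENNReal.ofReal_toReal hC]
        rw [← ENNReal.ofReal_pow (by positivity), ← ENNReal.ofReal_mul (by positivity),
          ← ENNReal.ofReal_mul (by positivity), ← ENNReal.ofReal_mul (by positivity),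
          ← ENNReal.ofReal_mul (by positivity)]
        refine ENNReal.ofReal_le_ofReal ?_
        refine mul_le_mul_of_nonneg_right ?_ (by positivity)
        nlinarith [ENNReal.toReal_nonneg
          (a := eLpNorm V (ENNReal.ofReal (θ / 2)) (volume.restrict Ω))]

end Weighted

/-! ### Boundedness of the weak form on `H¹`. -/

section WeakForm

variable {m N : ℕ} {Ω : Set (Eu m)}

/-- The integrand of the weak formulation. -/
noncomputable def weakIntegrand (a : Fin N → Fin N → Eu m → ℝ) (C : Fin N → Fin N → Eu m → Eu m)
    (D : Fin N → Eu m → Eu N) (y : Eu m → Eu N) (G : Fin N → Eu m → Eu m) (φ : Eu m → Eu N)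
    (Φ : Fin N → Eu m → Eu m) (x : Eu m) : ℝ :=
  (∑ i, ∑ j, a i j x * inner ℝ (G j x) (Φ i x))
    + ∑ i, ((∑ j, inner ℝ (C i j x) (G j x) * φ x i) + inner ℝ (D i x) (y x) * φ x i)

/-- A weight dominating the lower order coefficients. -/
noncomputable def sysWeight (C : Fin N → Fin N → Eu m → Eu m) (D : Fin N → Eu m → Eu N)
    (f : Eu m → Eu N) (x : Eu m) : ℝ :=
  (∑ i, ∑ j, ‖C i j x‖ ^ 2) + (∑ i, ‖D i x‖) + ‖f x‖ + 1

theorem sysWeight_pos (C : Fin N → Fin N → Eu m → Eu m) (D : Fin N → Eu m → Eu N)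
    (f : Eu m → Eu N) (x : Eu m) : 0 < sysWeight C D f x := by
  have h1 : 0 ≤ ∑ i, ∑ j, ‖C i j x‖ ^ 2 := by positivity
  have h2 : 0 ≤ ∑ i, ‖D i x‖ := by positivity
  rw [sysWeight]
  positivity

theorem sq_norm_eq_sum (z : Eu N) : ‖z‖ ^ 2 = ∑ i, z i ^ 2 := by
  rw [EuclideanSpace.real_norm_sq_eq]

theorem abs_sum_mul_inner_le {a : Fin N → Fin N → ℝ} {Λ : ℝ} (ha : ∀ i j, |a i j| ≤ Λ)
    (G Φ : Fin N → Eu m) :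
    |∑ i, ∑ j, a i j * inner ℝ (G j) (Φ i)| ≤
      N * Λ * ((∑ i, ‖G i‖ ^ 2) + ∑ i, ‖Φ i‖ ^ 2) := by
  have e1 : ∑ i : Fin N, ∑ j : Fin N, Λ * (‖G j‖ ^ 2 + ‖Φ i‖ ^ 2)
      = N * Λ * ((∑ i, ‖G i‖ ^ 2) + ∑ i, ‖Φ i‖ ^ 2) := by
    simp_rw [← Finset.mul_sum, Finset.sum_add_distrib, Finset.sum_const, Finset.card_univ,
      Fintype.card_fin, nsmul_eq_mul, ← Finset.mul_sum]
    ring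
  rw [← e1]
  refine (Finset.abs_sum_le_sum_abs _ _).trans (Finset.sum_le_sum fun i _ =>
    (Finset.abs_sum_le_sum_abs _ _).trans (Finset.sum_le_sum fun j _ => ?_))
  rw [abs_mul]
  have hL : 0 ≤ Λ := (abs_nonneg _).trans (ha i j)
  have h1 := abs_real_inner_le_norm (G j) (Φ i)
  have h2 : ‖G j‖ * ‖Φ i‖ ≤ ‖G j‖ ^ 2 + ‖Φ i‖ ^ 2 := by
    nlinarith [sq_nonneg (‖G j‖ - ‖Φ i‖), sq_nonneg (‖G j‖), sq_nonneg (‖Φ i‖)]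
  exact mul_le_mul (ha i j) (h1.trans h2) (abs_nonneg _) hL

theorem abs_sum_inner_mul_le (C : Fin N → Fin N → Eu m) (G : Fin N → Eu m) (φ : Eu N) :
    |∑ i, ∑ j, inner ℝ (C i j) (G j) * φ i| ≤
      N * (∑ i, ‖G i‖ ^ 2) + (∑ i, ∑ j, ‖C i j‖ ^ 2) * ‖φ‖ ^ 2 := by
  have e2 : ∑ i : Fin N, ∑ j : Fin N, (‖G j‖ ^ 2 + ‖C i j‖ ^ 2 * φ i ^ 2) ≤
      N * (∑ i, ‖G i‖ ^ 2) + (∑ i, ∑ j, ‖C i j‖ ^ 2) * ‖φ‖ ^ 2 := by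
    simp_rw [Finset.sum_add_distrib, Finset.sum_const, Finset.card_univ,
      Fintype.card_fin, nsmul_eq_mul]
    gcongr
    rw [Finset.sum_mul]
    refine Finset.sum_le_sum fun i _ => ?_
    rw [Finset.sum_mul]
    refine Finset.sum_le_sum fun j _ => ?_
    gcongr ?_ * ?_
    rw [sq_norm_eq_sum]
    exact Finset.single_le_sum (f := fun i => φ i ^ 2) (fun i _ => sq_nonneg _)
      (Finset.mem_univ i)
  refine le_trans ?_ e2
  refine (Finset.abs_sum_le_sum_abs _ _).trans (Finset.sum_le_sum fun i _ =>
    (Finset.abs_sum_le_sum_abs _ _).trans (Finset.sum_le_sum fun j _ => ?_))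
  rw [abs_mul]
  have h1 := abs_real_inner_le_norm (C i j) (G j)
  have h2 : |inner ℝ (C i j) (G j)| * |φ i| ≤ ‖G j‖ * (‖C i j‖ * |φ i|) := by
    calc _ ≤ ‖C i j‖ * ‖G j‖ * |φ i| := by gcongr
      _ = _ := by ring
  refine h2.trans ?_
  have h3 : (‖C i j‖ * |φ i|) ^ 2 = ‖C i j‖ ^ 2 * φ i ^ 2 := by rw [mul_pow, sq_abs]
  nlinarith [sq_nonneg (‖G j‖ - ‖C i j‖ * |φ i|), sq_nonneg (‖G j‖),
    sq_nonneg (‖C i j‖ * |φ i|)]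

theorem abs_sum_inner_mul_le' (D : Fin N → Eu N) (y φ : Eu N) :
    |∑ i, inner ℝ (D i) y * φ i| ≤ (∑ i, ‖D i‖) * (‖y‖ ^ 2 + ‖φ‖ ^ 2) := by
  rw [Finset.sum_mul]
  refine (Finset.abs_sum_le_sum_abs _ _).trans (Finset.sum_le_sum fun i _ => ?_)
  rw [abs_mul]
  have h1 := abs_real_inner_le_norm (D i) (y)
  have h2 : |φ i| ≤ ‖φ‖ := PiLp.norm_apply_le (φ) i
  calc _ ≤ (‖D i‖ * ‖y‖) * ‖φ‖ := by gcongr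
    _ = ‖D i‖ * (‖y‖ * ‖φ‖) := by ring
    _ ≤ _ := by
      gcongr
      nlinarith [sq_nonneg (‖y‖ - ‖φ‖), sq_nonneg (‖y‖), sq_nonneg (‖φ‖)]

theorem weakIntegrand_abs_le {a : Fin N → Fin N → Eu m → ℝ} {C : Fin N → Fin N → Eu m → Eu m}
    {D : Fin N → Eu m → Eu N} (f : Eu m → Eu N) {Λ : ℝ} {x : Eu m} (ha : ∀ i j, |a i j x| ≤ Λ)
    (y : Eu m → Eu N) (G : Fin N → Eu m → Eu m) (φ : Eu m → Eu N) (Φ : Fin N → Eu m → Eu m) :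
    |weakIntegrand a C D y G φ Φ x| ≤
      (N * (Λ + 1)) * ((∑ i, ‖G i x‖ ^ 2) + ∑ i, ‖Φ i x‖ ^ 2)
        + sysWeight C D f x * (‖y x‖ ^ 2 + ‖φ x‖ ^ 2) := by
  have t1 := abs_sum_mul_inner_le ha (fun i => G i x) fun i => Φ i x
  have t2 := abs_sum_inner_mul_le (fun i j => C i j x) (fun i => G i x) (φ x)
  have t3 := abs_sum_inner_mul_le' (fun i => D i x) (y x) (φ x)
  have hΦ : 0 ≤ ∑ i, ‖Φ i x‖ ^ 2 := Finset.sum_nonneg fun i _ => sq_nonneg _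
  have hC : 0 ≤ ∑ i, ∑ j, ‖C i j x‖ ^ 2 :=
    Finset.sum_nonneg fun i _ => Finset.sum_nonneg fun j _ => sq_nonneg _
  have hy : 0 ≤ ‖y x‖ ^ 2 := sq_nonneg _
  have hφ : 0 ≤ ‖φ x‖ ^ 2 := sq_nonneg _
  have hf : 0 ≤ ‖f x‖ := norm_nonneg _
  have hN : (0 : ℝ) ≤ N := Nat.cast_nonneg N
  rw [weakIntegrand, sysWeight, Finset.sum_add_distrib, ← add_assoc]
  refine (abs_add_three _ _ _).trans ?_
  refine (add_le_add (add_le_add t1 t2) t3).trans ?_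
  generalize (∑ i, ‖G i x‖ ^ 2) = g at *
  generalize (∑ i, ‖Φ i x‖ ^ 2) = h at *
  generalize (∑ i, ∑ j, ‖C i j x‖ ^ 2) = k at *
  generalize (∑ i, ‖D i x‖) = d at *
  have q1 := mul_nonneg hN hΦ
  have q2 := mul_nonneg hC hy
  have q3 := mul_nonneg hf hy
  have q4 := mul_nonneg hf hφ
  ring_nf at *
  linarith

/-- `y ∈ H¹(Ω; ℝ^N)` with gradients `G`. -/
def H1Tuple (Ω : Set (Eu m)) (y : Eu m → Eu N) (G : Fin N → Eu m → Eu m) : Prop :=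
  ∀ i, HasH1Grad Ω (fun x => y x i) (G i)

/-- `y ∈ H¹₀(Ω; ℝ^N)` with gradients `G`. -/
def H10Tuple (Ω : Set (Eu m)) (y : Eu m → Eu N) (G : Fin N → Eu m → Eu m) : Prop :=
  ∀ i, HasH10Grad Ω (fun x => y x i) (G i)

/-- The squared `H¹` norm. -/
noncomputable def tupleSq (Ω : Set (Eu m)) (y : Eu m → Eu N) (G : Fin N → Eu m → Eu m) : ℝ :=
  (∫ x in Ω, ‖y x‖ ^ 2) + ∑ i, ∫ x in Ω, ‖G i x‖ ^ 2

theorem tupleSq_nonneg (y : Eu m → Eu N) (G : Fin N → Eu m → Eu m) : 0 ≤ tupleSq Ω y G :=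
  add_nonneg (integral_nonneg fun x => by positivity)
    (Finset.sum_nonneg fun i _ => integral_nonneg fun x => by positivity)

variable {y z : Eu m → Eu N} {G H : Fin N → Eu m → Eu m}

theorem H10Tuple.h1 (h : H10Tuple Ω y G) : H1Tuple Ω y G := fun i => (h i).hasH1Grad

theorem H1Tuple.add (h : H1Tuple Ω y G) (h' : H1Tuple Ω z H) : H1Tuple Ω (y + z) (G + H) :=
  fun i => (h i).add (h' i)

theorem H1Tuple.sub (h : H1Tuple Ω y G) (h' : H1Tuple Ω z H) : H1Tuple Ω (y - z) (G - H) :=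
  fun i => (h i).sub (h' i)

theorem H1Tuple.smul (h : H1Tuple Ω y G) (c : ℝ) : H1Tuple Ω (c • y) (c • G) :=
  fun i => (h i).const_smul c

theorem H10Tuple.sub (h : H10Tuple Ω y G) (h' : H10Tuple Ω z H) : H10Tuple Ω (y - z) (G - H) :=
  fun i => (h i).sub (h' i)

theorem H1Tuple.memLp (h : H1Tuple Ω y G) : MemLp y 2 (volume.restrict Ω) :=
  memLp_of_coord fun i => (h i).memLp

theorem H1Tuple.integral_normSq (h : H1Tuple Ω y G) :
    ∫ x in Ω, ‖y x‖ ^ 2 = ∑ i, ∫ x in Ω, y x i ^ 2 := by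
  simp_rw [sq_norm_eq_sum]
  refine integral_finsetSum _ fun i _ => ?_
  simpa using (h i).memLp.integrable_normSq

theorem H1Tuple.tupleSq_eq (h : H1Tuple Ω y G) :
    tupleSq Ω y G = ∑ i, ((∫ x in Ω, y x i ^ 2) + ∫ x in Ω, ‖G i x‖ ^ 2) := by
  rw [tupleSq, h.integral_normSq, Finset.sum_add_distrib]

theorem tupleSq_smul (c : ℝ) : tupleSq Ω (c • y) (c • G) = c ^ 2 * tupleSq Ω y G := by
  simp only [tupleSq, Pi.smul_apply, norm_smul, mul_pow, Real.norm_eq_abs, sq_abs,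
    integral_const_mul, ← Finset.mul_sum]
  ring

/-- Bounds on the data of the system. -/
structure SysBound (Ω : Set (Eu m)) (θ Λ : ℝ) (a : Fin N → Fin N → Eu m → ℝ)
    (C : Fin N → Fin N → Eu m → Eu m) (D : Fin N → Eu m → Eu N) (f : Eu m → Eu N) : Prop where
  meas_a : ∀ i j, AEStronglyMeasurable (a i j) (volume.restrict Ω)
  bound_a : ∀ᵐ x ∂(volume.restrict Ω), ∀ i j, |a i j x| ≤ Λ
  meas_C : ∀ i j, AEStronglyMeasurable (C i j) (volume.restrict Ω)
  meas_D : ∀ i, AEStronglyMeasurable (D i) (volume.restrict Ω)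
  meas_f : AEStronglyMeasurable f (volume.restrict Ω)
  memLp_weight : MemLp (sysWeight C D f) (ENNReal.ofReal (θ / 2)) (volume.restrict Ω)
  weight_le : (eLpNorm (sysWeight C D f) (ENNReal.ofReal (θ / 2)) (volume.restrict Ω)).toReal ≤ Λ

/-- The weighted inequality in `H¹(Ω)` with constant `c`. -/
def WeightedIneq (Ω : Set (Eu m)) (θ c : ℝ) : Prop :=
  ∀ (u : Eu m → ℝ) (G : Eu m → Eu m),
      HasH1Grad Ω u G → ∀ V : Eu m → ℝ, MemLp V (ENNReal.ofReal (θ / 2)) (volume.restrict Ω) →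
      Integrable (fun x => |V x| * u x ^ 2) (volume.restrict Ω) ∧
        ∫ x in Ω, |V x| * u x ^ 2 ≤ c *
          (eLpNorm V (ENNReal.ofReal (θ / 2)) (volume.restrict Ω)).toReal *
          ((∫ x in Ω, u x ^ 2) + ∫ x in Ω, ‖G x‖ ^ 2)

theorem WeightedIneq.tuple {θ c : ℝ} (hw : WeightedIneq Ω θ c) {V : Eu m → ℝ}
    (hV : MemLp V (ENNReal.ofReal (θ / 2)) (volume.restrict Ω)) (h : H1Tuple Ω y G) :
    Integrable (fun x => |V x| * ‖y x‖ ^ 2) (volume.restrict Ω) ∧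
      ∫ x in Ω, |V x| * ‖y x‖ ^ 2 ≤ c *
          (eLpNorm V (ENNReal.ofReal (θ / 2)) (volume.restrict Ω)).toReal * tupleSq Ω y G := by
  have h1 := fun i => hw _ _ (h i) V hV
  simp_rw [sq_norm_eq_sum, Finset.mul_sum]
  refine ⟨integrable_finsetSum _ fun i _ => (h1 i).1, ?_⟩
  rw [integral_finsetSum _ fun i _ => (h1 i).1, h.tupleSq_eq, Finset.mul_sum]
  exact Finset.sum_le_sum fun i _ => (h1 i).2

/-- The best choice is t = √(q / p). Replacing `p` and `q` by `p + ε` and `q + ε` avoids the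
division by zero, and then ε → 0. -/
theorem le_two_mul_sqrt {b K p q : ℝ} (hK : 0 ≤ K) (hp : 0 ≤ p) (hq : 0 ≤ q)
    (h : ∀ t : ℝ, 0 < t → b ≤ K * (t * p + q / t)) : b ≤ 2 * K * Real.sqrt (p * q) := by
  have key : ∀ ε : ℝ, 0 < ε → b ≤ 2 * K * Real.sqrt ((p + ε) * (q + ε)) := by
    intro ε hε
    have hp' : 0 < p + ε := by linarith
    have hq' : 0 < q + ε := by linarith
    have h1 := h (Real.sqrt ((q + ε) / (p + ε))) (Real.sqrt_pos.2 (by positivity))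
    refine h1.trans ?_
    have sp := Real.sqrt_pos.2 hp'
    have sq' := Real.sqrt_pos.2 hq'
    rw [Real.sqrt_div hq'.le, Real.sqrt_mul hp'.le, mul_comm 2 K, mul_assoc]
    refine mul_le_mul_of_nonneg_left ?_ hK
    have e1 : Real.sqrt (q + ε) / Real.sqrt (p + ε) * p ≤
        Real.sqrt (q + ε) / Real.sqrt (p + ε) * (p + ε) := by gcongr; linarith
    have e2 : q / (Real.sqrt (q + ε) / Real.sqrt (p + ε)) ≤
        (q + ε) / (Real.sqrt (q + ε) / Real.sqrt (p + ε)) := by gcongr; linarith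
    have e3 : Real.sqrt (q + ε) / Real.sqrt (p + ε) * (p + ε)
        = Real.sqrt (p + ε) * Real.sqrt (q + ε) := by
      have := Real.mul_self_sqrt hp'.le
      rw [div_mul_eq_mul_div, div_eq_iff sp.ne']
      nlinarith
    have e4 : (q + ε) / (Real.sqrt (q + ε) / Real.sqrt (p + ε))
        = Real.sqrt (p + ε) * Real.sqrt (q + ε) := by
      have := Real.mul_self_sqrt hq'.le
      rw [div_div_eq_mul_div, div_eq_iff sq'.ne']
      nlinarith
    linarith
  have lim : Tendsto (fun ε : ℝ => 2 * K * Real.sqrt ((p + ε) * (q + ε))) (𝓝[>] 0)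
      (𝓝 (2 * K * Real.sqrt ((p + 0) * (q + 0)))) := by
    refine Tendsto.mono_left (Continuous.tendsto ?_ 0) nhdsWithin_le_nhds
    fun_prop
  rw [add_zero, add_zero] at lim
  exact ge_of_tendsto lim (by filter_upwards [self_mem_nhdsWithin] with ε hε using key ε hε)

variable {a : Fin N → Fin N → Eu m → ℝ} {C : Fin N → Fin N → Eu m → Eu m}
  {D : Fin N → Eu m → Eu N} {f : Eu m → Eu N} {θ Λ c : ℝ}
  {φ : Eu m → Eu N} {Φ : Fin N → Eu m → Eu m}

theorem aestronglyMeasurable_coord {μ : Measure (Eu m)} (h : AEStronglyMeasurable y μ)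
    (i : Fin N) : AEStronglyMeasurable (fun x => y x i) μ :=
  (EuclideanSpace.proj (𝕜 := ℝ) i).continuous.comp_aestronglyMeasurable h

theorem SysBound.aestronglyMeasurable_weakIntegrand (hs : SysBound Ω θ Λ a C D f)
    (hy : H1Tuple Ω y G) (hφ : H1Tuple Ω φ Φ) :
    AEStronglyMeasurable (weakIntegrand a C D y G φ Φ) (volume.restrict Ω) := by
  refine AEStronglyMeasurable.add ?_ ?_
  · exact Finset.aestronglyMeasurable_fun_sum _ fun i _ =>
      Finset.aestronglyMeasurable_fun_sum _ fun j _ =>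
        (hs.meas_a i j).mul ((hy j).memLp_grad.1.inner (hφ i).memLp_grad.1)
  · refine Finset.aestronglyMeasurable_fun_sum _ fun i _ => AEStronglyMeasurable.add ?_ ?_
    · exact Finset.aestronglyMeasurable_fun_sum _ fun j _ =>
        ((hs.meas_C i j).inner (hy j).memLp_grad.1).mul (hφ i).memLp.1
    · exact ((hs.meas_D i).inner hy.memLp.1).mul (hφ i).memLp.1

theorem H1Tuple.integrable_gradSq (hy : H1Tuple Ω y G) :
    Integrable (fun x => ∑ i, ‖G i x‖ ^ 2) (volume.restrict Ω) :=
  integrable_finsetSum _ fun i _ => (hy i).memLp_grad.integrable_normSq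

theorem H1Tuple.integral_gradSq (hy : H1Tuple Ω y G) :
    ∫ x in Ω, ∑ i, ‖G i x‖ ^ 2 = ∑ i, ∫ x in Ω, ‖G i x‖ ^ 2 :=
  integral_finsetSum _ fun i _ => (hy i).memLp_grad.integrable_normSq

theorem SysBound.weighted (hs : SysBound Ω θ Λ a C D f) (hw : WeightedIneq Ω θ c) (hc : 0 ≤ c)
    (hy : H1Tuple Ω y G) :
    Integrable (fun x => sysWeight C D f x * ‖y x‖ ^ 2) (volume.restrict Ω) ∧
      ∫ x in Ω, sysWeight C D f x * ‖y x‖ ^ 2 ≤ c * Λ * tupleSq Ω y G := by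
  have h := hw.tuple hs.memLp_weight hy
  simp_rw [abs_of_pos (sysWeight_pos C D f _)] at h
  refine ⟨h.1, h.2.trans ?_⟩
  have := tupleSq_nonneg (Ω := Ω) y G
  gcongr
  exact hs.weight_le

theorem SysBound.integrable_weakIntegrand (hs : SysBound Ω θ Λ a C D f)
    (hw : WeightedIneq Ω θ c) (hc : 0 ≤ c) (hy : H1Tuple Ω y G) (hφ : H1Tuple Ω φ Φ) :
    Integrable (weakIntegrand a C D y G φ Φ) (volume.restrict Ω) := by
  refine Integrable.mono' (((hy.integrable_gradSq.add hφ.integrable_gradSq).const_mul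
    (N * (Λ + 1))).add ((hs.weighted hw hc hy).1.add (hs.weighted hw hc hφ).1))
    (hs.aestronglyMeasurable_weakIntegrand hy hφ) ?_
  filter_upwards [hs.bound_a] with x hx
  have := weakIntegrand_abs_le (C := C) (D := D) f hx y G φ Φ
  rw [mul_add (sysWeight C D f x)] at this
  exact this

/-- The weak form is bounded on `H¹`. -/
theorem SysBound.abs_integral_weakIntegrand_le (hs : SysBound Ω θ Λ a C D f)
    (hw : WeightedIneq Ω θ c) (hc : 0 ≤ c) (hΛ : 0 ≤ Λ) (hy : H1Tuple Ω y G)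
    (hφ : H1Tuple Ω φ Φ) :
    |∫ x in Ω, weakIntegrand a C D y G φ Φ x| ≤
      2 * (N * (Λ + 1) + c * Λ) * Real.sqrt (tupleSq Ω y G * tupleSq Ω φ Φ) := by
  have hN : (0 : ℝ) ≤ N := Nat.cast_nonneg N
  have base : ∀ {y φ : Eu m → Eu N} {G Φ : Fin N → Eu m → Eu m}, H1Tuple Ω y G →
      H1Tuple Ω φ Φ → |∫ x in Ω, weakIntegrand a C D y G φ Φ x| ≤
        (N * (Λ + 1) + c * Λ) * (tupleSq Ω y G + tupleSq Ω φ Φ) := by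
    intro y φ G Φ hy hφ
    have i1 := (hy.integrable_gradSq.add hφ.integrable_gradSq).const_mul (N * (Λ + 1))
    have i2 := (hs.weighted hw hc hy).1.add (hs.weighted hw hc hφ).1
    have h1 : |∫ x in Ω, weakIntegrand a C D y G φ Φ x| ≤
        ∫ x in Ω, (N * (Λ + 1) * ((∑ i, ‖G i x‖ ^ 2) + ∑ i, ‖Φ i x‖ ^ 2)
          + (sysWeight C D f x * ‖y x‖ ^ 2 + sysWeight C D f x * ‖φ x‖ ^ 2)) := by
      rw [← Real.norm_eq_abs]
      refine norm_integral_le_of_norm_le (i1.add i2) ?_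
      filter_upwards [hs.bound_a] with x hx
      have := weakIntegrand_abs_le (C := C) (D := D) f hx y G φ Φ
      rw [mul_add (sysWeight C D f x)] at this
      exact this
    have e : ∫ x in Ω, (N * (Λ + 1) * ((∑ i, ‖G i x‖ ^ 2) + ∑ i, ‖Φ i x‖ ^ 2)
          + (sysWeight C D f x * ‖y x‖ ^ 2 + sysWeight C D f x * ‖φ x‖ ^ 2))
        = N * (Λ + 1) * ((∑ i, ∫ x in Ω, ‖G i x‖ ^ 2) + ∑ i, ∫ x in Ω, ‖Φ i x‖ ^ 2)
          + ((∫ x in Ω, sysWeight C D f x * ‖y x‖ ^ 2)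
            + ∫ x in Ω, sysWeight C D f x * ‖φ x‖ ^ 2) := by
      rw [← hy.integral_gradSq, ← hφ.integral_gradSq]
      erw [integral_add i1 i2]
      rw [integral_const_mul]
      erw [integral_add hy.integrable_gradSq hφ.integrable_gradSq,
        integral_add (hs.weighted hw hc hy).1 (hs.weighted hw hc hφ).1]
    rw [e] at h1
    have g1 : ∑ i, ∫ x in Ω, ‖G i x‖ ^ 2 ≤ tupleSq Ω y G :=
      le_add_of_nonneg_left (integral_nonneg fun x => by positivity)
    have g2 : ∑ i, ∫ x in Ω, ‖Φ i x‖ ^ 2 ≤ tupleSq Ω φ Φ :=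
      le_add_of_nonneg_left (integral_nonneg fun x => by positivity)
    calc _ ≤ _ := h1
      _ ≤ N * (Λ + 1) * (tupleSq Ω y G + tupleSq Ω φ Φ)
          + (c * Λ * tupleSq Ω y G + c * Λ * tupleSq Ω φ Φ) := by
        gcongr
        · exact (hs.weighted hw hc hy).2
        · exact (hs.weighted hw hc hφ).2
      _ = _ := by ring
  -- By bilinearity the form does not change when (y, φ) is replaced by (√t y, φ/√t), while the
  -- quadratic bound `base` becomes t |y|² + |φ|² / t; optimise over `t`.
  refine le_two_mul_sqrt (by positivity) (tupleSq_nonneg _ _) (tupleSq_nonneg _ _) fun t ht => ?_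
  have h2 := base (hy.smul (Real.sqrt t)) (hφ.smul (Real.sqrt t)⁻¹)
  rw [tupleSq_smul, tupleSq_smul, inv_pow, Real.sq_sqrt ht.le] at h2
  have st : Real.sqrt t ≠ 0 := (Real.sqrt_pos.2 ht).ne'
  have e : ∀ x, weakIntegrand a C D (Real.sqrt t • y) (Real.sqrt t • G)
      ((Real.sqrt t)⁻¹ • φ) ((Real.sqrt t)⁻¹ • Φ) x = weakIntegrand a C D y G φ Φ x := by
    intro x
    simp only [weakIntegrand, Pi.smul_apply, inner_smul_left, inner_smul_right, PiLp.smul_apply,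
      smul_eq_mul]
    congr 1
    · refine Finset.sum_congr rfl fun i _ => Finset.sum_congr rfl fun j _ => ?_
      simp only [RCLike.conj_to_real]
      field_simp
    · refine Finset.sum_congr rfl fun i _ => ?_
      congr 1
      · refine Finset.sum_congr rfl fun j _ => ?_
        field_simp
      · field_simp
  simp_rw [e] at h2
  rw [div_eq_mul_inv, mul_comm (tupleSq Ω φ Φ)]
  exact h2

theorem abs_sum_mul_le (f φ : Eu N) : |∑ i, f i * φ i| ≤ ‖f‖ * ‖φ‖ := by
  have := abs_real_inner_le_norm φ f
  rw [PiLp.inner_apply] at this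
  simpa [mul_comm] using this

theorem hasH1Grad_one (hb : Bornology.IsBounded Ω) :
    HasH1Grad Ω (fun _ : Eu m => (1 : ℝ)) 0 := by
  have : IsFiniteMeasure (volume.restrict Ω) := ⟨by
    rw [Measure.restrict_apply_univ]; exact hb.measure_lt_top⟩
  have h1 : MemLp (fun _ : Eu m => (1 : ℝ)) 2 (volume.restrict Ω) := memLp_const 1
  have h0 : MemLp (0 : Eu m → Eu m) 2 (volume.restrict Ω) := MemLp.zero
  refine ⟨h1, h0, h1.locallyIntegrableOn', h0.locallyIntegrableOn', fun φ hφ p => ?_⟩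
  have h := ContDiff.integral_mul_fderiv_test (Ω := Ω) (f := fun _ : Eu m => (1 : ℝ))
    contDiff_const hφ p
  have e : ∀ x : Eu m, gradient (fun _ : Eu m => (1 : ℝ)) x p = 0 := fun x => by
    rw [gradient_apply_coord]; simp
  simp_rw [e] at h
  exact h

/-- The weighted inequality for the constant function 1, whose gradient vanishes. -/
theorem SysBound.integrable_weight (hs : SysBound Ω θ Λ a C D f) (hw : WeightedIneq Ω θ c)
    (hc : 0 ≤ c) (hb : Bornology.IsBounded Ω) :
    Integrable (sysWeight C D f) (volume.restrict Ω) ∧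
      ∫ x in Ω, sysWeight C D f x ≤ c * Λ * (volume Ω).toReal := by
  have h := hw _ _ (hasH1Grad_one hb) _ hs.memLp_weight
  simp only [abs_of_pos (sysWeight_pos C D f _), one_pow, mul_one, Pi.zero_apply, norm_zero,
    ne_eq, OfNat.ofNat_ne_zero, not_false_eq_true, zero_pow, integral_zero, add_zero,
    integral_const, smul_eq_mul, measureReal_restrict_apply_univ] at h
  refine ⟨h.1, h.2.trans ?_⟩
  rw [Measure.real]
  gcongr
  exact hs.weight_le

theorem SysBound.integrable_sum_mul (hs : SysBound Ω θ Λ a C D f) (hw : WeightedIneq Ω θ c)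
    (hc : 0 ≤ c) (hb : Bornology.IsBounded Ω) (hφ : H1Tuple Ω φ Φ) :
    Integrable (fun x => ∑ i, f x i * φ x i) (volume.restrict Ω) := by
  refine Integrable.mono' ((hs.integrable_weight hw hc hb).1.add (hs.weighted hw hc hφ).1)
    (Finset.aestronglyMeasurable_fun_sum _ fun i _ =>
      (aestronglyMeasurable_coord hs.meas_f i).mul (hφ i).memLp.1) (ae_of_all _ fun x => ?_)
  refine (abs_sum_mul_le _ _).trans ?_
  have h1 : ‖f x‖ ≤ sysWeight C D f x := by
    have h1 : 0 ≤ ∑ i, ∑ j, ‖C i j x‖ ^ 2 := by positivity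
    have h2 : 0 ≤ ∑ i, ‖D i x‖ := by positivity
    rw [sysWeight]
    linarith
  have h2 : ‖φ x‖ ≤ 1 + ‖φ x‖ ^ 2 := by nlinarith [sq_nonneg (‖φ x‖ - 1)]
  have := sysWeight_pos C D f x
  calc _ ≤ sysWeight C D f x * (1 + ‖φ x‖ ^ 2) := by gcongr
    _ = _ := by simp [mul_add]

/-- The right hand side is a bounded functional on `H¹`. -/
theorem SysBound.abs_integral_sum_mul_le (hs : SysBound Ω θ Λ a C D f) (hw : WeightedIneq Ω θ c)
    (hc : 0 ≤ c) (hΛ : 0 ≤ Λ) (hb : Bornology.IsBounded Ω) (hφ : H1Tuple Ω φ Φ) :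
    |∫ x in Ω, ∑ i, f x i * φ x i| ≤
      2 * (c * Λ) * Real.sqrt ((volume Ω).toReal * tupleSq Ω φ Φ) := by
  have hwt := hs.integrable_weight hw hc hb
  have hwφ := hs.weighted hw hc hφ
  refine le_two_mul_sqrt (by positivity) (by positivity) (tupleSq_nonneg _ _) fun t ht => ?_
  have h1 : |∫ x in Ω, ∑ i, f x i * φ x i| ≤
      ∫ x in Ω, (t * sysWeight C D f x + t⁻¹ * (sysWeight C D f x * ‖φ x‖ ^ 2)) := by
    rw [← Real.norm_eq_abs]
    refine norm_integral_le_of_norm_le ((hwt.1.const_mul t).add (hwφ.1.const_mul t⁻¹))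
      (ae_of_all _ fun x => ?_)
    refine (abs_sum_mul_le _ _).trans ?_
    have h1 : ‖f x‖ ≤ sysWeight C D f x := by
      have h1 : 0 ≤ ∑ i, ∑ j, ‖C i j x‖ ^ 2 := by positivity
      have h2 : 0 ≤ ∑ i, ‖D i x‖ := by positivity
      rw [sysWeight]
      linarith
    have h2 : ‖φ x‖ ≤ t + t⁻¹ * ‖φ x‖ ^ 2 := by
      rw [inv_mul_eq_div, ← sub_nonneg]
      have : t + ‖φ x‖ ^ 2 / t - ‖φ x‖ = ((t - ‖φ x‖ / 2) ^ 2 + 3 / 4 * ‖φ x‖ ^ 2) / t := by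
        field_simp; ring
      rw [this]
      positivity
    have := sysWeight_pos C D f x
    calc _ ≤ sysWeight C D f x * (t + t⁻¹ * ‖φ x‖ ^ 2) := by gcongr
      _ = _ := by ring
  rw [integral_add (hwt.1.const_mul t) (hwφ.1.const_mul t⁻¹), integral_const_mul,
    integral_const_mul] at h1
  calc _ ≤ _ := h1
    _ ≤ t * (c * Λ * (volume Ω).toReal) + t⁻¹ * (c * Λ * tupleSq Ω φ Φ) := by
      gcongr
      · exact hwt.2
      · exact hwφ.2
    _ = _ := by ring

end WeakForm

/-! ### Coercivity on `H¹₀` from the condition on the zero order terms. -/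

section Coercivity

variable {m N : ℕ} {Ω : Set (Eu m)}

/-- The scaled weighted inequality in `H¹₀(Ω)` with constant `c`. -/
def WeightedIneq0 (Ω : Set (Eu m)) (θ c : ℝ) : Prop :=
  ∀ (u : Eu m → ℝ) (G : Eu m → Eu m), HasH10Grad Ω u G →
    ∀ V : Eu m → ℝ, MemLp V (ENNReal.ofReal (θ / 2)) (volume.restrict Ω) → ∀ h : ℝ, 0 < h →
      Integrable (fun x => |V x| * u x ^ 2) (volume.restrict Ω) ∧
        ∫ x in Ω, |V x| * u x ^ 2 ≤ c * h ^ (-(2 * m / θ)) *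
          (eLpNorm V (ENNReal.ofReal (θ / 2)) (volume.restrict Ω)).toReal *
          ((∫ x in Ω, u x ^ 2) + h ^ 2 * ∫ x in Ω, ‖G x‖ ^ 2)

/-- Take V = 1 and `h` so large that the factor c h^{-2m/θ} |1| is below 1/2; the term ∫ u² on the
right is then absorbed. -/
theorem WeightedIneq0.exists_poincare {θ c : ℝ} (hm : 0 < m) (hθ : 0 < θ)
    (hb : Bornology.IsBounded Ω) (hw : WeightedIneq0 Ω θ c) :
    ∃ P : ℝ, 0 < P ∧ ∀ (u : Eu m → ℝ) (G : Eu m → Eu m), HasH10Grad Ω u G →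
      ∫ x in Ω, u x ^ 2 ≤ P * ∫ x in Ω, ‖G x‖ ^ 2 := by
  have : IsFiniteMeasure (volume.restrict Ω) := ⟨by
    rw [Measure.restrict_apply_univ]; exact hb.measure_lt_top⟩
  set K := (eLpNorm (fun _ : Eu m => (1 : ℝ)) (ENNReal.ofReal (θ / 2))
    (volume.restrict Ω)).toReal with hK
  have hmθ : 0 < 2 * (m : ℝ) / θ := by positivity
  have lim : Tendsto (fun h : ℝ => c * h ^ (-(2 * m / θ)) * K) atTop (𝓝 (c * 0 * K)) :=
    ((tendsto_rpow_neg_atTop hmθ).const_mul c).mul_const K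
  rw [mul_zero, zero_mul] at lim
  obtain ⟨h, h1, h2⟩ := ((lim.eventually (gt_mem_nhds (by norm_num : (0 : ℝ) < 1 / 2))).and
    (eventually_gt_atTop 0)).exists
  refine ⟨h ^ 2, by positivity, fun u G hu => ?_⟩
  have := (hw u G hu _ (memLp_const 1) h h2).2
  simp only [abs_one, one_mul] at this
  have e1 : 0 ≤ ∫ x in Ω, u x ^ 2 := integral_nonneg fun x => by positivity
  have e2 : 0 ≤ ∫ x in Ω, ‖G x‖ ^ 2 := integral_nonneg fun x => by positivity
  have e3 : 0 ≤ (∫ x in Ω, u x ^ 2) + h ^ 2 * ∫ x in Ω, ‖G x‖ ^ 2 := by positivity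
  have := this.trans (mul_le_mul_of_nonneg_right h1.le e3)
  linarith

theorem eLpNorm_norm_sq {μ : Measure (Eu m)} {F : Type*} [NormedAddCommGroup F] (C : Eu m → F)
    {θ : ℝ} (hθ : 0 < θ) :
    eLpNorm (fun x => ‖C x‖ ^ 2) (ENNReal.ofReal (θ / 2)) μ
      = eLpNorm C (ENNReal.ofReal θ) μ ^ 2 := by
  have h := eLpNorm_norm_rpow (μ := μ) C (p := ENNReal.ofReal (θ / 2)) (q := 2) (by norm_num)
  rw [← ENNReal.ofReal_mul (by positivity), div_mul_cancel₀ θ (by norm_num)] at h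
  norm_cast at h

theorem MeasureTheory.MemLp.norm_sq' {μ : Measure (Eu m)} {F : Type*} [NormedAddCommGroup F]
    {C : Eu m → F} {θ : ℝ} (hθ : 0 < θ) (hC : MemLp C (ENNReal.ofReal θ) μ) :
    MemLp (fun x => ‖C x‖ ^ 2) (ENNReal.ofReal (θ / 2)) μ :=
  ⟨hC.1.norm.pow 2, by
    rw [eLpNorm_norm_sq C hθ]
    exact ENNReal.pow_lt_top hC.2⟩

theorem integrable_inner_mul {C G : Eu m → Eu m} {u : Eu m → ℝ} {μ : Measure (Eu m)}
    (hC : AEStronglyMeasurable C μ) (hu : AEStronglyMeasurable u μ) (hG : MemLp G 2 μ)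
    (h : Integrable (fun x => ‖C x‖ ^ 2 * u x ^ 2) μ) :
    Integrable (fun x => inner ℝ (C x) (G x) * u x) μ ∧
      ∀ t : ℝ, 0 < t → |∫ x, inner ℝ (C x) (G x) * u x ∂μ| ≤
        1 / 2 * (t * (∫ x, ‖G x‖ ^ 2 ∂μ) + (∫ x, ‖C x‖ ^ 2 * u x ^ 2 ∂μ) / t) := by
  have pt : ∀ t : ℝ, 0 < t → ∀ x, ‖inner ℝ (C x) (G x) * u x‖ ≤
      1 / 2 * t * ‖G x‖ ^ 2 + 1 / (2 * t) * (‖C x‖ ^ 2 * u x ^ 2) := by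
    intro t ht x
    rw [norm_mul, Real.norm_eq_abs, Real.norm_eq_abs, ← sq_abs (u x)]
    have h1 : |inner ℝ (C x) (G x)| * |u x| ≤ ‖G x‖ * (‖C x‖ * |u x|) := by
      calc _ ≤ ‖C x‖ * ‖G x‖ * |u x| := by gcongr; exact abs_real_inner_le_norm _ _
        _ = _ := by ring
    refine h1.trans ?_
    have : 1 / 2 * t * ‖G x‖ ^ 2 + 1 / (2 * t) * (‖C x‖ ^ 2 * |u x| ^ 2)
        - ‖G x‖ * (‖C x‖ * |u x|) = (t * ‖G x‖ - ‖C x‖ * |u x|) ^ 2 / (2 * t) := by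
      field_simp; ring
    rw [← sub_nonneg, this]
    positivity
  have int : ∀ t : ℝ, Integrable
      (fun x => 1 / 2 * t * ‖G x‖ ^ 2 + 1 / (2 * t) * (‖C x‖ ^ 2 * u x ^ 2)) μ := fun t =>
    (hG.integrable_normSq.const_mul _).add (h.const_mul _)
  refine ⟨(int 1).mono' ((hC.inner hG.1).mul hu) (ae_of_all _ (pt 1 one_pos)), fun t ht => ?_⟩
  have h1 := norm_integral_le_of_norm_le (int t) (ae_of_all _ (pt t ht))
  rw [integral_add (hG.integrable_normSq.const_mul _) (h.const_mul _), integral_const_mul,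
    integral_const_mul, Real.norm_eq_abs] at h1
  refine h1.trans (le_of_eq ?_)
  field_simp

/-- By Cauchy–Schwarz the integral is at most the root of X ∫|C|² u². The weighted inequality with V
= |C|² bounds the last integral by T² s² (Y/h² + X), where T = √c h^{1-m/θ} and s is the norm of
`C`. Finally X² + XY/h² ≤ (X + Y/(2h²))². -/
theorem HasH10Grad.abs_integral_inner_mul_le {θ c : ℝ} (hθ : 0 < θ) (hc : 0 ≤ c)
    (hw : WeightedIneq0 Ω θ c) {C : Eu m → Eu m}
    (hC : MemLp C (ENNReal.ofReal θ) (volume.restrict Ω)) {u : Eu m → ℝ} {U G : Eu m → Eu m}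
    (hu : HasH10Grad Ω u U) (hG : MemLp G 2 (volume.restrict Ω)) {h : ℝ} (hh : 0 < h) {X Y : ℝ}
    (hX : ∫ x in Ω, ‖G x‖ ^ 2 ≤ X) (hX' : ∫ x in Ω, ‖U x‖ ^ 2 ≤ X)
    (hY : ∫ x in Ω, u x ^ 2 ≤ Y) :
    Integrable (fun x => inner ℝ (C x) (G x) * u x) (volume.restrict Ω) ∧
      |∫ x in Ω, inner ℝ (C x) (G x) * u x| ≤
        Real.sqrt c * h ^ (1 - m / θ) *
          (eLpNorm C (ENNReal.ofReal θ) (volume.restrict Ω)).toReal * (X + Y / (2 * h ^ 2)) := by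
  set s := (eLpNorm C (ENNReal.ofReal θ) (volume.restrict Ω)).toReal with hs
  have h1 := hw u U hu _ (hC.norm_sq' hθ) h hh
  rw [eLpNorm_norm_sq C hθ, ENNReal.toReal_pow] at h1
  simp only [abs_pow, abs_norm] at h1
  obtain ⟨h2, h3⟩ := integrable_inner_mul hC.1 hu.memLp.1 hG h1.1
  refine ⟨h2, ?_⟩
  have X0 : 0 ≤ X := (integral_nonneg fun x => by positivity).trans hX
  have Y0 : 0 ≤ Y := (integral_nonneg fun x => by positivity).trans hY
  set T := Real.sqrt c * h ^ (1 - m / θ) with hT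
  have T0 : 0 ≤ T := by positivity
  have s0 : 0 ≤ s := ENNReal.toReal_nonneg
  have eT : c * h ^ (-(2 * m / θ)) = T ^ 2 / h ^ 2 := by
    rw [hT, mul_pow, Real.sq_sqrt hc, ← Real.rpow_natCast (h ^ (1 - m / θ)) 2,
      ← Real.rpow_mul hh.le, eq_div_iff (by positivity), mul_assoc, ← Real.rpow_natCast h 2,
      ← Real.rpow_add hh]
    congr 2
    push_cast
    ring
  have q : ∫ x in Ω, ‖C x‖ ^ 2 * u x ^ 2 ≤ T ^ 2 * s ^ 2 * (Y / h ^ 2 + X) := by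
    refine h1.2.trans ?_
    rw [eT]
    calc _ ≤ T ^ 2 / h ^ 2 * s ^ 2 * (Y + h ^ 2 * X) := by gcongr
      _ = _ := by field_simp
  have := le_two_mul_sqrt (b := |∫ x in Ω, inner ℝ (C x) (G x) * u x|) (K := 1 / 2)
    (p := X) (q := T ^ 2 * s ^ 2 * (Y / h ^ 2 + X)) (by norm_num) X0 (by positivity)
    fun t ht => (h3 t ht).trans (by gcongr)
  refine this.trans ?_
  rw [mul_one_div_cancel (by norm_num), one_mul]
  refine Real.sqrt_le_iff.2 ⟨by positivity, ?_⟩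
  have : (T * s * (X + Y / (2 * h ^ 2))) ^ 2 - X * (T ^ 2 * s ^ 2 * (Y / h ^ 2 + X))
      = (T * s * Y / (2 * h ^ 2)) ^ 2 := by field_simp; ring
  nlinarith [sq_nonneg (T * s * Y / (2 * h ^ 2))]

/-- Ellipticity of the leading coefficients. -/
def EllipticCoeff (Ω : Set (Eu m)) (ρ : ℝ) (a : Fin N → Fin N → Eu m → ℝ) : Prop :=
  ∀ᵐ x ∂(volume.restrict Ω), ∀ ξ : Fin N → Fin m → ℝ,
    ρ * ∑ i, ∑ p, ξ i p ^ 2 ≤ ∑ i, ∑ j, ∑ p, a i j x * ξ i p * ξ j p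

theorem sum_inner_ge {a : Fin N → Fin N → ℝ} {ρ : ℝ}
    (h : ∀ ξ : Fin N → Fin m → ℝ,
      ρ * ∑ i, ∑ p, ξ i p ^ 2 ≤ ∑ i, ∑ j, ∑ p, a i j * ξ i p * ξ j p) (W : Fin N → Eu m) :
    ρ * ∑ i, ‖W i‖ ^ 2 ≤ ∑ i, ∑ j, a i j * inner ℝ (W j) (W i) := by
  have := h fun i p => W i p
  simp_rw [sq_norm_eq_sum]
  refine this.trans (le_of_eq ?_)
  refine Finset.sum_congr rfl fun i _ => Finset.sum_congr rfl fun j _ => ?_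
  rw [PiLp.inner_apply, Finset.mul_sum]
  exact Finset.sum_congr rfl fun p _ => by simp [mul_assoc]

/-- The scale h = (ρ / (2S√c))^{θ/(θ-m)} solves √c h^{1-m/θ} S = ρ/2, and then ρ/(4h²) equals
(2√c)^{2θ/(θ-m)}/4 · ρ^{(m+θ)/(m-θ)} S^{2θ/(θ-m)}. This is the origin of the exponents in the
hypothesis on `D` and of the value of ν₀. For S = 0 there is nothing to absorb, hence the
conditional factor. -/
theorem coercive_scale {ρ S c m θ κ ν : ℝ} (hρ : 0 < ρ) (hS : 0 ≤ S) (hc : 0 < c) (hm : m < θ)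
    (hθ : 0 < θ)
    (hν : (2 * Real.sqrt c) ^ (2 * θ / (θ - m)) / 4 ≤ ν)
    (hκ : κ = ν * ρ ^ ((m + θ) / (m - θ)) * S ^ (2 * θ / (θ - m))) :
    ∃ h : ℝ, 0 < h ∧ Real.sqrt c * h ^ (1 - m / θ) * S ≤ ρ / 2 ∧ ρ / (4 * h ^ 2) * (if S = 0 then 0 else 1) ≤ κ ∧ 0 ≤ κ := by
  have hc' := Real.sqrt_pos.2 hc
  have hν0 : 0 ≤ ν := le_trans (by positivity) hν
  have hκ0 : 0 ≤ κ := by rw [hκ]; positivity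
  have hd : 0 < θ - m := by linarith
  rcases hS.eq_or_lt with h0 | hS
  · exact ⟨1, one_pos, by rw [← h0]; simp; positivity, by simp [← h0, hκ0], hκ0⟩
  set r := ρ / (2 * S * Real.sqrt c) with hr
  have hr0 : 0 < r := by positivity
  refine ⟨r ^ (θ / (θ - m)), by positivity, ?_, ?_, hκ0⟩
  · rw [← Real.rpow_mul hr0.le]
    have : θ / (θ - m) * (1 - m / θ) = 1 := by field_simp
    rw [this, Real.rpow_one, hr]
    refine le_of_eq ?_
    field_simp
  · rw [if_neg hS.ne', mul_one, hκ]
    have e : ρ / (4 * (r ^ (θ / (θ - m))) ^ 2)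
        = (2 * Real.sqrt c) ^ (2 * θ / (θ - m)) / 4 * ρ ^ ((m + θ) / (m - θ))
          * S ^ (2 * θ / (θ - m)) := by
      rw [← Real.rpow_natCast (r ^ (θ / (θ - m))) 2, ← Real.rpow_mul hr0.le]
      have e1 : θ / (θ - m) * ((2 : ℕ) : ℝ) = 2 * θ / (θ - m) := by push_cast; ring
      have e2 : (m + θ) / (m - θ) = 1 - 2 * θ / (θ - m) := by
        have : m - θ ≠ 0 := by linarith
        field_simp; ring
      have e3 : r = ρ / (S * (2 * Real.sqrt c)) := by rw [hr]; ring
      rw [e1, e2, Real.rpow_sub hρ, Real.rpow_one, e3, Real.div_rpow hρ.le (by positivity),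
        Real.mul_rpow hS.le (by positivity)]
      have p1 := Real.rpow_pos_of_pos hρ (2 * θ / (θ - m))
      field_simp
    rw [e]
    gcongr

theorem integral_add_three {α : Type*} [MeasurableSpace α] {μ : Measure α} {f g h : α → ℝ}
    (hf : Integrable f μ) (hg : Integrable g μ) (hh : Integrable h μ) :
    ∫ x, (f x + g x + h x) ∂μ = (∫ x, f x ∂μ) + (∫ x, g x ∂μ) + ∫ x, h x ∂μ := by
  have := integral_add (hf.add hg) hh
  rw [integral_add' hf hg] at this
  exact this

theorem coercive_arith {ρ κ X Y I T S r : ℝ} (hρ : 0 < ρ) (κ0 : 0 ≤ κ) (X0 : 0 ≤ X) (Y0 : 0 ≤ Y)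
    (hr1 : T * S ≤ ρ / 2) (hr2 : ρ / (4 * r ^ 2) * (if S = 0 then 0 else 1) ≤ κ)
    (up : |I| ≤ T * S * (X + Y / (2 * r ^ 2))) : ρ / 2 * X ≤ ρ * X + κ * Y + I := by
  have up2 := neg_le_of_abs_le up
  rcases eq_or_ne S 0 with hz | hz
  · rw [hz, mul_zero, zero_mul, neg_zero] at up2
    have := mul_nonneg κ0 Y0
    have := mul_nonneg hρ.le X0
    linarith
  · rw [if_neg hz, mul_one] at hr2
    have h1 : T * S * (X + Y / (2 * r ^ 2)) ≤ ρ / 2 * (X + Y / (2 * r ^ 2)) := by gcongr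
    have h2 : ρ / 2 * (Y / (2 * r ^ 2)) = ρ / (4 * r ^ 2) * Y := by ring
    have h3 := mul_le_mul_of_nonneg_right hr2 Y0
    linarith

/-- Coercivity of the weak form on `H¹₀`. -/
theorem SysBound.coercive {θ c c' Λ ρ ν : ℝ} (hmθ : (m : ℝ) < θ) (hθ : 0 < θ) (hc : 0 < c)
    (hc' : 0 ≤ c') (hw : WeightedIneq0 Ω θ c) (hw' : WeightedIneq Ω θ c')
    {a : Fin N → Fin N → Eu m → ℝ}
    {C : Fin N → Fin N → Eu m → Eu m} {D : Fin N → Eu m → Eu N} {f : Eu m → Eu N}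
    (hs : SysBound Ω θ Λ a C D f) (hρ : 0 < ρ) (hell : EllipticCoeff Ω ρ a)
    (hC : ∀ i j, MemLp (C i j) (ENNReal.ofReal θ) (volume.restrict Ω))
    (hν : (2 * Real.sqrt c) ^ (2 * θ / (θ - m)) / 4 ≤ ν)
    (hD : ∀ᵐ x ∂(volume.restrict Ω), ∀ μ : Eu N,
          ν * ρ ^ (((m : ℝ) + θ) / ((m : ℝ) - θ))
              * (∑ i, ∑ j, (eLpNorm (C i j) (ENNReal.ofReal θ) (volume.restrict Ω)).toReal)
                  ^ (2 * θ / (θ - (m : ℝ)))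
              * ‖μ‖ ^ 2
            ≤ ∑ i, inner ℝ (D i x) μ * μ i)
    {w : Eu m → Eu N} {W : Fin N → Eu m → Eu m} (h : H10Tuple Ω w W) :
    ρ / 2 * ∑ i, ∫ x in Ω, ‖W i x‖ ^ 2 ≤ ∫ x in Ω, weakIntegrand a C D w W w W x := by
  set S := ∑ i, ∑ j, (eLpNorm (C i j) (ENNReal.ofReal θ) (volume.restrict Ω)).toReal with hS
  have S0 : 0 ≤ S := Finset.sum_nonneg fun i _ => Finset.sum_nonneg fun j _ =>
    ENNReal.toReal_nonneg
  set κ := ν * ρ ^ (((m : ℝ) + θ) / ((m : ℝ) - θ)) * S ^ (2 * θ / (θ - (m : ℝ))) with hκ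
  obtain ⟨r, r0, hr1, hr2, κ0⟩ := coercive_scale hρ S0 hc hmθ hθ hν hκ
  set X := ∑ i, ∫ x in Ω, ‖W i x‖ ^ 2 with hX
  set Y := ∫ x in Ω, ‖w x‖ ^ 2 with hY
  have X0 : 0 ≤ X := Finset.sum_nonneg fun i _ => integral_nonneg fun x => by positivity
  have Y0 : 0 ≤ Y := integral_nonneg fun x => by positivity
  have hXi : ∀ i, ∫ x in Ω, ‖W i x‖ ^ 2 ≤ X := fun i =>
    Finset.single_le_sum (f := fun i => ∫ x in Ω, ‖W i x‖ ^ 2)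
      (fun i _ => integral_nonneg fun x => by positivity) (Finset.mem_univ i)
  have hYi : ∀ i, ∫ x in Ω, w x i ^ 2 ≤ Y := fun i => by
    rw [hY, h.h1.integral_normSq]
    exact Finset.single_le_sum (f := fun i => ∫ x in Ω, w x i ^ 2)
      (fun i _ => integral_nonneg fun x => by positivity) (Finset.mem_univ i)
  have hI := fun i j => (h i).abs_integral_inner_mul_le hθ hc.le hw (hC i j)
    (h j).memLp_grad r0 (hXi j) (hXi i) (hYi i)
  have iW := h.h1.integrable_gradSq.const_mul ρ
  have iw := (h.h1.memLp.integrable_normSq).const_mul κ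
  have iC : Integrable (fun x => ∑ i, ∑ j, inner ℝ (C i j x) (W j x) * w x i)
      (volume.restrict Ω) :=
    integrable_finsetSum _ fun i _ => integrable_finsetSum _ fun j _ => (hI i j).1
  -- Ellipticity and the lower bound on `D` hold pointwise; the terms with `C` are kept aside, as
  -- only their integrals can be absorbed.
  have low : ∫ x in Ω, (ρ * (∑ i, ‖W i x‖ ^ 2) + κ * ‖w x‖ ^ 2
      + ∑ i, ∑ j, inner ℝ (C i j x) (W j x) * w x i) ≤
        ∫ x in Ω, weakIntegrand a C D w W w W x := by
    refine integral_mono_ae ((iW.add iw).add iC)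
      (hs.integrable_weakIntegrand hw' hc' h.h1 h.h1) ?_
    filter_upwards [hell, hD] with x h1 h2
    have h3 := sum_inner_ge h1 fun i => W i x
    have h4 := h2 (w x)
    simp only [weakIntegrand, Finset.sum_add_distrib]
    linarith
  have e : ∫ x in Ω, (ρ * (∑ i, ‖W i x‖ ^ 2) + κ * ‖w x‖ ^ 2
      + ∑ i, ∑ j, inner ℝ (C i j x) (W j x) * w x i)
      = ρ * X + κ * Y + ∑ i, ∑ j, ∫ x in Ω, inner ℝ (C i j x) (W j x) * w x i := by
    have e1 : ∫ x in Ω, (∑ i, ∑ j, inner ℝ (C i j x) (W j x) * w x i)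
        = ∑ i, ∑ j, ∫ x in Ω, inner ℝ (C i j x) (W j x) * w x i := by
      rw [integral_finsetSum _ fun i _ => integrable_finsetSum _ fun j _ => (hI i j).1]
      exact Finset.sum_congr rfl fun i _ => integral_finsetSum _ fun j _ => (hI i j).1
    rw [integral_add_three iW iw iC, integral_const_mul, integral_const_mul,
      h.h1.integral_gradSq, e1]
  rw [e] at low
  have up : |∑ i, ∑ j, ∫ x in Ω, inner ℝ (C i j x) (W j x) * w x i| ≤
      Real.sqrt c * r ^ (1 - m / θ) * S * (X + Y / (2 * r ^ 2)) := by
    rw [hS, Finset.mul_sum, Finset.sum_mul]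
    refine (Finset.abs_sum_le_sum_abs _ _).trans (Finset.sum_le_sum fun i _ => ?_)
    rw [Finset.mul_sum, Finset.sum_mul]
    exact (Finset.abs_sum_le_sum_abs _ _).trans (Finset.sum_le_sum fun j _ => (hI i j).2)
  exact (coercive_arith hρ κ0 X0 Y0 hr1 hr2 up).trans low

theorem H10Tuple.coercive_tupleSq {ρ P : ℝ} (hρ : 0 < ρ) (hP : 0 < P)
    (hpo : ∀ (u : Eu m → ℝ) (G : Eu m → Eu m), HasH10Grad Ω u G →
      ∫ x in Ω, u x ^ 2 ≤ P * ∫ x in Ω, ‖G x‖ ^ 2)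
    {w : Eu m → Eu N} {W : Fin N → Eu m → Eu m} (h : H10Tuple Ω w W) :
    ρ / (2 * (1 + P)) * tupleSq Ω w W ≤ ρ / 2 * ∑ i, ∫ x in Ω, ‖W i x‖ ^ 2 := by
  have : tupleSq Ω w W ≤ (1 + P) * ∑ i, ∫ x in Ω, ‖W i x‖ ^ 2 := by
    rw [h.h1.tupleSq_eq, Finset.mul_sum]
    refine Finset.sum_le_sum fun i _ => ?_
    have := hpo _ _ (h i)
    linarith
  rw [div_mul_eq_mul_div, div_le_iff₀ (by positivity)]
  have := mul_le_mul_of_nonneg_left this hρ.le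
  linarith

end Coercivity

/-! ### The Hilbert space `H¹₀(Ω; ℝ^N)` and the Lax–Milgram theorem. -/

section Existence

variable {m N : ℕ} {Ω : Set (Eu m)}

theorem weakIntegrand_add_left (a : Fin N → Fin N → Eu m → ℝ) (C : Fin N → Fin N → Eu m → Eu m)
    (D : Fin N → Eu m → Eu N) (y z φ : Eu m → Eu N) (G H Φ : Fin N → Eu m → Eu m) (x : Eu m) :
    weakIntegrand a C D (y + z) (G + H) φ Φ x
      = weakIntegrand a C D y G φ Φ x + weakIntegrand a C D z H φ Φ x := by
  simp only [weakIntegrand, Pi.add_apply, inner_add_left, inner_add_right, mul_add, add_mul,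
    Finset.sum_add_distrib]
  ring

theorem weakIntegrand_add_right (a : Fin N → Fin N → Eu m → ℝ) (C : Fin N → Fin N → Eu m → Eu m)
    (D : Fin N → Eu m → Eu N) (y z φ : Eu m → Eu N) (G H Φ : Fin N → Eu m → Eu m) (x : Eu m) :
    weakIntegrand a C D φ Φ (y + z) (G + H) x
      = weakIntegrand a C D φ Φ y G x + weakIntegrand a C D φ Φ z H x := by
  simp only [weakIntegrand, Pi.add_apply, inner_add_right, mul_add, PiLp.add_apply,
    Finset.sum_add_distrib]
  ring

theorem weakIntegrand_smul_left (a : Fin N → Fin N → Eu m → ℝ) (C : Fin N → Fin N → Eu m → Eu m)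
    (D : Fin N → Eu m → Eu N) (k : ℝ) (y φ : Eu m → Eu N) (G Φ : Fin N → Eu m → Eu m) (x : Eu m) :
    weakIntegrand a C D (k • y) (k • G) φ Φ x = k * weakIntegrand a C D y G φ Φ x := by
  simp only [weakIntegrand, Pi.smul_apply, inner_smul_left, inner_smul_right, mul_add,
    Finset.mul_sum, RCLike.conj_to_real]
  congr 1
  · exact Finset.sum_congr rfl fun i _ => Finset.sum_congr rfl fun j _ => by ring
  · refine Finset.sum_congr rfl fun i _ => ?_
    congr 1
    · exact Finset.sum_congr rfl fun j _ => by ring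
    · ring

theorem weakIntegrand_smul_right (a : Fin N → Fin N → Eu m → ℝ) (C : Fin N → Fin N → Eu m → Eu m)
    (D : Fin N → Eu m → Eu N) (k : ℝ) (y φ : Eu m → Eu N) (G Φ : Fin N → Eu m → Eu m) (x : Eu m) :
    weakIntegrand a C D φ Φ (k • y) (k • G) x = k * weakIntegrand a C D φ Φ y G x := by
  simp only [weakIntegrand, Pi.smul_apply, inner_smul_right, mul_add, PiLp.smul_apply, smul_eq_mul,
    Finset.mul_sum]
  congr 1
  · exact Finset.sum_congr rfl fun i _ => Finset.sum_congr rfl fun j _ => by ring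
  · refine Finset.sum_congr rfl fun i _ => ?_
    congr 1
    · exact Finset.sum_congr rfl fun j _ => by ring
    · ring

theorem integral_weakIntegrand_congr {a : Fin N → Fin N → Eu m → ℝ}
    {C : Fin N → Fin N → Eu m → Eu m} {D : Fin N → Eu m → Eu N} {y y' φ φ' : Eu m → Eu N}
    {G G' Φ Φ' : Fin N → Eu m → Eu m}
    (hy : y =ᵐ[volume.restrict Ω] y') (hG : ∀ i, G i =ᵐ[volume.restrict Ω] G' i)
    (hφ : φ =ᵐ[volume.restrict Ω] φ') (hΦ : ∀ i, Φ i =ᵐ[volume.restrict Ω] Φ' i) :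
    ∫ x in Ω, weakIntegrand a C D y G φ Φ x = ∫ x in Ω, weakIntegrand a C D y' G' φ' Φ' x := by
  refine integral_congr_ae ?_
  filter_upwards [hy, hφ, ae_all_iff.2 hG, ae_all_iff.2 hΦ] with x h1 h2 h3 h4
  simp only [weakIntegrand, h1, h2, h3, h4]

/-- The values of a tuple and of its gradients at one point. -/
abbrev Jet (m N : ℕ) : Type := EuclideanSpace ℝ (Fin N × Option (Fin m))

/-- The values in a jet. -/
noncomputable def jetVal (m N : ℕ) : Jet m N →L[ℝ] Eu N :=
  LinearMap.toContinuousLinearMap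
    { toFun := fun z => WithLp.toLp 2 fun i => z (i, none)
      map_add' := fun _ _ => rfl
      map_smul' := fun _ _ => rfl }

/-- The gradients in a jet. -/
noncomputable def jetGrad (m N : ℕ) (i : Fin N) : Jet m N →L[ℝ] Eu m :=
  LinearMap.toContinuousLinearMap
    { toFun := fun z => WithLp.toLp 2 fun p => z (i, some p)
      map_add' := fun _ _ => rfl
      map_smul' := fun _ _ => rfl }

theorem jetVal_apply (z : Jet m N) (i : Fin N) : jetVal m N z i = z (i, none) := rfl

theorem jetGrad_apply (z : Jet m N) (i : Fin N) (p : Fin m) :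
    jetGrad m N i z p = z (i, some p) := rfl

theorem Jet.norm_sq (z : Jet m N) : ‖z‖ ^ 2 = ‖jetVal m N z‖ ^ 2 + ∑ i, ‖jetGrad m N i z‖ ^ 2 := by
  simp_rw [EuclideanSpace.real_norm_sq_eq, jetVal_apply, jetGrad_apply]
  rw [Fintype.sum_prod_type, ← Finset.sum_add_distrib]
  exact Finset.sum_congr rfl fun i _ => Fintype.sum_option _

/-- The jet of `y` with gradients `G`. -/
noncomputable def jet (y : Eu m → Eu N) (G : Fin N → Eu m → Eu m) (x : Eu m) : Jet m N :=
  WithLp.toLp 2 fun q => q.2.elim (y x q.1) fun p => G q.1 x p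

theorem jetVal_jet (y : Eu m → Eu N) (G : Fin N → Eu m → Eu m) (x : Eu m) :
    jetVal m N (jet y G x) = y x := rfl

theorem jetGrad_jet (y : Eu m → Eu N) (G : Fin N → Eu m → Eu m) (i : Fin N) (x : Eu m) :
    jetGrad m N i (jet y G x) = G i x := rfl

theorem H1Tuple.memLp_jet {y : Eu m → Eu N} {G : Fin N → Eu m → Eu m} (h : H1Tuple Ω y G) :
    MemLp (jet y G) 2 (volume.restrict Ω) := by
  have : jet y G = fun x => ∑ q, (jet y G x q) • (EuclideanSpace.single q (1 : ℝ) : Jet m N) := by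
    ext x i
    simp [Pi.single_apply]
  rw [this]
  refine memLp_finsetSum _ fun q _ => ((ContinuousLinearMap.id ℝ ℝ).smulRight
    (EuclideanSpace.single q (1 : ℝ) : Jet m N)).comp_memLp' ?_
  obtain ⟨i, _ | p⟩ := q
  · exact (h i).memLp
  · exact (h i).memLp_grad.coord p

/-- `H¹₀(Ω; ℝ^N)` as a subspace of `L²(Ω)`. -/
noncomputable def jetSpace (Ω : Set (Eu m)) (N : ℕ) :
    Submodule ℝ (Lp (Jet m N) 2 (volume.restrict Ω)) where
  carrier := {v | H10Tuple Ω (fun x => jetVal m N (v x)) fun i x => jetGrad m N i (v x)}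
  add_mem' := by
    intro v w hv hw i
    refine ((hv i).add (hw i)).congr ?_ ?_
    · filter_upwards [Lp.coeFn_add v w] with x hx
      rw [hx]
      rfl
    · filter_upwards [Lp.coeFn_add v w] with x hx
      rw [hx]
      exact ((jetGrad m N i).map_add _ _).symm
  zero_mem' := by
    intro i
    refine HasH10Grad.congr HasH10Grad.zero ?_ ?_
    · filter_upwards [Lp.coeFn_zero (Jet m N) 2 (volume.restrict Ω)] with x hx
      rw [hx]
      rfl
    · filter_upwards [Lp.coeFn_zero (Jet m N) 2 (volume.restrict Ω)] with x hx
      rw [hx]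
      exact ((jetGrad m N i).map_zero).symm
  smul_mem' := by
    intro c v hv i
    refine ((hv i).const_smul c).congr ?_ ?_
    · filter_upwards [Lp.coeFn_smul c v] with x hx
      rw [hx]
      rfl
    · filter_upwards [Lp.coeFn_smul c v] with x hx
      rw [hx]
      exact ((jetGrad m N i).map_smul _ _).symm

/-- Jets record the function together with its gradients, so L² convergence of jets is convergence
in `H¹`, under which `H¹₀` is closed. Completeness, needed for Lax–Milgram, follows. -/
theorem isClosed_jetSpace (Ω : Set (Eu m)) (N : ℕ) :
    IsClosed (jetSpace Ω N : Set (Lp (Jet m N) 2 (volume.restrict Ω))) := by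
  refine isSeqClosed_iff_isClosed.1 fun v w hv hw i => ?_
  have h : L2Lim (volume.restrict Ω) (fun n => (v n : Eu m → Jet m N)) w :=
    (Lp.tendsto_Lp_iff_tendsto_eLpNorm' v w).1 hw
  have hw2 : MemLp (w : Eu m → Jet m N) 2 (volume.restrict Ω) := Lp.memLp w
  let T : Jet m N →L[ℝ] ℝ := EuclideanSpace.proj (i, none)
  have m1 : MemLp (fun x => T (w x)) 2 (volume.restrict Ω) := T.comp_memLp' hw2
  have m2 : MemLp (fun x => jetGrad m N i (w x)) 2 (volume.restrict Ω) :=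
    (jetGrad m N i).comp_memLp' hw2
  exact HasH10Grad.of_L2Lim m1 m2 (h.clm T) (h.clm (jetGrad m N i)) fun n => hv n i

instance (Ω : Set (Eu m)) (N : ℕ) : CompleteSpace (jetSpace Ω N) :=
  (isClosed_jetSpace Ω N).completeSpace_coe

/-- The function represented by an element of `jetSpace`. -/
noncomputable def jetSpaceVal (v : jetSpace Ω N) (x : Eu m) : Eu N := jetVal m N (v.1 x)

/-- The gradients of the function represented by an element of `jetSpace`. -/
noncomputable def jetSpaceGrad (v : jetSpace Ω N) (i : Fin N) (x : Eu m) : Eu m :=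
  jetGrad m N i (v.1 x)

theorem jetSpace_h10 (v : jetSpace Ω N) : H10Tuple Ω (jetSpaceVal v) (jetSpaceGrad v) := v.2

theorem jetSpace_norm_sq (v : jetSpace Ω N) : ‖v‖ ^ 2 = tupleSq Ω (jetSpaceVal v) (jetSpaceGrad v) := by
  have h1 : ‖v‖ ^ 2 = ∫ x in Ω, ‖v.1 x‖ ^ 2 := by
    rw [Submodule.coe_norm, ← real_inner_self_eq_norm_sq, L2.inner_def]
    simp_rw [real_inner_self_eq_norm_sq]
  rw [h1, tupleSq, ← (jetSpace_h10 v).h1.integral_gradSq, ← integral_add (jetSpace_h10 v).h1.memLp.integrable_normSq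
    (jetSpace_h10 v).h1.integrable_gradSq]
  simp_rw [Jet.norm_sq]
  rfl

theorem jetSpace_val_add (v w : jetSpace Ω N) :
    jetSpaceVal (v + w) =ᵐ[volume.restrict Ω] (jetSpaceVal v) + (jetSpaceVal w) := by
  filter_upwards [Lp.coeFn_add v.1 w.1] with x hx
  exact (congrArg _ hx).trans (map_add _ _ _)

theorem jetSpace_grad_add (v w : jetSpace Ω N) (i : Fin N) :
    jetSpaceGrad (v + w) i =ᵐ[volume.restrict Ω] ((jetSpaceGrad v) + (jetSpaceGrad w)) i := by
  filter_upwards [Lp.coeFn_add v.1 w.1] with x hx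
  exact (congrArg _ hx).trans (map_add _ _ _)

theorem jetSpace_val_smul (c : ℝ) (v : jetSpace Ω N) :
    jetSpaceVal (c • v) =ᵐ[volume.restrict Ω] c • (jetSpaceVal v) := by
  filter_upwards [Lp.coeFn_smul c v.1] with x hx
  exact (congrArg _ hx).trans ((jetVal m N).map_smul _ _)

theorem jetSpace_grad_smul (c : ℝ) (v : jetSpace Ω N) (i : Fin N) :
    jetSpaceGrad (c • v) i =ᵐ[volume.restrict Ω] (c • (jetSpaceGrad v)) i := by
  filter_upwards [Lp.coeFn_smul c v.1] with x hx
  exact (congrArg _ hx).trans ((jetGrad m N i).map_smul _ _)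

/-- This lets an equation solved in the Hilbert space be tested with an arbitrary tuple of `H¹₀`
functions. -/
theorem H10Tuple.exists_jetSpace {φ : Eu m → Eu N} {Φ : Fin N → Eu m → Eu m}
    (h : H10Tuple Ω φ Φ) : ∃ v : jetSpace Ω N, (jetSpaceVal v) =ᵐ[volume.restrict Ω] φ ∧
      ∀ i, (jetSpaceGrad v) i =ᵐ[volume.restrict Ω] Φ i := by
  have e := h.h1.memLp_jet.coeFn_toLp
  refine ⟨⟨h.h1.memLp_jet.toLp, fun i => (h i).congr ?_ ?_⟩, ?_, fun i => ?_⟩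
  · filter_upwards [e] with x hx
    rw [hx, jetVal_jet]
  · filter_upwards [e] with x hx
    rw [hx, jetGrad_jet]
  · filter_upwards [e] with x hx
    rw [jetSpaceVal, hx, jetVal_jet]
  · filter_upwards [e] with x hx
    rw [jetSpaceGrad, hx, jetGrad_jet]

variable {a : Fin N → Fin N → Eu m → ℝ} {C : Fin N → Fin N → Eu m → Eu m}
  {D : Fin N → Eu m → Eu N} {f : Eu m → Eu N} {θ Λ c : ℝ}

/-- The weak form on `H¹₀`. -/
noncomputable def SysBound.bilin (hs : SysBound Ω θ Λ a C D f) (hw : WeightedIneq Ω θ c)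
    (hc : 0 ≤ c) (hΛ : 0 ≤ Λ) : jetSpace Ω N →L[ℝ] jetSpace Ω N →L[ℝ] ℝ :=
  LinearMap.mkContinuous₂
    (LinearMap.mk₂ ℝ (fun v w : jetSpace Ω N =>
      ∫ x in Ω, weakIntegrand a C D (jetSpaceVal v) (jetSpaceGrad v) (jetSpaceVal w) (jetSpaceGrad w) x)
      (fun v v' w => by
        rw [integral_weakIntegrand_congr (jetSpace_val_add v v') (jetSpace_grad_add v v') (ae_eq_refl _)
          fun _ => ae_eq_refl _]
        simp_rw [weakIntegrand_add_left]
        exact integral_add (hs.integrable_weakIntegrand hw hc (jetSpace_h10 v).h1 (jetSpace_h10 w).h1)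
          (hs.integrable_weakIntegrand hw hc (jetSpace_h10 v').h1 (jetSpace_h10 w).h1))
      (fun k v w => by
        rw [integral_weakIntegrand_congr (jetSpace_val_smul k v) (jetSpace_grad_smul k v) (ae_eq_refl _)
          fun _ => ae_eq_refl _]
        simp_rw [weakIntegrand_smul_left]
        exact integral_const_mul _ _)
      (fun v w w' => by
        rw [integral_weakIntegrand_congr (ae_eq_refl _) (fun _ => ae_eq_refl _) (jetSpace_val_add w w')
          (jetSpace_grad_add w w')]
        simp_rw [weakIntegrand_add_right]
        exact integral_add (hs.integrable_weakIntegrand hw hc (jetSpace_h10 v).h1 (jetSpace_h10 w).h1)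
          (hs.integrable_weakIntegrand hw hc (jetSpace_h10 v).h1 (jetSpace_h10 w').h1))
      (fun k v w => by
        rw [integral_weakIntegrand_congr (ae_eq_refl _) (fun _ => ae_eq_refl _) (jetSpace_val_smul k w)
          (jetSpace_grad_smul k w)]
        simp_rw [weakIntegrand_smul_right]
        exact integral_const_mul _ _))
    (2 * (N * (Λ + 1) + c * Λ))
    (fun v w => by
      rw [LinearMap.mk₂_apply, Real.norm_eq_abs]
      refine (hs.abs_integral_weakIntegrand_le hw hc hΛ (jetSpace_h10 v).h1 (jetSpace_h10 w).h1).trans (le_of_eq ?_)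
      rw [← jetSpace_norm_sq v, ← jetSpace_norm_sq w, ← mul_pow, Real.sqrt_sq (by positivity), ← mul_assoc])

theorem SysBound.bilin_apply (hs : SysBound Ω θ Λ a C D f) (hw : WeightedIneq Ω θ c)
    (hc : 0 ≤ c) (hΛ : 0 ≤ Λ) (v w : jetSpace Ω N) :
    hs.bilin hw hc hΛ v w = ∫ x in Ω, weakIntegrand a C D (jetSpaceVal v) (jetSpaceGrad v) (jetSpaceVal w) (jetSpaceGrad w) x := rfl

theorem SysBound.abs_rhs_le (hs : SysBound Ω θ Λ a C D f) (hw : WeightedIneq Ω θ c)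
    (hc : 0 ≤ c) (hΛ : 0 ≤ Λ) (hb : Bornology.IsBounded Ω) {g φ : Eu m → Eu N}
    {Γ Φ : Fin N → Eu m → Eu m} (hg : H1Tuple Ω g Γ) (hφ : H1Tuple Ω φ Φ) :
    |(∫ x in Ω, ∑ i, f x i * φ x i) - ∫ x in Ω, weakIntegrand a C D g Γ φ Φ x| ≤
      (2 * (c * Λ) * Real.sqrt (volume Ω).toReal
        + 2 * (N * (Λ + 1) + c * Λ) * Real.sqrt (tupleSq Ω g Γ)) * Real.sqrt (tupleSq Ω φ Φ) := by
  have h1 := hs.abs_integral_sum_mul_le hw hc hΛ hb hφ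
  have h2 := hs.abs_integral_weakIntegrand_le hw hc hΛ hg hφ
  rw [Real.sqrt_mul ENNReal.toReal_nonneg] at h1
  rw [Real.sqrt_mul (tupleSq_nonneg _ _)] at h2
  rw [add_mul, mul_assoc _ (Real.sqrt _) (Real.sqrt (tupleSq Ω φ Φ)),
    mul_assoc _ (Real.sqrt (tupleSq Ω g Γ))]
  exact (abs_sub _ _).trans (add_le_add h1 h2)

/-- The right hand side for boundary data `g`. -/
noncomputable def SysBound.rhs (hs : SysBound Ω θ Λ a C D f) (hw : WeightedIneq Ω θ c)
    (hc : 0 ≤ c) (hΛ : 0 ≤ Λ) (hb : Bornology.IsBounded Ω) {g : Eu m → Eu N}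
    {Γ : Fin N → Eu m → Eu m} (hg : H1Tuple Ω g Γ) : jetSpace Ω N →L[ℝ] ℝ :=
  LinearMap.mkContinuous
    { toFun := fun w => (∫ x in Ω, ∑ i, f x i * (jetSpaceVal w) x i)
        - ∫ x in Ω, weakIntegrand a C D g Γ (jetSpaceVal w) (jetSpaceGrad w) x
      map_add' := fun w w' => by
        rw [integral_weakIntegrand_congr (ae_eq_refl _) (fun _ => ae_eq_refl _) (jetSpace_val_add w w')
          (jetSpace_grad_add w w')]
        simp_rw [weakIntegrand_add_right]
        rw [integral_add (hs.integrable_weakIntegrand hw hc hg (jetSpace_h10 w).h1)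
          (hs.integrable_weakIntegrand hw hc hg (jetSpace_h10 w').h1)]
        have e : ∫ x in Ω, ∑ i, f x i * jetSpaceVal (w + w') x i
            = ∫ x in Ω, ((∑ i, f x i * (jetSpaceVal w) x i) + ∑ i, f x i * (jetSpaceVal w') x i) := by
          refine integral_congr_ae ?_
          filter_upwards [jetSpace_val_add w w'] with x hx
          simp [hx, mul_add, Finset.sum_add_distrib]
        rw [e, integral_add (hs.integrable_sum_mul hw hc hb (jetSpace_h10 w).h1)
          (hs.integrable_sum_mul hw hc hb (jetSpace_h10 w').h1)]
        ring
      map_smul' := fun k w => by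
        rw [integral_weakIntegrand_congr (ae_eq_refl _) (fun _ => ae_eq_refl _) (jetSpace_val_smul k w)
          (jetSpace_grad_smul k w)]
        simp_rw [weakIntegrand_smul_right]
        rw [integral_const_mul]
        have e : ∫ x in Ω, ∑ i, f x i * jetSpaceVal (k • w) x i
            = ∫ x in Ω, k * ∑ i, f x i * (jetSpaceVal w) x i := by
          refine integral_congr_ae ?_
          filter_upwards [jetSpace_val_smul k w] with x hx
          simp only [hx, Pi.smul_apply, PiLp.smul_apply, smul_eq_mul, Finset.mul_sum]
          exact Finset.sum_congr rfl fun i _ => by ring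
        rw [e, integral_const_mul]
        simp [mul_sub] }
    (2 * (c * Λ) * Real.sqrt (volume Ω).toReal
      + 2 * (N * (Λ + 1) + c * Λ) * Real.sqrt (tupleSq Ω g Γ))
    (fun w => by
      have h := hs.abs_rhs_le hw hc hΛ hb hg (jetSpace_h10 w).h1
      rw [← jetSpace_norm_sq w, Real.sqrt_sq (norm_nonneg _)] at h
      exact h)

/-- Existence of a weak solution. -/
theorem SysBound.exists_solution (hs : SysBound Ω θ Λ a C D f) (hw : WeightedIneq Ω θ c)
    (hc : 0 ≤ c) (hΛ : 0 ≤ Λ) (hb : Bornology.IsBounded Ω) {g : Eu m → Eu N}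
    {Γ : Fin N → Eu m → Eu m} (hg : H1Tuple Ω g Γ) {k : ℝ} (hk : 0 < k)
    (coer : ∀ w W, H10Tuple Ω w W →
      k * tupleSq Ω w W ≤ ∫ x in Ω, weakIntegrand a C D w W w W x) :
    ∃ w W, H10Tuple Ω w W ∧ ∀ φ Φ, H10Tuple Ω φ Φ →
      ∫ x in Ω, weakIntegrand a C D (g + w) (Γ + W) φ Φ x = ∫ x in Ω, ∑ i, f x i * φ x i := by
  have hB : IsCoercive (hs.bilin hw hc hΛ) := by
    refine ⟨k, hk, fun v => ?_⟩
    rw [hs.bilin_apply, mul_assoc, ← pow_two, jetSpace_norm_sq v]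
    exact coer _ _ (jetSpace_h10 v)
  -- Lax–Milgram: the Riesz representative of the functional is pulled back by the isomorphism which
  -- the coercive form defines.
  set r := (InnerProductSpace.toDual ℝ (jetSpace Ω N)).symm (hs.rhs hw hc hΛ hb hg) with hr
  set v := hB.continuousLinearEquivOfBilin.symm r with hv
  refine ⟨(jetSpaceVal v), (jetSpaceGrad v), (jetSpace_h10 v), fun φ Φ hφ => ?_⟩
  obtain ⟨w, hw1, hw2⟩ := hφ.exists_jetSpace
  have key : hs.bilin hw hc hΛ v w = hs.rhs hw hc hΛ hb hg w := by
    rw [← hB.continuousLinearEquivOfBilin_apply, hv, ContinuousLinearEquiv.apply_symm_apply, hr,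
      InnerProductSpace.toDual_symm_apply]
  have e1 : ∫ x in Ω, ∑ i, f x i * φ x i = ∫ x in Ω, ∑ i, f x i * (jetSpaceVal w) x i := by
    refine integral_congr_ae ?_
    filter_upwards [hw1] with x hx
    rw [hx]
  rw [e1, ← integral_weakIntegrand_congr (ae_eq_refl _) (fun _ => ae_eq_refl _) hw1 hw2]
  simp_rw [weakIntegrand_add_left]
  rw [integral_add (hs.integrable_weakIntegrand hw hc hg (jetSpace_h10 w).h1)
    (hs.integrable_weakIntegrand hw hc (jetSpace_h10 v).h1 (jetSpace_h10 w).h1), ← hs.bilin_apply hw hc hΛ, key]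
  change _ + ((∫ x in Ω, ∑ i, f x i * (jetSpaceVal w) x i) - _) = _
  ring

/-- The energy estimate. -/
theorem SysBound.tupleSq_le (hs : SysBound Ω θ Λ a C D f) (hw : WeightedIneq Ω θ c)
    (hc : 0 ≤ c) (hΛ : 0 ≤ Λ) (hb : Bornology.IsBounded Ω) {g w : Eu m → Eu N}
    {Γ W : Fin N → Eu m → Eu m} (hg : H1Tuple Ω g Γ) {k : ℝ} (hk : 0 < k)
    (coer : k * tupleSq Ω w W ≤ ∫ x in Ω, weakIntegrand a C D w W w W x)
    (h : H10Tuple Ω w W)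
    (eq : ∫ x in Ω, weakIntegrand a C D (g + w) (Γ + W) w W x = ∫ x in Ω, ∑ i, f x i * w x i) :
    Real.sqrt (tupleSq Ω w W) ≤ (2 * (c * Λ) * Real.sqrt (volume Ω).toReal
      + 2 * (N * (Λ + 1) + c * Λ) * Real.sqrt (tupleSq Ω g Γ)) / k := by
  simp_rw [weakIntegrand_add_left] at eq
  rw [integral_add (hs.integrable_weakIntegrand hw hc hg h.h1)
    (hs.integrable_weakIntegrand hw hc h.h1 h.h1)] at eq
  have h1 := (le_abs_self _).trans (hs.abs_integral_sum_mul_le hw hc hΛ hb h.h1)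
  have h2 := neg_le_of_abs_le (hs.abs_integral_weakIntegrand_le hw hc hΛ hg h.h1)
  rw [Real.sqrt_mul ENNReal.toReal_nonneg] at h1
  rw [Real.sqrt_mul (tupleSq_nonneg _ _)] at h2
  set s := Real.sqrt (tupleSq Ω w W) with hs'
  have es : s * s = tupleSq Ω w W := Real.mul_self_sqrt (tupleSq_nonneg _ _)
  -- Testing with `w` itself gives k s² ≤ const · s. One factor s cancels unless s = 0.
  rcases (Real.sqrt_nonneg (tupleSq Ω w W)).eq_or_lt with h0 | h0
  · rw [hs', ← h0]
    positivity
  · rw [le_div_iff₀ hk]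
    refine le_of_mul_le_mul_right ?_ h0
    rw [← es] at coer
    linarith

/-- A tuple in `H¹₀` with vanishing weak form is zero. -/
theorem H10Tuple.ae_eq_zero {w : Eu m → Eu N} {W : Fin N → Eu m → Eu m} (h : H10Tuple Ω w W)
    {k : ℝ} (hk : 0 < k) (coer : k * tupleSq Ω w W ≤ ∫ x in Ω, weakIntegrand a C D w W w W x)
    (eq : ∫ x in Ω, weakIntegrand a C D w W w W x = 0) : w =ᵐ[volume.restrict Ω] 0 := by
  rw [eq] at coer
  have h0 : tupleSq Ω w W ≤ 0 := by
    by_contra hh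
    have := mul_pos hk (not_le.1 hh)
    linarith
  have h1 : ∫ x in Ω, ‖w x‖ ^ 2 = 0 := by
    refine le_antisymm (le_trans ?_ h0) (integral_nonneg fun x => by positivity)
    exact le_add_of_nonneg_right (Finset.sum_nonneg fun i _ => integral_nonneg fun x => by
      positivity)
  have h2 := (integral_eq_zero_iff_of_nonneg (fun x => by positivity)
    h.h1.memLp.integrable_normSq).1 h1
  filter_upwards [h2] with x hx
  simpa using hx

end Existence

/-! ### Weak solutions: existence, uniqueness, energy estimate. -/

section WeakSolution

variable {m N : ℕ} {Ω : Set (Eu m)} {a : Fin N → Fin N → Eu m → ℝ}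
  {C : Fin N → Fin N → Eu m → Eu m}
  {D : Fin N → Eu m → Eu N} {f g y z : Eu m → Eu N} {θ Λ c : ℝ}

theorem SysBound.integrable_leading (hs : SysBound Ω θ Λ a C D f) {G H : Eu m → Eu m}
    (hG : MemLp G 2 (volume.restrict Ω)) (hH : MemLp H 2 (volume.restrict Ω)) (i j : Fin N) :
    Integrable (fun x => a i j x * inner ℝ (G x) (H x)) (volume.restrict Ω) := by
  have h1 : Integrable (fun x => inner ℝ (G x) (H x)) (volume.restrict Ω) := by
    refine (hG.integrable_normSq.add hH.integrable_normSq).mono' (hG.1.inner hH.1)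
      (ae_of_all _ fun x => (abs_real_inner_le_norm _ _).trans ?_)
    simp only [Pi.add_apply]
    nlinarith [sq_nonneg (‖G x‖ - ‖H x‖), sq_nonneg ‖G x‖, sq_nonneg ‖H x‖]
  refine h1.bdd_mul (c := Λ) (hs.meas_a i j) ?_
  filter_upwards [hs.bound_a] with x hx using hx i j

/-- The weighted inequality makes the leading and the lower order parts separately integrable, so
the integrals in `IsWeakSolution` may be merged into one. -/
theorem SysBound.weak_form_eq (hs : SysBound Ω θ Λ a C D f) (hw : WeightedIneq Ω θ c)
    (hc : 0 ≤ c) {φ : Eu m → Eu N} {G Φ : Fin N → Eu m → Eu m} (hy : H1Tuple Ω y G)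
    (hφ : H1Tuple Ω φ Φ) :
    (∑ i, ∑ j, ∫ x in Ω, a i j x * inner ℝ (G j x) (Φ i x))
      + (∫ x in Ω, ∑ i, ((∑ j, inner ℝ (C i j x) (G j x) * φ x i)
          + inner ℝ (D i x) (y x) * φ x i))
      = ∫ x in Ω, weakIntegrand a C D y G φ Φ x := by
  have h1 : ∀ i j, Integrable (fun x => a i j x * inner ℝ (G j x) (Φ i x))
    (volume.restrict Ω) := fun i j => hs.integrable_leading (hy j).memLp_grad (hφ i).memLp_grad i j
  have h2 : Integrable (fun x => ∑ i, ∑ j, a i j x * inner ℝ (G j x) (Φ i x))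
    (volume.restrict Ω) := integrable_finsetSum _ fun i _ => integrable_finsetSum _ fun j _ => h1 i j
  have h3 : Integrable (fun x => ∑ i, ((∑ j, inner ℝ (C i j x) (G j x) * φ x i)
          + inner ℝ (D i x) (y x) * φ x i)) (volume.restrict Ω) := by
    refine ((hs.integrable_weakIntegrand hw hc hy hφ).sub h2).congr (ae_of_all _ fun x => ?_)
    simp [weakIntegrand]
  simp only [weakIntegrand]
  rw [integral_add h2 h3, integral_finsetSum _ fun i _ => integrable_finsetSum _ fun j _ => h1 i j]
  congr 1
  exact Finset.sum_congr rfl fun i _ => (integral_finsetSum _ fun j _ => h1 i j).symm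

theorem weakGrad_form_eq (hΩ : IsOpen Ω) {φ : Eu m → Eu N} {G Φ : Fin N → Eu m → Eu m}
    (hy : H1Tuple Ω y G) (hφ : H1Tuple Ω φ Φ) :
    (∑ i, ∑ j, ∫ x in Ω, a i j x *
        inner ℝ (weakGrad Ω (fun z => y z j) x) (weakGrad Ω (fun z => φ z i) x))
      + (∫ x in Ω, ∑ i, ((∑ j, inner ℝ (C i j x) (weakGrad Ω (fun z => y z j) x) * φ x i)
          + inner ℝ (D i x) (y x) * φ x i))
      = (∑ i, ∑ j, ∫ x in Ω, a i j x * inner ℝ (G j x) (Φ i x))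
      + (∫ x in Ω, ∑ i, ((∑ j, inner ℝ (C i j x) (G j x) * φ x i)
          + inner ℝ (D i x) (y x) * φ x i)) := by
  have h1 := fun j => (hy j).weakGrad_ae_eq hΩ
  have h2 := fun j => (hφ j).weakGrad_ae_eq hΩ
  congr 1
  · refine Finset.sum_congr rfl fun i _ => Finset.sum_congr rfl fun j _ => integral_congr_ae ?_
    filter_upwards [h1 j, h2 i] with x e1 e2
    rw [e1, e2]
  · refine integral_congr_ae ?_
    filter_upwards [ae_all_iff.2 h1] with x e1
    simp only [e1]

/-- `y` solves the system tested against `H¹₀`. -/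
def SolvesWeakly (Ω : Set (Eu m)) (a : Fin N → Fin N → Eu m → ℝ)
    (C : Fin N → Fin N → Eu m → Eu m) (D : Fin N → Eu m → Eu N) (f y : Eu m → Eu N)
    (G : Fin N → Eu m → Eu m) : Prop :=
  ∀ φ Φ, H10Tuple Ω φ Φ →
    ∫ x in Ω, weakIntegrand a C D y G φ Φ x = ∫ x in Ω, ∑ i, f x i * φ x i

theorem SysBound.isWeakSolution (hΩ : IsOpen Ω) (hs : SysBound Ω θ Λ a C D f)
    (hw : WeightedIneq Ω θ c) (hc : 0 ≤ c) {W G : Fin N → Eu m → Eu m} (hy : H1Tuple Ω y G)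
    (hyg : H10Tuple Ω (fun x => y x - g x) W) (h : SolvesWeakly Ω a C D f y G) :
    IsWeakSolution Ω a C D f g y := by
  refine ⟨fun i => (hy i).memH1 hΩ, fun i => (hyg i).memH10 hΩ, fun φ hφ => ?_⟩
  have h1 : H10Tuple Ω φ fun i => weakGrad Ω fun x => φ x i := fun i => (hφ i).hasH10Grad hΩ
  rw [weakGrad_form_eq hΩ hy h1.h1, hs.weak_form_eq hw hc hy h1.h1, h _ _ h1]

theorem SysBound.solvesWeakly (hΩ : IsOpen Ω) (hs : SysBound Ω θ Λ a C D f)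
    (hw : WeightedIneq Ω θ c) (hc : 0 ≤ c) (h : IsWeakSolution Ω a C D f g y)
    {G : Fin N → Eu m → Eu m} (hy : H1Tuple Ω y G) : SolvesWeakly Ω a C D f y G := by
  intro φ Φ hφ
  rw [← h.equation φ fun i => (hφ i).memH10 hΩ, weakGrad_form_eq hΩ hy hφ.h1,
    hs.weak_form_eq hw hc hy hφ.h1]

theorem IsWeakSolution.h1Tuple (h : IsWeakSolution Ω a C D f g y) :
    H1Tuple Ω y fun i => weakGrad Ω fun x => y x i := fun i => (h.memH1 i).hasH1Grad

theorem IsWeakSolution.h10Tuple (hΩ : IsOpen Ω) (h : IsWeakSolution Ω a C D f g y) :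
    H10Tuple Ω (y - g) fun i => weakGrad Ω fun x => y x i - g x i :=
  fun i => (h.boundary i).hasH10Grad hΩ

/-- The weak form is coercive on `H¹₀`. -/
def CoerciveForm (Ω : Set (Eu m)) (a : Fin N → Fin N → Eu m → ℝ)
    (C : Fin N → Fin N → Eu m → Eu m) (D : Fin N → Eu m → Eu N) (k : ℝ) : Prop :=
  ∀ w W, H10Tuple Ω w W → k * tupleSq Ω w W ≤ ∫ x in Ω, weakIntegrand a C D w W w W x

/-- Existence and uniqueness of weak solutions. -/
theorem SysBound.exists_unique_weakSolution (hΩ : IsOpen Ω) (hb : Bornology.IsBounded Ω)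
    (hs : SysBound Ω θ Λ a C D f) (hw : WeightedIneq Ω θ c) (hc : 0 ≤ c) (hΛ : 0 ≤ Λ)
    (hg : ∀ i, MemH1 Ω fun x => g x i) {k : ℝ} (hk : 0 < k) (coer : CoerciveForm Ω a C D k) :
    ∃ y, IsWeakSolution Ω a C D f g y ∧
      ∀ z, IsWeakSolution Ω a C D f g z → z =ᵐ[volume.restrict Ω] y := by
  have hg' : H1Tuple Ω g fun i => weakGrad Ω fun x => g x i := fun i => (hg i).hasH1Grad
  obtain ⟨w, W, h1, h2⟩ := hs.exists_solution hw hc hΛ hb hg' hk coer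
  have hy := hg'.add h1.h1
  have hyg : H10Tuple Ω (fun x => (g + w) x - g x) W := by
    simpa using h1
  refine ⟨g + w, hs.isWeakSolution hΩ hw hc hy hyg h2, fun z hz => ?_⟩
  have hz1 := hz.h1Tuple
  -- The difference is (z - g) - w, hence in `H¹₀`. Uniqueness of weak gradients rewrites its
  -- gradient as a difference of gradients, so that bilinearity applies.
  have hz2 : H10Tuple Ω (z - (g + w)) ((fun i => weakGrad Ω fun x => z x i)
      - ((fun i => weakGrad Ω fun x => g x i) + W)) := by
    intro i
    have e1 := ((hz.h10Tuple hΩ).sub h1) i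
    refine e1.congr (ae_of_all _ fun x => ?_) ?_
    · simp [sub_sub]
    · have e2 := (hz1.sub hy) i
      refine (e1.hasH1Grad.weakGrad_ae_eq hΩ).symm.trans ?_
      have e3 := e2.weakGrad_ae_eq hΩ
      refine EventuallyEq.trans (ae_of_all _ fun x => ?_) e3
      congr 2
      ext x
      simp [sub_sub]
  have hsol := hs.solvesWeakly hΩ hw hc hz hz1
  have h0 := hz2.ae_eq_zero hk (coer _ _ hz2) (by
    have e1 := hsol _ _ hz2
    have e2 := h2 _ _ hz2
    rw [← e2] at e1
    have e3 : ∀ x, weakIntegrand a C D z (fun i => weakGrad Ω fun x => z x i) (z - (g + w))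
        ((fun i => weakGrad Ω fun x => z x i) - ((fun i => weakGrad Ω fun x => g x i) + W)) x
        = weakIntegrand a C D (z - (g + w))
          ((fun i => weakGrad Ω fun x => z x i) - ((fun i => weakGrad Ω fun x => g x i) + W))
          (z - (g + w))
          ((fun i => weakGrad Ω fun x => z x i) - ((fun i => weakGrad Ω fun x => g x i) + W)) x
        + weakIntegrand a C D (g + w) ((fun i => weakGrad Ω fun x => g x i) + W) (z - (g + w))
        ((fun i => weakGrad Ω fun x => z x i) - ((fun i => weakGrad Ω fun x => g x i) + W)) x := by
      intro x
      rw [← weakIntegrand_add_left, sub_add_cancel, sub_add_cancel]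
    simp_rw [e3] at e1
    rw [integral_add (hs.integrable_weakIntegrand hw hc hz2.h1 hz2.h1)
      (hs.integrable_weakIntegrand hw hc hy hz2.h1)] at e1
    linarith)
  filter_upwards [h0] with x hx
  simpa [sub_eq_zero] using hx

theorem tupleSq_add_le {G H : Fin N → Eu m → Eu m} (hy : H1Tuple Ω y G) (hz : H1Tuple Ω z H) :
    tupleSq Ω (y + z) (G + H) ≤ 2 * tupleSq Ω y G + 2 * tupleSq Ω z H := by
  have base : ∀ {F : Type} [NormedAddCommGroup F] {u v : Eu m → F}, MemLp u 2 (volume.restrict Ω) →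
      MemLp v 2 (volume.restrict Ω) → ∫ x in Ω, ‖(u + v) x‖ ^ 2 ≤
        2 * (∫ x in Ω, ‖u x‖ ^ 2) + 2 * ∫ x in Ω, ‖v x‖ ^ 2 := by
    intro F _ u v hu hv
    rw [← integral_const_mul, ← integral_const_mul, ← integral_add (hu.integrable_normSq.const_mul _)
      (hv.integrable_normSq.const_mul _)]
    refine integral_mono (hu.add hv).integrable_normSq ((hu.integrable_normSq.const_mul _).add
      (hv.integrable_normSq.const_mul _)) fun x => ?_
    have := norm_add_le (u x) (v x)
    have h0 := norm_nonneg (u x + v x)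
    simp only [Pi.add_apply]
    nlinarith [sq_nonneg (‖u x‖ - ‖v x‖)]
  rw [tupleSq, tupleSq, tupleSq]
  have h1 := base hy.memLp hz.memLp
  have h2 := Finset.sum_le_sum fun i (_ : i ∈ Finset.univ) =>
    base (hy i).memLp_grad (hz i).memLp_grad
  rw [Finset.sum_add_distrib, ← Finset.mul_sum, ← Finset.mul_sum] at h2
  simp only [Pi.add_apply] at h1 h2 ⊢
  linarith

/-- The energy estimate for weak solutions. -/
theorem SysBound.energy (hΩ : IsOpen Ω) (hb : Bornology.IsBounded Ω)
    (hs : SysBound Ω θ Λ a C D f) (hw : WeightedIneq Ω θ c) (hc : 0 ≤ c) (hΛ : 0 ≤ Λ)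
    {Γ G : Fin N → Eu m → Eu m} (hg : H1Tuple Ω g Γ) {k : ℝ} (hk : 0 < k)
    (coer : CoerciveForm Ω a C D k) (hy : IsWeakSolution Ω a C D f g y) (hyG : H1Tuple Ω y G) :
    tupleSq Ω y G ≤ 2 * tupleSq Ω g Γ + 2 * ((2 * (c * Λ) * Real.sqrt (volume Ω).toReal
      + 2 * (N * (Λ + 1) + c * Λ) * Real.sqrt (tupleSq Ω g Γ)) / k) ^ 2 := by
  have hw1 : H10Tuple Ω (y - g) (G - Γ) := fun i =>
    ((hy.h10Tuple hΩ) i).congr (ae_eq_refl _)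
      (((hy.h10Tuple hΩ i).hasH1Grad.weakGrad_ae_eq hΩ).symm.trans
        (((hyG.sub hg) i).weakGrad_ae_eq hΩ))
  have h1 := hs.tupleSq_le hw hc hΛ hb hg hk (coer _ _ hw1) hw1 (by
    rw [add_sub_cancel, add_sub_cancel]
    exact hs.solvesWeakly hΩ hw hc hy hyG _ _ hw1)
  have h2 := tupleSq_add_le hg hw1.h1
  rw [add_sub_cancel, add_sub_cancel] at h2
  have h3 := Real.sqrt_le_iff.1 h1
  linarith [h3.2]

end WeakSolution

/-! ### Cutoffs in |y|² and the truncation t(|y|²) y. -/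

/-- `t` is a `C¹` transition from `0` on `(-∞, σ]` to `1` on `[τ, ∞)` with derivative `t'`. -/
structure IsCutoff (t t' : ℝ → ℝ) (σ τ κ : ℝ) : Prop where
  hasDerivAt : ∀ s, HasDerivAt t (t' s) s
  continuous_deriv : Continuous t'
  nonneg : ∀ s, 0 ≤ t s
  le_one : ∀ s, t s ≤ 1
  zero_of_le : ∀ s, s ≤ σ → t s = 0
  one_of_ge : ∀ s, τ ≤ s → t s = 1
  deriv_nonneg : ∀ s, 0 ≤ t' s
  mul_deriv_le : ∀ s, 0 ≤ s → s * t' s ≤ κ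

/-- The derivative is at most L/δ and vanishes beyond σ + δ ≤ 2, whence s t'(s) ≤ 2L/δ. This
product, not t' alone, bounds the derivative of z ↦ t(|z|²) z. -/
theorem exists_isCutoff : ∃ L : ℝ, 0 < L ∧ ∀ σ δ : ℝ, 0 ≤ σ → 0 < δ → σ + δ ≤ 2 →
    ∃ t t', IsCutoff t t' σ (σ + δ) (2 * L / δ) := by
  obtain ⟨L, hL0, hL⟩ := exists_deriv_smoothTransition_le
  refine ⟨L, hL0, fun σ δ hσ hδ hτ => ?_⟩
  have hd : ∀ s, HasDerivAt (fun s => Real.smoothTransition ((s - σ) / δ))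
      (deriv Real.smoothTransition ((s - σ) / δ) / δ) s := by
    intro s
    have h2 := ((Real.smoothTransition.contDiff (n := 1)).differentiable (by norm_num)
      ((s - σ) / δ)).hasDerivAt.comp s (((hasDerivAt_id s).sub_const σ).div_const δ)
    simpa [div_eq_mul_inv, Function.comp_def] using h2
  have nn : ∀ s, 0 ≤ deriv Real.smoothTransition s := fun s => Real.smoothTransition.monotone.deriv_nonneg
  refine ⟨_, _, hd, ?_, fun s => Real.smoothTransition.nonneg _,
    fun s => Real.smoothTransition.le_one _, fun s hs => ?_, fun s hs => ?_,
    fun s => div_nonneg (nn _) hδ.le, fun s hs => ?_⟩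
  · exact (((Real.smoothTransition.contDiff (n := 1)).continuous_deriv (by norm_num)).comp
      (by fun_prop)).div_const δ
  · exact Real.smoothTransition.zero_of_nonpos (div_nonpos_of_nonpos_of_nonneg (by linarith) hδ.le)
  · exact Real.smoothTransition.one_of_one_le ((one_le_div hδ).2 (by linarith))
  · rcases le_or_gt s (σ + δ) with h | h
    · have h1 := (le_abs_self _).trans (hL ((s - σ) / δ))
      rw [mul_div_assoc']
      gcongr
      · exact nn _
      · linarith
    · have : Real.smoothTransition =ᶠ[𝓝 ((s - σ) / δ)] fun _ => (1 : ℝ) := by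
        filter_upwards [lt_mem_nhds ((one_lt_div hδ).2 (by linarith : δ < s - σ))] with y hy
        exact Real.smoothTransition.one_of_one_le hy.le
      rw [this.deriv_eq, deriv_const, zero_div, mul_zero]
      positivity

section Truncation

variable {m N : ℕ} {Ω : Set (Eu m)}

/-- The truncation `t(|y|²) y`. -/
noncomputable def trunc (t : ℝ → ℝ) (y : Eu m → Eu N) (x : Eu m) : Eu N := t (‖y x‖ ^ 2) • y x

/-- The gradients of `t(|y|²) y`. -/
noncomputable def truncGrad (t t' : ℝ → ℝ) (y : Eu m → Eu N) (G : Fin N → Eu m → Eu m) (k : Fin N)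
    (x : Eu m) : Eu m :=
  t (‖y x‖ ^ 2) • G k x + (2 * t' (‖y x‖ ^ 2) * y x k) • ∑ i, y x i • G i x

variable {t t' : ℝ → ℝ} {σ τ κ : ℝ}

theorem IsCutoff.hasFDerivAt (ht : IsCutoff t t' σ τ κ) (k : Fin N) (z : Eu N) :
    HasFDerivAt (fun z : Eu N => t (‖z‖ ^ 2) * z k)
      (t (‖z‖ ^ 2) • (EuclideanSpace.proj k : Eu N →L[ℝ] ℝ)
        + z k • (t' (‖z‖ ^ 2) • (2 • innerSL ℝ z))) z := by
  have h1 : HasFDerivAt (fun z : Eu N => t (‖z‖ ^ 2)) (t' (‖z‖ ^ 2) • (2 • innerSL ℝ z)) z :=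
    (ht.hasDerivAt (‖z‖ ^ 2)).comp_hasFDerivAt z (hasStrictFDerivAt_norm_sq z).hasFDerivAt
  exact h1.mul (EuclideanSpace.proj k : Eu N →L[ℝ] ℝ).hasFDerivAt

theorem IsCutoff.contDiff (ht : IsCutoff t t' σ τ κ) (k : Fin N) :
    ContDiff ℝ 1 fun z : Eu N => t (‖z‖ ^ 2) * z k := by
  have h1 : ContDiff ℝ 1 t := by
    rw [contDiff_one_iff_deriv]
    refine ⟨fun s => (ht.hasDerivAt s).differentiableAt, ?_⟩
    rw [show deriv t = t' from funext fun s => (ht.hasDerivAt s).deriv]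
    exact ht.continuous_deriv
  exact (h1.comp (contDiff_norm_sq ℝ)).mul (EuclideanSpace.proj k : Eu N →L[ℝ] ℝ).contDiff

/-- The chain rule for z ↦ t(|z|²) z_k, whose derivative is at most t + 2|z|² t' ≤ 1 + 2κ. -/
theorem H1Tuple.truncate (hΩ : IsOpen Ω) (hb : Bornology.IsBounded Ω) {y : Eu m → Eu N}
    {G : Fin N → Eu m → Eu m} (h : H1Tuple Ω y G) (ht : IsCutoff t t' σ τ κ) :
    H1Tuple Ω (trunc t y) (truncGrad t t' y G) := by
  intro k
  have h1 := HasH1Grad.comp_contDiff hΩ hb h (ht.contDiff k) (L := 1 + 2 * κ) (fun z => by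
    rw [(ht.hasFDerivAt k z).fderiv]
    refine (norm_add_le _ _).trans (add_le_add ?_ ?_)
    · rw [norm_smul, Real.norm_eq_abs, abs_of_nonneg (ht.nonneg _)]
      have : ‖(EuclideanSpace.proj k : Eu N →L[ℝ] ℝ)‖ ≤ 1 :=
        ContinuousLinearMap.opNorm_le_bound _ zero_le_one fun v => by
          rw [one_mul]; exact PiLp.norm_apply_le v k
      exact mul_le_one₀ (ht.le_one _) (norm_nonneg _) this
    · rw [norm_smul, norm_smul, Real.norm_eq_abs (t' _), abs_of_nonneg (ht.deriv_nonneg _),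
        ← Nat.cast_smul_eq_nsmul ℝ, norm_smul, innerSL_apply_norm]
      have h1 : ‖z k‖ ≤ ‖z‖ := PiLp.norm_apply_le z k
      have h2 := ht.mul_deriv_le (‖z‖ ^ 2) (by positivity)
      have h3 := ht.deriv_nonneg (‖z‖ ^ 2)
      calc _ ≤ ‖z‖ * (t' (‖z‖ ^ 2) * (‖((2 : ℕ) : ℝ)‖ * ‖z‖)) := by gcongr
        _ = 2 * (‖z‖ ^ 2 * t' (‖z‖ ^ 2)) := by
          rw [Real.norm_natCast]; push_cast; ring
        _ ≤ _ := by gcongr)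
  refine h1.congr (ae_of_all _ fun x => ?_) (ae_of_all _ fun x => ?_)
  · simp [trunc]
  · simp only [(ht.hasFDerivAt k (y x)).fderiv, truncGrad]
    have e : ∀ i : Fin N, (t (‖y x‖ ^ 2) • (EuclideanSpace.proj k : Eu N →L[ℝ] ℝ)
        + y x k • (t' (‖y x‖ ^ 2) • (2 • innerSL ℝ (y x)))) (EuclideanSpace.single i 1) • G i x
        = (if i = k then t (‖y x‖ ^ 2) • G i x else 0)
          + (2 * t' (‖y x‖ ^ 2) * y x k) • (y x i • G i x) := by
      intro i
      have e1 : (t (‖y x‖ ^ 2) • (EuclideanSpace.proj k : Eu N →L[ℝ] ℝ)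
        + y x k • (t' (‖y x‖ ^ 2) • (2 • innerSL ℝ (y x)))) (EuclideanSpace.single i 1)
        = (if i = k then t (‖y x‖ ^ 2) else 0) + 2 * t' (‖y x‖ ^ 2) * y x k * y x i := by
        simp [EuclideanSpace.inner_single_right, eq_comm]
        ring
      rw [e1, add_smul, smul_smul]
      congr 1
      split_ifs <;> simp
    simp_rw [e, Finset.sum_add_distrib, ← Finset.smul_sum]
    simp

/-- Because the cutoff is radial, the terms with t' add up to the square of P = Σ_i y^i ∇y^i. Hence
the diagonalised leading part is nonnegative. -/
theorem IsCutoff.inner_truncGrad (y : Eu m → Eu N)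
    (G : Fin N → Eu m → Eu m) (x : Eu m) :
    ∑ k, inner ℝ (G k x) (truncGrad t t' y G k x)
      = t (‖y x‖ ^ 2) * (∑ k, ‖G k x‖ ^ 2) + 2 * t' (‖y x‖ ^ 2) * ‖∑ i, y x i • G i x‖ ^ 2 := by
  have e : 2 * t' (‖y x‖ ^ 2) * ‖∑ i, y x i • G i x‖ ^ 2
      = ∑ k, 2 * t' (‖y x‖ ^ 2) * y x k * inner ℝ (G k x) (∑ i, y x i • G i x) := by
    rw [← real_inner_self_eq_norm_sq (∑ i, y x i • G i x)]
    nth_rewrite 1 [sum_inner]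
    rw [Finset.mul_sum]
    refine Finset.sum_congr rfl fun k _ => ?_
    rw [real_inner_smul_left]
    ring
  rw [e, Finset.mul_sum, ← Finset.sum_add_distrib]
  refine Finset.sum_congr rfl fun k _ => ?_
  rw [truncGrad, inner_add_right, real_inner_smul_right, real_inner_smul_right,
    real_inner_self_eq_norm_sq]

theorem IsCutoff.le_inner_truncGrad (ht : IsCutoff t t' σ τ κ) (y : Eu m → Eu N)
    (G : Fin N → Eu m → Eu m) (x : Eu m) :
    t (‖y x‖ ^ 2) * (∑ k, ‖G k x‖ ^ 2) ≤ ∑ k, inner ℝ (G k x) (truncGrad t t' y G k x) := by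
  rw [IsCutoff.inner_truncGrad]
  have := ht.deriv_nonneg (‖y x‖ ^ 2)
  exact le_add_of_nonneg_right (by positivity)

/-- Both squares are compared with the two nonnegative terms of `IsCutoff.inner_truncGrad`: t² ≤ t
for the first, and |y|² t' ≤ κ for the surplus factor in the second. -/
theorem IsCutoff.norm_truncGrad_le (ht : IsCutoff t t' σ τ κ) (y : Eu m → Eu N)
    (G : Fin N → Eu m → Eu m) (x : Eu m) :
    ∑ k, ‖truncGrad t t' y G k x‖ ^ 2 ≤
      (2 + 4 * κ) * ∑ k, inner ℝ (G k x) (truncGrad t t' y G k x) := by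
  rw [IsCutoff.inner_truncGrad]
  set s := ‖y x‖ ^ 2 with hs
  set P := ∑ i, y x i • G i x with hP
  have h1 : ∀ k, ‖truncGrad t t' y G k x‖ ^ 2 ≤
      2 * t s ^ 2 * ‖G k x‖ ^ 2 + 2 * (2 * t' s) ^ 2 * ‖P‖ ^ 2 * y x k ^ 2 := by
    intro k
    rw [truncGrad]
    have h0 := norm_add_le (t s • G k x) ((2 * t' s * y x k) • P)
    have h2 : ‖t s • G k x‖ ^ 2 = t s ^ 2 * ‖G k x‖ ^ 2 := by
      rw [norm_smul, mul_pow, Real.norm_eq_abs, sq_abs]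
    have h3 : ‖(2 * t' s * y x k) • P‖ ^ 2 = (2 * t' s) ^ 2 * ‖P‖ ^ 2 * y x k ^ 2 := by
      rw [norm_smul, mul_pow, Real.norm_eq_abs, sq_abs]; ring
    have h4 := pow_le_pow_left₀ (norm_nonneg _) h0 2
    nlinarith [sq_nonneg (‖t s • G k x‖ - ‖(2 * t' s * y x k) • P‖)]
  have h2 : ∑ k, y x k ^ 2 = s := (sq_norm_eq_sum _).symm
  have k0 := ht.deriv_nonneg s
  have k1 := ht.mul_deriv_le s (by positivity)
  have k2 := ht.nonneg s
  have k3 := ht.le_one s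
  have k4 : 0 ≤ κ := le_trans (by positivity) k1
  have G0 : 0 ≤ ∑ k, ‖G k x‖ ^ 2 := Finset.sum_nonneg fun k _ => sq_nonneg _
  calc _ ≤ _ := Finset.sum_le_sum fun k _ => h1 k
    _ = 2 * t s ^ 2 * (∑ k, ‖G k x‖ ^ 2) + (4 * (s * t' s)) * (2 * t' s * ‖P‖ ^ 2) := by
      rw [Finset.sum_add_distrib, ← Finset.mul_sum, ← Finset.mul_sum, h2]; ring
    _ ≤ (2 + 4 * κ) * (t s * ∑ k, ‖G k x‖ ^ 2) + (2 + 4 * κ) * (2 * t' s * ‖P‖ ^ 2) := by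
      refine add_le_add ?_ ?_
      · rw [← mul_assoc]
        refine mul_le_mul_of_nonneg_right ?_ G0
        nlinarith [mul_nonneg k4 k2]
      · refine mul_le_mul_of_nonneg_right ?_ (by positivity)
        linarith
    _ = _ := by ring

/-- Where (|y| - l)₊ < 1 - l one has |y| < 1, so |y|² ≤ σ and the truncation vanishes;
`HasH1Grad.hasH10Grad_of_vanish` applies with δ = 1 - l. -/
theorem H1Tuple.truncate_h10 (hΩ : IsOpen Ω) (hb : Bornology.IsBounded Ω) {y : Eu m → Eu N}
    {G : Fin N → Eu m → Eu m} (h : H1Tuple Ω y G) (ht : IsCutoff t t' σ τ κ) (hσ : 1 ≤ σ)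
    {l : ℝ} (hl : l < 1) {U : Eu m → Eu m} (hu : HasH10Grad Ω (fun x => max (‖y x‖ - l) 0) U) :
    H10Tuple Ω (trunc t y) (truncGrad t t' y G) := by
  intro k
  refine (h.truncate hΩ hb ht k).hasH10Grad_of_vanish hΩ hb hu (sub_pos.2 hl)
    (ae_of_all _ fun x hx => ?_)
  have h1 : ‖y x‖ < 1 := by
    have := (le_max_left (‖y x‖ - l) 0).trans_lt hx
    linarith
  have h2 : ‖y x‖ ^ 2 ≤ σ := by nlinarith [norm_nonneg (y x)]
  simp [trunc, ht.zero_of_le _ h2]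

end Truncation

/-! ### Diagonalisation by cofactors and the pointwise tested inequality. -/

section Diagonal

variable {m N : ℕ} {Ω : Set (Eu m)}

/-- The matrix `A` of an elliptic system satisfies `det A / (adj A)₀₀ ≥ ρ`. -/
theorem le_det_div_adjugate {n : ℕ} {ρ : ℝ} (hρ : 0 < ρ) {A : Matrix (Fin (n + 1)) (Fin (n + 1)) ℝ}
    (h : ∀ v : Fin (n + 1) → ℝ, ρ * ∑ i, v i ^ 2 ≤ ∑ i, v i * A.mulVec v i) :
    A.adjugate 0 0 ≠ 0 ∧ ρ ≤ A.det / A.adjugate 0 0 := by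
  have inj : ∀ v : Fin (n + 1) → ℝ, A.mulVec v = 0 → v = 0 := by
    intro v hv
    have h1 := h v
    simp only [hv, Pi.zero_apply, mul_zero, Finset.sum_const_zero] at h1
    have h2 : ∑ i, v i ^ 2 = 0 := le_antisymm (by
      by_contra hh
      have := mul_pos hρ (not_le.1 hh)
      linarith) (Finset.sum_nonneg fun i _ => sq_nonneg _)
    rw [Finset.sum_eq_zero_iff_of_nonneg fun i _ => sq_nonneg _] at h2
    ext i
    simpa using h2 i (Finset.mem_univ i)
  have hdet : A.det ≠ 0 := fun h0 => by
    obtain ⟨v, hv, hv'⟩ := Matrix.exists_mulVec_eq_zero_iff.2 h0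
    exact hv (inj v hv')
  -- The first column of the adjugate satisfies A v = det A · e₀. Positivity at `v` therefore reads
  -- ρ |v|² ≤ v₀ det A, and v₀ = 0 would force v = 0 and then det A = 0.
  set v : Fin (n + 1) → ℝ := fun i => A.adjugate i 0 with hv
  have hAv : ∀ i, A.mulVec v i = if i = 0 then A.det else 0 := by
    intro i
    have := congrFun (congrFun A.mul_adjugate i) 0
    rw [Matrix.mul_apply] at this
    simpa [Matrix.mulVec, dotProduct, hv, Matrix.one_apply] using this
  have h1 := h v
  simp only [hAv, mul_ite, mul_zero, Finset.sum_ite_eq', Finset.mem_univ, if_true] at h1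
  have h2 : v 0 ^ 2 ≤ ∑ i, v i ^ 2 :=
    Finset.single_le_sum (f := fun i => v i ^ 2) (fun i _ => sq_nonneg _) (Finset.mem_univ 0)
  have h0 : v 0 ≠ 0 := by
    intro h0
    rw [h0, zero_mul] at h1
    have h3 : ∑ i, v i ^ 2 = 0 := le_antisymm (by
      by_contra hh
      have := mul_pos hρ (not_le.1 hh)
      linarith) (Finset.sum_nonneg fun i _ => sq_nonneg _)
    rw [Finset.sum_eq_zero_iff_of_nonneg fun i _ => sq_nonneg _] at h3
    have h4 : v = 0 := by
      ext i
      simpa using h3 i (Finset.mem_univ i)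
    have := hAv 0
    rw [h4, Matrix.mulVec_zero] at this
    exact hdet (by simpa using this.symm)
  refine ⟨h0, ?_⟩
  have h3 : 0 < v 0 ^ 2 := by positivity
  have h4 : A.det / v 0 = v 0 * A.det / v 0 ^ 2 := by field_simp
  change ρ ≤ A.det / v 0
  rw [h4, le_div_iff₀ h3]
  exact (mul_le_mul_of_nonneg_left h2 hρ.le).trans h1

/-- The coefficients are entries of the adjugate divided by its entry (0,0). Since entry (j,i) of
`A` is a^{ij}, the sum is an entry of A · adj A = det A · 1 over that number, and α = det A / det B.
Ellipticity of the matrix `A` comes from ξ concentrated in a single space direction, which exists as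
m ≥ 1. -/
theorem sum_mul_minorDet {n : ℕ} {a : Fin (n + 1) → Fin (n + 1) → Eu m → ℝ} {ρ : ℝ} (hm : 0 < m)
    (hρ : 0 < ρ) {x : Eu m}
    (h : ∀ ξ : Fin (n + 1) → Fin m → ℝ,
      ρ * ∑ i, ∑ p, ξ i p ^ 2 ≤ ∑ i, ∑ j, ∑ p, a i j x * ξ i p * ξ j p) :
    ∃ α, ρ ≤ α ∧ ∀ j k : Fin (n + 1), ∑ i, a i j x * ((-1) ^ (i + k : ℕ) * (minorDet a i k x / minorDet a 0 0 x))
      = if j = k then α else 0 := by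
  set A := coeffMatrix a x with hA
  have hadj : ∀ i k, A.adjugate i k = (-1) ^ (i + k : ℕ) * minorDet a i k x := by
    intro i k
    rw [Matrix.adjugate_fin_succ_eq_det_submatrix, add_comm]
    rfl
  have h00 : A.adjugate 0 0 = minorDet a 0 0 x := by rw [hadj]; simp
  obtain ⟨h1, h2⟩ := le_det_div_adjugate (A := A) hρ fun v => by
    have h1 := h fun i p => if p = ⟨0, hm⟩ then v i else 0
    simp only [ite_pow, ne_eq, OfNat.ofNat_ne_zero, not_false_eq_true, zero_pow, mul_ite, mul_zero,
      Finset.sum_ite_eq', Finset.mem_univ, if_true, ite_mul, zero_mul] at h1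
    refine h1.trans (le_of_eq ?_)
    rw [Finset.sum_comm]
    refine Finset.sum_congr rfl fun j _ => ?_
    rw [Matrix.mulVec, dotProduct, Finset.mul_sum]
    refine Finset.sum_congr rfl fun i _ => ?_
    simp [hA, coeffMatrix]
    ring
  refine ⟨A.det / A.adjugate 0 0, h2, fun j k => ?_⟩
  have h3 := congrFun (congrFun A.mul_adjugate j) k
  rw [Matrix.mul_apply] at h3
  have h4 : ∑ i, a i j x * ((-1) ^ (i + k : ℕ) * (minorDet a i k x / minorDet a 0 0 x))
      = (∑ i, A j i * A.adjugate i k) / A.adjugate 0 0 := by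
    rw [Finset.sum_div]
    refine Finset.sum_congr rfl fun i _ => ?_
    rw [hadj, h00]
    simp [hA, coeffMatrix]
    ring
  rw [h4, h3]
  simp [Matrix.one_apply]
  split_ifs <;> simp

/-- A bounded matrix `b` with bounded gradients which diagonalises the leading part. -/
structure DiagCoeff (Ω : Set (Eu m)) (ρ Λ : ℝ) (a b : Fin N → Fin N → Eu m → ℝ)
    (β : Fin N → Fin N → Eu m → Eu m) : Prop where
  h1 : ∀ i k, HasH1Grad Ω (b i k) (β i k)
  memLp : ∀ i k, MemLp (b i k) ∞ (volume.restrict Ω)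
  memLp_grad : ∀ i k, MemLp (β i k) ∞ (volume.restrict Ω)
  bound : ∀ᵐ x ∂(volume.restrict Ω), ∀ i k, |b i k x| ≤ Λ
  bound_grad : ∀ᵐ x ∂(volume.restrict Ω), ∀ i k, ‖β i k x‖ ≤ Λ
  diag : ∀ᵐ x ∂(volume.restrict Ω), ∃ α, ρ ≤ α ∧ ∀ j k, ∑ i, a i j x * b i k x
    = if j = k then α else 0

theorem mul_young {ε p q r s T : ℝ} (hε : 0 < ε) (hT : 0 ≤ T) (h : |p| ≤ T * q * r * s) :
    |p| ≤ T * (ε * q ^ 2 + 1 / (4 * ε) * (r * s) ^ 2) := by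
  refine h.trans ?_
  have : T * (ε * q ^ 2 + 1 / (4 * ε) * (r * s) ^ 2) - T * q * r * s
      = T * ((2 * ε * q - r * s) ^ 2 / (4 * ε)) := by field_simp; ring
  rw [← sub_nonneg, this]
  positivity

/-- The constant in the tested inequality. -/
noncomputable def testConst (N : ℕ) (ρ Λ : ℝ) : ℝ :=
  N ^ 3 * (1 / (4 * (ρ / (4 * (N ^ 2 + 1)))) * Λ ^ 4)
    + N * (1 / (4 * (ρ / (4 * (N ^ 2 + 1)))) * Λ ^ 2) + N * Λ + N ^ 2 * Λ

theorem testConst_nonneg {ρ Λ : ℝ} (hρ : 0 < ρ) (hΛ : 0 ≤ Λ) : 0 ≤ testConst N ρ Λ := by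
  rw [testConst]; positivity

theorem abs_sum₃_le {p q : Fin N → Fin N → Fin N → ℝ} (h : ∀ i j k, |p i j k| ≤ q i j k) :
    |∑ i, ∑ j, ∑ k, p i j k| ≤ ∑ i, ∑ j, ∑ k, q i j k :=
  (Finset.abs_sum_le_sum_abs _ _).trans <| Finset.sum_le_sum fun i _ =>
    (Finset.abs_sum_le_sum_abs _ _).trans <| Finset.sum_le_sum fun j _ =>
      (Finset.abs_sum_le_sum_abs _ _).trans <| Finset.sum_le_sum fun k _ => h i j k

theorem abs_leading_error_le {a : Fin N → Fin N → ℝ} {Λ ε T : ℝ} (hε : 0 < ε) (hT : 0 ≤ T)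
    (ha : ∀ i j, |a i j| ≤ Λ) {β : Fin N → Fin N → Eu m} (hβ : ∀ i k, ‖β i k‖ ≤ Λ)
    (G : Fin N → Eu m) (y : Eu N) :
    |∑ i, ∑ j, ∑ k, a i j * (T * y k) * inner ℝ (G j) (β i k)| ≤
      T * (N ^ 2 * ε * (∑ j, ‖G j‖ ^ 2) + N ^ 3 * (1 / (4 * ε) * Λ ^ 4) * ‖y‖ ^ 2) := by
  have h1 := abs_sum₃_le (p := fun i j k => a i j * (T * y k) * inner ℝ (G j) (β i k))
    (q := fun i j k => T * (ε * ‖G j‖ ^ 2 + 1 / (4 * ε) * (Λ ^ 2 * ‖y‖) ^ 2)) fun i j k => by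
      refine mul_young hε hT ?_
      have hL : 0 ≤ Λ := (abs_nonneg _).trans (ha i j)
      have hy : |y k| ≤ ‖y‖ := PiLp.norm_apply_le y k
      rw [abs_mul, abs_mul, abs_mul, abs_of_nonneg hT]
      calc _ ≤ Λ * (T * ‖y‖) * (‖G j‖ * Λ) := by
            gcongr
            · exact ha i j
            · exact (abs_real_inner_le_norm _ _).trans (by gcongr; exact hβ i k)
        _ = _ := by ring
  refine h1.trans (le_of_eq ?_)
  simp only [Finset.sum_add_distrib, ← Finset.mul_sum, Finset.sum_const, Finset.card_univ,
    Fintype.card_fin, nsmul_eq_mul]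
  ring

theorem abs_transport_error_le {b : Fin N → Fin N → ℝ} {Λ ε T : ℝ} (hε : 0 < ε) (hT : 0 ≤ T)
    (hb : ∀ i j, |b i j| ≤ Λ) (C : Fin N → Fin N → Eu m) (G : Fin N → Eu m) (y : Eu N) :
    |∑ i, ∑ j, ∑ k, inner ℝ (C i j) (G j) * (b i k * (T * y k))| ≤
      T * (N ^ 2 * ε * (∑ j, ‖G j‖ ^ 2)
        + N * (1 / (4 * ε) * Λ ^ 2) * (∑ i, ∑ j, ‖C i j‖ ^ 2) * ‖y‖ ^ 2) := by
  have h1 := abs_sum₃_le (p := fun i j k => inner ℝ (C i j) (G j) * (b i k * (T * y k)))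
    (q := fun i j k => T * (ε * ‖G j‖ ^ 2 + 1 / (4 * ε) * (Λ * (‖C i j‖ * ‖y‖)) ^ 2))
    fun i j k => by
      refine mul_young hε hT ?_
      have hL : 0 ≤ Λ := (abs_nonneg _).trans (hb i j)
      have hy : |y k| ≤ ‖y‖ := PiLp.norm_apply_le y k
      rw [abs_mul, abs_mul, abs_mul, abs_of_nonneg hT]
      calc _ ≤ (‖C i j‖ * ‖G j‖) * (Λ * (T * ‖y‖)) := by
            gcongr
            · exact abs_real_inner_le_norm _ _
            · exact hb i k
        _ = _ := by ring
  refine h1.trans (le_of_eq ?_)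
  simp only [Finset.sum_add_distrib, ← Finset.mul_sum, Finset.sum_const, Finset.card_univ,
    Fintype.card_fin, nsmul_eq_mul, mul_pow, ← Finset.sum_mul]
  ring

theorem abs_zero_order_error_le {b : Fin N → Fin N → ℝ} {Λ T : ℝ} (hT : 0 ≤ T)
    (hb : ∀ i j, |b i j| ≤ Λ) (D : Fin N → Eu N) (y : Eu N) :
    |∑ i, ∑ k, inner ℝ (D i) y * (b i k * (T * y k))| ≤
      T * (N * Λ * (∑ i, ‖D i‖) * ‖y‖ ^ 2) := by
  have h1 : |∑ i, ∑ k, inner ℝ (D i) y * (b i k * (T * y k))| ≤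
      ∑ i : Fin N, ∑ k : Fin N, T * Λ * ‖y‖ ^ 2 * ‖D i‖ := by
    refine (Finset.abs_sum_le_sum_abs _ _).trans (Finset.sum_le_sum fun i _ =>
      (Finset.abs_sum_le_sum_abs _ _).trans (Finset.sum_le_sum fun k _ => ?_))
    have hL : 0 ≤ Λ := (abs_nonneg _).trans (hb i k)
    have hy : |y k| ≤ ‖y‖ := PiLp.norm_apply_le y k
    rw [abs_mul, abs_mul, abs_mul, abs_of_nonneg hT]
    calc _ ≤ (‖D i‖ * ‖y‖) * (Λ * (T * ‖y‖)) := by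
          gcongr
          · exact abs_real_inner_le_norm _ _
          · exact hb i k
      _ = _ := by ring
  refine h1.trans (le_of_eq ?_)
  simp only [Finset.sum_const, Finset.card_univ, Fintype.card_fin, nsmul_eq_mul,
    ← Finset.mul_sum]
  ring

/-- The source enters linearly in `y`, but |y| ≥ 1 wherever the cutoff is nonzero, so |y| ≤ |y|² and
`f` may be treated as a zero order coefficient. -/
theorem abs_source_error_le {b : Fin N → Fin N → ℝ} {Λ T : ℝ} (hΛ : 0 ≤ Λ) (hT : 0 ≤ T)
    (hb : ∀ i j, |b i j| ≤ Λ) (f : Eu N) (y : Eu N) (hy1 : T ≠ 0 → 1 ≤ ‖y‖) :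
    |∑ i, ∑ k, f i * (b i k * (T * y k))| ≤ T * (N ^ 2 * Λ * ‖f‖ * ‖y‖ ^ 2) := by
  have h1 : |∑ i, ∑ k, f i * (b i k * (T * y k))| ≤
      ∑ i : Fin N, ∑ k : Fin N, ‖f‖ * (Λ * (T * ‖y‖)) := by
    refine (Finset.abs_sum_le_sum_abs _ _).trans (Finset.sum_le_sum fun i _ =>
      (Finset.abs_sum_le_sum_abs _ _).trans (Finset.sum_le_sum fun k _ => ?_))
    have hy : |y k| ≤ ‖y‖ := PiLp.norm_apply_le y k
    have hf : |f i| ≤ ‖f‖ := PiLp.norm_apply_le f i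
    rw [abs_mul, abs_mul, abs_mul, abs_of_nonneg hT]
    gcongr
    exact hb i k
  refine h1.trans ?_
  simp only [Finset.sum_const, Finset.card_univ, Fintype.card_fin, nsmul_eq_mul]
  rcases eq_or_ne T 0 with h0 | h0
  · simp [h0]
  · have h2 := hy1 h0
    have h3 : ‖y‖ ≤ ‖y‖ ^ 2 := by nlinarith
    calc _ = T * (N ^ 2 * Λ * ‖f‖ * ‖y‖) := by ring
      _ ≤ _ := by gcongr

theorem test_arith {α ρ E T g Y R1 R2 R3 R4 M k1 k2 k3 k4 c d f : ℝ}
    (hα : ρ ≤ α) (hE : T * g ≤ E) (hTg : 0 ≤ T * g) (hTY : 0 ≤ T * Y) (hM : 0 ≤ ρ / 2 - 2 * M)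
    (hc : 0 ≤ c) (hd : 0 ≤ d) (hf : 0 ≤ f) (h1 : 0 ≤ k1) (h2 : 0 ≤ k2) (h3 : 0 ≤ k3) (h4 : 0 ≤ k4)
    (hM0 : 0 ≤ M)
    (s1 : |R1| ≤ T * (M * g + k1 * Y)) (s2 : |R2| ≤ T * (M * g + k2 * c * Y))
    (s3 : |R3| ≤ T * (k3 * d * Y)) (s4 : |R4| ≤ T * (k4 * f * Y)) :
    ρ / 2 * E ≤ α * E + R1 + (R2 + R3) - R4 + (k1 + k2 + k3 + k4) * ((c + d + f + 1) * (T * Y)) := by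
  have s1 := neg_le_of_abs_le s1
  have s2 := neg_le_of_abs_le s2
  have s3 := neg_le_of_abs_le s3
  have s4 := le_of_abs_le s4
  have q1 : ρ * E ≤ α * E := mul_le_mul_of_nonneg_right hα (hTg.trans hE)
  have q2 : (ρ / 2 - 2 * M) * (T * g) ≤ (ρ / 2 - 2 * M) * E := mul_le_mul_of_nonneg_left hE hM
  have q3 : 2 * M * (T * g) ≤ 2 * M * E := mul_le_mul_of_nonneg_left hE (by positivity)
  have q4 : 0 ≤ (ρ / 2 - 2 * M) * (T * g) := mul_nonneg hM hTg
  have r : k1 + k2 * c + k3 * d + k4 * f ≤ (k1 + k2 + k3 + k4) * (c + d + f + 1) := by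
    have : 0 ≤ k1 * (c + d + f) + k2 * (d + f + 1) + k3 * (c + f + 1) + k4 * (c + d + 1) := by
      positivity
    linarith
  have r' := mul_le_mul_of_nonneg_right r hTY
  linarith

/-- The pointwise form of the tested equation. -/
theorem test_pointwise {a b : Fin N → Fin N → Eu m → ℝ} {C β : Fin N → Fin N → Eu m → Eu m}
    {D : Fin N → Eu m → Eu N} {f y : Eu m → Eu N} {G Ψ : Fin N → Eu m → Eu m} {ρ Λ T α : ℝ}
    {x : Eu m} (hρ : 0 < ρ) (hΛ : 0 ≤ Λ) (hT : 0 ≤ T)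
    (ha : ∀ i j, |a i j x| ≤ Λ) (hb : ∀ i j, |b i j x| ≤ Λ) (hβ : ∀ i k, ‖β i k x‖ ≤ Λ)
    (hα : ρ ≤ α) (hdiag : ∀ j k, ∑ i, a i j x * b i k x = if j = k then α else 0)
    (hy1 : T ≠ 0 → 1 ≤ ‖y x‖)
    (he : T * (∑ k, ‖G k x‖ ^ 2) ≤ ∑ k, inner ℝ (G k x) (Ψ k x)) :
    ρ / 2 * (∑ k, inner ℝ (G k x) (Ψ k x)) ≤
      weakIntegrand a C D y G (fun x => WithLp.toLp 2 fun i => ∑ k, b i k x * (T * y x k))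
        (fun i x => ∑ k, (b i k x • Ψ k x + (T * y x k) • β i k x)) x
      - (∑ i, f x i * ∑ k, b i k x * (T * y x k))
      + testConst N ρ Λ * (sysWeight C D f x * (T * ‖y x‖ ^ 2)) := by
  -- Two error terms contain the gradient and each costs N² ε ≤ ρ/4, so half of the ellipticity
  -- survives. This ε is built into `testConst`.
  set ε := ρ / (4 * ((N : ℝ) ^ 2 + 1)) with hε
  have ε0 : 0 < ε := by positivity
  -- Summing over `i` first, the diagonal identity collapses the part without derivatives of `b`;
  -- what remains carries `β`.
  have e1 : ∑ i, ∑ j, a i j x * inner ℝ (G j x)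
      (∑ k, (b i k x • Ψ k x + (T * y x k) • β i k x))
      = α * (∑ k, inner ℝ (G k x) (Ψ k x))
        + ∑ i, ∑ j, ∑ k, a i j x * (T * y x k) * inner ℝ (G j x) (β i k x) := by
    have : α * (∑ k, inner ℝ (G k x) (Ψ k x))
        = ∑ i, ∑ j, ∑ k, a i j x * b i k x * inner ℝ (G j x) (Ψ k x) := by
      rw [Finset.sum_comm, Finset.mul_sum]
      refine Finset.sum_congr rfl fun j _ => ?_
      rw [Finset.sum_comm]
      simp_rw [← Finset.sum_mul, hdiag]
      simp
    rw [this]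
    simp_rw [← Finset.sum_add_distrib, inner_sum, inner_add_right, real_inner_smul_right,
      Finset.mul_sum]
    refine Finset.sum_congr rfl fun i _ => Finset.sum_congr rfl fun j _ =>
      Finset.sum_congr rfl fun k _ => by ring
  have t1 := abs_leading_error_le ε0 hT ha hβ (fun j => G j x) (y x)
  have t2 := abs_transport_error_le ε0 hT hb (fun i j => C i j x) (fun j => G j x) (y x)
  have t3 := abs_zero_order_error_le hT hb (fun i => D i x) (y x)
  have t4 := abs_source_error_le hΛ hT hb (f x) (y x) hy1
  have N0 : (0 : ℝ) ≤ N := Nat.cast_nonneg N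
  have key := test_arith (ρ := ρ) hα he
    (mul_nonneg hT (Finset.sum_nonneg fun k _ => sq_nonneg _)) (mul_nonneg hT (sq_nonneg ‖y x‖))
    (M := N ^ 2 * ε) (by
      have : N ^ 2 * ε ≤ ρ / 4 := by
        rw [hε, mul_div_assoc', div_le_div_iff₀ (by positivity) (by norm_num)]
        nlinarith
      linarith)
    (Finset.sum_nonneg fun i _ => Finset.sum_nonneg fun j _ => sq_nonneg ‖C i j x‖)
    (Finset.sum_nonneg fun i _ => norm_nonneg (D i x)) (norm_nonneg (f x))
    (by positivity) (by positivity) (by positivity) (by positivity) (by positivity) t1 t2 t3 t4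
  have e2 : ∑ i, ∑ j, inner ℝ (C i j x) (G j x) * (∑ k, b i k x * (T * y x k))
      = ∑ i, ∑ j, ∑ k, inner ℝ (C i j x) (G j x) * (b i k x * (T * y x k)) := by
    simp_rw [Finset.mul_sum]
  have e3 : ∑ i, inner ℝ (D i x) (y x) * (∑ k, b i k x * (T * y x k))
      = ∑ i, ∑ k, inner ℝ (D i x) (y x) * (b i k x * (T * y x k)) := by
    simp_rw [Finset.mul_sum]
  have e4 : ∑ i, f x i * (∑ k, b i k x * (T * y x k))
      = ∑ i, ∑ k, f x i * (b i k x * (T * y x k)) := by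
    simp_rw [Finset.mul_sum]
  simp only [weakIntegrand]
  rw [Finset.sum_add_distrib, e1, e2, e3, e4, testConst, sysWeight]
  exact key

end Diagonal

/-! ### The Caccioppoli inequality and estimates on superlevel sets. -/

section Step

variable {m N : ℕ} {Ω : Set (Eu m)} {a b : Fin N → Fin N → Eu m → ℝ}
  {C β : Fin N → Fin N → Eu m → Eu m}
  {D : Fin N → Eu m → Eu N} {f y : Eu m → Eu N} {G : Fin N → Eu m → Eu m}
  {θ Λ ρ c₁ : ℝ} {t t' : ℝ → ℝ} {σ τ κ : ℝ}

/-- The test function for the diagonalised system is admissible. -/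
theorem DiagCoeff.h10Tuple (hΩ : IsOpen Ω) (hd : DiagCoeff Ω ρ Λ a b β) {ψ : Eu m → Eu N}
    {Ψ : Fin N → Eu m → Eu m} (hψ : H10Tuple Ω ψ Ψ) :
    H10Tuple Ω (fun x => WithLp.toLp 2 fun i => ∑ k, b i k x * ψ x k)
      (fun i x => ∑ k, (b i k x • Ψ k x + ψ x k • β i k x)) := by
  intro i
  have h := HasH10Grad.finset_sum Finset.univ
    (fun k _ => HasH10Grad.mul_linfty hΩ (hd.h1 i k) (hd.memLp i k) (hd.memLp_grad i k) (hψ k))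
  refine h.congr (ae_of_all _ fun x => ?_) (ae_of_all _ fun x => ?_)
  · simp
  · simp

theorem IsCutoff.continuous (ht : IsCutoff t t' σ τ κ) : Continuous t :=
  continuous_iff_continuousAt.2 fun s => (ht.hasDerivAt s).continuousAt

theorem SysBound.integrable_weight_cutoff (hs : SysBound Ω θ Λ a C D f)
    (hw : WeightedIneq Ω θ c₁) (hc : 0 ≤ c₁) (hy : H1Tuple Ω y G) (ht : IsCutoff t t' σ τ κ) :
    Integrable (fun x => sysWeight C D f x * (t (‖y x‖ ^ 2) * ‖y x‖ ^ 2))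
      (volume.restrict Ω) := by
  refine (hs.weighted hw hc hy).1.mono (hs.memLp_weight.1.mul
    ((ht.continuous.comp_aestronglyMeasurable (hy.memLp.1.norm.pow 2)).mul
      (hy.memLp.1.norm.pow 2))) (ae_of_all _ fun x => ?_)
  have h1 := ht.nonneg (‖y x‖ ^ 2)
  have h2 := ht.le_one (‖y x‖ ^ 2)
  have h3 := sysWeight_pos C D f x
  rw [Real.norm_eq_abs, Real.norm_eq_abs, abs_of_nonneg (by positivity),
    abs_of_nonneg (by positivity)]
  gcongr
  exact mul_le_of_le_one_left (by positivity) h2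

/-- The Caccioppoli inequality. -/
theorem SysBound.caccioppoli (hΩ : IsOpen Ω) (hb : Bornology.IsBounded Ω)
    (hs : SysBound Ω θ Λ a C D f) (hw : WeightedIneq Ω θ c₁) (hc : 0 ≤ c₁) (hρ : 0 < ρ)
    (hΛ : 0 ≤ Λ) (hd : DiagCoeff Ω ρ Λ a b β) (hy : H1Tuple Ω y G)
    (hsol : SolvesWeakly Ω a C D f y G)
    (ht : IsCutoff t t' σ τ κ) (hσ : 1 ≤ σ) (hκ : 0 ≤ κ)
    (hψ : H10Tuple Ω (trunc t y) (truncGrad t t' y G)) :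
    ∑ k, ∫ x in Ω, ‖truncGrad t t' y G k x‖ ^ 2 ≤ (2 + 4 * κ) * (2 * testConst N ρ Λ / ρ) *
      ∫ x in Ω, sysWeight C D f x * (t (‖y x‖ ^ 2) * ‖y x‖ ^ 2) := by
  have iW := hs.integrable_weight_cutoff hw hc hy ht
  have hφ := hd.h10Tuple hΩ hψ
  set φ : Eu m → Eu N := fun x => WithLp.toLp 2 fun i => ∑ k, b i k x * trunc t y x k with hφ'
  set Φ : Fin N → Eu m → Eu m := fun i x =>
    ∑ k, (b i k x • truncGrad t t' y G k x + trunc t y x k • β i k x) with hΦ'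
  have ie : Integrable (fun x => ∑ k, inner ℝ (G k x) (truncGrad t t' y G k x))
      (volume.restrict Ω) := by
    refine integrable_finsetSum _ fun k _ => ?_
    refine ((hy k).memLp_grad.integrable_normSq.add
      (hψ k).memLp_grad.integrable_normSq).mono' ((hy k).memLp_grad.1.inner (hψ k).memLp_grad.1)
      (ae_of_all _ fun x => (abs_real_inner_le_norm _ _).trans ?_)
    simp only [Pi.add_apply]
    nlinarith [sq_nonneg (‖G k x‖ - ‖truncGrad t t' y G k x‖), sq_nonneg ‖G k x‖,
      sq_nonneg ‖truncGrad t t' y G k x‖]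
  have i1 := hs.integrable_weakIntegrand hw hc hy hφ.h1
  have i2 := hs.integrable_sum_mul hw hc hb hφ.h1
  -- The pointwise inequality is integrated. The weak equation then cancels the form against the
  -- source and leaves only the weight term.
  have main : ∫ x in Ω, ρ / 2 * (∑ k, inner ℝ (G k x) (truncGrad t t' y G k x)) ≤
      ∫ x in Ω, ((weakIntegrand a C D y G φ Φ x - ∑ i, f x i * φ x i)
        + testConst N ρ Λ * (sysWeight C D f x * (t (‖y x‖ ^ 2) * ‖y x‖ ^ 2))) := by
    refine integral_mono_ae (ie.const_mul _) ((i1.sub i2).add (iW.const_mul _)) ?_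
    filter_upwards [hs.bound_a, hd.bound, hd.bound_grad, hd.diag] with x ha hb' hβ hα
    obtain ⟨α, hα1, hα2⟩ := hα
    refine test_pointwise hρ hΛ (ht.nonneg (‖y x‖ ^ 2)) ha hb' hβ hα1 hα2 (fun h0 => ?_)
      (ht.le_inner_truncGrad y G x)
    by_contra hh
    refine h0 (ht.zero_of_le _ ?_)
    nlinarith [norm_nonneg (y x), not_le.1 hh]
  have e1 : ∫ x in Ω, ((weakIntegrand a C D y G φ Φ x - ∑ i, f x i * φ x i)
        + testConst N ρ Λ * (sysWeight C D f x * (t (‖y x‖ ^ 2) * ‖y x‖ ^ 2)))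
      = testConst N ρ Λ * ∫ x in Ω, sysWeight C D f x * (t (‖y x‖ ^ 2) * ‖y x‖ ^ 2) := by
    have h1 := integral_add (i1.sub i2) (iW.const_mul (testConst N ρ Λ))
    rw [integral_sub' i1 i2, hsol φ Φ hφ, sub_self, zero_add, integral_const_mul] at h1
    exact h1
  rw [e1, integral_const_mul] at main
  have up : ∑ k, ∫ x in Ω, ‖truncGrad t t' y G k x‖ ^ 2 ≤
      (2 + 4 * κ) * ∫ x in Ω, ∑ k, inner ℝ (G k x) (truncGrad t t' y G k x) := by
    rw [← hψ.h1.integral_gradSq, ← integral_const_mul]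
    exact integral_mono hψ.h1.integrable_gradSq (ie.const_mul _) fun x =>
      ht.norm_truncGrad_le y G x
  refine up.trans ?_
  rw [mul_assoc]
  refine mul_le_mul_of_nonneg_left ?_ (by positivity)
  rw [div_mul_eq_mul_div, le_div_iff₀ hρ]
  linarith

theorem WeightedIneq0.tuple {θ c : ℝ} (hw : WeightedIneq0 Ω θ c) {V : Eu m → ℝ}
    (hV : MemLp V (ENNReal.ofReal (θ / 2)) (volume.restrict Ω)) (h : H10Tuple Ω y G) {r : ℝ}
    (hr : 0 < r) :
    Integrable (fun x => |V x| * ‖y x‖ ^ 2) (volume.restrict Ω) ∧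
      ∫ x in Ω, |V x| * ‖y x‖ ^ 2 ≤ c * r ^ (-(2 * m / θ)) *
          (eLpNorm V (ENNReal.ofReal (θ / 2)) (volume.restrict Ω)).toReal *
          ((∫ x in Ω, ‖y x‖ ^ 2) + r ^ 2 * ∑ i, ∫ x in Ω, ‖G i x‖ ^ 2) := by
  have h1 := fun i => hw _ _ (h i) V hV r hr
  simp_rw [h.h1.integral_normSq, sq_norm_eq_sum (y _), Finset.mul_sum]
  refine ⟨integrable_finsetSum _ fun i _ => (h1 i).1, ?_⟩
  rw [integral_finsetSum _ fun i _ => (h1 i).1, ← Finset.sum_add_distrib, Finset.mul_sum]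
  exact Finset.sum_le_sum fun i _ => (h1 i).2

theorem setIntegral_le_eLpNorm_mul {μ : Measure (Eu m)} [IsFiniteMeasure μ] {V : Eu m → ℝ}
    {q : ℝ} (hq : 1 ≤ q) (hV : MemLp V (ENNReal.ofReal q) μ) (h0 : ∀ x, 0 ≤ V x)
    (S : Set (Eu m)) :
    ∫ x in S, V x ∂μ ≤
      (eLpNorm V (ENNReal.ofReal q) μ).toReal * (μ S).toReal ^ (1 - 1 / q) := by
  have h1 := eLpNorm_le_eLpNorm_mul_rpow_measure_univ (μ := μ.restrict S) (p := 1)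
    (q := ENNReal.ofReal q) (f := V) (by simpa using hq) hV.1.restrict
  rw [Measure.restrict_apply_univ, ENNReal.toReal_one, ENNReal.toReal_ofReal (by linarith),
    div_one] at h1
  have h2 : eLpNorm V (ENNReal.ofReal q) (μ.restrict S) ≤ eLpNorm V (ENNReal.ofReal q) μ :=
    eLpNorm_mono_measure _ Measure.restrict_le_self
  have hpos : 0 ≤ 1 - 1 / q := by
    rw [sub_nonneg, div_le_one (by linarith)]; exact hq
  have h3 := h1.trans (mul_le_mul_left h2 _)
  have h4 : ∫ x in S, V x ∂μ = (eLpNorm V 1 (μ.restrict S)).toReal := by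
    rw [eLpNorm_one_eq_lintegral_enorm, ← integral_norm_eq_lintegral_enorm hV.1.restrict]
    simp_rw [Real.norm_of_nonneg (h0 _)]
  rw [h4]
  refine (ENNReal.toReal_mono (ENNReal.mul_ne_top hV.2.ne ?_) h3).trans (le_of_eq ?_)
  · exact ENNReal.rpow_ne_top_of_nonneg hpos (measure_ne_top _ _)
  · rw [ENNReal.toReal_mul, ENNReal.toReal_rpow]

/-- The energy of `y` over a superlevel set. -/
noncomputable def levelEnergy (Ω : Set (Eu m)) (y : Eu m → Eu N) (σ : ℝ) : ℝ :=
  ∫ x in {x | σ < ‖y x‖ ^ 2}, ‖y x‖ ^ 2 ∂(volume.restrict Ω)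

theorem levelEnergy_nonneg (y : Eu m → Eu N) (σ : ℝ) : 0 ≤ levelEnergy Ω y σ :=
  integral_nonneg fun x => by positivity

theorem measurableSet_level (hym : Measurable y) (σ : ℝ) : MeasurableSet {x | σ < ‖y x‖ ^ 2} :=
  measurableSet_lt measurable_const (hym.norm.pow_const 2)

/-- Chebyshev's inequality; σ ≥ 1 removes the factor 1/σ. -/
theorem measure_level_le (hym : Measurable y) (hy : MemLp y 2 (volume.restrict Ω)) (hσ : 1 ≤ σ)
    [IsFiniteMeasure (volume.restrict Ω)] :
    ((volume.restrict Ω) {x | σ < ‖y x‖ ^ 2}).toReal ≤ levelEnergy Ω y σ := by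
  have h : ∫ x in {x | σ < ‖y x‖ ^ 2}, (1 : ℝ) ∂(volume.restrict Ω) ≤ levelEnergy Ω y σ := by
    refine setIntegral_mono_on (integrable_const _) hy.integrable_normSq.integrableOn
      (measurableSet_level hym σ) fun x hx => ?_
    exact hσ.trans (le_of_lt hx)
  simpa [Measure.real] using h

theorem norm_trunc_sq (y : Eu m → Eu N) (x : Eu m) :
    ‖trunc t y x‖ ^ 2 = t (‖y x‖ ^ 2) ^ 2 * ‖y x‖ ^ 2 := by
  rw [trunc, norm_smul, mul_pow, Real.norm_eq_abs, sq_abs]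

theorem IsCutoff.integral_trunc_le (ht : IsCutoff t t' σ τ κ) (hym : Measurable y)
    (hy : H1Tuple Ω y G) (hψ : H10Tuple Ω (trunc t y) (truncGrad t t' y G)) :
    ∫ x in Ω, ‖trunc t y x‖ ^ 2 ≤ levelEnergy Ω y σ := by
  rw [levelEnergy, ← integral_indicator (measurableSet_level hym σ)]
  refine integral_mono hψ.h1.memLp.integrable_normSq
    (hy.memLp.integrable_normSq.indicator (measurableSet_level hym σ)) fun x => ?_
  simp only [norm_trunc_sq]
  by_cases hx : σ < ‖y x‖ ^ 2
  · rw [Set.indicator_of_mem (show x ∈ {x | σ < ‖y x‖ ^ 2} from hx)]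
    exact mul_le_of_le_one_left (by positivity)
      (pow_le_one₀ (ht.nonneg _) (ht.le_one _))
  · rw [Set.indicator_of_notMem (show x ∉ {x | σ < ‖y x‖ ^ 2} from hx),
      ht.zero_of_le _ (not_lt.1 hx)]
    simp

/-- Gain of integrability on superlevel sets. -/
theorem IsCutoff.levelEnergy_le [IsFiniteMeasure (volume.restrict Ω)] {θ' c' : ℝ} (hθ' : 2 ≤ θ')
    (hw' : WeightedIneq0 Ω θ' c') (hc' : 0 ≤ c') (ht : IsCutoff t t' σ τ κ) (hσ : 1 ≤ σ)
    (hστ : σ ≤ τ)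
    (hym : Measurable y) (hy : H1Tuple Ω y G)
    (hψ : H10Tuple Ω (trunc t y) (truncGrad t t' y G)) :
    levelEnergy Ω y τ ≤ c' * levelEnergy Ω y σ ^ (2 / θ') *
      (levelEnergy Ω y σ + ∑ k, ∫ x in Ω, ‖truncGrad t t' y G k x‖ ^ 2) := by
  have hS := measurableSet_level hym τ
  set S := {x | τ < ‖y x‖ ^ 2} with hSdef
  -- The weight is the indicator of the higher superlevel set, where t = 1. Its norm is the power
  -- 2/θ' of the measure of that set, which Chebyshev bounds by the energy on the lower set.
  have hV : MemLp (S.indicator fun _ => (1 : ℝ)) (ENNReal.ofReal (θ' / 2)) (volume.restrict Ω) :=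
    (memLp_const 1).indicator hS
  have h1 := (hw'.tuple hV hψ one_pos).2
  have e1 : levelEnergy Ω y τ
      ≤ ∫ x in Ω, |S.indicator (fun _ => (1 : ℝ)) x| * ‖trunc t y x‖ ^ 2 := by
    rw [levelEnergy, ← integral_indicator hS]
    refine le_of_eq (integral_congr_ae (ae_of_all _ fun x => ?_))
    simp only [norm_trunc_sq]
    by_cases hx : x ∈ S
    · rw [Set.indicator_of_mem hx, Set.indicator_of_mem hx, ht.one_of_ge _ (le_of_lt hx)]
      simp
    · rw [Set.indicator_of_notMem hx, Set.indicator_of_notMem hx]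
      simp
  have hp : ENNReal.ofReal (θ' / 2) ≠ 0 := by
    rw [ne_eq, ENNReal.ofReal_eq_zero]; linarith
  have e2 : (eLpNorm (S.indicator fun _ => (1 : ℝ)) (ENNReal.ofReal (θ' / 2))
      (volume.restrict Ω)).toReal ≤ levelEnergy Ω y σ ^ (2 / θ') := by
    rw [eLpNorm_indicator_const hS hp ENNReal.ofReal_ne_top, ENNReal.toReal_ofReal (by linarith),
      enorm_one, one_mul, one_div_div, ← ENNReal.toReal_rpow]
    refine Real.rpow_le_rpow ENNReal.toReal_nonneg ?_ (by positivity)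
    refine le_trans (ENNReal.toReal_mono (measure_ne_top _ _) (measure_mono fun x hx => ?_))
      (measure_level_le hym hy.memLp hσ)
    exact hστ.trans_lt hx
  refine e1.trans (h1.trans ?_)
  rw [Real.one_rpow, mul_one, one_pow, one_mul]
  have p1 : 0 ≤ ∑ k, ∫ x in Ω, ‖truncGrad t t' y G k x‖ ^ 2 :=
    Finset.sum_nonneg fun k _ => integral_nonneg fun x => by positivity
  have p2 : 0 ≤ ∫ x in Ω, ‖trunc t y x‖ ^ 2 := integral_nonneg fun x => by positivity
  have p3 := levelEnergy_nonneg (Ω := Ω) y σ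
  exact mul_le_mul (mul_le_mul_of_nonneg_left e2 hc')
    (add_le_add (ht.integral_trunc_le hym hy hψ) le_rfl) (add_nonneg p2 p1)
    (mul_nonneg hc' (Real.rpow_nonneg p3 _))

/-- With S = {|y|² > σ} one has t|y|² ≤ t²|y|² + 2·1_S: beyond τ because t = 1, in the transition
zone because |y|² ≤ τ ≤ 2. The first term is |ty|², to which the scaled weighted inequality applies;
the integral of the weight over `S` is estimated by Hölder and Chebyshev. -/
theorem SysBound.weight_cutoff_le [IsFiniteMeasure (volume.restrict Ω)] (hθ : 2 ≤ θ) (hΛ : 0 ≤ Λ)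
    {c : ℝ} (hw0 : WeightedIneq0 Ω θ c) (hc : 0 ≤ c)
    (hs : SysBound Ω θ Λ a C D f) (hw : WeightedIneq Ω θ c₁) (hc₁ : 0 ≤ c₁)
    (ht : IsCutoff t t' σ τ κ) (hσ : 1 ≤ σ) (hτ : τ ≤ 2)
    (hym : Measurable y) (hy : H1Tuple Ω y G)
    (hψ : H10Tuple Ω (trunc t y) (truncGrad t t' y G)) {r : ℝ} (hr : 0 < r) :
    ∫ x in Ω, sysWeight C D f x * (t (‖y x‖ ^ 2) * ‖y x‖ ^ 2) ≤
      c * r ^ (-(2 * m / θ)) * Λ * (levelEnergy Ω y σ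
        + r ^ 2 * ∑ k, ∫ x in Ω, ‖truncGrad t t' y G k x‖ ^ 2)
      + 2 * (Λ * levelEnergy Ω y σ ^ (1 - 2 / θ)) := by
  have hS := measurableSet_level hym σ
  set S := {x | σ < ‖y x‖ ^ 2} with hSdef
  set W := sysWeight C D f with hW
  have hWp : ∀ x, 0 < W x := fun x => sysWeight_pos C D f x
  obtain ⟨i1, h1⟩ := hw0.tuple hs.memLp_weight hψ hr
  simp_rw [← hW, abs_of_pos (hWp _)] at i1 h1
  have iW : Integrable W (volume.restrict Ω) := hs.memLp_weight.integrable (by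
    rw [ENNReal.one_le_ofReal]; linarith)
  have i2 := (iW.indicator hS).const_mul 2
  have split : ∫ x in Ω, W x * (t (‖y x‖ ^ 2) * ‖y x‖ ^ 2) ≤
      ∫ x in Ω, (W x * ‖trunc t y x‖ ^ 2 + 2 * S.indicator W x) := by
    refine integral_mono (hs.integrable_weight_cutoff hw hc₁ hy ht) (i1.add i2) fun x => ?_
    simp only [norm_trunc_sq]
    by_cases hx : x ∈ S
    · rw [Set.indicator_of_mem hx]
      have t0 := ht.nonneg (‖y x‖ ^ 2)
      have t1 := ht.le_one (‖y x‖ ^ 2)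
      have : t (‖y x‖ ^ 2) * ‖y x‖ ^ 2 ≤ t (‖y x‖ ^ 2) ^ 2 * ‖y x‖ ^ 2 + 2 := by
        rcases le_or_gt τ (‖y x‖ ^ 2) with h | h
        · rw [ht.one_of_ge _ h]; linarith
        · have : t (‖y x‖ ^ 2) * ‖y x‖ ^ 2 ≤ 1 * 2 := by
            gcongr
            linarith
          have : 0 ≤ t (‖y x‖ ^ 2) ^ 2 * ‖y x‖ ^ 2 := by positivity
          linarith
      have := mul_le_mul_of_nonneg_left this (hWp x).le
      linarith
    · rw [Set.indicator_of_notMem hx, ht.zero_of_le _ (not_lt.1 hx)]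
      simp
  rw [integral_add i1 i2, integral_const_mul, integral_indicator hS] at split
  have h2 := setIntegral_le_eLpNorm_mul (by linarith : (1 : ℝ) ≤ θ / 2) hs.memLp_weight
    (fun x => (hWp x).le) S
  rw [one_div_div] at h2
  have p1 : 0 ≤ ∑ k, ∫ x in Ω, ‖truncGrad t t' y G k x‖ ^ 2 :=
    Finset.sum_nonneg fun k _ => integral_nonneg fun x => by positivity
  have p2 : 0 ≤ ∫ x in Ω, ‖trunc t y x‖ ^ 2 := integral_nonneg fun x => by positivity
  have p4 : 0 ≤ 1 - 2 / θ := by rw [sub_nonneg, div_le_one (by linarith)]; exact hθ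
  refine split.trans (add_le_add ?_ (mul_le_mul_of_nonneg_left (h2.trans ?_) two_pos.le))
  · have p5 : 0 ≤ c * r ^ (-(2 * m / θ)) := by positivity
    exact h1.trans (mul_le_mul (mul_le_mul_of_nonneg_left hs.weight_le p5)
      (add_le_add (ht.integral_trunc_le hym hy hψ) le_rfl)
      (add_nonneg p2 (mul_nonneg (sq_nonneg r) p1)) (mul_nonneg p5 hΛ))
  · refine mul_le_mul hs.weight_le (Real.rpow_le_rpow ENNReal.toReal_nonneg
      (measure_level_le hym hy.memLp hσ) p4) (by positivity) hΛ

end Step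

/-! ### The De Giorgi iteration. -/

/-- Fast geometric convergence. -/
theorem exists_fast_convergence {L B δ : ℝ} (hL : 0 < L) (hB : 1 ≤ B) (hδ : 0 < δ) :
    ∃ ε : ℝ, 0 < ε ∧ ∀ Y : ℕ → ℝ, (∀ j, 0 ≤ Y j) →
      (∀ j, Y j ≤ 1 → Y (j + 1) ≤ L * B ^ j * Y j ^ (1 + δ)) → Y 0 ≤ ε →
      ∃ r : ℝ, 0 < r ∧ r < 1 ∧ ∀ j, Y j ≤ ε * r ^ j := by
  have hB2 : 0 < 2 * B := by linarith
  -- Then r^δ = 1/(2B) compensates the growth of B^j; the factor 2 makes r < 1 even for B = 1.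
  set r := (2 * B) ^ (-(1 / δ)) with hr
  have r0 : 0 < r := Real.rpow_pos_of_pos hB2 _
  have r1 : r < 1 := Real.rpow_lt_one_of_one_lt_of_neg (by linarith) (by
    have : 0 < 1 / δ := by positivity
    linarith)
  have rδ : r ^ δ = (2 * B)⁻¹ := by
    rw [hr, ← Real.rpow_mul hB2.le, neg_mul, one_div_mul_cancel hδ.ne', Real.rpow_neg_one]
  -- ε ≤ 1 preserves Y_j ≤ 1, under which alone the recursion is available, and L ε^δ ≤ r closes the
  -- induction.
  set ε := min 1 ((r / L) ^ (1 / δ)) with hε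
  have e0 : 0 < ε := lt_min one_pos (Real.rpow_pos_of_pos (by positivity) _)
  have eδ : L * ε ^ δ ≤ r := by
    have : ε ^ δ ≤ ((r / L) ^ (1 / δ)) ^ δ :=
      Real.rpow_le_rpow e0.le (min_le_right _ _) hδ.le
    rw [← Real.rpow_mul (by positivity), one_div_mul_cancel hδ.ne', Real.rpow_one,
      le_div_iff₀ hL] at this
    linarith
  refine ⟨ε, e0, fun Y hY0 hY h0 => ⟨r, r0, r1, fun j => ?_⟩⟩
  induction j with
  | zero => simpa using h0
  | succ j ih =>
    have rj : r ^ j ≤ 1 := pow_le_one₀ r0.le r1.le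
    have h1 : Y j ≤ 1 := ih.trans (mul_le_one₀ (min_le_left _ _) (by positivity) rj)
    have h2 : Y j ^ (1 + δ) ≤ (ε * r ^ j) ^ (1 + δ) := Real.rpow_le_rpow (hY0 j) ih (by linarith)
    have h3 : (ε * r ^ j) ^ (1 + δ) = ε * r ^ j * (ε ^ δ * ((2 * B)⁻¹) ^ j) := by
      rw [Real.rpow_add (by positivity), Real.rpow_one, Real.mul_rpow e0.le (by positivity),
        ← rδ, ← Real.rpow_natCast r j, ← Real.rpow_mul r0.le, mul_comm (j : ℝ) δ,
        Real.rpow_mul r0.le, Real.rpow_natCast, Real.rpow_natCast]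
    have h4 : B ^ j * ((2 * B)⁻¹) ^ j ≤ 1 := by
      rw [← mul_pow]
      refine pow_le_one₀ (by positivity) ?_
      rw [← div_eq_mul_inv, div_le_one hB2]
      linarith
    calc Y (j + 1) ≤ L * B ^ j * (ε * r ^ j * (ε ^ δ * ((2 * B)⁻¹) ^ j)) := by
          rw [← h3]
          exact (hY j h1).trans (mul_le_mul_of_nonneg_left h2 (by positivity))
      _ = (L * ε ^ δ) * (B ^ j * ((2 * B)⁻¹) ^ j) * (ε * r ^ j) := by ring
      _ ≤ r * 1 * (ε * r ^ j) := by gcongr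
      _ = ε * r ^ (j + 1) := by ring

/-- Absorption of the gradient term. -/
theorem absorb_gradient {c Λ Q μ θ A P Y : ℝ} (hc : 0 < c) (hΛ : 0 < Λ) (hQ : 0 < Q)
    (hμθ : μ < θ) (hθ : 2 ≤ θ) (hY : 0 ≤ Y) (hY1 : Y ≤ 1) (hP : P ≤ Q * A)
    (h : ∀ r : ℝ, 0 < r → A ≤ c * r ^ (-(2 * μ / θ)) * Λ * (Y + r ^ 2 * P)
      + 2 * (Λ * Y ^ (1 - 2 / θ))) :
    A ≤ (2 * c * Λ * (2 * c * Λ * Q) ^ (μ / (θ - μ)) + 4 * Λ) * Y ^ (1 - 2 / θ) := by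
  have θ0 : 0 < θ := by linarith
  have hd : 0 < θ - μ := by linarith
  set X := 2 * c * Λ * Q with hX
  have X0 : 0 < X := by positivity
  -- This r solves c Λ Q r^{2 - 2μ/θ} = 1/2, so the gradient term is at most A/2 and can be
  -- absorbed.
  set r := X ^ (-(θ / (2 * (θ - μ)))) with hr
  have r0 : 0 < r := Real.rpow_pos_of_pos X0 _
  have e1 : r ^ (-(2 * μ / θ)) = X ^ (μ / (θ - μ)) := by
    rw [hr, ← Real.rpow_mul X0.le]
    congr 1
    field_simp
  have e2 : r ^ (-(2 * μ / θ)) * r ^ 2 = X⁻¹ := by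
    rw [← Real.rpow_natCast r 2, ← Real.rpow_add r0, hr, ← Real.rpow_mul X0.le,
      ← Real.rpow_neg_one]
    congr 1
    push_cast
    field_simp
    ring
  have h1 := h r r0
  have h2 : c * r ^ (-(2 * μ / θ)) * Λ * (Y + r ^ 2 * P) ≤
      c * Λ * X ^ (μ / (θ - μ)) * Y + A / 2 := by
    have h3 : c * Λ * X⁻¹ * P ≤ c * Λ * X⁻¹ * (Q * A) := by gcongr
    have h4 : c * Λ * X⁻¹ * (Q * A) = A / 2 := by rw [hX]; field_simp
    calc _ = c * Λ * r ^ (-(2 * μ / θ)) * Y + c * Λ * (r ^ (-(2 * μ / θ)) * r ^ 2) * P := by ring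
      _ ≤ _ := by rw [e2, e1]; linarith
  have h5 : Y ≤ Y ^ (1 - 2 / θ) := by
    have h0 : 0 < 2 / θ := by positivity
    have h1' : 2 / θ ≤ 1 := (div_le_one θ0).2 hθ
    rcases hY.eq_or_lt with hz | hz
    · rw [← hz]; positivity
    · calc Y = Y ^ (1 : ℝ) := (Real.rpow_one Y).symm
        _ ≤ _ := Real.rpow_le_rpow_of_exponent_ge hz hY1 (by linarith)
  have h6 : c * Λ * X ^ (μ / (θ - μ)) * Y ≤ c * Λ * X ^ (μ / (θ - μ)) * Y ^ (1 - 2 / θ) := by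
    gcongr
  linarith

section DeGiorgi

variable {m N : ℕ} {Ω : Set (Eu m)}

/-- One step of the De Giorgi iteration. -/
theorem exists_level_step {θ θ' Λ ρ c c' c₁ : ℝ} (hΩ : IsOpen Ω) (hb : Bornology.IsBounded Ω)
    (hθ : 2 ≤ θ) (hmθ : (m : ℝ) < θ) (hθ' : 2 ≤ θ') (hc : 0 < c) (hc' : 0 < c') (hc₁ : 0 ≤ c₁)
    (hw : WeightedIneq0 Ω θ c) (hw' : WeightedIneq0 Ω θ' c') (hw₁ : WeightedIneq Ω θ c₁)
    (hΛ : 0 < Λ) (hρ : 0 < ρ) :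
    ∃ L B : ℝ, 0 < L ∧ 1 ≤ B ∧ ∀ (a b : Fin N → Fin N → Eu m → ℝ)
      (C β : Fin N → Fin N → Eu m → Eu m) (D : Fin N → Eu m → Eu N) (f y : Eu m → Eu N)
      (G : Fin N → Eu m → Eu m) (l : ℝ) (U : Eu m → Eu m),
      SysBound Ω θ Λ a C D f → DiagCoeff Ω ρ Λ a b β → Measurable y → H1Tuple Ω y G →
      SolvesWeakly Ω a C D f y G → l < 1 → HasH10Grad Ω (fun x => max (‖y x‖ - l) 0) U →
      ∀ j : ℕ, levelEnergy Ω y (2 - (1 / 2) ^ j) ≤ 1 →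
        levelEnergy Ω y (2 - (1 / 2) ^ (j + 1)) ≤
          L * B ^ j * levelEnergy Ω y (2 - (1 / 2) ^ j) ^ (1 + (2 / θ' - 2 / θ)) := by
  have : IsFiniteMeasure (volume.restrict Ω) := ⟨by
    rw [Measure.restrict_apply_univ]; exact hb.measure_lt_top⟩
  obtain ⟨L₀, hL₀, cut⟩ := exists_isCutoff
  have hK := testConst_nonneg (N := N) hρ hΛ.le
  set K := testConst N ρ Λ with hKdef
  -- `Q * 2 ^ j` bounds the Caccioppoli constant at step `j`, where κ = 4 L₀ 2^j. The summand 1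
  -- ensures Q > 0, as the absorption requires.
  set Q := (2 + 16 * L₀) * (2 * K / ρ) + 1 with hQ
  have Q0 : 0 < Q := by positivity
  set γ := (m : ℝ) / (θ - m) with hγ
  have hd : 0 < θ - m := by linarith
  have γ0 : 0 ≤ γ := by positivity
  set E := 2 * c * Λ * (2 * c * Λ * Q) ^ γ + 4 * Λ with hE
  have E0 : 0 < E := by positivity
  set B := 2 * (2 : ℝ) ^ γ with hB
  have g1 : 1 ≤ (2 : ℝ) ^ γ := Real.one_le_rpow (by norm_num) γ0
  have B1 : 1 ≤ B := by linarith
  refine ⟨c' * (1 + Q * E), B, by positivity, B1, ?_⟩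
  intro a b C β D f y G l U hs hdg hym hy hsol hl hU j hj
  set σ : ℝ := 2 - (1 / 2) ^ j with hσ
  set δ : ℝ := (1 / 2) ^ (j + 1) with hδ
  have δ0 : 0 < δ := by positivity
  have hτ : (2 : ℝ) - (1 / 2) ^ (j + 1) = σ + δ := by rw [hσ, hδ]; ring
  have hσ1 : 1 ≤ σ := by
    have : ((1 : ℝ) / 2) ^ j ≤ 1 := pow_le_one₀ (by norm_num) (by norm_num)
    linarith
  have hσδ : σ + δ ≤ 2 := by
    rw [← hτ]; linarith
  obtain ⟨t, t', ht⟩ := cut σ δ (by linarith) δ0 hσδ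
  have hψ := hy.truncate_h10 hΩ hb ht hσ1 hl hU
  have two_j : (1 : ℝ) ≤ 2 ^ j := one_le_pow₀ (by norm_num)
  have hκ : 2 * L₀ / δ = 4 * L₀ * 2 ^ j := by
    rw [hδ, div_pow, one_pow, div_div_eq_mul_div, div_one, pow_succ]; ring
  have cac := hs.caccioppoli hΩ hb hw₁ hc₁ hρ hΛ.le hdg hy hsol ht hσ1 (by positivity) hψ
  set A := ∫ x in Ω, sysWeight C D f x * (t (‖y x‖ ^ 2) * ‖y x‖ ^ 2) with hA
  set P := ∑ k, ∫ x in Ω, ‖truncGrad t t' y G k x‖ ^ 2 with hP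
  set Y := levelEnergy Ω y σ with hY
  have Y0 : 0 ≤ Y := levelEnergy_nonneg y σ
  have A0 : 0 ≤ A := integral_nonneg fun x =>
    mul_nonneg (sysWeight_pos C D f x).le (mul_nonneg (ht.nonneg _) (sq_nonneg _))
  have hPA : P ≤ Q * 2 ^ j * A := by
    refine cac.trans (mul_le_mul_of_nonneg_right ?_ A0)
    rw [hκ, hQ]
    have : (2 + 4 * (4 * L₀ * 2 ^ j)) ≤ (2 + 16 * L₀) * 2 ^ j := by linarith
    calc _ ≤ (2 + 16 * L₀) * 2 ^ j * (2 * K / ρ) := by gcongr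
      _ ≤ _ := by
        have : (0 : ℝ) < 2 ^ j := by positivity
        linarith
  have key := absorb_gradient hc hΛ (by positivity : 0 < Q * 2 ^ j) hmθ hθ Y0 hj
    hPA fun r hr => hs.weight_cutoff_le hθ hΛ.le hw hc.le hw₁ hc₁ ht hσ1 hσδ hym hy hψ hr
  have lev := ht.levelEnergy_le hθ' hw' hc'.le hσ1 (by linarith) hym hy hψ
  rw [hτ]
  refine lev.trans ?_
  set Z := Y ^ (1 - 2 / θ) with hZ
  have Z0 : 0 ≤ Z := Real.rpow_nonneg Y0 _
  have θ0 : 0 < θ := by linarith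
  have g2 : 1 ≤ ((2 : ℝ) ^ γ) ^ j := one_le_pow₀ g1
  have hAE : A ≤ E * ((2 : ℝ) ^ γ) ^ j * Z := by
    refine key.trans (mul_le_mul_of_nonneg_right ?_ Z0)
    have e : (2 * c * Λ * (Q * 2 ^ j)) ^ γ = (2 * c * Λ * Q) ^ γ * ((2 : ℝ) ^ γ) ^ j := by
      rw [← mul_assoc, Real.mul_rpow (by positivity) (by positivity), ← Real.rpow_natCast 2 j,
        ← Real.rpow_natCast (2 ^ γ) j, ← Real.rpow_mul two_pos.le, ← Real.rpow_mul two_pos.le,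
        mul_comm (j : ℝ) γ]
    rw [e, hE, add_mul]
    refine add_le_add (le_of_eq (by ring)) ?_
    exact le_mul_of_one_le_right (by positivity) g2
  have hYZ : Y ≤ Z := by
    have h1' : 2 / θ ≤ 1 := (div_le_one θ0).2 hθ
    have h0 : 0 < 2 / θ := by positivity
    rcases Y0.eq_or_lt with hz | hz
    · rw [← hz]; exact Z0
    · calc Y = Y ^ (1 : ℝ) := (Real.rpow_one Y).symm
        _ ≤ _ := Real.rpow_le_rpow_of_exponent_ge hz hj (by linarith)
  have hBj : B ^ j = 2 ^ j * ((2 : ℝ) ^ γ) ^ j := by rw [hB, mul_pow]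
  have Bj1 : 1 ≤ B ^ j := one_le_pow₀ B1
  have sum_le : Y + P ≤ (1 + Q * E) * B ^ j * Z := by
    have : P ≤ Q * E * B ^ j * Z := by
      calc P ≤ Q * 2 ^ j * A := hPA
        _ ≤ Q * 2 ^ j * (E * ((2 : ℝ) ^ γ) ^ j * Z) := by gcongr
        _ = _ := by rw [hBj]; ring
    have h2 : Z ≤ B ^ j * Z := le_mul_of_one_le_left Z0 Bj1
    calc Y + P ≤ B ^ j * Z + Q * E * B ^ j * Z := by linarith
      _ = _ := by ring
  -- The gain 2/θ' comes from the indicator weight, the loss 2/θ from the data weight, which lies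
  -- only in L^{θ/2}. The total exceeds 1 exactly when θ' < θ.
  have hθθ : Y ^ (2 / θ') * Z ≤ Y ^ (1 + (2 / θ' - 2 / θ)) := by
    rcases Y0.eq_or_lt with hz | hz
    · rw [← hz, Real.zero_rpow (by positivity), zero_mul]
      positivity
    · rw [hZ, ← Real.rpow_add hz]
      exact le_of_eq (by ring_nf)
  calc c' * Y ^ (2 / θ') * (Y + P) ≤ c' * Y ^ (2 / θ') * ((1 + Q * E) * B ^ j * Z) := by gcongr
    _ = c' * (1 + Q * E) * B ^ j * (Y ^ (2 / θ') * Z) := by ring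
    _ ≤ _ := by gcongr

/-- A solution with small energy is bounded. -/
theorem exists_small_energy_bound {θ θ' Λ ρ c c' c₁ : ℝ} (hΩ : IsOpen Ω)
    (hb : Bornology.IsBounded Ω)
    (hmθ : (m : ℝ) < θ) (hθ' : 2 ≤ θ') (hθθ : θ' < θ) (hc : 0 < c) (hc' : 0 < c')
    (hc₁ : 0 ≤ c₁)
    (hw : WeightedIneq0 Ω θ c) (hw' : WeightedIneq0 Ω θ' c') (hw₁ : WeightedIneq Ω θ c₁)
    (hΛ : 0 < Λ) (hρ : 0 < ρ) :
    ∃ ε : ℝ, 0 < ε ∧ ∀ (a b : Fin N → Fin N → Eu m → ℝ)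
      (C β : Fin N → Fin N → Eu m → Eu m) (D : Fin N → Eu m → Eu N) (f y : Eu m → Eu N)
      (G : Fin N → Eu m → Eu m) (l : ℝ) (U : Eu m → Eu m),
      SysBound Ω θ Λ a C D f → DiagCoeff Ω ρ Λ a b β → H1Tuple Ω y G →
      SolvesWeakly Ω a C D f y G → l < 1 → HasH10Grad Ω (fun x => max (‖y x‖ - l) 0) U →
      ∫ x in Ω, ‖y x‖ ^ 2 ≤ ε → ∀ᵐ x ∂(volume.restrict Ω), ‖y x‖ ^ 2 ≤ 2 := by
  obtain ⟨L, B, hL, hB, step⟩ := exists_level_step (N := N) hΩ hb (hθ'.trans hθθ.le) hmθ hθ' hc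
    hc' hc₁ hw hw' hw₁ hΛ hρ
  have hδ : 0 < 2 / θ' - 2 / θ := by
    rw [sub_pos]
    exact div_lt_div_of_pos_left two_pos (by linarith) hθθ
  obtain ⟨ε, hε, conv⟩ := exists_fast_convergence hL hB hδ
  refine ⟨ε, hε, fun a b C β D f y₀ G l U hs hdg hy₀ hsol₀ hl hU₀ he₀ => ?_⟩
  -- The iteration works with superlevel sets, which are measurable only for a measurable
  -- representative.
  obtain ⟨y, hym, hyy⟩ : ∃ y : Eu m → Eu N, Measurable y ∧ y₀ =ᵐ[volume.restrict Ω] y :=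
    ⟨_, hy₀.memLp.1.stronglyMeasurable_mk.measurable, hy₀.memLp.1.ae_eq_mk⟩
  have hy : H1Tuple Ω y G := fun i => (hy₀ i).congr (by
    filter_upwards [hyy] with x hx
    rw [hx]) (ae_eq_refl _)
  have hsol : SolvesWeakly Ω a C D f y G := fun φ Φ hφ => by
    rw [← hsol₀ φ Φ hφ]
    exact integral_weakIntegrand_congr hyy.symm (fun _ => ae_eq_refl _) (ae_eq_refl _)
      fun _ => ae_eq_refl _
  have hU : HasH10Grad Ω (fun x => max (‖y x‖ - l) 0) U := hU₀.congr (by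
    filter_upwards [hyy] with x hx
    rw [hx]) (ae_eq_refl _)
  have he : ∫ x in Ω, ‖y x‖ ^ 2 ≤ ε := by
    refine le_trans (le_of_eq (integral_congr_ae ?_)) he₀
    filter_upwards [hyy] with x hx
    rw [hx]
  have h0 : levelEnergy Ω y (2 - (1 / 2) ^ 0) ≤ ε :=
    (setIntegral_le_integral hy.memLp.integrable_normSq
      (ae_of_all _ fun x => by positivity)).trans he
  obtain ⟨r, r0, r1, hr⟩ := conv (fun j => levelEnergy Ω y (2 - (1 / 2) ^ j))
    (fun j => levelEnergy_nonneg y _)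
    (fun j hj => step a b C β D f y G l U hs hdg hym hy hsol hl hU j hj) h0
  have h2 : ∀ j : ℕ, levelEnergy Ω y 2 ≤ ε * r ^ j := fun j => by
    refine le_trans ?_ (hr j)
    refine setIntegral_mono_set hy.memLp.integrable_normSq.integrableOn
      (ae_of_all _ fun x => by positivity) (ae_of_all _ fun x (hx : 2 < ‖y x‖ ^ 2) => ?_)
    have : (0 : ℝ) ≤ (1 / 2) ^ j := by positivity
    exact lt_of_le_of_lt (sub_le_self 2 this) hx
  have h3 : levelEnergy Ω y 2 ≤ 0 := by
    have lim : Tendsto (fun j : ℕ => ε * r ^ j) atTop (𝓝 (ε * 0)) :=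
      (tendsto_pow_atTop_nhds_zero_of_lt_one r0.le r1).const_mul ε
    rw [mul_zero] at lim
    exact ge_of_tendsto' lim h2
  have h4 : ∫ x in {x | 2 < ‖y x‖ ^ 2}, ‖y x‖ ^ 2 ∂(volume.restrict Ω) = 0 :=
    le_antisymm h3 (levelEnergy_nonneg y 2)
  rw [setIntegral_eq_zero_iff_of_nonneg_ae (ae_of_all _ fun x => by positivity)
    hy.memLp.integrable_normSq.integrableOn] at h4
  have h5 := (ae_restrict_iff' (measurableSet_level hym 2)).1 h4
  filter_upwards [h5, hyy] with x hx hxy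
  rw [hxy]
  by_contra hh
  have h6 := hx (not_le.1 hh)
  simp only [Pi.zero_apply] at h6
  rw [h6] at hh
  norm_num at hh

end DeGiorgi

/-! ### The a priori bound for the essential supremum. -/

section SupBound

variable {m N : ℕ} {Ω : Set (Eu m)}

/-- The embedding of `H¹` into `L^∞` given by the weighted inequality for weights in `L¹`. -/
theorem WeightedIneq.sq_le {c : ℝ} (hb : Bornology.IsBounded Ω) (hw : WeightedIneq Ω 2 c)
    {u : Eu m → ℝ} {G : Eu m → Eu m} (hu : HasH1Grad Ω u G) :
    ∀ᵐ x ∂(volume.restrict Ω),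
      u x ^ 2 ≤ c * ((∫ x in Ω, u x ^ 2) + ∫ x in Ω, ‖G x‖ ^ 2) + 1 := by
  have : IsFiniteMeasure (volume.restrict Ω) := ⟨by
    rw [Measure.restrict_apply_univ]; exact hb.measure_lt_top⟩
  obtain ⟨v, hv, huv⟩ : ∃ v : Eu m → ℝ, Measurable v ∧ u =ᵐ[volume.restrict Ω] v :=
    ⟨_, hu.memLp.1.stronglyMeasurable_mk.measurable, hu.memLp.1.ae_eq_mk⟩
  have hvG := hu.congr huv (ae_eq_refl _)
  have e0 : ∫ x in Ω, u x ^ 2 = ∫ x in Ω, v x ^ 2 := integral_congr_ae (by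
    filter_upwards [huv] with x hx
    rw [hx])
  rw [e0]
  set E := (∫ x in Ω, v x ^ 2) + ∫ x in Ω, ‖G x‖ ^ 2 with hE
  -- The weight 1_S gives (cE + 1)|S| ≤ cE|S|, hence |S| = 0; the summand 1 makes the comparison
  -- strict.
  set S : Set (Eu m) := {x | c * E + 1 < v x ^ 2} with hS
  have hSm : MeasurableSet S := measurableSet_lt measurable_const (hv.pow_const 2)
  have hV : MemLp (S.indicator fun _ => (1 : ℝ)) (ENNReal.ofReal (2 / 2)) (volume.restrict Ω) :=
    (memLp_const 1).indicator hSm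
  obtain ⟨i1, h1⟩ := hw v G hvG _ hV
  have hp : ENNReal.ofReal (2 / 2) = 1 := by norm_num
  rw [hp, eLpNorm_indicator_const hSm one_ne_zero ENNReal.one_ne_top, enorm_one, one_mul,
    ENNReal.toReal_one, div_one, ENNReal.rpow_one] at h1
  set k := ((volume.restrict Ω) S).toReal with hk
  have low : (c * E + 1) * k ≤ ∫ x in Ω, |S.indicator (fun _ => (1 : ℝ)) x| * v x ^ 2 := by
    have e1 : (c * E + 1) * k = ∫ x in Ω, S.indicator (fun _ => c * E + 1) x := by
      rw [integral_indicator hSm, setIntegral_const, smul_eq_mul, mul_comm, Measure.real]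
    rw [e1]
    refine integral_mono ((integrable_const _).indicator hSm) i1 fun x => ?_
    by_cases hx : x ∈ S
    · simp only [Set.indicator_of_mem hx, abs_one, one_mul]
      exact le_of_lt hx
    · simp [Set.indicator_of_notMem hx]
  have k0 : k ≤ 0 := by
    have := low.trans h1
    linarith
  have hz : (volume.restrict Ω) S = 0 := by
    have : k = 0 := le_antisymm k0 ENNReal.toReal_nonneg
    exact (ENNReal.toReal_eq_zero_iff _).1 this |>.resolve_right (measure_ne_top _ _)
  have h2 : ∀ᵐ x ∂(volume.restrict Ω), x ∉ S := measure_eq_zero_iff_ae_notMem.1 hz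
  filter_upwards [h2, huv] with x hx hxx
  rw [hxx]
  exact not_lt.1 hx

variable {a b : Fin N → Fin N → Eu m → ℝ} {C β : Fin N → Fin N → Eu m → Eu m}
  {D : Fin N → Eu m → Eu N} {f g y : Eu m → Eu N} {G : Fin N → Eu m → Eu m} {θ Λ ρ c : ℝ}

/-- Dividing a solution by M ≥ 1 changes only the source, and makes it smaller, so the same Λ still
bounds the data. -/
theorem SysBound.smul_source (hs : SysBound Ω θ Λ a C D f) {s : ℝ} (h0 : 0 ≤ s) (h1 : s ≤ 1) :
    SysBound Ω θ Λ a C D (s • f) := by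
  have hle : ∀ x, ‖sysWeight C D (s • f) x‖ ≤ ‖sysWeight C D f x‖ := fun x => by
    rw [Real.norm_of_nonneg (sysWeight_pos _ _ _ _).le, Real.norm_of_nonneg
      (sysWeight_pos _ _ _ _).le, sysWeight, sysWeight, Pi.smul_apply, norm_smul,
      Real.norm_of_nonneg h0]
    have := mul_le_of_le_one_left (norm_nonneg (f x)) h1
    linarith
  have hm : AEStronglyMeasurable (sysWeight C D (s • f)) (volume.restrict Ω) := by
    refine AEStronglyMeasurable.add (AEStronglyMeasurable.add (AEStronglyMeasurable.add ?_ ?_) ?_)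
      aestronglyMeasurable_const
    · exact Finset.aestronglyMeasurable_fun_sum _ fun i _ =>
        Finset.aestronglyMeasurable_fun_sum _ fun j _ => (hs.meas_C i j).norm.pow 2
    · exact Finset.aestronglyMeasurable_fun_sum _ fun i _ => (hs.meas_D i).norm
    · exact (hs.meas_f.const_smul s).norm
  refine ⟨hs.meas_a, hs.bound_a, hs.meas_C, hs.meas_D, hs.meas_f.const_smul s,
    hs.memLp_weight.mono hm (ae_of_all _ hle), ?_⟩
  exact (ENNReal.toReal_mono hs.memLp_weight.2.ne (eLpNorm_mono hle)).trans hs.weight_le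

theorem SolvesWeakly.smul (h : SolvesWeakly Ω a C D f y G) (s : ℝ) :
    SolvesWeakly Ω a C D (s • f) (s • y) (s • G) := by
  intro φ Φ hφ
  simp_rw [weakIntegrand_smul_left]
  rw [integral_const_mul, h φ Φ hφ, ← integral_const_mul]
  congr 1
  ext x
  rw [Finset.mul_sum]
  exact Finset.sum_congr rfl fun i _ => by simp [mul_assoc]

/-- A priori bound for weak solutions in terms of the size of the data. -/
theorem exists_sup_bound {c₁ k : ℝ} (hm : 0 < m) (hmθ : (m : ℝ) < θ) (hθ : 2 ≤ θ) (hΩ : IsOpen Ω)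
    (hb : Bornology.IsBounded Ω) (hc₁ : 0 ≤ c₁) (hw₁ : WeightedIneq Ω θ c₁) (hk : 0 < k)
    (hρ : 0 < ρ) (hΛ : 0 < Λ) :
    ∃ M : ℝ, 0 ≤ M ∧ ∀ (a b : Fin N → Fin N → Eu m → ℝ)
      (C β : Fin N → Fin N → Eu m → Eu m) (D : Fin N → Eu m → Eu N) (f g y : Eu m → Eu N)
      (Γ G : Fin N → Eu m → Eu m) (l : ℝ) (U : Eu m → Eu m),
      SysBound Ω θ Λ a C D f → DiagCoeff Ω ρ Λ a b β → CoerciveForm Ω a C D k →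
      H1Tuple Ω g Γ → Real.sqrt (tupleSq Ω g Γ) ≤ Λ → H1Tuple Ω y G →
      IsWeakSolution Ω a C D f g y → l ≤ Λ →
      HasH10Grad Ω (fun x => max (‖y x‖ - l) 0) U →
      ∀ᵐ x ∂(volume.restrict Ω), ‖y x‖ ≤ M := by
  set E := 2 * Λ ^ 2 + 2 * ((2 * (c₁ * Λ) * Real.sqrt (volume Ω).toReal
      + 2 * (N * (Λ + 1) + c₁ * Λ) * Λ) / k) ^ 2 with hE
  have E0 : 0 ≤ E := by positivity
  have energy : ∀ (a b : Fin N → Fin N → Eu m → ℝ)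
      (C β : Fin N → Fin N → Eu m → Eu m) (D : Fin N → Eu m → Eu N) (f g y : Eu m → Eu N)
      (Γ G : Fin N → Eu m → Eu m), SysBound Ω θ Λ a C D f → CoerciveForm Ω a C D k →
      H1Tuple Ω g Γ → Real.sqrt (tupleSq Ω g Γ) ≤ Λ → H1Tuple Ω y G →
      IsWeakSolution Ω a C D f g y → tupleSq Ω y G ≤ E := by
    intro a b C β D f g y Γ G hs coer hg hgΛ hy hsol
    refine (hs.energy hΩ hb hw₁ hc₁ hΛ.le hg hk coer hsol hy).trans ?_
    have h1 := (Real.sqrt_le_iff.1 hgΛ).2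
    rw [hE]
    gcongr
  -- For θ = 2 there is no θ' in [2, θ), hence no De Giorgi gain. In that case the weights may be
  -- merely L¹ and the energy bound already controls the supremum.
  rcases hθ.eq_or_lt with h2 | h2
  · subst h2
    refine ⟨Real.sqrt (N * (c₁ * E + 1)), Real.sqrt_nonneg _, ?_⟩
    intro a b C β D f g y Γ G l U hs hd coer hg hgΛ hy hsol hl hU
    have hyE := energy a b C β D f g y Γ G hs coer hg hgΛ hy hsol
    have h3 := fun i => hw₁.sq_le hb (hy i)
    filter_upwards [ae_all_iff.2 h3] with x hx
    refine Real.le_sqrt_of_sq_le ?_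
    rw [sq_norm_eq_sum]
    calc ∑ i, y x i ^ 2 ≤ ∑ i : Fin N, (c₁ * E + 1) := by
          refine Finset.sum_le_sum fun i _ => (hx i).trans ?_
          rw [hy.tupleSq_eq] at hyE
          have h4 := (Finset.single_le_sum
            (f := fun i => (∫ x in Ω, y x i ^ 2) + ∫ x in Ω, ‖G i x‖ ^ 2)
            (fun i _ => add_nonneg (integral_nonneg fun x => sq_nonneg _)
              (integral_nonneg fun x => sq_nonneg _)) (Finset.mem_univ i)).trans hyE
          gcongr
      _ = _ := by simp [mul_add]
  · set θ' := (max (m : ℝ) 2 + θ) / 2 with hθ'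
    have hmax : max (m : ℝ) 2 < θ := max_lt hmθ h2
    have l1 := le_max_left (m : ℝ) 2
    have l2 := le_max_right (m : ℝ) 2
    have t1 : 2 ≤ θ' := by linarith
    have t2 : θ' < θ := by linarith
    have t3 : (m : ℝ) < θ' := by linarith
    obtain ⟨c, hc, hw⟩ := exists_weighted_H10 hm hmθ hθ
    obtain ⟨c', hc', hw'⟩ := exists_weighted_H10 hm t3 t1
    obtain ⟨ε, hε, small⟩ := exists_small_energy_bound (N := N) hΩ hb hmθ t1 t2 hc hc' hc₁
      (hw Ω hΩ) (hw' Ω hΩ) hw₁ hΛ hρ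
    -- After division by M the boundary level is at most Λ/M < 1 and the energy at most E/M² ≤ ε.
    -- The conclusion |y|² ≤ 2M² is rounded to |y| ≤ 2M.
    set M := Λ + 1 + Real.sqrt (E / ε) with hM
    have M1 : 1 ≤ M := by
      have := Real.sqrt_nonneg (E / ε)
      linarith
    have M0 : 0 < M := by linarith
    refine ⟨2 * M, by linarith, ?_⟩
    intro a b C β D f g y Γ G l U hs hd coer hg hgΛ hy hsol hl hU
    have hyE := energy a b C β D f g y Γ G hs coer hg hgΛ hy hsol
    have hsol' := (hs.solvesWeakly hΩ hw₁ hc₁ hsol hy).smul M⁻¹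
    have hs' := hs.smul_source (inv_nonneg.2 M0.le) (inv_le_one_of_one_le₀ M1)
    have hlM : l / M < 1 := by
      rw [div_lt_one M0]
      have := Real.sqrt_nonneg (E / ε)
      linarith
    have nrm : ∀ x, ‖(M⁻¹ • y) x‖ = ‖y x‖ / M := fun x => by
      rw [Pi.smul_apply, norm_smul, Real.norm_of_nonneg (inv_nonneg.2 M0.le), inv_mul_eq_div]
    have hU' : HasH10Grad Ω (fun x => max (‖(M⁻¹ • y) x‖ - l / M) 0) (M⁻¹ • U) := by
      refine (hU.const_smul M⁻¹).congr (ae_of_all _ fun x => ?_) (ae_eq_refl _)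
      change M⁻¹ * max (‖y x‖ - l) 0 = max (‖(M⁻¹ • y) x‖ - l / M) 0
      rw [nrm, mul_max_of_nonneg _ _ (inv_nonneg.2 M0.le), mul_zero, mul_sub, inv_mul_eq_div,
        inv_mul_eq_div]
    have en : ∫ x in Ω, ‖(M⁻¹ • y) x‖ ^ 2 ≤ ε := by
      simp_rw [nrm, div_pow]
      rw [integral_div, div_le_iff₀ (by positivity)]
      have h1 : ∫ x in Ω, ‖y x‖ ^ 2 ≤ E := le_trans (le_add_of_nonneg_right
        (Finset.sum_nonneg fun i _ => integral_nonneg fun x => sq_nonneg _)) hyE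
      have h2 : Real.sqrt (E / ε) ^ 2 ≤ M ^ 2 :=
        pow_le_pow_left₀ (Real.sqrt_nonneg _) (by linarith) 2
      rw [Real.sq_sqrt (by positivity), div_le_iff₀ hε] at h2
      linarith
    have fin := small a b C β D (M⁻¹ • f) (M⁻¹ • y) (M⁻¹ • G) (l / M) (M⁻¹ • U) hs' hd
      (hy.smul M⁻¹) hsol' hlM hU' en
    filter_upwards [fin] with x hx
    rw [nrm, div_pow, div_le_iff₀ (by positivity)] at hx
    nlinarith [norm_nonneg (y x)]

end SupBound

/-! ### From the norms in the statement to the working hypotheses. -/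

section Data

variable {m N : ℕ} {Ω : Set (Eu m)}

/-- Minkowski in L^{θ/2}, where θ/2 ≥ 1, and the fact that the L^{θ/2} norm of |C|² is the square of
the L^θ norm of `C`. -/
theorem eLpNorm_sysWeight_le {μ : Measure (Eu m)} {θ : ℝ} (hθ : 2 ≤ θ)
    {C : Fin N → Fin N → Eu m → Eu m} {D : Fin N → Eu m → Eu N} {f : Eu m → Eu N}
    (hC : ∀ i j, MemLp (C i j) (ENNReal.ofReal θ) μ)
    (hD : ∀ i, MemLp (D i) (ENNReal.ofReal (θ / 2)) μ)
    (hf : MemLp f (ENNReal.ofReal (θ / 2)) μ) [IsFiniteMeasure μ] :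
    MemLp (sysWeight C D f) (ENNReal.ofReal (θ / 2)) μ ∧
    (eLpNorm (sysWeight C D f) (ENNReal.ofReal (θ / 2)) μ).toReal ≤
      (∑ i, ∑ j, (eLpNorm (C i j) (ENNReal.ofReal θ) μ).toReal ^ 2)
        + (∑ i, (eLpNorm (D i) (ENNReal.ofReal (θ / 2)) μ).toReal)
        + (eLpNorm f (ENNReal.ofReal (θ / 2)) μ).toReal
        + (eLpNorm (fun _ : Eu m => (1 : ℝ)) (ENNReal.ofReal (θ / 2)) μ).toReal := by
  have θ0 : 0 < θ := by linarith
  set q := ENNReal.ofReal (θ / 2) with hq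
  have q1 : 1 ≤ q := by rw [hq, ENNReal.one_le_ofReal]; linarith
  have add_le : ∀ {u v : Eu m → ℝ}, MemLp u q μ → MemLp v q μ → MemLp (fun x => u x + v x) q μ ∧
      (eLpNorm (fun x => u x + v x) q μ).toReal ≤ (eLpNorm u q μ).toReal + (eLpNorm v q μ).toReal := by
    intro u v hu hv
    refine ⟨hu.add hv, ?_⟩
    rw [← ENNReal.toReal_add hu.2.ne hv.2.ne]
    exact ENNReal.toReal_mono (ENNReal.add_ne_top.2 ⟨hu.2.ne, hv.2.ne⟩)
      (eLpNorm_add_le hu.1 hv.1 q1)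
  have sum_le : ∀ {u : Fin N → Eu m → ℝ}, (∀ i, MemLp (u i) q μ) →
      MemLp (fun x => ∑ i, u i x) q μ ∧
      (eLpNorm (fun x => ∑ i, u i x) q μ).toReal ≤ ∑ i, (eLpNorm (u i) q μ).toReal := by
    intro u hu
    refine ⟨memLp_finsetSum _ fun i _ => hu i, ?_⟩
    rw [← ENNReal.toReal_sum fun i _ => (hu i).2.ne]
    refine ENNReal.toReal_mono (ENNReal.sum_ne_top.2 fun i _ => (hu i).2.ne) ?_
    have := eLpNorm_sum_le (s := Finset.univ) (fun i _ => (hu i).1) q1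
    refine le_trans (le_of_eq ?_) this
    congr 1
    ext x
    simp
  have hC2 := fun i j => (hC i j).norm_sq' θ0
  have h1 := fun i => sum_le (hC2 i)
  have h2 := sum_le fun i => (h1 i).1
  have h3 := sum_le fun i => (hD i).norm
  have h4 := add_le h2.1 h3.1
  have h5 := add_le h4.1 hf.norm
  have h6 := add_le h5.1 (memLp_const (1 : ℝ))
  refine ⟨h6.1, ?_⟩
  have e1 : ∀ i j, (eLpNorm (fun x => ‖C i j x‖ ^ 2) q μ).toReal
      = (eLpNorm (C i j) (ENNReal.ofReal θ) μ).toReal ^ 2 := fun i j => by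
    rw [hq, eLpNorm_norm_sq _ θ0, ENNReal.toReal_pow]
  simp only [eLpNorm_norm] at h3 h5
  have h7 := h2.2.trans (Finset.sum_le_sum fun i _ => (h1 i).2)
  simp only [e1] at h7
  refine h6.2.trans ?_
  linarith [h5.2, h4.2, h3.2]

theorem ae_norm_le_toReal {F : Type*} [NormedAddCommGroup F] {u : Eu m → F}
    {μ : Measure (Eu m)} (h : MemLp u ∞ μ) :
    ∀ᵐ x ∂μ, ‖u x‖ ≤ (eLpNorm u ∞ μ).toReal := by
  have h1 : eLpNormEssSup u μ ≠ ⊤ := by rw [← eLpNorm_exponent_top]; exact h.2.ne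
  filter_upwards [enorm_ae_le_eLpNormEssSup u μ] with x hx
  rw [eLpNorm_exponent_top, ← toReal_enorm]
  exact ENNReal.toReal_mono h1 hx

theorem MemW1inf.hasH1Grad (hb : Bornology.IsBounded Ω) {u : Eu m → ℝ} (h : MemW1inf Ω u) :
    HasH1Grad Ω u (weakGrad Ω u) := by
  have : IsFiniteMeasure (volume.restrict Ω) := ⟨by
    rw [Measure.restrict_apply_univ]; exact hb.measure_lt_top⟩
  refine ⟨h.memLp.mono_exponent le_top, h.memLp_grad.mono_exponent le_top, ?_⟩
  rw [weakGrad, dif_pos h.weakDiff]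
  exact h.weakDiff.choose_spec

/-- A level within 1 of the infimum is enough, so whether the infimum is attained plays no role.
This accounts for `s.toReal + 1` in `dataSize`. -/
theorem exists_of_boundarySup_ne_top {y : Eu m → Eu N} (h : boundarySup Ω y ≠ ⊤) :
    ∃ K : ℝ≥0, (K : ℝ) ≤ (boundarySup Ω y).toReal + 1 ∧
      MemH10 Ω (fun x => max (‖y x‖ - K) 0) := by
  have h1 : boundarySup Ω y < boundarySup Ω y + 1 :=
    ENNReal.lt_add_right h one_ne_zero
  conv_lhs at h1 => rw [boundarySup]
  simp only [iInf_lt_iff] at h1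
  obtain ⟨K, hK, hlt⟩ := h1
  refine ⟨K, ?_, hK⟩
  have := ENNReal.toReal_mono (ENNReal.add_ne_top.2 ⟨h, ENNReal.one_ne_top⟩) hlt.le
  rwa [ENNReal.toReal_add h ENNReal.one_ne_top, ENNReal.toReal_one, ENNReal.coe_toReal] at this

theorem H1Tuple.sqrt_tupleSq_eq {g : Eu m → Eu N} (hg : ∀ i, MemH1 Ω fun x => g x i) :
    Real.sqrt (tupleSq Ω g fun i => weakGrad Ω fun x => g x i) = (h1NormVec Ω g).toReal := by
  have h : H1Tuple Ω g fun i => weakGrad Ω fun x => g x i := fun i => (hg i).hasH1Grad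
  have e : ∀ i, h1Norm Ω (fun x => g x i) ^ 2 = ENNReal.ofReal ((∫ x in Ω, g x i ^ 2)
      + ∫ x in Ω, ‖weakGrad Ω (fun x => g x i) x‖ ^ 2) := by
    intro i
    rw [h1Norm, ← ENNReal.rpow_natCast, ← ENNReal.rpow_mul]
    norm_num
    rw [(hg i).memLp.eLpNorm_two_sq_eq, (hg i).memLp_grad.eLpNorm_two_sq_eq,
      ← ENNReal.ofReal_add (integral_nonneg fun x => by positivity)
        (integral_nonneg fun x => by positivity)]
    simp
  rw [h1NormVec, ← ENNReal.toReal_rpow, Real.sqrt_eq_rpow, h.tupleSq_eq]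
  simp_rw [e]
  rw [ENNReal.toReal_sum fun i _ => ENNReal.ofReal_ne_top]
  congr 1
  refine Finset.sum_congr rfl fun i _ => (ENNReal.toReal_ofReal ?_).symm
  exact add_nonneg (integral_nonneg fun x => by positivity)
    (integral_nonneg fun x => by positivity)

/-- The diagonalising coefficients of an elliptic system. -/
theorem diagCoeff_minorDet {n : ℕ} {ρ Λ : ℝ} (hm : 0 < m) (hb : Bornology.IsBounded Ω)
    (hρ : 0 < ρ) {a : Fin (n + 1) → Fin (n + 1) → Eu m → ℝ} (hell : EllipticCoeff Ω ρ a)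
    (h : ∀ i j, MemW1inf Ω (fun x => minorDet a i j x / minorDet a 0 0 x))
    (hΛ : ∀ i j, (w1infNorm Ω (fun x => minorDet a i j x / minorDet a 0 0 x)).toReal ≤ Λ) :
    DiagCoeff Ω ρ Λ a
      (fun i k x => (-1) ^ (i + k : ℕ) * (minorDet a i k x / minorDet a 0 0 x))
      (fun i k => ((-1 : ℝ) ^ (i + k : ℕ)) •
        weakGrad Ω fun x => minorDet a i k x / minorDet a 0 0 x) := by
  have le1 : ∀ i j, (eLpNorm (fun x => minorDet a i j x / minorDet a 0 0 x) ∞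
      (volume.restrict Ω)).toReal ≤ Λ := fun i j =>
    (ENNReal.toReal_mono (ENNReal.add_ne_top.2 ⟨(h i j).memLp.2.ne, (h i j).memLp_grad.2.ne⟩)
      le_self_add).trans (hΛ i j)
  have le2 : ∀ i j, (eLpNorm (weakGrad Ω fun x => minorDet a i j x / minorDet a 0 0 x) ∞
      (volume.restrict Ω)).toReal ≤ Λ := fun i j =>
    (ENNReal.toReal_mono (ENNReal.add_ne_top.2 ⟨(h i j).memLp.2.ne, (h i j).memLp_grad.2.ne⟩)
      le_add_self).trans (hΛ i j)
  refine ⟨fun i k => ((h i k).hasH1Grad hb).const_smul _, fun i k => (h i k).memLp.const_mul _,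
    fun i k => (h i k).memLp_grad.const_smul _, ?_, ?_, ?_⟩
  · filter_upwards [ae_all_iff.2 fun i => ae_all_iff.2 fun k =>
      ae_norm_le_toReal (h i k).memLp] with x hx i k
    rw [abs_mul, abs_pow, abs_neg, abs_one, one_pow, one_mul]
    exact (hx i k).trans (le1 i k)
  · filter_upwards [ae_all_iff.2 fun i => ae_all_iff.2 fun k =>
      ae_norm_le_toReal (h i k).memLp_grad] with x hx i k
    rw [Pi.smul_apply, norm_smul, norm_pow, norm_neg, norm_one, one_pow, one_mul]
    exact (hx i k).trans (le2 i k)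
  · filter_upwards [hell] with x hx
    exact sum_mul_minorDet hm hρ hx

end Data

/-! ### The main theorem. -/

/-- The total size of the data. -/
noncomputable def dataSize {m N : ℕ} (Ω : Set (Eu m)) (θ : ℝ) (a C : Fin N → Fin N → ℝ≥0∞)
    (D : Fin N → ℝ≥0∞) (b : Fin N → Fin N → ℝ≥0∞) (g f s : ℝ≥0∞) : ℝ :=
  (∑ i, ∑ j, (a i j).toReal)
    + ((∑ i, ∑ j, (C i j).toReal ^ 2) + (∑ i, (D i).toReal) + f.toReal
      + (eLpNorm (fun _ : Eu m => (1 : ℝ)) (ENNReal.ofReal (θ / 2)) (volume.restrict Ω)).toReal)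
    + (∑ i, ∑ j, (b i j).toReal) + g.toReal + (s.toReal + 1)

theorem le_sum_sum_toReal {N : ℕ} (a : Fin N → Fin N → ℝ≥0∞) (i j : Fin N) :
    (a i j).toReal ≤ ∑ i, ∑ j, (a i j).toReal :=
  (Finset.single_le_sum (f := fun j => (a i j).toReal) (fun _ _ => ENNReal.toReal_nonneg)
    (Finset.mem_univ j)).trans
    (Finset.single_le_sum (f := fun i => ∑ j, (a i j).toReal)
      (fun _ _ => Finset.sum_nonneg fun _ _ => ENNReal.toReal_nonneg) (Finset.mem_univ i))

theorem sysBound_of_memLp {m N : ℕ} {Ω : Set (Eu m)} {θ Λ : ℝ} (hθ : 2 ≤ θ)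
    [IsFiniteMeasure (volume.restrict Ω)]
    {a : Fin N → Fin N → Eu m → ℝ} {C : Fin N → Fin N → Eu m → Eu m} {D : Fin N → Eu m → Eu N}
    {f : Eu m → Eu N} (ha : ∀ i j, MemLp (a i j) ∞ (volume.restrict Ω))
    (hC : ∀ i j, MemLp (C i j) (ENNReal.ofReal θ) (volume.restrict Ω))
    (hD : ∀ i, MemLp (D i) (ENNReal.ofReal (θ / 2)) (volume.restrict Ω))
    (hf : MemLp f (ENNReal.ofReal (θ / 2)) (volume.restrict Ω))
    (h1 : ∀ i j, (eLpNorm (a i j) ∞ (volume.restrict Ω)).toReal ≤ Λ)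
    (h2 : (∑ i, ∑ j, (eLpNorm (C i j) (ENNReal.ofReal θ) (volume.restrict Ω)).toReal ^ 2)
        + (∑ i, (eLpNorm (D i) (ENNReal.ofReal (θ / 2)) (volume.restrict Ω)).toReal)
        + (eLpNorm f (ENNReal.ofReal (θ / 2)) (volume.restrict Ω)).toReal
        + (eLpNorm (fun _ : Eu m => (1 : ℝ)) (ENNReal.ofReal (θ / 2))
            (volume.restrict Ω)).toReal ≤ Λ) :
    SysBound Ω θ Λ a C D f where
  meas_a i j := (ha i j).1
  bound_a := by
    filter_upwards [ae_all_iff.2 fun i => ae_all_iff.2 fun j => ae_norm_le_toReal (ha i j)]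
      with x hx i j
    exact (hx i j).trans (h1 i j)
  meas_C i j := (hC i j).1
  meas_D i := (hD i).1
  meas_f := hf.1
  memLp_weight := (eLpNorm_sysWeight_le hθ hC hD hf).1
  weight_le := (eLpNorm_sysWeight_le hθ hC hD hf).2.trans h2

/-- The number of equations is `n + 1`, the number of space variables is `m`. -/
theorem theorem2p1 (m n : ℕ) (hm : 0 < m) (θ : ℝ) (hθm : (m : ℝ) < θ) (hθ2 : 2 ≤ θ) :
    ∃ ν₀ : ℝ, 0 < ν₀ ∧
    ∀ (Ω : Set (Eu m)), IsOpen Ω → Bornology.IsBounded Ω → ConeProperty Ω →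
    ∀ ρ : ℝ, 0 < ρ →
    ∃ bound :
        (Fin (n + 1) → Fin (n + 1) → ℝ≥0∞) → -- the norms of `a^{ij}`
        (Fin (n + 1) → Fin (n + 1) → ℝ≥0∞) → -- the norms of `C^{ij}`
        (Fin (n + 1) → ℝ≥0∞) → -- the norms of `D^i`
        (Fin (n + 1) → Fin (n + 1) → ℝ≥0∞) → -- the norms of `det B^{ij} / det B`
        ℝ≥0∞ → -- the norm of `g`
        ℝ≥0∞ → -- the norm of `f`
        ℝ≥0∞ → -- the essential supremum of `|y|` on the boundary
        ℝ≥0,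
    ∀ (a : Fin (n + 1) → Fin (n + 1) → Eu m → ℝ)
      (C : Fin (n + 1) → Fin (n + 1) → Eu m → Eu m)
      (D : Fin (n + 1) → Eu m → Eu (n + 1))
      (f g : Eu m → Eu (n + 1)),
      (∀ i j, MemLp (a i j) ∞ (volume.restrict Ω)) →
      (∀ i j, MemLp (C i j) (ENNReal.ofReal θ) (volume.restrict Ω)) →
      (∀ i, MemLp (D i) (ENNReal.ofReal (θ / 2)) (volume.restrict Ω)) →
      MemLp f (ENNReal.ofReal (θ / 2)) (volume.restrict Ω) →
      (∀ i, MemH1 Ω (fun x => g x i)) →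
      -- ellipticity
      (∀ᵐ x ∂(volume.restrict Ω), ∀ ξ : Fin (n + 1) → Fin m → ℝ,
        ρ * ∑ i, ∑ p, ξ i p ^ 2 ≤ ∑ i, ∑ j, ∑ p, a i j x * ξ i p * ξ j p) →
      -- the condition on the zero order coefficients
      (∀ ν : ℝ, ν₀ ≤ ν →
        (∀ᵐ x ∂(volume.restrict Ω), ∀ μ : Eu (n + 1),
          ν * ρ ^ (((m : ℝ) + θ) / ((m : ℝ) - θ))
              * (∑ i, ∑ j, (eLpNorm (C i j) (ENNReal.ofReal θ) (volume.restrict Ω)).toReal)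
                  ^ (2 * θ / (θ - (m : ℝ)))
              * ‖μ‖ ^ 2
            ≤ ∑ i, inner ℝ (D i x) μ * μ i) →
        (∀ i j, MemW1inf Ω (fun x => minorDet a i j x / minorDet a 0 0 x)) →
        -- there is exactly one weak solution (up to null sets), and it is bounded
        (∃ y, IsWeakSolution Ω a C D f g y ∧
          ∀ z, IsWeakSolution Ω a C D f g z → z =ᵐ[volume.restrict Ω] y) ∧
        ∀ y, IsWeakSolution Ω a C D f g y → boundarySup Ω y ≠ ⊤ →
          eLpNorm y ∞ (volume.restrict Ω) ≤
            bound
              (fun i j => eLpNorm (a i j) ∞ (volume.restrict Ω))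
              (fun i j => eLpNorm (C i j) (ENNReal.ofReal θ) (volume.restrict Ω))
              (fun i => eLpNorm (D i) (ENNReal.ofReal (θ / 2)) (volume.restrict Ω))
              (fun i j => w1infNorm Ω (fun x => minorDet a i j x / minorDet a 0 0 x))
              (h1NormVec Ω g)
              (eLpNorm f (ENNReal.ofReal (θ / 2)) (volume.restrict Ω))
              (boundarySup Ω y)) := by
  have θ0 : 0 < θ := by linarith
  obtain ⟨c, hc, hw⟩ := exists_weighted_H10 hm hθm hθ2
  -- The threshold of `coercive_scale`. It can be fixed before `Ω` because `c` is the constant of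
  -- the `H¹₀` inequality, uniform over all open sets.
  refine ⟨(2 * Real.sqrt c) ^ (2 * θ / (θ - m)) / 4, ?_, ?_⟩
  · have := Real.sqrt_pos.2 hc
    positivity
  intro Ω hΩ hb hcone ρ hρ
  have : IsFiniteMeasure (volume.restrict Ω) := ⟨by
    rw [Measure.restrict_apply_univ]; exact hb.measure_lt_top⟩
  obtain ⟨c₁, hc₁, hw₁⟩ := exists_weighted_H1 hm hθm hθ2 hΩ hcone
  obtain ⟨P, hP, hpo⟩ := WeightedIneq0.exists_poincare hm θ0 hb (hw Ω hΩ)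
  have hk : 0 < ρ / (2 * (1 + P)) := by positivity
  -- All data enter the bound through the single number Λ, so choosing the bound for every Λ gives a
  -- function of the listed norms alone.
  have sup := fun (Λ : ℝ) (hΛ : 0 < Λ) => exists_sup_bound (N := n + 1) hm hθm hθ2 hΩ hb hc₁.le
    hw₁ hk hρ hΛ
  choose! M hM0 hM using sup
  refine ⟨fun a C D b g f s => (M (dataSize Ω θ a C D b g f s)).toNNReal, ?_⟩
  intro a C D f g ha hC hD hf hg hell ν hν hDν hW
  have coercive : ∀ Λ, SysBound Ω θ Λ a C D f →
      CoerciveForm Ω a C D (ρ / (2 * (1 + P))) := fun Λ hs w W hwW =>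
    (H10Tuple.coercive_tupleSq hρ hP hpo hwW).trans
      (hs.coercive hθm θ0 hc hc₁.le (hw Ω hΩ) hw₁ hρ hell hC hν hDν hwW)
  have nnD : 0 ≤ ∑ i, ∑ j, (eLpNorm (a i j) ∞ (volume.restrict Ω)).toReal :=
    Finset.sum_nonneg fun _ _ => Finset.sum_nonneg fun _ _ => ENNReal.toReal_nonneg
  have nnb : 0 ≤ ∑ i, ∑ j,
      (w1infNorm Ω (fun x => minorDet a i j x / minorDet a 0 0 x)).toReal :=
    Finset.sum_nonneg fun _ _ => Finset.sum_nonneg fun _ _ => ENNReal.toReal_nonneg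
  have nng : 0 ≤ (h1NormVec Ω g).toReal := ENNReal.toReal_nonneg
  have nnw : 0 ≤ (∑ i, ∑ j, (eLpNorm (C i j) (ENNReal.ofReal θ) (volume.restrict Ω)).toReal ^ 2)
        + (∑ i, (eLpNorm (D i) (ENNReal.ofReal (θ / 2)) (volume.restrict Ω)).toReal)
        + (eLpNorm f (ENNReal.ofReal (θ / 2)) (volume.restrict Ω)).toReal
        + (eLpNorm (fun _ : Eu m => (1 : ℝ)) (ENNReal.ofReal (θ / 2))
            (volume.restrict Ω)).toReal := by positivity
  have size : ∀ s : ℝ≥0∞, ∃ Λ, Λ = dataSize Ω θ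
      (fun i j => eLpNorm (a i j) ∞ (volume.restrict Ω))
      (fun i j => eLpNorm (C i j) (ENNReal.ofReal θ) (volume.restrict Ω))
      (fun i => eLpNorm (D i) (ENNReal.ofReal (θ / 2)) (volume.restrict Ω))
      (fun i j => w1infNorm Ω (fun x => minorDet a i j x / minorDet a 0 0 x))
      (h1NormVec Ω g) (eLpNorm f (ENNReal.ofReal (θ / 2)) (volume.restrict Ω)) s ∧
      0 < Λ ∧ SysBound Ω θ Λ a C D f ∧ (h1NormVec Ω g).toReal ≤ Λ ∧ s.toReal + 1 ≤ Λ ∧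
      ∀ i j, (w1infNorm Ω (fun x => minorDet a i j x / minorDet a 0 0 x)).toReal ≤ Λ := by
    intro s
    have nns : 0 ≤ s.toReal := ENNReal.toReal_nonneg
    refine ⟨_, rfl, ?_, sysBound_of_memLp hθ2 ha hC hD hf (fun i j => ?_) ?_, ?_, ?_,
      fun i j => ?_⟩
    · rw [dataSize]; linarith
    · have := le_sum_sum_toReal (fun i j => eLpNorm (a i j) ∞ (volume.restrict Ω)) i j
      rw [dataSize]; linarith
    · rw [dataSize]; linarith
    · rw [dataSize]; linarith
    · rw [dataSize]; linarith
    · have := le_sum_sum_toReal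
        (fun i j => w1infNorm Ω (fun x => minorDet a i j x / minorDet a 0 0 x)) i j
      rw [dataSize]; linarith
  refine ⟨?_, fun y hy hbd => ?_⟩
  -- Existence and uniqueness do not involve the boundary supremum; any value serves in its place.
  · obtain ⟨Λ, -, hΛ, hs, -⟩ := size 0
    exact hs.exists_unique_weakSolution hΩ hb hw₁ hc₁.le hΛ.le hg hk (coercive Λ hs)
  · obtain ⟨Λ, hΛe, hΛ, hs, hgΛ, hsΛ, hbΛ⟩ := size (boundarySup Ω y)
    obtain ⟨K, hK, hK0⟩ := exists_of_boundarySup_ne_top hbd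
    have bound := hM Λ hΛ a _ C _ D f g y _ _ K _ hs (diagCoeff_minorDet hm hb hρ hell hW hbΛ)
      (coercive Λ hs) (fun i => (hg i).hasH1Grad)
      ((H1Tuple.sqrt_tupleSq_eq hg).le.trans hgΛ) hy.h1Tuple hy (hK.trans hsΛ)
      (hK0.hasH10Grad hΩ)
    beta_reduce
    rw [← hΛe, eLpNorm_exponent_top]
    refine (eLpNormEssSup_le_of_ae_bound bound).trans (le_of_eq ?_)
    rw [ENNReal.ofReal]
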